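/- **Setting.** For $\alpha>0$ and a symbol $a(x,\xi)$ on $\mathbb R\times\mathbb R$, $\operatorname{op}^l_\alpha(a)$ denotes the bounded operator on $L^2(\mathbb R)$ given on Schwartz functions by $$(\operatorname{op}^l_\alpha(a)u)(x)=\frac{\alpha}{2\pi}\int\!\!\int e^{i\alpha(x-y)\xi}a(x,\xi)u(y)\,dy\,d\xi .$$ For measurable $\Lambda,\Omega\subset\mathbb R$ put $P_{\Omega,\alpha}=\operatorname{op}^l_\alpha(\chi_\Omega(\xi))$ and $T(a;\Lambda,\Omega)=\chi_\Lambda P_{\Omega,\alpha}\operatorname{op}^l_\alpha(a)P_{\Omega,\alpha}\chi_\Lambda$. For $\ell,\rho>0$ let $$\mathsf N^{(n,m)}(a;\ell,\rho)=\max_{i\le n,\ j\le m}\ \sup_{x,\xi}\ \ell^i\rho^j|\partial_x^i\partial_\xi^ja(x,\xi)| ,$$ and let $\mathbf S^{(n,m)}$ be the class of complex-valued symbols that are continuous and bounded together with these derivatives. Put $$\mathfrak A(g)=\frac1{(2\pi)^2}\int_0^1\frac{g(t)-t\,g(1)}{t(1-t)}\,dt .$$ For a finite set $X\subset(-2\rho,2\rho)$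 let $m_\delta(X)=(4\rho)^{-\delta}$ if $X=\varnothing$; otherwise $m_\delta(X)=\sum_{\xi\in X}\rho_\xi^{-\delta}$, where $\rho_\xi=\operatorname{dist}(\xi,X\setminus\{\xi\})$ if $X$ has at least two points and $\rho_\xi=4\rho$ if $X=\{\xi\}$. **Theorem 8.6.** Let $p\in\{1,2,\dots\}$, $g(t)=t^p-t$, $\delta\ge1$ and $c>0$. There is a constant $C=C(p,\delta,c)>0$ such that the following holds for all $\alpha,\rho,L,r$ with $\alpha,\rho>0$, $\alpha\rho\ge c$ and $L\ge r\ge1$. Let $\Omega\subset\mathbb R$ be a measurable set such that $$\Omega\cap(-2\rho,2\rho)=\Bigl(\bigcup_jI_j\Bigr)\cap(-2\rho,2\rho)$$ for a finite (possibly empty) collection of nonempty open intervals $I_j$ with pairwise disjoint closures, and let $X$ be the set of endpoints of the $I_j$ that lie in $(-2\rho,2\rho)$. Let $\psi\in C_0^\infty(\mathbb R)$ satisfy $0\le\psi\le1$, $\psi=0$ outside $(1,4r)$ and $\psi=1$ on $(4,r)$. Let $a\in\mathbf S^{(2,2)}$ satisfy $a(x,\xi)=0$ for $|\xi|\ge\rho$.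 Then $\operatorname{op}^l_\alpha(\psi a)$ is a well-defined bounded operator on $L^2(\mathbb R)$, the operator $\operatorname{op}^l_\alpha(\psi a)\,g(T(1;\mathbb R_+,\Omega))$ is of trace class, and $$\Bigl|\operatorname{tr}\bigl(\operatorname{op}^l_\alpha(\psi a)\,g(T(1;\mathbb R_+,\Omega))\bigr)-\mathfrak A(g)\sum_{\xi\in X}a(0,\xi)\,\log r\Bigr|\le C\,m_\delta(X)\bigl[\rho^\delta+\alpha^{1-\delta}\rho r+\alpha^{-\delta}\log r\bigr]\,\mathsf N^{(2,2)}(a;L,\rho),$$ where the sum is $0$ if $X=\varnothing$. -/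

import Mathlib

open MeasureTheory Set
open scoped SchwartzMap FourierTransform ContDiff

noncomputable section

/-- The Hilbert space `L²(ℝ)`. -/
abbrev L2R : Type := Lp ℂ 2 (volume : Measure ℝ)

/-! ### Trace class operators and their trace -/

/-- Trace class operators on a complex Hilbert space: the operators
`A = ∑ₙ ⟨xₙ, ·⟩ yₙ` with `∑ₙ ‖xₙ‖ ‖yₙ‖ < ∞` (on a Hilbert space these are exactly the operators
with summable singular values). -/
def IsTraceClass {H : Type*} [NormedAddCommGroup H] [InnerProductSpace ℂ H]
    (A : H →L[ℂ] H) : Prop :=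
  ∃ x y : ℕ → H, Summable (fun n => ‖x n‖ * ‖y n‖) ∧
    ∀ u : H, HasSum (fun n => inner ℂ (x n) (u) • y n) (A u)

/-- An orthonormal basis of a Hilbert space, as a set of vectors. -/
def stdBasisSet (H : Type*) [NormedAddCommGroup H] [InnerProductSpace ℂ H] [CompleteSpace H] :
    Set H :=
  (exists_hilbertBasis ℂ H).choose

/-- The trace `∑ₑ ⟨e, A e⟩` over an orthonormal basis. For a trace class operator the sum converges
absolutely and does not depend on the basis. -/
def opTrace {H : Type*} [NormedAddCommGroup H] [InnerProductSpace ℂ H] [CompleteSpace H]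
    (A : H →L[ℂ] H) : ℂ :=
  ∑' e : stdBasisSet H, inner ℂ (e : H) (A e)

theorem IsTraceClass.hasSum_aux {H : Type*} [NormedAddCommGroup H] [InnerProductSpace ℂ H]
    [CompleteSpace H] {A : H →L[ℂ] H} {x y : ℕ → H} (hxy : Summable (fun n => ‖x n‖ * ‖y n‖))
    (hA : ∀ u : H, HasSum (fun n => inner ℂ (x n) (u) • y n) (A u)) {ι : Type*}
    (e : HilbertBasis ι ℂ H) :
    HasSum (fun i => inner ℂ (e i) (A (e i))) (∑' n, inner ℂ (x n) (y n)) := by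
  let F : ℕ × ι → ℂ := fun q => inner ℂ (x q.1) (e q.2) * inner ℂ (e q.2) (y q.1)
  have hfin : ∀ n (s : Finset ι), ∑ i ∈ s, ‖F (n, i)‖ ≤ ‖x n‖ * ‖y n‖ := by
    intro n s
    have h1 := e.orthonormal.sum_inner_products_le (x n) (s := s)
    have h2 := e.orthonormal.sum_inner_products_le (y n) (s := s)
    have h3 := Finset.sum_mul_sq_le_sq_mul_sq s (fun i => ‖inner ℂ (e i) (x n)‖)
      (fun i => ‖inner ℂ (e i) (y n)‖)
    have h4 : ∑ i ∈ s, ‖F (n, i)‖ =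
        ∑ i ∈ s, ‖inner ℂ (e i) (x n)‖ * ‖inner ℂ (e i) (y n)‖ :=
      Finset.sum_congr rfl fun i _ => by simp only [F, norm_mul]; rw [norm_inner_symm]
    rw [h4]
    refine abs_le_of_sq_le_sq' ?_ (by positivity) |>.2
    refine h3.trans ?_
    rw [mul_pow]
    exact mul_le_mul h1 h2 (Finset.sum_nonneg fun _ _ => by positivity) (by positivity)
  have hrow : ∀ n, Summable fun i => ‖F (n, i)‖ := fun n =>
    summable_of_sum_le (fun _ => norm_nonneg _) (hfin n)
  have hF : Summable F := by
    refine Summable.of_norm ((summable_prod_of_nonneg fun _ => norm_nonneg _).2 ⟨hrow, ?_⟩)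
    exact Summable.of_nonneg_of_le (fun n => tsum_nonneg fun _ => norm_nonneg _)
      (fun n => (hrow n).tsum_le_of_sum_le (hfin n)) hxy
  have hval : ∑' q, F q = ∑' n, inner ℂ (x n) (y n) := by
    rw [hF.tsum_prod]
    exact tsum_congr fun n => e.tsum_inner_mul_inner (x n) (y n)
  have hsw : HasSum (fun q : ι × ℕ => F q.swap) (∑' n, inner ℂ (x n) (y n)) := by
    rw [← hval]
    exact (Equiv.prodComm ι ℕ).hasSum_iff.2 hF.hasSum
  refine hsw.prod_fiberwise fun i => ?_
  have h := (innerSL ℂ (e i)).hasSum (hA (e i))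
  simp only [innerSL_apply_apply, inner_smul_right] at h
  exact h

/-- The trace of a trace class operator does not depend on the orthonormal basis. -/
theorem IsTraceClass.hasSum {H : Type*} [NormedAddCommGroup H] [InnerProductSpace ℂ H]
    [CompleteSpace H] {A : H →L[ℂ] H} (hA : IsTraceClass A) {ι : Type*}
    (b : HilbertBasis ι ℂ H) : HasSum (fun i => inner ℂ (b i) (A (b i))) (opTrace A) := by
  obtain ⟨x, y, hxy, hAu⟩ := hA
  obtain ⟨e, he⟩ := (exists_hilbertBasis ℂ H).choose_spec
  have h := IsTraceClass.hasSum_aux hxy hAu e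
  rw [he] at h
  have h' : opTrace A = ∑' n, inner ℂ (x n) (y n) := h.tsum_eq
  rw [h']
  exact IsTraceClass.hasSum_aux hxy hAu b

/-! ### Pseudo-differential operators -/

/-- `A` is the bounded operator on `L²(ℝ)` which on Schwartz functions `u` is given by
`(A u)(x) = (α / 2π) ∫ ∫ e^{iα(x-y)ξ} a(x, ξ) u(y) dy dξ`. -/
def IsLeftPDO (α : ℝ) (a : ℝ → ℝ → ℂ) (A : L2R →L[ℂ] L2R) : Prop :=
  ∀ u : 𝓢(ℝ, ℂ), (A (u.toLp 2 volume) : ℝ → ℂ) =ᵐ[volume] fun x =>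
    ((α / (2 * Real.pi) : ℝ) : ℂ) *
      ∫ ξ : ℝ, ∫ y : ℝ, Complex.exp (Complex.I * ((α * (x - y) * ξ : ℝ) : ℂ)) * a x ξ * u y

/-- There is at most one such bounded operator. -/
theorem IsLeftPDO.unique {α : ℝ} {a : ℝ → ℝ → ℂ} {A B : L2R →L[ℂ] L2R}
    (hA : IsLeftPDO α a A) (hB : IsLeftPDO α a B) : A = B := by
  have hd : DenseRange (SchwartzMap.toLpCLM ℝ (E := ℝ) ℂ 2 (volume : Measure ℝ)) :=
    SchwartzMap.denseRange_toLpCLM ENNReal.ofNat_ne_top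
  have h : (A : L2R → L2R) = B := by
    refine hd.equalizer A.continuous B.continuous ?_
    funext u
    exact Lp.ext ((hA u).trans (hB u).symm)
  exact DFunLike.coe_injective h

open Classical in
/-- The operator `op_α^l(a)` on `L²(ℝ)` (set to zero if the symbol `a` does not define a bounded
operator). -/
def opL (α : ℝ) (a : ℝ → ℝ → ℂ) : L2R →L[ℂ] L2R :=
  if h : ∃ A, IsLeftPDO α a A then h.choose else 0

theorem IsLeftPDO.opL_eq {α : ℝ} {a : ℝ → ℝ → ℂ} {A : L2R →L[ℂ] L2R} (h : IsLeftPDO α a A) :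
    opL α a = A := by
  have h' : ∃ A, IsLeftPDO α a A := ⟨A, h⟩
  rw [opL, dif_pos h']
  exact h'.choose_spec.unique h

/-- Multiplication by an essentially bounded function on `L²(ℝ)`. -/
def mulLinf (f : Lp ℂ ⊤ (volume : Measure ℝ)) : L2R →L[ℂ] L2R :=
  (ContinuousLinearMap.mul ℂ ℂ).holderL volume ⊤ 2 2 f

theorem mulLinf_ae (f : Lp ℂ ⊤ (volume : Measure ℝ)) (u : L2R) :
    (mulLinf f u : ℝ → ℂ) =ᵐ[volume] fun x => f x * u x :=
  (ContinuousLinearMap.mul ℂ ℂ).coeFn_holder f u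

theorem memLp_top_chi {Λ : Set ℝ} (hΛ : MeasurableSet Λ) :
    MemLp (Λ.indicator (fun _ => (1 : ℂ))) ⊤ (volume : Measure ℝ) :=
  MemLp.indicator hΛ (memLp_top_const (1 : ℂ))

/-- Multiplication by the characteristic function of the measurable set `Λ` on `L²(ℝ)`. -/
def mulChi (Λ : Set ℝ) (hΛ : MeasurableSet Λ) : L2R →L[ℂ] L2R :=
  mulLinf ((memLp_top_chi hΛ).toLp _)

theorem mulChi_ae (Λ : Set ℝ) (hΛ : MeasurableSet Λ) (u : L2R) :
    (mulChi Λ hΛ u : ℝ → ℂ) =ᵐ[volume] fun x => Λ.indicator (fun _ => (1 : ℂ)) x * u x := by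
  filter_upwards [mulLinf_ae ((memLp_top_chi hΛ).toLp _) u,
    MemLp.coeFn_toLp (memLp_top_chi hΛ)] with x h1 h2
  rw [mulChi, h1, h2]

/-- The characteristic function of `Ω` as a symbol depending on `ξ` only. -/
def chiSymbol (Ω : Set ℝ) : ℝ → ℝ → ℂ := fun _ ξ => Ω.indicator (fun _ => (1 : ℂ)) ξ

theorem fourierInv_L2_ae (h : L2R) (hi : Integrable (h : ℝ → ℂ)) :
    ((𝓕⁻ h : L2R) : ℝ → ℂ) =ᵐ[volume] 𝓕⁻ (h : ℝ → ℂ) := by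
  have hcont : Continuous (𝓕⁻ (h : ℝ → ℂ)) :=
    VectorFourier.fourierIntegral_continuous (L := -innerₗ ℝ) Real.continuous_fourierChar
      continuous_inner.neg hi
  refine ae_eq_of_integral_contDiff_smul_eq
    ((Lp.memLp (𝓕⁻ h : L2R)).locallyIntegrable (by norm_num)) hcont.locallyIntegrable ?_
  intro g hg hgs
  have hs : HasCompactSupport (fun x => (g x : ℂ)) := hgs.comp_left Complex.ofReal_zero
  have hd : ContDiff ℝ ∞ (fun x => (g x : ℂ)) := Complex.ofRealCLM.contDiff.comp hg
  let φ : 𝓢(ℝ, ℂ) := hs.toSchwartzMap hd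
  have h1 : ∫ x, φ x • ((𝓕⁻ h : L2R) : ℝ → ℂ) x = ∫ x, (𝓕⁻ φ : 𝓢(ℝ, ℂ)) x • h x := by
    have := congrArg (fun T => T φ) (Lp.fourierInv_toTemperedDistribution_eq h)
    simp only [TemperedDistribution.fourierInv_apply, Lp.toTemperedDistribution_apply] at this
    exact this.symm
  have h2 : ∫ x, (𝓕⁻ φ : 𝓢(ℝ, ℂ)) x • h x = ∫ x, φ x • 𝓕⁻ (h : ℝ → ℂ) x := by
    have := VectorFourier.integral_fourierIntegral_smul_eq_flip (μ := volume) (ν := volume)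
      (f := (φ : ℝ → ℂ)) (g := (h : ℝ → ℂ)) (L := -innerₗ ℝ) Real.continuous_fourierChar
      continuous_inner.neg φ.integrable hi
    rw [SchwartzMap.fourierInv_coe]
    refine this.trans ?_
    refine integral_congr_ae (Filter.Eventually.of_forall fun x => ?_)
    simp only [FourierTransformInv.fourierInv, VectorFourier.fourierIntegral]
    simp [mul_comm]
  have h3 : ∀ x, φ x = (g x : ℂ) := fun x => rfl
  simp only [h3] at h1 h2
  simpa using h1.trans h2

/-- The operator `op_α(m)` of a bounded symbol `m` depending on `ξ` only is a bounded Fourier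
multiplier. -/
theorem isLeftPDO_multiplier {α : ℝ} (hα : 0 < α) {m : ℝ → ℂ}
    (hm : MemLp (fun η => m (2 * Real.pi / α * η)) ⊤ (volume : Measure ℝ)) :
    IsLeftPDO α (fun _ ξ => m ξ)
      ((Lp.fourierTransformₗᵢ ℝ ℂ).symm.toContinuousLinearEquiv.toContinuousLinearMap *
        mulLinf (hm.toLp _) *
        (Lp.fourierTransformₗᵢ ℝ ℂ).toContinuousLinearEquiv.toContinuousLinearMap) := by
  intro u
  set h : L2R := mulLinf (hm.toLp _) ((𝓕 u).toLp 2 volume) with hh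
  have hA : ((Lp.fourierTransformₗᵢ ℝ ℂ).symm.toContinuousLinearEquiv.toContinuousLinearMap *
        mulLinf (hm.toLp _) *
        (Lp.fourierTransformₗᵢ ℝ ℂ).toContinuousLinearEquiv.toContinuousLinearMap)
          (u.toLp 2 volume) = (𝓕⁻ h : L2R) := by
    rw [hh, ← SchwartzMap.toLp_fourier_eq]
    rfl
  have hae : (h : ℝ → ℂ) =ᵐ[volume] fun η => m (2 * Real.pi / α * η) * 𝓕 (u : ℝ → ℂ) η := by
    filter_upwards [mulLinf_ae (hm.toLp _) ((𝓕 u).toLp 2 volume), hm.coeFn_toLp,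
      (𝓕 u).coeFn_toLp 2 volume] with η h1 h2 h3
    rw [h1, h2, h3, SchwartzMap.fourier_coe]
  have hi : Integrable (h : ℝ → ℂ) := by
    refine Integrable.congr ?_ hae.symm
    have : Integrable (fun η => (𝓕 u : 𝓢(ℝ, ℂ)) η * m (2 * Real.pi / α * η)) :=
      (𝓕 u).integrable.mul_of_top_left hm
    refine this.congr (Filter.Eventually.of_forall fun η => ?_)
    simp only [SchwartzMap.fourier_coe]
    ring
  rw [hA]
  refine (fourierInv_L2_ae h hi).trans (Filter.Eventually.of_forall fun x => ?_)
  have hinner : ∀ ξ : ℝ, (∫ y : ℝ, Complex.exp (Complex.I * ((α * (x - y) * ξ : ℝ) : ℂ)) * m ξ * u y)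
      = Complex.exp (Complex.I * ((α * x * ξ : ℝ) : ℂ)) * m ξ *
        𝓕 (u : ℝ → ℂ) (α / (2 * Real.pi) * ξ) := by
    intro ξ
    rw [Real.fourier_real_eq_integral_exp_smul, ← integral_const_mul]
    refine integral_congr_ae (Filter.Eventually.of_forall fun y => ?_)
    simp only [smul_eq_mul]
    have : Complex.exp (Complex.I * ((α * (x - y) * ξ : ℝ) : ℂ)) =
        Complex.exp (Complex.I * ((α * x * ξ : ℝ) : ℂ)) *
        Complex.exp (((-2 * Real.pi * y * (α / (2 * Real.pi) * ξ) : ℝ) : ℂ) * Complex.I) := by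
      rw [← Complex.exp_add]
      congr 1
      have hpi : (Real.pi : ℂ) ≠ 0 := by exact_mod_cast Real.pi_ne_zero
      push_cast
      field_simp
      ring
    rw [this]
    ring
  simp only [hinner]
  have hs := Measure.integral_comp_mul_left
    (fun ξ : ℝ => Complex.exp (Complex.I * ((α * x * ξ : ℝ) : ℂ)) *
      m ξ * 𝓕 (u : ℝ → ℂ) (α / (2 * Real.pi) * ξ)) (2 * Real.pi / α)
  have hpi := Real.pi_pos
  have hpos : (0 : ℝ) < α / (2 * Real.pi) := by positivity
  rw [inv_div, abs_of_pos hpos, Complex.real_smul] at hs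
  rw [← hs, Real.fourierInv_eq']
  refine integral_congr_ae ?_
  filter_upwards [hae] with η hη
  rw [hη, smul_eq_mul]
  have e1 : α / (2 * Real.pi) * (2 * Real.pi / α * η) = η := by field_simp
  have e2 : α * x * (2 * Real.pi / α * η) = 2 * Real.pi * inner ℝ η x := by
    simp only [RCLike.inner_apply, conj_trivial]
    field_simp
  simp only [e1, e2]
  rw [mul_comm Complex.I]
  ring

/-- `P_{Ω,α} = op_α(χ_Ω)` is a bounded operator on `L²(ℝ)` for every measurable set `Ω`. -/
theorem isLeftPDO_chi {α : ℝ} (hα : 0 < α) {Ω : Set ℝ} (hΩ : MeasurableSet Ω) :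
    IsLeftPDO α (chiSymbol Ω) (opL α (chiSymbol Ω)) := by
  have hm : MemLp (fun η : ℝ => Ω.indicator (fun _ => (1 : ℂ)) (2 * Real.pi / α * η)) ⊤
      (volume : Measure ℝ) :=
    memLp_top_chi (Λ := (fun η : ℝ => 2 * Real.pi / α * η) ⁻¹' Ω)
      (hΩ.preimage (measurable_const_mul _))
  have h := isLeftPDO_multiplier hα (m := fun ξ => Ω.indicator (fun _ => (1 : ℂ)) ξ) hm
  have h' : IsLeftPDO α (chiSymbol Ω) _ := h
  rw [h'.opL_eq]
  exact h'

/-- The symbol `1` gives the identity operator. -/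
theorem opL_one {α : ℝ} (hα : 0 < α) : opL α (fun _ _ => 1) = 1 := by
  have hm : MemLp (fun _ : ℝ => (1 : ℂ)) ⊤ (volume : Measure ℝ) := memLp_top_const 1
  have h := isLeftPDO_multiplier hα (m := fun _ => (1 : ℂ)) hm
  rw [h.opL_eq]
  have h1 : mulLinf (hm.toLp _) = 1 := by
    ext1 u
    refine Lp.ext ?_
    filter_upwards [mulLinf_ae (hm.toLp _) u, hm.coeFn_toLp] with x h1 h2
    rw [h1, h2]
    simp
  rw [h1]
  ext1 u
  simp

/-- `T_α(a; Λ, Ω) = χ_Λ P_{Ω,α} op_α^l(a) P_{Ω,α} χ_Λ`, where `P_{Ω,α} = op_α(χ_Ω)`. -/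
def truncOp (α : ℝ) (a : ℝ → ℝ → ℂ) (Λ : Set ℝ) (hΛ : MeasurableSet Λ) (Ω : Set ℝ) :
    L2R →L[ℂ] L2R :=
  mulChi Λ hΛ * opL α (chiSymbol Ω) * opL α a * opL α (chiSymbol Ω) * mulChi Λ hΛ

/-! ### Symbol classes -/

/-- The mixed derivative `∂_x^i ∂_ξ^j a`. -/
def mixedDeriv (i j : ℕ) (a : ℝ → ℝ → ℂ) (x ξ : ℝ) : ℂ :=
  iteratedDeriv i (fun t => iteratedDeriv j (a t) ξ) x

/-- The class `S^{(n,m)}` of symbols `a(x, ξ)` which are continuous and bounded together with their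
partial derivatives up to order `n` in `x` and up to order `m` in `ξ`. -/
structure IsSymbol (n m : ℕ) (a : ℝ → ℝ → ℂ) : Prop where
  contDiff_xi : ∀ x, ContDiff ℝ m (a x)
  contDiff_x : ∀ j ≤ m, ∀ ξ, ContDiff ℝ n (fun x => iteratedDeriv j (a x) ξ)
  continuous_deriv : ∀ i ≤ n, ∀ j ≤ m, Continuous (fun z : ℝ × ℝ => mixedDeriv i j a z.1 z.2)
  bounded_deriv : ∀ i ≤ n, ∀ j ≤ m, ∃ M : ℝ, ∀ x ξ, ‖mixedDeriv i j a x ξ‖ ≤ M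

/-- `N^{(n,m)}(a; ℓ, ρ) = max_{i ≤ n, j ≤ m} sup_{x,ξ} ℓ^i ρ^j |∂_x^i ∂_ξ^j a(x, ξ)|`. -/
def symbolNorm (n m : ℕ) (a : ℝ → ℝ → ℂ) (ℓ ρ : ℝ) : ℝ :=
  ⨆ q : (Fin (n + 1) × Fin (m + 1)) × (ℝ × ℝ),
    ℓ ^ (q.1.1 : ℕ) * ρ ^ (q.1.2 : ℕ) * ‖mixedDeriv q.1.1 q.1.2 a q.2.1 q.2.2‖

/-- A smooth compactly supported `ψ` with `0 ≤ ψ ≤ 1`, `ψ = 0` outside `(1, 4r)` and `ψ = 1` on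
`(4, r)`. -/
structure IsCutoff (r : ℝ) (ψ : ℝ → ℝ) : Prop where
  contDiff : ContDiff ℝ ∞ ψ
  hasCompactSupport : HasCompactSupport ψ
  nonneg : ∀ x, 0 ≤ ψ x
  le_one : ∀ x, ψ x ≤ 1
  eq_zero : ∀ x, x ∉ Ioo 1 (4 * r) → ψ x = 0
  eq_one : ∀ x ∈ Ioo 4 r, ψ x = 1

/-! ### Coefficients -/

/-- `𝔄(g; b) = (2π)⁻² ∫₀¹ (g(bt) - t g(b)) / (t(1-t)) dt`. -/
def coeffA (g : ℝ → ℝ) (b : ℝ) : ℝ :=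
  1 / (2 * Real.pi) ^ 2 * ∫ t in (0 : ℝ)..1, (g (b * t) - t * g b) / (t * (1 - t))

/-- The spacing of `ξ ∈ X`: the distance to the other points of `X`, or `4ρ` if `ξ` is the only
point of `X`. -/
def spacing (ρ : ℝ) (X : Finset ℝ) (ξ : ℝ) : ℝ :=
  if X.card = 1 then 4 * ρ else Metric.infDist ξ ((X : Set ℝ) \ {ξ})

/-- The number `m_δ(X)`: `(4ρ)^{-δ}` for empty `X`, and otherwise the sum over `X` of the spacings to
the power `-δ`. -/
def spacingSum (ρ δ : ℝ) (X : Finset ℝ) : ℝ :=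
  if X = ∅ then (4 * ρ) ^ (-δ) else ∑ ξ ∈ X, spacing ρ X ξ ^ (-δ)

/-- `I` is a nonempty open interval of the line (bounded or not). -/
def IsOpenInterval (I : Set ℝ) : Prop :=
  IsOpen I ∧ I.OrdConnected ∧ I.Nonempty

end

open MeasureTheory Set
open scoped SchwartzMap FourierTransform ContDiff

noncomputable section

/-! ### Trace norm bounds -/

section TraceNorm

variable {H : Type*} [NormedAddCommGroup H] [InnerProductSpace ℂ H]

/-! In the frequency variable η = κξ with κ = α/(2π), the operator op(ψa) becomes the quantization A
of the symbol ψ(x) a(x, η/κ), and T becomes χ₊ P χ₊ with P the projection onto frequencies in κΩ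
(`IsPdo.isLeftPDO`, `truncOp_one`). Everything is done in these units, where a frequency width w
corresponds to a length 1/w.

The logarithm comes from the half line. Let (Vh)(x) = x^{-1/2} h(log x). Since V V* = χ₊,
conjugation by V diagonalizes the truncated projection onto positive frequencies: it is the Fourier
multiplier with symbol 1/(1 + e^{-4π²s}) (`logCoisom_fmul_logIsom`, from the Gamma integral and the
reflection formula). Another end point is reached by modulation. Hence for a half line g(T) has, up
to phases, the kernel (xy)^{-1/2} k(log x - log y), where k is the inverse Fourier transform of g
composed with that symbol. As g vanishes at 0 and 1, k is bounded and Lipschitz, and the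
substitution t = 1/(1 + e^{-4π²s}) gives k(0) = 𝔄(g) (`integral_powSymbol`). Near the diagonal the
kernel is about k(0)/x. If the kernel of A decays at frequency scale w ≥ 1, replacing the kernel of
g(T) by k(0)/x changes tr A g(T) by O(N) (`kernel_difference_le`, `norm_opTrace_model_sub_le`). What
remains is 𝔄(g) ∫ ψ(x) a(x, ξ) dx/x, which is 𝔄(g) a(0, ξ) log r + O(N) because r ≤ L
(`norm_integral_cutoff_sub_le`).

For general Ω the symbol is cut in frequency into a bump around each relevant end point, of width
1/16 of the scaled spacing, and a rest. The main tool is that the commutator of χ₊ with a smooth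
multiplier is of trace class, with a bound that does not change under scaling (`traceBound_hankel`,
`traceBound_commutator`). Since multipliers commute with P, it follows that Ω may be replaced by a
half line near an end point at cost O(N) (`traceBound_localize`). The rest vanishes near the
boundary of Ω, so that its product with χ_Ω is still smooth; therefore it gives only a remainder
(`traceBound_mul_pow_sub`), whose size is governed by the ratios of ρ to the spacings. When a bump
is narrower than 1 the model is useless, and the trace norm of the piece is bounded by a multiple of
N r instead (`traceBound_pdo`).

Thus an end point of spacing D costs O(1 + ρ/D), and in addition O(r) when αD is bounded. Elementary
inequalities with δ ≥ 1 and αρ ≥ c put all of this below D^{-δ} times the bracket of the theorem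
(`endpoint_remainder_le`); summing over X gives m_δ(X). -/

/-- The operator `A` is of trace class, with trace norm at most `K`. -/
def TraceBound (A : H →L[ℂ] H) (K : ℝ) : Prop :=
  ∃ (ι : Type) (x y : ι → H), Summable (fun i => ‖x i‖ * ‖y i‖) ∧
    ∑' i, ‖x i‖ * ‖y i‖ ≤ K ∧ ∀ u : H, HasSum (fun i => inner ℂ (x i) u • y i) (A u)

/-- A nuclear representation over an arbitrary index type can be reindexed by `ℕ`. -/
theorem exists_nat_nuclear {A : H →L[ℂ] H} {ι : Type} {x y : ι → H}
    (hs : Summable (fun i => ‖x i‖ * ‖y i‖))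
    (hA : ∀ u : H, HasSum (fun i => inner ℂ (x i) u • y i) (A u)) :
    ∃ x' y' : ℕ → H, Summable (fun n => ‖x' n‖ * ‖y' n‖) ∧
      (∀ u : H, HasSum (fun n => inner ℂ (x' n) u • y' n) (A u)) ∧
      ∑' n, inner ℂ (x' n) (y' n) = ∑' i, inner ℂ (x i) (y i) := by
  -- A summable family has countable support, and the indices outside it contribute nothing; the
  -- support is injected into ℕ and extended by zero.
  let S : Set ι := Function.support fun i => ‖x i‖ * ‖y i‖
  have hS : S.Countable := hs.countable_support
  have : Countable S := hS.to_subtype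
  obtain ⟨f, hf⟩ := exists_injective_nat S
  let x' : ℕ → H := Function.extend f (fun s => x s) 0
  let y' : ℕ → H := Function.extend f (fun s => y s) 0
  have hx : ∀ s, x' (f s) = x s := fun s => hf.extend_apply _ _ _
  have hy : ∀ s, y' (f s) = y s := fun s => hf.extend_apply _ _ _
  have hx0 : ∀ n, n ∉ range f → x' n = 0 := fun n hn => by
    simp only [x']
    rw [Function.extend_apply' _ _ _ hn]
    rfl
  have hns : ∀ i, i ∉ S → x i = 0 ∨ y i = 0 := fun i hi => by
    simpa [S, or_iff_not_imp_left] using hi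
  refine ⟨x', y', ?_, ?_, ?_⟩
  · rw [← hf.summable_iff (fun n hn => by simp [hx0 n hn])]
    refine (hs.subtype S).congr fun s => ?_
    simp [hx, hy]
  · intro u
    rw [← hf.hasSum_iff (fun n hn => by simp [hx0 n hn])]
    have := (hasSum_subtype_iff_of_support_subset (s := S)
      (f := fun i => inner ℂ (x i) u • y i) (fun i hi => by
        by_contra h
        rcases hns i h with h | h <;> simp [h] at hi)).2 (hA u)
    refine this.congr_fun fun s => ?_
    simp [hx, hy]
  · rw [← hf.tsum_eq (f := fun n => inner ℂ (x' n) (y' n)) (fun n hn => by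
      by_contra h
      simp [hx0 n h] at hn)]
    rw [← tsum_subtype_eq_of_support_subset (s := S) (f := fun i => inner ℂ (x i) (y i))
      (fun i hi => by
        by_contra h
        rcases hns i h with h | h <;> simp [h] at hi)]
    exact tsum_congr fun s => by simp [hx, hy]

theorem TraceBound.isTraceClass {A : H →L[ℂ] H} {K : ℝ} (h : TraceBound A K) :
    IsTraceClass A := by
  obtain ⟨ι, x, y, hs, -, hA⟩ := h
  obtain ⟨x', y', h1, h2, -⟩ := exists_nat_nuclear hs hA
  exact ⟨x', y', h1, h2⟩

theorem TraceBound.mono {A : H →L[ℂ] H} {K K' : ℝ} (h : TraceBound A K) (hK : K ≤ K') :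
    TraceBound A K' := by
  obtain ⟨ι, x, y, hs, hb, hA⟩ := h
  exact ⟨ι, x, y, hs, hb.trans hK, hA⟩

theorem TraceBound.zero : TraceBound (0 : H →L[ℂ] H) 0 :=
  ⟨Empty, fun _ => 0, fun _ => 0, by simp, by simp, fun u => by simp⟩

/-- Representations are concatenated over a disjoint union of index types; this is why the index
type is left free rather than fixed to ℕ. -/
theorem TraceBound.add {A B : H →L[ℂ] H} {K K' : ℝ} (hA : TraceBound A K)
    (hB : TraceBound B K') : TraceBound (A + B) (K + K') := by
  obtain ⟨ι, x, y, hs, hb, hA⟩ := hA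
  obtain ⟨ι', x', y', hs', hb', hA'⟩ := hB
  have h := HasSum.sum (f := fun i : ι ⊕ ι' => ‖Sum.elim x x' i‖ * ‖Sum.elim y y' i‖)
    hs.hasSum hs'.hasSum
  exact ⟨ι ⊕ ι', Sum.elim x x', Sum.elim y y', h.summable, h.tsum_eq.le.trans (add_le_add hb hb'),
    fun u => HasSum.sum (f := fun i : ι ⊕ ι' => inner ℂ (Sum.elim x x' i) u • Sum.elim y y' i)
      (hA u) (hA' u)⟩

theorem TraceBound.mul_left {A : H →L[ℂ] H} {K : ℝ} (hA : TraceBound A K) (C : H →L[ℂ] H) :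
    TraceBound (C * A) (‖C‖ * K) := by
  obtain ⟨ι, x, y, hs, hb, hA⟩ := hA
  have h1 : ∀ i, ‖x i‖ * ‖C (y i)‖ ≤ ‖C‖ * (‖x i‖ * ‖y i‖) := fun i => by
    calc ‖x i‖ * ‖C (y i)‖ ≤ ‖x i‖ * (‖C‖ * ‖y i‖) := by gcongr; exact C.le_opNorm _
      _ = _ := by ring
  have h2 : Summable fun i => ‖x i‖ * ‖C (y i)‖ :=
    Summable.of_nonneg_of_le (fun i => by positivity) h1 (hs.mul_left _)
  refine ⟨ι, x, fun i => C (y i), h2, ?_, fun u => ?_⟩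
  · refine (h2.tsum_le_tsum h1 (hs.mul_left _)).trans ?_
    rw [tsum_mul_left]
    gcongr
  · simpa using C.hasSum (hA u)

theorem TraceBound.mul_right [CompleteSpace H] {A : H →L[ℂ] H} {K : ℝ} (hA : TraceBound A K)
    (C : H →L[ℂ] H) : TraceBound (A * C) (‖C‖ * K) := by
  obtain ⟨ι, x, y, hs, hb, hA⟩ := hA
  let D := ContinuousLinearMap.adjoint C
  have hD : ‖D‖ = ‖C‖ := (ContinuousLinearMap.adjoint (𝕜 := ℂ)).norm_map C
  have h1 : ∀ i, ‖D (x i)‖ * ‖y i‖ ≤ ‖C‖ * (‖x i‖ * ‖y i‖) := fun i => by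
    calc ‖D (x i)‖ * ‖y i‖ ≤ (‖D‖ * ‖x i‖) * ‖y i‖ := by gcongr; exact D.le_opNorm _
      _ = _ := by rw [hD]; ring
  have h2 : Summable fun i => ‖D (x i)‖ * ‖y i‖ :=
    Summable.of_nonneg_of_le (fun i => by positivity) h1 (hs.mul_left _)
  refine ⟨ι, fun i => D (x i), y, h2, ?_, fun u => ?_⟩
  · refine (h2.tsum_le_tsum h1 (hs.mul_left _)).trans ?_
    rw [tsum_mul_left]
    gcongr
  · simpa [D, ContinuousLinearMap.adjoint_inner_left] using hA (C u)

theorem TraceBound.mul_left_le {A C : H →L[ℂ] H} {K M : ℝ} (hA : TraceBound A K) (hK : 0 ≤ K)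
    (hC : ‖C‖ ≤ M) : TraceBound (C * A) (M * K) :=
  (hA.mul_left C).mono (by gcongr)

theorem TraceBound.mul_right_le [CompleteSpace H] {A C : H →L[ℂ] H} {K M : ℝ}
    (hA : TraceBound A K) (hK : 0 ≤ K) (hC : ‖C‖ ≤ M) : TraceBound (A * C) (M * K) :=
  (hA.mul_right C).mono (by gcongr)

theorem TraceBound.neg {A : H →L[ℂ] H} {K : ℝ} (hA : TraceBound A K) : TraceBound (-A) K := by
  obtain ⟨ι, x, y, hs, hb, hA⟩ := hA
  exact ⟨ι, x, fun i => -y i, by simpa using hs, by simpa using hb,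
    fun u => by simpa using (hA u).neg⟩

theorem TraceBound.sub {A B : H →L[ℂ] H} {K K' : ℝ} (hA : TraceBound A K)
    (hB : TraceBound B K') : TraceBound (A - B) (K + K') := by
  rw [sub_eq_add_neg]
  exact hA.add hB.neg

theorem TraceBound.sum {κ : Type*} (s : Finset κ) {A : κ → H →L[ℂ] H} {K : κ → ℝ}
    (h : ∀ i ∈ s, TraceBound (A i) (K i)) : TraceBound (∑ i ∈ s, A i) (∑ i ∈ s, K i) := by
  classical
  induction s using Finset.induction_on with
  | empty => simpa using TraceBound.zero
  | insert a s ha ih =>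
    rw [Finset.sum_insert ha, Finset.sum_insert ha]
    exact (h a (Finset.mem_insert_self _ _)).add
      (ih fun i hi => h i (Finset.mem_insert_of_mem hi))

variable [CompleteSpace H]

/-- The trace can be read off any nuclear representation. Its norm bound and its cyclicity thereby
become statements about series, with no basis involved. -/
theorem opTrace_eq_tsum {A : H →L[ℂ] H} {ι : Type} {x y : ι → H}
    (hs : Summable (fun i => ‖x i‖ * ‖y i‖))
    (hA : ∀ u : H, HasSum (fun i => inner ℂ (x i) u • y i) (A u)) :
    opTrace A = ∑' i, inner ℂ (x i) (y i) := by
  obtain ⟨x', y', h1, h2, h3⟩ := exists_nat_nuclear hs hA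
  obtain ⟨b, hb⟩ := (exists_hilbertBasis ℂ H).choose_spec
  rw [← h3]
  exact (IsTraceClass.hasSum (A := A) ⟨x', y', h1, h2⟩ b).unique (IsTraceClass.hasSum_aux h1 h2 b)

theorem TraceBound.norm_opTrace_le {A : H →L[ℂ] H} {K : ℝ} (h : TraceBound A K) :
    ‖opTrace A‖ ≤ K := by
  obtain ⟨ι, x, y, hs, hb, hA⟩ := h
  rw [opTrace_eq_tsum hs hA]
  refine le_trans ?_ hb
  exact tsum_of_norm_bounded hs.hasSum fun i => norm_inner_le_norm _ _

theorem TraceBound.nonneg {A : H →L[ℂ] H} {K : ℝ} (h : TraceBound A K) : 0 ≤ K :=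
  (norm_nonneg _).trans h.norm_opTrace_le

theorem opTrace_add {A B : H →L[ℂ] H} (hA : IsTraceClass A) (hB : IsTraceClass B) :
    opTrace (A + B) = opTrace A + opTrace B := by
  obtain ⟨b, hb⟩ := (exists_hilbertBasis ℂ H).choose_spec
  have h1 := (hA.hasSum b).add (hB.hasSum b)
  have : ∀ e : stdBasisSet H, inner ℂ (e : H) ((A + B) e) =
      inner ℂ (e : H) (A e) + inner ℂ (e : H) (B e) := fun e => by
    rw [add_apply, inner_add_right]
  rw [hb] at h1
  refine (tsum_congr this).trans h1.tsum_eq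

/-- Both traces are the same series: in each term `C` acts on the right vector, or its adjoint on
the left one. -/
theorem opTrace_comm {A : H →L[ℂ] H} {K : ℝ} (h : TraceBound A K) (C : H →L[ℂ] H) :
    opTrace (C * A) = opTrace (A * C) := by
  obtain ⟨ι, x, y, hs, hb, hA⟩ := h
  let D := ContinuousLinearMap.adjoint C
  have e1 : opTrace (C * A) = ∑' i, inner ℂ (x i) (C (y i)) := by
    refine opTrace_eq_tsum ?_ fun u => by simpa using C.hasSum (hA u)
    refine Summable.of_nonneg_of_le (fun i => by positivity) (fun i => ?_) (hs.mul_left ‖C‖)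
    calc ‖x i‖ * ‖C (y i)‖ ≤ ‖x i‖ * (‖C‖ * ‖y i‖) := by gcongr; exact C.le_opNorm _
      _ = _ := by ring
  have e2 : opTrace (A * C) = ∑' i, inner ℂ (D (x i)) (y i) := by
    refine opTrace_eq_tsum ?_ fun u => by
      simpa [D, ContinuousLinearMap.adjoint_inner_left] using hA (C u)
    refine Summable.of_nonneg_of_le (fun i => by positivity) (fun i => ?_) (hs.mul_left ‖D‖)
    calc ‖D (x i)‖ * ‖y i‖ ≤ (‖D‖ * ‖x i‖) * ‖y i‖ := by gcongr; exact D.le_opNorm _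
      _ = _ := by ring
  rw [e1, e2]
  exact tsum_congr fun i => (ContinuousLinearMap.adjoint_inner_left C _ _).symm

end TraceNorm

/-! ### Integral operators with square integrable kernels -/

section Kernels

theorem norm_sq_L2R (f : L2R) : ‖f‖ ^ 2 = ∫ x, ‖f x‖ ^ 2 := by
  have h : ((‖f‖ : ℂ)) ^ 2 = ((∫ x, ‖f x‖ ^ 2 : ℝ) : ℂ) := by
    have := inner_self_eq_norm_sq_to_K (𝕜 := ℂ) f
    rw [← RCLike.ofReal_eq_complex_ofReal] at *
    rw [← this, L2.inner_def, ← integral_ofReal]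
    refine integral_congr_ae (Filter.Eventually.of_forall fun x => ?_)
    simp
  exact_mod_cast h

theorem integrable_norm_sq_L2R (f : L2R) : Integrable fun x => ‖f x‖ ^ 2 :=
  (memLp_two_iff_integrable_sq_norm (Lp.aestronglyMeasurable f)).1 (Lp.memLp f)

theorem norm_sq_toLp {f : ℝ → ℂ} (hf : MemLp f 2 volume) : ‖hf.toLp f‖ ^ 2 = ∫ x, ‖f x‖ ^ 2 := by
  rw [norm_sq_L2R]
  refine integral_congr_ae ?_
  filter_upwards [hf.coeFn_toLp] with x hx
  rw [hx]

theorem memLp_conj {f : ℝ → ℂ} {p : ENNReal} (hf : MemLp f p volume) :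
    MemLp (fun x => (starRingEnd ℂ) (f x)) p volume :=
  hf.star

/-- The pairing `∫ f u` as an inner product. -/
theorem integral_mul_eq_inner {f : ℝ → ℂ} (hf : MemLp f 2 volume) (u : L2R) :
    ∫ y, f y * u y = inner ℂ ((memLp_conj hf).toLp _) u := by
  rw [L2.inner_def]
  refine integral_congr_ae ?_
  filter_upwards [(memLp_conj hf).coeFn_toLp] with y hy
  rw [hy, RCLike.inner_apply]
  simp [mul_comm]

theorem norm_integral_mul_sq_le {f : ℝ → ℂ} (hf : MemLp f 2 volume) (u : L2R) :
    ‖∫ y, f y * u y‖ ^ 2 ≤ (∫ y, ‖f y‖ ^ 2) * ‖u‖ ^ 2 := by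
  rw [integral_mul_eq_inner hf]
  have h := norm_inner_le_norm (𝕜 := ℂ) ((memLp_conj hf).toLp _) u
  have h2 : ‖(memLp_conj hf).toLp _‖ ^ 2 = ∫ y, ‖f y‖ ^ 2 := by
    rw [norm_sq_toLp]; simp
  rw [← h2, ← mul_pow]
  gcongr

/-- `A` is the integral operator with kernel `q`. -/
def IsKer (A : L2R →L[ℂ] L2R) (q : ℝ → ℝ → ℂ) : Prop :=
  ∀ u : L2R, (A u : ℝ → ℂ) =ᵐ[volume] fun x => ∫ y, q x y * u y

theorem IsKer.unique {A B : L2R →L[ℂ] L2R} {q : ℝ → ℝ → ℂ} (hA : IsKer A q) (hB : IsKer B q) :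
    A = B := by
  ext1 u
  exact Lp.ext ((hA u).trans (hB u).symm)

/-- The kernel `q` is square integrable, with Hilbert-Schmidt norm at most `K`. -/
structure IsHS (q : ℝ → ℝ → ℂ) (K : ℝ) : Prop where
  meas : StronglyMeasurable (Function.uncurry q)
  int : Integrable (fun z : ℝ × ℝ => ‖q z.1 z.2‖ ^ 2) (volume.prod volume)
  bound : ∫ z : ℝ × ℝ, ‖q z.1 z.2‖ ^ 2 ∂(volume.prod volume) ≤ K ^ 2
  nonneg : 0 ≤ K

namespace IsHS

variable {q : ℝ → ℝ → ℂ} {K : ℝ}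

theorem meas_left (h : IsHS q K) (x : ℝ) : StronglyMeasurable (q x) :=
  h.meas.comp_measurable measurable_prodMk_left

theorem ae_memLp (h : IsHS q K) : ∀ᵐ x, MemLp (q x) 2 volume := by
  filter_upwards [h.int.prod_right_ae] with x hx
  exact (memLp_two_iff_integrable_sq_norm (h.meas_left x).aestronglyMeasurable).2 hx

theorem integrable_row (h : IsHS q K) : Integrable fun x => ∫ y, ‖q x y‖ ^ 2 :=
  h.int.integral_prod_left

theorem integral_row_le (h : IsHS q K) : ∫ x, ∫ y, ‖q x y‖ ^ 2 ≤ K ^ 2 := by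
  have := integral_prod _ h.int
  exact this ▸ h.bound

theorem conj_swap (h : IsHS q K) : IsHS (fun x y => (starRingEnd ℂ) (q y x)) K where
  meas := Complex.continuous_conj.comp_stronglyMeasurable (h.meas.comp_measurable measurable_swap)
  int := by
    have := h.int.swap
    refine this.congr (Filter.Eventually.of_forall fun z => ?_)
    simp
  bound := by
    refine le_trans (le_of_eq ?_) h.bound
    rw [← integral_prod_swap (fun z : ℝ × ℝ => ‖q z.1 z.2‖ ^ 2)]
    simp
  nonneg := h.nonneg

theorem meas_apply (h : IsHS q K) (u : L2R) : StronglyMeasurable fun x => ∫ y, q x y * u y := by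
  refine StronglyMeasurable.integral_prod_right ?_
  exact h.meas.mul ((Lp.stronglyMeasurable u).comp_measurable measurable_snd)

theorem ae_bound (h : IsHS q K) (u : L2R) :
    ∀ᵐ x, ‖∫ y, q x y * u y‖ ^ 2 ≤ (∫ y, ‖q x y‖ ^ 2) * ‖u‖ ^ 2 := by
  filter_upwards [h.ae_memLp] with x hx
  exact norm_integral_mul_sq_le hx u

theorem memLp_apply (h : IsHS q K) (u : L2R) : MemLp (fun x => ∫ y, q x y * u y) 2 volume := by
  rw [memLp_two_iff_integrable_sq_norm (h.meas_apply u).aestronglyMeasurable]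
  refine (h.integrable_row.mul_const (‖u‖ ^ 2)).mono'
    ((h.meas_apply u).aestronglyMeasurable.norm.pow 2) ?_
  filter_upwards [h.ae_bound u] with x hx
  rw [Real.norm_of_nonneg (by positivity)]
  exact hx

theorem ae_integrable_mul (h : IsHS q K) (u : L2R) : ∀ᵐ x, Integrable fun y => q x y * u y := by
  filter_upwards [h.ae_memLp] with x hx
  exact hx.integrable_mul (Lp.memLp u)

theorem exists_isKer (h : IsHS q K) : ∃ A : L2R →L[ℂ] L2R, IsKer A q ∧ ‖A‖ ≤ K := by
  let f : L2R →ₗ[ℂ] L2R :=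
    { toFun := fun u => (h.memLp_apply u).toLp _
      map_add' := fun u v => by
        refine Lp.ext ?_
        filter_upwards [(h.memLp_apply (u + v)).coeFn_toLp, (h.memLp_apply u).coeFn_toLp,
          (h.memLp_apply v).coeFn_toLp, Lp.coeFn_add ((h.memLp_apply u).toLp _)
            ((h.memLp_apply v).toLp _), h.ae_integrable_mul u, h.ae_integrable_mul v]
          with x h1 h2 h3 h4 h5 h6
        rw [h1, h4, Pi.add_apply, h2, h3, ← integral_add h5 h6]
        refine integral_congr_ae ?_
        filter_upwards [Lp.coeFn_add u v] with y hy
        rw [hy, Pi.add_apply, mul_add]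
      map_smul' := fun c u => by
        refine Lp.ext ?_
        filter_upwards [(h.memLp_apply (c • u)).coeFn_toLp, (h.memLp_apply u).coeFn_toLp,
          Lp.coeFn_smul c ((h.memLp_apply u).toLp _)] with x h1 h2 h3
        simp only [RingHom.id_apply]
        rw [h1, h3, Pi.smul_apply, h2, smul_eq_mul, ← integral_const_mul]
        refine integral_congr_ae ?_
        filter_upwards [Lp.coeFn_smul c u] with y hy
        rw [hy, Pi.smul_apply, smul_eq_mul]
        ring }
  have hf : ∀ u, ‖f u‖ ≤ K * ‖u‖ := fun u => by
    have h1 : ‖f u‖ ^ 2 ≤ (K * ‖u‖) ^ 2 := by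
      have : ‖f u‖ ^ 2 = ∫ x, ‖∫ y, q x y * u y‖ ^ 2 := norm_sq_toLp (h.memLp_apply u)
      rw [this, mul_pow]
      refine (integral_mono_ae ?_ (h.integrable_row.mul_const (‖u‖ ^ 2)) (h.ae_bound u)).trans ?_
      · exact (memLp_two_iff_integrable_sq_norm (h.meas_apply u).aestronglyMeasurable).1
          (h.memLp_apply u)
      · rw [integral_mul_const]
        gcongr
        exact h.integral_row_le
    exact (sq_le_sq₀ (norm_nonneg _) (mul_nonneg h.nonneg (norm_nonneg _))).1 h1
  exact ⟨f.mkContinuous K hf, fun u => (h.memLp_apply u).coeFn_toLp,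
    f.mkContinuous_norm_le h.nonneg hf⟩

/-- The reflected conjugate kernel is itself square integrable and so defines an operator; Fubini
identifies this operator with the adjoint. -/
theorem isKer_adjoint (h : IsHS q K) {Q : L2R →L[ℂ] L2R} (hQ : IsKer Q q) :
    IsKer (ContinuousLinearMap.adjoint Q) (fun x y => (starRingEnd ℂ) (q y x)) := by
  obtain ⟨R, hR, -⟩ := h.conj_swap.exists_isKer
  suffices R = ContinuousLinearMap.adjoint Q from this ▸ hR
  rw [ContinuousLinearMap.eq_adjoint_iff]
  intro u v
  have hint : Integrable (fun z : ℝ × ℝ => q z.1 z.2 * (v z.2 * (starRingEnd ℂ) (u z.1)))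
      (volume.prod volume) := by
    have h1 : MemLp (fun z : ℝ × ℝ => q z.1 z.2) 2 (volume.prod volume) :=
      (memLp_two_iff_integrable_sq_norm h.meas.aestronglyMeasurable).2 h.int
    have hm : StronglyMeasurable (fun z : ℝ × ℝ => v z.2 * (starRingEnd ℂ) (u z.1)) :=
      ((Lp.stronglyMeasurable v).comp_measurable measurable_snd).mul
        (Complex.continuous_conj.comp_stronglyMeasurable
          ((Lp.stronglyMeasurable u).comp_measurable measurable_fst))
    have h2 : MemLp (fun z : ℝ × ℝ => v z.2 * (starRingEnd ℂ) (u z.1)) 2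
        (volume.prod volume) := by
      rw [memLp_two_iff_integrable_sq_norm hm.aestronglyMeasurable]
      refine ((integrable_norm_sq_L2R u).mul_prod (integrable_norm_sq_L2R v)).congr
        (Filter.Eventually.of_forall fun z => ?_)
      simp [mul_pow, mul_comm]
    exact h1.integrable_mul h2
  have e1 : inner ℂ (R u) v = ∫ y, ∫ x, q x y * (v y * (starRingEnd ℂ) (u x)) := by
    rw [L2.inner_def]
    refine integral_congr_ae ?_
    filter_upwards [hR u] with y hy
    rw [hy, RCLike.inner_apply, ← integral_conj, ← integral_const_mul]
    refine integral_congr_ae (Filter.Eventually.of_forall fun x => ?_)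
    simp
    ring
  have e2 : inner ℂ u (Q v) = ∫ x, ∫ y, q x y * (v y * (starRingEnd ℂ) (u x)) := by
    rw [L2.inner_def]
    refine integral_congr_ae ?_
    filter_upwards [hQ v] with x hx
    rw [hx, RCLike.inner_apply, ← integral_mul_const]
    refine integral_congr_ae (Filter.Eventually.of_forall fun y => ?_)
    simp only
    ring
  rw [e1, e2]
  exact (integral_integral_swap hint).symm

/-- Bessel's inequality for almost every row of the kernel, integrated over the rows. -/
theorem sum_norm_sq_le (h : IsHS q K) {Q : L2R →L[ℂ] L2R} (hQ : IsKer Q q) {ι : Type}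
    {b : ι → L2R} (hb : Orthonormal ℂ b) (s : Finset ι) : ∑ i ∈ s, ‖Q (b i)‖ ^ 2 ≤ K ^ 2 := by
  simp only [norm_sq_L2R]
  rw [← integral_finsetSum s fun i _ => integrable_norm_sq_L2R _]
  refine le_trans (integral_mono_ae (integrable_finsetSum s fun i _ => integrable_norm_sq_L2R _)
    h.integrable_row ?_) h.integral_row_le
  have hall : ∀ᵐ x, ∀ i ∈ s, Q (b i) x = ∫ y, q x y * b i y :=
    (ae_ball_iff s.countable_toSet).2 fun i _ => hQ (b i)
  filter_upwards [h.ae_memLp, hall] with x hx hi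
  have h1 := hb.sum_inner_products_le ((memLp_conj hx).toLp _) (s := s)
  rw [norm_sq_toLp] at h1
  simp only [RCLike.norm_conj] at h1
  refine le_trans (le_of_eq (Finset.sum_congr rfl fun i his => ?_)) h1
  rw [hi i his, integral_mul_eq_inner hx, norm_inner_symm]

theorem summable_norm_sq (h : IsHS q K) {Q : L2R →L[ℂ] L2R} (hQ : IsKer Q q) {ι : Type}
    {b : ι → L2R} (hb : Orthonormal ℂ b) : Summable fun i => ‖Q (b i)‖ ^ 2 :=
  summable_of_sum_le (fun _ => by positivity) (h.sum_norm_sq_le hQ hb)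

end IsHS

/-- Orthonormal vectors lie at distance √2, so balls of radius 1/2 about them are disjoint open sets
in a separable space. Countability lets an almost everywhere identity hold for all basis vectors at
once. -/
theorem Orthonormal.countable_index {ι : Type} {b : ι → L2R} (hb : Orthonormal ℂ b) :
    Countable ι := by
  have hd : ∀ i j, i ≠ j → 1 < dist (b i) (b j) := fun i j hij => by
    have h1 : ‖b i - b j‖ ^ 2 = 2 := by
      rw [@norm_sub_sq ℂ, hb.2 hij, hb.1 i, hb.1 j]
      norm_num
    rw [dist_eq_norm]
    nlinarith [norm_nonneg (b i - b j)]
  have : Fact ((2 : ENNReal) ≠ ⊤) := ⟨ENNReal.ofNat_ne_top⟩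
  have : SecondCountableTopology L2R := Lp.SecondCountableTopology
  refine Pairwise.countable_of_isOpen_disjoint (s := fun i => Metric.ball (b i) (1 / 2))
    (fun i j hij => ?_) (fun i => Metric.isOpen_ball) (fun i => ⟨b i, by simp⟩)
  refine Metric.ball_disjoint_ball ?_
  linarith [hd i j hij]

/-- The product of two Hilbert-Schmidt operators is of trace class; its trace is the double
integral of the product of the kernels. -/
theorem IsHS.traceBound_mul {q r : ℝ → ℝ → ℂ} {K K' : ℝ} (hq : IsHS q K) (hr : IsHS r K')
    {Q R : L2R →L[ℂ] L2R} (hQ : IsKer Q q) (hR : IsKer R r) :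
    TraceBound (Q * R) (K * K') ∧ opTrace (Q * R) = ∫ x, ∫ y, q x y * r y x := by
  obtain ⟨w, b, -⟩ := exists_hilbertBasis ℂ L2R
  have : Countable w := b.orthonormal.countable_index
  let R' := ContinuousLinearMap.adjoint R
  have hR' := hr.isKer_adjoint hR
  have hr' := hr.conj_swap
  have s1 := hq.summable_norm_sq hQ b.orthonormal
  have s2 := hr'.summable_norm_sq hR' b.orthonormal
  have hfin : ∀ s : Finset w, ∑ i ∈ s, ‖R' (b i)‖ * ‖Q (b i)‖ ≤ K * K' := fun s => by
    refine abs_le_of_sq_le_sq' ?_ (mul_nonneg hq.nonneg hr.nonneg) |>.2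
    refine (Finset.sum_mul_sq_le_sq_mul_sq s _ _).trans ?_
    rw [mul_pow, mul_comm]
    exact mul_le_mul (hq.sum_norm_sq_le hQ b.orthonormal s)
      (hr'.sum_norm_sq_le hR' b.orthonormal s) (Finset.sum_nonneg fun _ _ => by positivity)
      (by positivity)
  have hs : Summable fun i => ‖R' (b i)‖ * ‖Q (b i)‖ :=
    summable_of_sum_le (fun _ => by positivity) hfin
  -- Expanding `R u` in the basis and applying `Q` gives the nuclear representation; Cauchy-Schwarz
  -- has already bounded it by the two Hilbert-Schmidt norms.
  have hA : ∀ u, HasSum (fun i => inner ℂ (R' (b i)) u • Q (b i)) ((Q * R) u) := fun u => by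
    have := Q.hasSum (b.hasSum_repr (R u))
    simpa [R', ContinuousLinearMap.adjoint_inner_left, HilbertBasis.repr_apply_apply] using this
  refine ⟨⟨w, fun i => R' (b i), fun i => Q (b i), hs, hs.tsum_le_of_sum_le hfin, hA⟩, ?_⟩
  rw [opTrace_eq_tsum hs hA]
  have hF : ∀ i, Integrable fun x => inner ℂ (R' (b i) x) (Q (b i) x) := fun i =>
    L2.integrable_inner _ _
  have hFs : Summable fun i => ∫ x, ‖inner ℂ (R' (b i) x) (Q (b i) x)‖ := by
    refine Summable.of_nonneg_of_le (fun i => integral_nonneg fun x => norm_nonneg _)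
      (fun i => ?_) ((s2.add s1))
    have h0 := (integrable_norm_sq_L2R (R' (b i))).add (integrable_norm_sq_L2R (Q (b i)))
    have h1 : ∫ x, ‖inner ℂ (R' (b i) x) (Q (b i) x)‖ ≤
        ∫ x, (‖R' (b i) x‖ ^ 2 + ‖Q (b i) x‖ ^ 2) := by
      refine integral_mono (hF i).norm h0 fun x => ?_
      have := norm_inner_le_norm (𝕜 := ℂ) (R' (b i) x) (Q (b i) x)
      simp only
      nlinarith [sq_nonneg (‖R' (b i) x‖ - ‖Q (b i) x‖), norm_nonneg (R' (b i) x),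
        norm_nonneg (Q (b i) x)]
    rw [integral_add (integrable_norm_sq_L2R _) (integrable_norm_sq_L2R _), ← norm_sq_L2R,
      ← norm_sq_L2R] at h1
    exact h1
  -- The sum over the basis is moved under the integral in x; for fixed x, Parseval then turns it
  -- into the integral over y.
  have key := (hasSum_integral_of_summable_integral_norm hF hFs).tsum_eq
  simp only [L2.inner_def]
  rw [key]
  refine integral_congr_ae ?_
  have a1 : ∀ᵐ x, ∀ i, Q (b i) x = ∫ y, q x y * b i y := ae_all_iff.2 fun i => hQ (b i)
  have a2 : ∀ᵐ x, ∀ i, R' (b i) x = ∫ y, (starRingEnd ℂ) (r y x) * b i y :=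
    ae_all_iff.2 fun i => hR' (b i)
  filter_upwards [a1, a2, hq.ae_memLp, hr'.ae_memLp] with x h1 h2 h3 h4
  have h5 : MemLp (fun y => r y x) 2 volume := by simpa using memLp_conj h4
  have h6 := b.tsum_inner_mul_inner ((memLp_conj h3).toLp _) (h5.toLp _)
  have h7 : ∀ i, inner ℂ (R' (b i) x) (Q (b i) x) =
      inner ℂ ((memLp_conj h3).toLp _) (b i) * inner ℂ (b i) (h5.toLp _) := fun i => by
    rw [RCLike.inner_apply, h1 i, h2 i, integral_mul_eq_inner h3, integral_mul_eq_inner h4,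
      inner_conj_symm]
    congr 2
    refine Lp.ext ?_
    filter_upwards [(memLp_conj h4).coeFn_toLp, h5.coeFn_toLp] with y e1 e2
    rw [e1, e2]
    simp
  simp only [h7]
  rw [h6, ← integral_mul_eq_inner h3]
  refine integral_congr_ae ?_
  filter_upwards [h5.coeFn_toLp] with y hy
  rw [hy]

/-- A kernel dominated by a product of functions of one variable. -/
theorem IsHS.of_le_mul {q : ℝ → ℝ → ℂ} {f g : ℝ → ℝ} {K : ℝ}
    (hm : StronglyMeasurable (Function.uncurry q)) (hf : Integrable f) (hg : Integrable g)
    (hb : ∀ x y, ‖q x y‖ ^ 2 ≤ f x * g y) (hK : 0 ≤ K) (hKb : (∫ x, f x) * ∫ y, g y ≤ K ^ 2) :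
    IsHS q K := by
  have hfg := hf.mul_prod hg
  have hint : Integrable (fun z : ℝ × ℝ => ‖q z.1 z.2‖ ^ 2) (volume.prod volume) :=
    hfg.mono' (hm.norm.pow 2).aestronglyMeasurable (Filter.Eventually.of_forall fun z => by
      rw [Real.norm_of_nonneg (by positivity)]
      exact hb _ _)
  refine ⟨hm, hint, (integral_mono hint hfg fun z => hb _ _).trans ?_, hK⟩
  rw [integral_prod_mul f g]
  exact hKb

theorem measurePreserving_fst_sub :
    MeasurePreserving (fun z : ℝ × ℝ => (z.1, z.1 - z.2)) (volume.prod volume)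
      (volume.prod volume) := by
  refine MeasurePreserving.skew_product (g := fun x y => x - y) (MeasurePreserving.id _)
    (by fun_prop) ?_
  exact Filter.Eventually.of_forall fun x => (Measure.measurePreserving_sub_left volume x).map_eq

theorem integrable_mul_comp_sub {f g : ℝ → ℝ} (hf : Integrable f) (hg : Integrable g) :
    Integrable (fun z : ℝ × ℝ => f z.1 * g (z.1 - z.2)) (volume.prod volume) :=
  measurePreserving_fst_sub.integrable_comp_of_integrable (hf.mul_prod hg)

theorem integral_mul_comp_sub (f g : ℝ → ℝ) :
    ∫ z : ℝ × ℝ, f z.1 * g (z.1 - z.2) ∂(volume.prod volume) = (∫ x, f x) * ∫ y, g y := by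
  rw [← integral_prod_mul f g]
  have hme : MeasurableEmbedding (fun z : ℝ × ℝ => (z.1, z.1 - z.2)) := by
    let e : (ℝ × ℝ) ≃ᵐ (ℝ × ℝ) :=
      { toFun := fun z => (z.1, z.1 - z.2)
        invFun := fun z => (z.1, z.1 - z.2)
        left_inv := fun z => by simp
        right_inv := fun z => by simp
        measurable_toFun := by simp only [Equiv.coe_fn_mk]; fun_prop
        measurable_invFun := by simp only [Equiv.coe_fn_symm_mk]; fun_prop }
    exact e.measurableEmbedding
  exact measurePreserving_fst_sub.integral_comp hme (fun z : ℝ × ℝ => f z.1 * g z.2)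

/-- A kernel dominated by `f x * g (x - y)`. -/
theorem IsHS.of_le_conv {q : ℝ → ℝ → ℂ} {f g : ℝ → ℝ} {K : ℝ}
    (hm : StronglyMeasurable (Function.uncurry q)) (hf : Integrable f) (hg : Integrable g)
    (hb : ∀ x y, ‖q x y‖ ^ 2 ≤ f x * g (x - y)) (hK : 0 ≤ K)
    (hKb : (∫ x, f x) * ∫ y, g y ≤ K ^ 2) : IsHS q K := by
  have hfg := integrable_mul_comp_sub hf hg
  have hint : Integrable (fun z : ℝ × ℝ => ‖q z.1 z.2‖ ^ 2) (volume.prod volume) :=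
    hfg.mono' (hm.norm.pow 2).aestronglyMeasurable (Filter.Eventually.of_forall fun z => by
      rw [Real.norm_of_nonneg (by positivity)]
      exact hb _ _)
  refine ⟨hm, hint, (integral_mono hint hfg fun z => hb _ _).trans ?_, hK⟩
  rw [integral_mul_comp_sub]
  exact hKb

/-- A kernel dominated by `f y * g (x - y)`. -/
theorem IsHS.of_le_conv' {q : ℝ → ℝ → ℂ} {f g : ℝ → ℝ} {K : ℝ}
    (hm : StronglyMeasurable (Function.uncurry q)) (hf : Integrable f) (hg : Integrable g)
    (hb : ∀ x y, ‖q x y‖ ^ 2 ≤ f y * g (x - y)) (hK : 0 ≤ K)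
    (hKb : (∫ x, f x) * ∫ y, g y ≤ K ^ 2) : IsHS q K := by
  have h := IsHS.of_le_conv (q := fun x y => (starRingEnd ℂ) (q y x)) (g := fun t => g (-t))
    (Complex.continuous_conj.comp_stronglyMeasurable (hm.comp_measurable measurable_swap))
    hf hg.comp_neg (fun x y => by simpa using hb y x) hK (by rwa [integral_neg_eq_self])
  simpa using h.conj_swap

end Kernels

/-! ### Multiplication operators and Fourier multipliers -/

section Multipliers

open Classical in
/-- Multiplication by an essentially bounded function (zero if the function is not). -/
def mulOp (m : ℝ → ℂ) : L2R →L[ℂ] L2R :=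
  if h : MemLp m ⊤ (volume : Measure ℝ) then mulLinf (h.toLp m) else 0

theorem mulOp_ae {m : ℝ → ℂ} (hm : MemLp m ⊤ volume) (u : L2R) :
    (mulOp m u : ℝ → ℂ) =ᵐ[volume] fun x => m x * u x := by
  rw [mulOp, dif_pos hm]
  filter_upwards [mulLinf_ae (hm.toLp _) u, hm.coeFn_toLp] with x h1 h2
  rw [h1, h2]

theorem mulChi_eq_mulOp {Λ : Set ℝ} (hΛ : MeasurableSet Λ) :
    mulChi Λ hΛ = mulOp (Λ.indicator fun _ => (1 : ℂ)) := by
  rw [mulOp, dif_pos (memLp_top_chi hΛ)]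
  rfl

theorem memLp_mul_top {f g : ℝ → ℂ} {p : ENNReal} (hf : MemLp f ⊤ volume)
    (hg : MemLp g p volume) : MemLp (fun x => f x * g x) p volume :=
  hg.mul hf

theorem mulOp_mul {f g : ℝ → ℂ} (hf : MemLp f ⊤ volume) (hg : MemLp g ⊤ volume) :
    mulOp f * mulOp g = mulOp (fun x => f x * g x) := by
  ext1 u
  refine Lp.ext ?_
  filter_upwards [mulOp_ae hf (mulOp g u), mulOp_ae hg u, mulOp_ae (memLp_mul_top hf hg) u]
    with x h1 h2 h3
  rw [mul_apply_eq_comp, h1, h2, h3, mul_assoc]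

theorem mulOp_add {f g : ℝ → ℂ} (hf : MemLp f ⊤ volume) (hg : MemLp g ⊤ volume) :
    mulOp f + mulOp g = mulOp (fun x => f x + g x) := by
  ext1 u
  refine Lp.ext ?_
  filter_upwards [mulOp_ae hf u, mulOp_ae hg u, mulOp_ae (hf.add hg) u,
    Lp.coeFn_add (mulOp f u) (mulOp g u)] with x h1 h2 h3 h4
  have h5 : (mulOp (fun x => f x + g x) u : ℝ → ℂ) x = (f x + g x) * u x := h3
  rw [add_apply, h4, Pi.add_apply, h1, h2, h5, add_mul]

theorem mulOp_sub {f g : ℝ → ℂ} (hf : MemLp f ⊤ volume) (hg : MemLp g ⊤ volume) :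
    mulOp f - mulOp g = mulOp (fun x => f x - g x) := by
  rw [sub_eq_iff_eq_add, mulOp_add (f := fun x => f x - g x) (hf.sub hg) hg]
  simp

theorem mulOp_congr {f g : ℝ → ℂ} (hf : MemLp f ⊤ volume) (h : f =ᵐ[volume] g) :
    mulOp f = mulOp g := by
  ext1 u
  refine Lp.ext ?_
  filter_upwards [mulOp_ae hf u, mulOp_ae (hf.ae_eq h) u, h] with x h1 h2 h3
  rw [h1, h2, h3]

theorem memLp_top_one : MemLp (fun _ : ℝ => (1 : ℂ)) ⊤ volume := memLp_top_const 1

theorem mulOp_one : mulOp (fun _ => 1) = 1 := by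
  ext1 u
  refine Lp.ext ?_
  filter_upwards [mulOp_ae memLp_top_one u] with x h1
  rw [h1]
  simp

theorem norm_mulOp_le {m : ℝ → ℂ} (hm : MemLp m ⊤ volume) {C : ℝ} (hC : 0 ≤ C)
    (h : ∀ x, ‖m x‖ ≤ C) : ‖mulOp m‖ ≤ C := by
  refine ContinuousLinearMap.opNorm_le_bound _ hC fun u => ?_
  refine Lp.norm_le_mul_norm_of_ae_le_mul ?_
  filter_upwards [mulOp_ae hm u] with x hx
  rw [hx, norm_mul]
  gcongr
  exact h x

theorem adjoint_mulOp {m : ℝ → ℂ} (hm : MemLp m ⊤ volume) :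
    ContinuousLinearMap.adjoint (mulOp m) = mulOp fun x => (starRingEnd ℂ) (m x) := by
  symm
  rw [ContinuousLinearMap.eq_adjoint_iff]
  intro u v
  rw [L2.inner_def, L2.inner_def]
  refine integral_congr_ae ?_
  filter_upwards [mulOp_ae (memLp_conj hm) u, mulOp_ae hm v] with x h1 h2
  rw [h1, h2]
  simp only [RCLike.inner_apply, map_mul, Complex.conj_conj]
  ring

/-- The Fourier transform as a bounded operator. -/
def fourierOp : L2R →L[ℂ] L2R :=
  (Lp.fourierTransformₗᵢ ℝ ℂ).toContinuousLinearEquiv.toContinuousLinearMap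

/-- The inverse Fourier transform as a bounded operator. -/
def fourierInvOp : L2R →L[ℂ] L2R :=
  (Lp.fourierTransformₗᵢ ℝ ℂ).symm.toContinuousLinearEquiv.toContinuousLinearMap

theorem fourierOp_apply (u : L2R) : fourierOp u = 𝓕 u := rfl

theorem fourierInvOp_apply (u : L2R) : fourierInvOp u = 𝓕⁻ u := rfl

theorem fourierOp_mul_inv : fourierOp * fourierInvOp = 1 := by
  ext1 u
  exact (Lp.fourierTransformₗᵢ ℝ ℂ).apply_symm_apply u

theorem fourierInvOp_mul : fourierInvOp * fourierOp = 1 := by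
  ext1 u
  exact (Lp.fourierTransformₗᵢ ℝ ℂ).symm_apply_apply u

theorem adjoint_fourierOp : ContinuousLinearMap.adjoint fourierOp = fourierInvOp := by
  symm
  rw [ContinuousLinearMap.eq_adjoint_iff]
  intro u v
  have h := (Lp.fourierTransformₗᵢ ℝ ℂ).inner_map_map ((Lp.fourierTransformₗᵢ ℝ ℂ).symm u) v
  rw [(Lp.fourierTransformₗᵢ ℝ ℂ).apply_symm_apply] at h
  exact h.symm

theorem adjoint_fourierInvOp : ContinuousLinearMap.adjoint fourierInvOp = fourierOp := by
  rw [← adjoint_fourierOp, ContinuousLinearMap.adjoint_adjoint]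

theorem norm_fourierOp_le : ‖fourierOp‖ ≤ 1 :=
  ContinuousLinearMap.opNorm_le_bound _ zero_le_one fun u => by
    rw [one_mul]
    exact ((Lp.fourierTransformₗᵢ ℝ ℂ).norm_map u).le

theorem norm_fourierInvOp_le : ‖fourierInvOp‖ ≤ 1 :=
  ContinuousLinearMap.opNorm_le_bound _ zero_le_one fun u => by
    rw [one_mul]
    exact ((Lp.fourierTransformₗᵢ ℝ ℂ).symm.norm_map u).le

/-- The Fourier multiplier with symbol `m`. -/
def fmul (m : ℝ → ℂ) : L2R →L[ℂ] L2R := fourierInvOp * mulOp m * fourierOp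

theorem fourierOp_fmul (m : ℝ → ℂ) : fourierOp * fmul m = mulOp m * fourierOp := by
  rw [fmul, ← mul_assoc, ← mul_assoc, fourierOp_mul_inv, one_mul]

theorem fmul_mul {f g : ℝ → ℂ} (hf : MemLp f ⊤ volume) (hg : MemLp g ⊤ volume) :
    fmul f * fmul g = fmul (fun x => f x * g x) := by
  rw [fmul, mul_assoc _ fourierOp, fourierOp_fmul, fmul, ← mulOp_mul hf hg]
  simp only [mul_assoc]

theorem fmul_sub {f g : ℝ → ℂ} (hf : MemLp f ⊤ volume) (hg : MemLp g ⊤ volume) :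
    fmul f - fmul g = fmul (fun x => f x - g x) := by
  simp only [fmul, ← mulOp_sub hf hg, mul_sub, sub_mul]

theorem fmul_congr {f g : ℝ → ℂ} (hf : MemLp f ⊤ volume) (h : f =ᵐ[volume] g) :
    fmul f = fmul g := by
  rw [fmul, fmul, mulOp_congr hf h]

theorem fmul_one : fmul (fun _ => 1) = 1 := by
  rw [fmul, mulOp_one, mul_one, fourierInvOp_mul]

theorem norm_fmul_le {m : ℝ → ℂ} (hm : MemLp m ⊤ volume) {C : ℝ} (hC : 0 ≤ C)
    (h : ∀ x, ‖m x‖ ≤ C) : ‖fmul m‖ ≤ C := by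
  calc ‖fmul m‖ ≤ ‖fourierInvOp‖ * ‖mulOp m‖ * ‖fourierOp‖ :=
        (norm_mul_le _ _).trans (by gcongr; exact norm_mul_le _ _)
    _ ≤ 1 * C * 1 := by
        gcongr
        · exact norm_fourierInvOp_le
        · exact norm_mulOp_le hm hC h
        · exact norm_fourierOp_le
    _ = C := by ring

/-- The character `e^{2πit}`. -/
def ph (t : ℝ) : ℂ := Complex.exp ((2 * Real.pi * t : ℝ) * Complex.I)

theorem continuous_ph : Continuous ph := by unfold ph; fun_prop

theorem norm_ph (t : ℝ) : ‖ph t‖ = 1 := Complex.norm_exp_ofReal_mul_I _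

theorem ph_add (s t : ℝ) : ph (s + t) = ph s * ph t := by
  rw [ph, ph, ph, ← Complex.exp_add]
  congr 1
  push_cast
  ring

theorem ph_zero : ph 0 = 1 := by simp [ph]

theorem conj_ph (t : ℝ) : (starRingEnd ℂ) (ph t) = ph (-t) := by
  rw [ph, ph, ← Complex.exp_conj]
  congr 1
  simp only [map_mul, Complex.conj_ofReal, Complex.conj_I]
  push_cast
  ring

theorem fourierInv_eq_ph (f : ℝ → ℂ) (x : ℝ) : 𝓕⁻ f x = ∫ η, ph (x * η) * f η := by
  rw [Real.fourierInv_eq']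
  refine integral_congr_ae (Filter.Eventually.of_forall fun η => ?_)
  simp [ph, mul_comm, mul_left_comm]

theorem fourier_eq_ph (f : ℝ → ℂ) (x : ℝ) : 𝓕 f x = ∫ η, ph (-(x * η)) * f η := by
  rw [Real.fourier_eq']
  refine integral_congr_ae (Filter.Eventually.of_forall fun η => ?_)
  simp [ph, mul_comm, mul_left_comm]

theorem norm_fourierInv_le (f : ℝ → ℂ) (x : ℝ) : ‖𝓕⁻ f x‖ ≤ ∫ η, ‖f η‖ := by
  rw [fourierInv_eq_ph]
  refine (norm_integral_le_integral_norm _).trans (le_of_eq ?_)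
  simp [norm_ph]

/-- Both sides are tested against smooth compactly supported functions: on the left through the
distributional definition, on the right through Fubini. -/
theorem fourier_L2_ae (h : L2R) (hi : Integrable (h : ℝ → ℂ)) :
    ((𝓕 h : L2R) : ℝ → ℂ) =ᵐ[volume] 𝓕 (h : ℝ → ℂ) := by
  have hcont : Continuous (𝓕 (h : ℝ → ℂ)) :=
    VectorFourier.fourierIntegral_continuous (L := innerₗ ℝ) Real.continuous_fourierChar
      continuous_inner hi
  refine ae_eq_of_integral_contDiff_smul_eq
    ((Lp.memLp (𝓕 h : L2R)).locallyIntegrable (by norm_num)) hcont.locallyIntegrable ?_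
  intro g hg hgs
  have hs : HasCompactSupport (fun x => (g x : ℂ)) := hgs.comp_left Complex.ofReal_zero
  have hd : ContDiff ℝ ∞ (fun x => (g x : ℂ)) := Complex.ofRealCLM.contDiff.comp hg
  let φ : 𝓢(ℝ, ℂ) := hs.toSchwartzMap hd
  have h1 : ∫ x, φ x • ((𝓕 h : L2R) : ℝ → ℂ) x = ∫ x, (𝓕 φ : 𝓢(ℝ, ℂ)) x • h x := by
    have := congrArg (fun T => T φ) (Lp.fourier_toTemperedDistribution_eq h)
    simp only [TemperedDistribution.fourier_apply, Lp.toTemperedDistribution_apply] at this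
    exact this.symm
  have h2 : ∫ x, (𝓕 φ : 𝓢(ℝ, ℂ)) x • h x = ∫ x, φ x • 𝓕 (h : ℝ → ℂ) x := by
    have := VectorFourier.integral_fourierIntegral_smul_eq_flip (μ := volume) (ν := volume)
      (f := (φ : ℝ → ℂ)) (g := (h : ℝ → ℂ)) (L := innerₗ ℝ) Real.continuous_fourierChar
      continuous_inner φ.integrable hi
    rw [SchwartzMap.fourier_coe]
    refine this.trans ?_
    refine integral_congr_ae (Filter.Eventually.of_forall fun x => ?_)
    simp only [FourierTransform.fourier, VectorFourier.fourierIntegral]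
    simp
  have h3 : ∀ x, φ x = (g x : ℂ) := fun x => rfl
  simp only [h3] at h1 h2
  simpa using h1.trans h2

theorem fourier_toLp_ae {f : ℝ → ℂ} (hf : MemLp f 2 volume) (hi : Integrable f) :
    ((𝓕 (hf.toLp f) : L2R) : ℝ → ℂ) =ᵐ[volume] 𝓕 f := by
  refine (fourier_L2_ae _ (hi.congr hf.coeFn_toLp.symm)).trans
    (Filter.Eventually.of_forall fun x => ?_)
  rw [fourier_eq_ph, fourier_eq_ph]
  refine integral_congr_ae ?_
  filter_upwards [hf.coeFn_toLp] with y hy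
  rw [hy]

theorem fourierInv_toLp_ae {f : ℝ → ℂ} (hf : MemLp f 2 volume) (hi : Integrable f) :
    ((𝓕⁻ (hf.toLp f) : L2R) : ℝ → ℂ) =ᵐ[volume] 𝓕⁻ f := by
  refine (fourierInv_L2_ae _ (hi.congr hf.coeFn_toLp.symm)).trans
    (Filter.Eventually.of_forall fun x => ?_)
  rw [fourierInv_eq_ph, fourierInv_eq_ph]
  refine integral_congr_ae ?_
  filter_upwards [hf.coeFn_toLp] with y hy
  rw [hy]

theorem conj_fourierInv_conj (f : ℝ → ℂ) (x : ℝ) :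
    (starRingEnd ℂ) (𝓕⁻ (fun η => (starRingEnd ℂ) (f η)) x) = 𝓕 f x := by
  rw [fourierInv_eq_ph, fourier_eq_ph, ← integral_conj]
  simp [conj_ph]

/-- The multiplication formula `∫ g û = ∫ ĝ u`. -/
theorem integral_mul_fourier {g : ℝ → ℂ} (h2 : MemLp g 2 volume) (h1 : Integrable g) (u : L2R) :
    ∫ η, g η * (𝓕 u : L2R) η = ∫ y, 𝓕 g y * u y := by
  rw [integral_mul_eq_inner h2]
  have hadj : inner ℂ ((memLp_conj h2).toLp _) (𝓕 u : L2R) =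
      inner ℂ (𝓕⁻ ((memLp_conj h2).toLp _) : L2R) u := by
    rw [← fourierOp_apply, ← fourierInvOp_apply, ← adjoint_fourierOp,
      ContinuousLinearMap.adjoint_inner_left]
  rw [hadj, L2.inner_def]
  have hi : Integrable fun η => (starRingEnd ℂ) (g η) := memLp_one_iff_integrable.1
    (memLp_conj (memLp_one_iff_integrable.2 h1))
  refine integral_congr_ae ?_
  filter_upwards [fourierInv_toLp_ae (memLp_conj h2) hi] with y hy
  rw [hy, RCLike.inner_apply, conj_fourierInv_conj, mul_comm]

/-! ### Pseudodifferential operators on the whole of `L²` -/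

/-- `A` is the operator `(A u)(x) = ∫ e^{2πixη} σ(x, η) û(η) dη`. -/
def IsPdo (A : L2R →L[ℂ] L2R) (σ : ℝ → ℝ → ℂ) : Prop :=
  ∀ u : L2R, (A u : ℝ → ℂ) =ᵐ[volume] fun x => ∫ η, ph (x * η) * σ x η * (𝓕 u : L2R) η

theorem IsPdo.unique {A B : L2R →L[ℂ] L2R} {σ : ℝ → ℝ → ℂ} (hA : IsPdo A σ) (hB : IsPdo B σ) :
    A = B := by
  ext1 u
  exact Lp.ext ((hA u).trans (hB u).symm)

/-- The multiplication formula moves the Fourier transform from `u` to the modulated symbol, which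
passes from the symbol to the kernel. -/
theorem integral_pdo_eq_kernel {s : ℝ → ℂ} (h2 : MemLp s 2 volume) (h1 : Integrable s) (x : ℝ)
    (u : L2R) :
    ∫ η, ph (x * η) * s η * (𝓕 u : L2R) η = ∫ y, 𝓕⁻ s (x - y) * u y := by
  have hm : Continuous fun η => ph (x * η) := continuous_ph.comp (by fun_prop)
  have hb : MemLp (fun η => ph (x * η)) ⊤ volume :=
    memLp_top_of_bound hm.aestronglyMeasurable 1
      (Filter.Eventually.of_forall fun η => (norm_ph _).le)
  rw [integral_mul_fourier (memLp_mul_top hb h2) (memLp_one_iff_integrable.1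
    (memLp_mul_top hb (memLp_one_iff_integrable.2 h1)))]
  refine integral_congr_ae (Filter.Eventually.of_forall fun y => ?_)
  simp only
  rw [fourier_eq_ph, fourierInv_eq_ph]
  congr 1
  refine integral_congr_ae (Filter.Eventually.of_forall fun η => ?_)
  simp only
  rw [← mul_assoc, ← ph_add]
  congr 2
  ring

theorem IsPdo.isKer {A : L2R →L[ℂ] L2R} {σ : ℝ → ℝ → ℂ} (hA : IsPdo A σ)
    (h2 : ∀ x, MemLp (σ x) 2 volume) (h1 : ∀ x, Integrable (σ x)) :
    IsKer A fun x y => 𝓕⁻ (σ x) (x - y) := fun u =>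
  (hA u).trans (Filter.Eventually.of_forall fun x => integral_pdo_eq_kernel (h2 x) (h1 x) x u)

theorem IsKer.isPdo {A : L2R →L[ℂ] L2R} {σ : ℝ → ℝ → ℂ}
    (hA : IsKer A fun x y => 𝓕⁻ (σ x) (x - y))
    (h2 : ∀ x, MemLp (σ x) 2 volume) (h1 : ∀ x, Integrable (σ x)) : IsPdo A σ := fun u =>
  (hA u).trans (Filter.Eventually.of_forall fun x =>
    (integral_pdo_eq_kernel (h2 x) (h1 x) x u).symm)

/-- A multiplier on the right multiplies the symbol exactly, with no composition error. For this
reason frequency cutoffs are always placed to the right of the operator. -/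
theorem IsPdo.mul_fmul {A : L2R →L[ℂ] L2R} {σ : ℝ → ℝ → ℂ} (hA : IsPdo A σ) {m : ℝ → ℂ}
    (hm : MemLp m ⊤ volume) : IsPdo (A * fmul m) fun x η => σ x η * m η := by
  intro u
  filter_upwards [hA (fmul m u)] with x hx
  rw [mul_apply_eq_comp, hx]
  refine integral_congr_ae ?_
  have h := congrArg (fun B : L2R →L[ℂ] L2R => B u) (fourierOp_fmul m)
  simp only [mul_apply_eq_comp, fourierOp_apply] at h
  rw [h]
  filter_upwards [mulOp_ae hm (𝓕 u)] with η hη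
  rw [hη]
  ring

theorem isPdo_fmul {m : ℝ → ℂ} (hm : MemLp m ⊤ volume) (h2 : MemLp m 2 volume) :
    IsPdo (fmul m) fun _ η => m η := by
  intro u
  have hae := mulOp_ae hm (𝓕 u)
  have hi : Integrable (mulOp m (𝓕 u) : ℝ → ℂ) :=
    (h2.integrable_mul (Lp.memLp (𝓕 u : L2R))).congr hae.symm
  refine (fourierInv_L2_ae _ hi).trans (Filter.Eventually.of_forall fun x => ?_)
  rw [fourierInv_eq_ph]
  refine integral_congr_ae ?_
  filter_upwards [hae] with η hη
  rw [hη, mul_assoc]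

theorem isKer_fmul {m : ℝ → ℂ} (hm : MemLp m ⊤ volume) (h2 : MemLp m 2 volume)
    (h1 : Integrable m) : IsKer (fmul m) fun x y => 𝓕⁻ m (x - y) :=
  (isPdo_fmul hm h2).isKer (fun _ => h2) fun _ => h1

theorem IsKer.mulOp_mul {A : L2R →L[ℂ] L2R} {q : ℝ → ℝ → ℂ} (hA : IsKer A q) {f : ℝ → ℂ}
    (hf : MemLp f ⊤ volume) : IsKer (mulOp f * A) fun x y => f x * q x y := by
  intro u
  filter_upwards [mulOp_ae hf (A u), hA u] with x h1 h2
  rw [mul_apply_eq_comp, h1, h2, ← integral_const_mul]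
  refine integral_congr_ae (Filter.Eventually.of_forall fun η => ?_)
  simp only
  ring

theorem IsKer.mul_mulOp {A : L2R →L[ℂ] L2R} {q : ℝ → ℝ → ℂ} (hA : IsKer A q) {f : ℝ → ℂ}
    (hf : MemLp f ⊤ volume) : IsKer (A * mulOp f) fun x y => q x y * f y := by
  intro u
  filter_upwards [hA (mulOp f u)] with x h1
  rw [mul_apply_eq_comp, h1]
  refine integral_congr_ae ?_
  filter_upwards [mulOp_ae hf u] with y hy
  rw [hy]
  ring

/-- Trace norm bound for a product of two integral operators, with a weight inserted between
them. -/
theorem traceBound_mul_of_weight {Q R : L2R →L[ℂ] L2R} {q r : ℝ → ℝ → ℂ} {wt : ℝ → ℝ} {K K' : ℝ}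
    (hQ : IsKer Q q) (hR : IsKer R r) (hwt : Measurable wt) (hpos : ∀ y, 0 < wt y)
    (hle : ∀ y, wt y ≤ 1) (hq : IsHS (fun x y => q x y * ((wt y)⁻¹ : ℝ)) K)
    (hr : IsHS (fun x y => (wt x : ℂ) * r x y) K') : TraceBound (Q * R) (K * K') := by
  obtain ⟨Q', hQ', -⟩ := hq.exists_isKer
  have hm : MemLp (fun y => (wt y : ℂ)) ⊤ volume :=
    memLp_top_of_bound (Complex.measurable_ofReal.comp hwt).aestronglyMeasurable 1
      (Filter.Eventually.of_forall fun y => by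
        rw [Complex.norm_real, Real.norm_of_nonneg (hpos y).le]; exact hle y)
  -- `Q` is factored through the weight, so `Q R` is the product of two Hilbert-Schmidt operators
  -- although `R` alone need not be one.
  have e : Q' * mulOp (fun y => (wt y : ℂ)) = Q := by
    refine IsKer.unique ?_ hQ
    have h := hQ'.mul_mulOp hm
    convert! h using 3 with x y
    have : (wt y : ℂ) ≠ 0 := by exact_mod_cast (hpos y).ne'
    push_cast
    field_simp
  have h := (hq.traceBound_mul hr hQ' (hR.mulOp_mul hm)).1
  rwa [← mul_assoc, e] at h

end Multipliers

/-! ### Decay of kernels, Schur bounds, and trace norm bounds -/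

section Decay

/-- The function `k` is bounded by the profile `K w / (1 + (w t)²)`. -/
def HasDecay (k : ℝ → ℂ) (K w : ℝ) : Prop := ∀ t, ‖k t‖ ≤ K * (w * (1 + (w * t) ^ 2)⁻¹)

/-- The L¹ norm of m bounds its transform, and the L¹ norm of m'' bounds t² times its transform;
adding the two with weight w² gives the profile. -/
theorem hasDecay_fourierInv {m : ℝ → ℂ} (hm : ContDiff ℝ 2 m) (hs : HasCompactSupport m)
    {K w : ℝ} (hw : 0 < w) (hK : (∫ η, ‖m η‖) + w ^ 2 * ∫ η, ‖iteratedDeriv 2 m η‖ ≤ K * w) :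
    HasDecay (𝓕⁻ m) K w := by
  intro t
  have hi : ∀ n : ℕ, (n : ℕ∞) ≤ 2 → Integrable (iteratedDeriv n m) := fun n hn => by
    have hc : Continuous (iteratedDeriv n m) := hm.continuous_iteratedDeriv n (by exact_mod_cast hn)
    refine hc.integrable_of_hasCompactSupport ?_
    refine hs.mono' ?_
    rw [iteratedDeriv_eq_iterate]
    have : ∀ n : ℕ, tsupport (deriv^[n] m) ⊆ tsupport m := fun n => by
      induction n with
      | zero => simp
      | succ n ih =>
        rw [Function.iterate_succ_apply']
        exact tsupport_deriv_subset.trans ih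
    exact (subset_tsupport _).trans (this n)
  have h2 := congrFun (Real.fourier_iteratedDeriv (N := 2) (n := 2) hm
    (fun n hn => hi n hn) le_rfl) (-t)
  have h3 : ‖𝓕 (iteratedDeriv 2 m) (-t)‖ ≤ ∫ η, ‖iteratedDeriv 2 m η‖ := by
    rw [← Real.fourierInv_eq_fourier_neg]
    exact norm_fourierInv_le _ _
  rw [h2] at h3
  have h4 : 𝓕 m (-t) = 𝓕⁻ m t := (Real.fourierInv_eq_fourier_neg m t).symm
  rw [h4, norm_smul, norm_pow] at h3
  have h5 : ‖(2 * Real.pi * Complex.I * ((-t : ℝ) : ℂ) : ℂ)‖ = 2 * Real.pi * |t| := by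
    simp [abs_of_pos Real.pi_pos]
  rw [h5] at h3
  -- The factor (2π)² coming from two derivatives is only used as being at least 1.
  have h6 : t ^ 2 ≤ (2 * Real.pi * |t|) ^ 2 := by
    rw [mul_pow, sq_abs]
    have : 1 ≤ (2 * Real.pi) ^ 2 := by nlinarith [Real.pi_gt_three]
    nlinarith [sq_nonneg t]
  have h7 := norm_fourierInv_le m t
  have h8 : t ^ 2 * ‖𝓕⁻ m t‖ ≤ ∫ η, ‖iteratedDeriv 2 m η‖ :=
    (mul_le_mul_of_nonneg_right h6 (norm_nonneg _)).trans h3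
  rw [← mul_assoc, ← div_eq_mul_inv, le_div_iff₀ (by positivity)]
  refine le_trans ?_ hK
  have h9 : w ^ 2 * (t ^ 2 * ‖𝓕⁻ m t‖) ≤ w ^ 2 * ∫ η, ‖iteratedDeriv 2 m η‖ := by gcongr
  nlinarith

/-- The profile `(1 + (w y)²)^(-β)`. -/
def bracket (β w y : ℝ) : ℝ := (1 + (w * y) ^ 2) ^ (-β)

theorem bracket_pos (β w y : ℝ) : 0 < bracket β w y := by unfold bracket; positivity

theorem measurable_bracket (β w : ℝ) : Measurable (bracket β w) := by
  unfold bracket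
  fun_prop

theorem bracket_le_one {β : ℝ} (hβ : 0 ≤ β) (w y : ℝ) : bracket β w y ≤ 1 :=
  Real.rpow_le_one_of_one_le_of_nonpos (by nlinarith [sq_nonneg (w * y)]) (by linarith)

theorem bracket_add (β γ w y : ℝ) : bracket β w y * bracket γ w y = bracket (β + γ) w y := by
  unfold bracket
  rw [← Real.rpow_add (by positivity)]
  congr 1
  ring

theorem bracket_inv (β w y : ℝ) : (bracket β w y)⁻¹ = bracket (-β) w y := by
  unfold bracket
  rw [← Real.rpow_neg (by positivity)]

theorem bracket_sq (β w y : ℝ) : bracket β w y ^ 2 = bracket (2 * β) w y := by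
  rw [sq, bracket_add, two_mul]

theorem bracket_one (w y : ℝ) : bracket 1 w y = (1 + (w * y) ^ 2)⁻¹ := by
  unfold bracket
  rw [Real.rpow_neg_one]

theorem bracket_le_of_le {β : ℝ} (hβ : 0 ≤ β) {w y z : ℝ} (h : |y| ≤ |z|) :
    bracket β w z ≤ bracket β w y := by
  unfold bracket
  refine Real.rpow_le_rpow_of_nonpos (by positivity) ?_ (by linarith)
  have : y ^ 2 ≤ z ^ 2 := sq_le_sq.2 h
  rw [mul_pow, mul_pow]
  gcongr

/-- The integral of `(1 + y²)^(-β)`. -/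
def bracketInt (β : ℝ) : ℝ := ∫ y : ℝ, bracket β 1 y

theorem bracketInt_nonneg (β : ℝ) : 0 ≤ bracketInt β :=
  integral_nonneg fun y => (bracket_pos β 1 y).le

theorem integrable_bracket {β w : ℝ} (hβ : 1 / 2 < β) (hw : 0 < w) : Integrable (bracket β w) := by
  have h := integrable_rpow_neg_one_add_norm_sq (E := ℝ) (μ := volume) (r := 2 * β)
    (by simp; linarith)
  have h1 : Integrable (bracket β 1) := h.congr (Filter.Eventually.of_forall fun y => by
    simp only [bracket, Real.norm_eq_abs, sq_abs, one_mul]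
    congr 1
    ring)
  refine (h1.comp_mul_left' hw.ne').congr (Filter.Eventually.of_forall fun y => ?_)
  simp [bracket]

theorem integral_bracket {β w : ℝ} (hw : 0 < w) : ∫ y, bracket β w y = bracketInt β / w := by
  have h := Measure.integral_comp_mul_left (bracket β 1) w
  rw [abs_of_pos (inv_pos.2 hw), smul_eq_mul] at h
  rw [bracketInt, div_eq_inv_mul, ← h]
  simp [bracket]

theorem HasDecay.norm_le {k : ℝ → ℂ} {K w : ℝ} (h : HasDecay k K w) (t : ℝ) :
    ‖k t‖ ≤ K * w * bracket 1 w t := by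
  rw [bracket_one, mul_assoc]
  exact h t

theorem HasDecay.nonneg {k : ℝ → ℂ} {K w : ℝ} (h : HasDecay k K w) (hw : 0 < w) : 0 ≤ K := by
  have h1 := (norm_nonneg _).trans (h 0)
  by_contra hK
  push Not at hK
  have : K * (w * (1 + (w * 0) ^ 2)⁻¹) < 0 := mul_neg_of_neg_of_pos hK (by positivity)
  linarith

theorem HasDecay.norm_sq_le {k : ℝ → ℂ} {K w : ℝ} (h : HasDecay k K w) (t : ℝ) :
    ‖k t‖ ^ 2 ≤ K ^ 2 * w ^ 2 * bracket 2 w t := by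
  have := pow_le_pow_left₀ (norm_nonneg _) (h.norm_le t) 2
  rwa [mul_pow, mul_pow, bracket_sq, mul_one] at this

/-- Schur's test for kernels dominated by a convolution kernel. -/
theorem norm_le_of_kernel_le {A : L2R →L[ℂ] L2R} {q : ℝ → ℝ → ℂ} (hA : IsKer A q) {g : ℝ → ℝ}
    (hg : Integrable g) (hb : ∀ x y, ‖q x y‖ ≤ g (x - y)) {c : ℝ} (hc : ∫ t, g t ≤ c) :
    ‖A‖ ≤ c := by
  have hg0 : ∀ t, 0 ≤ g t := fun t => (norm_nonneg _).trans (by simpa using hb t 0)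
  have hc0 : 0 ≤ c := (integral_nonneg hg0).trans hc
  refine le_of_forall_pos_le_add fun ε hε => ?_
  -- The bound is proved with c + ε in place of c, so that one may divide by it even when c = 0.
  have hd : 0 < c + ε := by linarith
  have hd' : ∫ t, g t ≤ c + ε := by linarith
  generalize c + ε = d at hd hd'
  refine ContinuousLinearMap.opNorm_le_bound _ hd.le fun u => ?_
  set v := A u with hv
  have hi1 := integrable_mul_comp_sub (integrable_norm_sq_L2R v) hg
  have hi2' := integrable_mul_comp_sub (integrable_norm_sq_L2R u) hg.comp_neg
  have hi2 : Integrable (fun z : ℝ × ℝ => ‖u z.2‖ ^ 2 * g (z.1 - z.2)) (volume.prod volume) := by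
    refine hi2'.swap.congr (Filter.Eventually.of_forall fun z => ?_)
    simp
  have v2 : ∫ z : ℝ × ℝ, ‖u z.2‖ ^ 2 * g (z.1 - z.2) ∂(volume.prod volume) =
      ‖u‖ ^ 2 * ∫ t, g t := by
    rw [← integral_prod_swap, norm_sq_L2R, ← integral_neg_eq_self g, ← integral_mul_comp_sub]
    simp
  have v1 : ∫ z : ℝ × ℝ, ‖v z.1‖ ^ 2 * g (z.1 - z.2) ∂(volume.prod volume) =
      ‖v‖ ^ 2 * ∫ t, g t := by
    rw [norm_sq_L2R, ← integral_mul_comp_sub]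
  have hF : Integrable (fun z : ℝ × ℝ => (1 / (2 * d)) * (‖v z.1‖ ^ 2 * g (z.1 - z.2)) +
      (d / 2) * (‖u z.2‖ ^ 2 * g (z.1 - z.2))) (volume.prod volume) :=
    (hi1.const_mul _).add (hi2.const_mul _)
  have hvF : ∫ z : ℝ × ℝ, ((1 / (2 * d)) * (‖v z.1‖ ^ 2 * g (z.1 - z.2)) +
      (d / 2) * (‖u z.2‖ ^ 2 * g (z.1 - z.2))) ∂(volume.prod volume) =
      (1 / (2 * d)) * (‖v‖ ^ 2 * ∫ t, g t) + (d / 2) * (‖u‖ ^ 2 * ∫ t, g t) := by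
    rw [integral_add (hi1.const_mul _) (hi2.const_mul _), integral_const_mul, integral_const_mul,
      v1, v2]
  -- The inequality |v||u| ≤ |v|²/(2d) + d|u|²/2 is integrated against g(x - y). As ∫ g ≤ d, half of
  -- ‖v‖² can then be absorbed on the left.
  have key : ‖v‖ ^ 2 ≤ (1 / (2 * d)) * (‖v‖ ^ 2 * ∫ t, g t) + (d / 2) * (‖u‖ ^ 2 * ∫ t, g t) := by
    rw [← hvF, integral_prod _ hF, norm_sq_L2R]
    refine integral_mono_ae (integrable_norm_sq_L2R v) hF.integral_prod_left ?_
    filter_upwards [hA u, hF.prod_right_ae] with x hx hxi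
    have h1 : ‖v x‖ ≤ ∫ y, g (x - y) * ‖u y‖ := by
      rw [hv, hx]
      refine norm_integral_le_of_norm_le ?_ (Filter.Eventually.of_forall fun y => ?_)
      -- Only integrability of g(x - y)|u(y)| is needed: |u| ≤ |u|² + 1, and a generous multiple of
      -- the slice already known to be integrable dominates the first part.
      · refine hxi.const_mul (1 / d * 2 + 2 * d) |>.add ((hg.comp_sub_left x).const_mul 1)
          |>.mono' ?_ (Filter.Eventually.of_forall fun y => ?_)
        · exact (hg.comp_sub_left x).aestronglyMeasurable.mul
            (Lp.aestronglyMeasurable u).norm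
        · rw [Real.norm_of_nonneg (mul_nonneg (hg0 _) (norm_nonneg _))]
          simp only [Pi.add_apply, one_mul]
          have e1 := hg0 (x - y)
          have e2 : 0 ≤ ‖v x‖ ^ 2 * g (x - y) := by positivity
          have e3 : ‖u y‖ ≤ ‖u y‖ ^ 2 + 1 := by nlinarith [sq_nonneg (‖u y‖ - 1), norm_nonneg (u y)]
          have e4 : (1 / d * 2 + 2 * d) * (1 / (2 * d) * (‖v x‖ ^ 2 * g (x - y)) +
              d / 2 * (‖u y‖ ^ 2 * g (x - y))) = (1 / d * 2 + 2 * d) * (1 / (2 * d)) *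
              (‖v x‖ ^ 2 * g (x - y)) + (1 + d ^ 2) * (‖u y‖ ^ 2 * g (x - y)) := by
            field_simp
          rw [e4]
          have e5 : 0 ≤ (1 / d * 2 + 2 * d) * (1 / (2 * d)) * (‖v x‖ ^ 2 * g (x - y)) := by
            positivity
          have e6 : 0 ≤ d ^ 2 * (‖u y‖ ^ 2 * g (x - y)) := by positivity
          nlinarith
      · rw [norm_mul]
        gcongr
        exact hb x y
    have h2 : ‖v x‖ ^ 2 ≤ ∫ y, ‖v x‖ * (g (x - y) * ‖u y‖) := by
      rw [integral_const_mul, sq]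
      gcongr
    refine h2.trans ?_
    refine integral_mono_of_nonneg (Filter.Eventually.of_forall fun y => by
      have := hg0 (x - y)
      simp only [Pi.zero_apply]
      positivity) hxi (Filter.Eventually.of_forall fun y => ?_)
    simp only
    have e1 := hg0 (x - y)
    have e2 : ‖v x‖ * ‖u y‖ ≤ 1 / (2 * d) * ‖v x‖ ^ 2 + d / 2 * ‖u y‖ ^ 2 := by
      have : 1 / (2 * d) * ‖v x‖ ^ 2 + d / 2 * ‖u y‖ ^ 2 - ‖v x‖ * ‖u y‖ =
          (‖v x‖ - d * ‖u y‖) ^ 2 / (2 * d) := by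
        field_simp
        ring
      have h3 : 0 ≤ (‖v x‖ - d * ‖u y‖) ^ 2 / (2 * d) := by positivity
      linarith
    nlinarith
  have k2 : (1 / (2 * d)) * (‖v‖ ^ 2 * ∫ t, g t) ≤ 1 / 2 * ‖v‖ ^ 2 := by
    calc (1 / (2 * d)) * (‖v‖ ^ 2 * ∫ t, g t) ≤ (1 / (2 * d)) * (‖v‖ ^ 2 * d) := by gcongr
      _ = _ := by field_simp
  have k3 : (d / 2) * (‖u‖ ^ 2 * ∫ t, g t) ≤ d / 2 * (‖u‖ ^ 2 * d) := by gcongr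
  refine (sq_le_sq₀ (norm_nonneg _) (by positivity)).1 ?_
  nlinarith

theorem norm_le_of_decay {A : L2R →L[ℂ] L2R} {q : ℝ → ℝ → ℂ} (hA : IsKer A q) {K w : ℝ}
    (hw : 0 < w) (hb : ∀ x y, ‖q x y‖ ≤ K * w * bracket 1 w (x - y)) :
    ‖A‖ ≤ K * bracketInt 1 := by
  refine norm_le_of_kernel_le hA (g := fun t => K * w * bracket 1 w t)
    ((integrable_bracket (by norm_num) hw).const_mul _) hb ?_
  rw [integral_const_mul, integral_bracket hw]
  refine le_of_eq ?_
  field_simp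

end Decay

/-! ### Trace norm of Hankel blocks and of commutators with the half-line truncation -/

section TraceEstimates

/-- The mirror image of `traceBound_mul_of_weight`: here the second factor has decay to spare and
pays for the weight. -/
theorem traceBound_mul_of_weight' {Q R : L2R →L[ℂ] L2R} {q r : ℝ → ℝ → ℂ} {wt : ℝ → ℝ} {K K' : ℝ}
    (hQ : IsKer Q q) (hR : IsKer R r) (hwt : Measurable wt) (hpos : ∀ y, 0 < wt y)
    (hle : ∀ y, wt y ≤ 1) (hq : IsHS (fun x y => q x y * (wt y : ℂ)) K)
    (hr : IsHS (fun x y => ((wt x)⁻¹ : ℝ) * r x y) K') : TraceBound (Q * R) (K * K') := by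
  obtain ⟨R', hR', -⟩ := hr.exists_isKer
  have hm : MemLp (fun y => (wt y : ℂ)) ⊤ volume :=
    memLp_top_of_bound (Complex.measurable_ofReal.comp hwt).aestronglyMeasurable 1
      (Filter.Eventually.of_forall fun y => by
        rw [Complex.norm_real, Real.norm_of_nonneg (hpos y).le]; exact hle y)
  have e : mulOp (fun y => (wt y : ℂ)) * R' = R := by
    refine IsKer.unique ?_ hR
    have h := hR'.mulOp_mul hm
    convert! h using 3 with x y
    have : (wt x : ℂ) ≠ 0 := by exact_mod_cast (hpos x).ne'
    push_cast
    field_simp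
  have h := (hq.traceBound_mul hr (hQ.mul_mulOp hm) hR').1
  rwa [mul_assoc, e] at h

/-- The characteristic function of `S`, as an operator. -/
def chiOp (S : Set ℝ) : L2R →L[ℂ] L2R := mulOp (S.indicator fun _ => (1 : ℂ))

theorem norm_indicator_one_le (S : Set ℝ) (x : ℝ) : ‖S.indicator (fun _ => (1 : ℂ)) x‖ ≤ 1 := by
  by_cases h : x ∈ S <;> simp [h]

theorem norm_chiOp_le {S : Set ℝ} (hS : MeasurableSet S) : ‖chiOp S‖ ≤ 1 :=
  norm_mulOp_le (memLp_top_chi hS) zero_le_one (norm_indicator_one_le S)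

theorem chiOp_mul_self {S : Set ℝ} (hS : MeasurableSet S) : chiOp S * chiOp S = chiOp S := by
  rw [chiOp, mulOp_mul (memLp_top_chi hS) (memLp_top_chi hS)]
  congr 1
  ext x
  by_cases h : x ∈ S <;> simp [h]

theorem chiOp_add_compl {S : Set ℝ} (hS : MeasurableSet S) : chiOp S + chiOp Sᶜ = 1 := by
  rw [chiOp, chiOp, mulOp_add (memLp_top_chi hS) (memLp_top_chi hS.compl), ← mulOp_one]
  congr 1
  ext x
  by_cases h : x ∈ S <;> simp [h]

theorem chiOp_compl {S : Set ℝ} (hS : MeasurableSet S) : chiOp Sᶜ = 1 - chiOp S := by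
  rw [← chiOp_add_compl hS]
  abel

/-- An absolute constant. -/
def hankelConst : ℝ :=
  Real.sqrt (bracketInt (3 / 4) * bracketInt (5 / 8)) * Real.sqrt (bracketInt (5 / 8) * bracketInt 2) +
  Real.sqrt (bracketInt (5 / 8) * bracketInt 2) * Real.sqrt (bracketInt (3 / 4) * bracketInt (5 / 8))

theorem hankelConst_nonneg : 0 ≤ hankelConst := by unfold hankelConst; positivity

/-- For off-diagonal blocks, where decay in x - y splits into decay in x times decay in y. -/
theorem isHS_truncated {m : ℝ → ℂ} (hc : Continuous (𝓕⁻ m)) {K w : ℝ} (hw : 0 < w)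
    (hd : HasDecay (𝓕⁻ m) K w) {f g : ℝ → ℂ} (hf : Measurable f)
    (hg : Measurable g) {a b : ℝ → ℝ} (ha : Integrable a) (hb : Integrable b) {A : ℝ} (hA : 0 ≤ A)
    (hab : ∀ x y, ‖f x‖ ^ 2 * ‖g y‖ ^ 2 * (w ^ 2 * bracket 2 w (x - y)) ≤ a x * b y)
    (hAab : (∫ x, a x) * ∫ y, b y ≤ A) :
    IsHS (fun x y => f x * 𝓕⁻ m (x - y) * g y) (K * Real.sqrt A) := by
  have hK := hd.nonneg hw
  refine IsHS.of_le_mul (f := fun x => K ^ 2 * a x) (g := b) ?_ (ha.const_mul _) hb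
    (fun x y => ?_) (by positivity) ?_
  · have h1 : Measurable fun z : ℝ × ℝ => 𝓕⁻ m (z.1 - z.2) :=
      (hc.comp (by fun_prop : Continuous fun z : ℝ × ℝ => z.1 - z.2)).measurable
    exact (((hf.comp measurable_fst).mul h1).mul (hg.comp measurable_snd)).stronglyMeasurable
  · have h1 := hd.norm_sq_le (x - y)
    have h2 := hab x y
    calc ‖f x * 𝓕⁻ m (x - y) * g y‖ ^ 2 = ‖f x‖ ^ 2 * ‖g y‖ ^ 2 * ‖𝓕⁻ m (x - y)‖ ^ 2 := by
          rw [norm_mul, norm_mul]; ring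
      _ ≤ ‖f x‖ ^ 2 * ‖g y‖ ^ 2 * (K ^ 2 * w ^ 2 * bracket 2 w (x - y)) := by gcongr
      _ = K ^ 2 * (‖f x‖ ^ 2 * ‖g y‖ ^ 2 * (w ^ 2 * bracket 2 w (x - y))) := by ring
      _ ≤ K ^ 2 * (a x * b y) := by gcongr
      _ = _ := by ring
  · rw [integral_const_mul, mul_pow, Real.sq_sqrt hA, mul_assoc]
    gcongr

/-- For diagonal blocks, where the kernel is integrable in x - y and a weight must supply
integrability in the other direction. -/
theorem isHS_weighted {m : ℝ → ℂ} (hc : Continuous (𝓕⁻ m)) {K w : ℝ} (hw : 0 < w)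
    (hd : HasDecay (𝓕⁻ m) K w) {f g : ℝ → ℂ} (hf : Measurable f)
    (hg : Measurable g) {a : ℝ → ℝ} (ha : Integrable a) {A : ℝ} (hA : 0 ≤ A)
    (hab : (∀ x y, ‖f x‖ ^ 2 * ‖g y‖ ^ 2 ≤ a x) ∨ (∀ x y, ‖f x‖ ^ 2 * ‖g y‖ ^ 2 ≤ a y))
    (hAab : w * (∫ x, a x) * bracketInt 2 ≤ A) :
    IsHS (fun x y => f x * 𝓕⁻ m (x - y) * g y) (K * Real.sqrt A) := by
  have hK := hd.nonneg hw
  have hm : StronglyMeasurable (Function.uncurry fun x y => f x * 𝓕⁻ m (x - y) * g y) := by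
    have h1 : Measurable fun z : ℝ × ℝ => 𝓕⁻ m (z.1 - z.2) :=
      (hc.comp (by fun_prop : Continuous fun z : ℝ × ℝ => z.1 - z.2)).measurable
    exact (((hf.comp measurable_fst).mul h1).mul (hg.comp measurable_snd)).stronglyMeasurable
  have hi : Integrable fun t => K ^ 2 * w ^ 2 * bracket 2 w t :=
    (integrable_bracket (by norm_num) hw).const_mul _
  have hval : (∫ x, a x) * ∫ t, K ^ 2 * w ^ 2 * bracket 2 w t ≤ (K * Real.sqrt A) ^ 2 := by
    rw [integral_const_mul, integral_bracket hw, mul_pow, Real.sq_sqrt hA]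
    calc _ = K ^ 2 * (w * (∫ x, a x) * bracketInt 2) := by field_simp
      _ ≤ _ := by gcongr
  have hpt : ∀ x y, ‖f x * 𝓕⁻ m (x - y) * g y‖ ^ 2 ≤
      ‖f x‖ ^ 2 * ‖g y‖ ^ 2 * (K ^ 2 * w ^ 2 * bracket 2 w (x - y)) := fun x y => by
    have h1 := hd.norm_sq_le (x - y)
    calc ‖f x * 𝓕⁻ m (x - y) * g y‖ ^ 2 = ‖f x‖ ^ 2 * ‖g y‖ ^ 2 * ‖𝓕⁻ m (x - y)‖ ^ 2 := by
          rw [norm_mul, norm_mul]; ring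
      _ ≤ _ := by gcongr
  have hbp : ∀ t, 0 ≤ K ^ 2 * w ^ 2 * bracket 2 w t := fun t => by
    have := bracket_pos 2 w t
    positivity
  rcases hab with h | h
  · exact IsHS.of_le_conv hm ha hi (fun x y => (hpt x y).trans
      (mul_le_mul_of_nonneg_right (h x y) (hbp _))) (by positivity) hval
  · exact IsHS.of_le_conv' hm ha hi (fun x y => (hpt x y).trans
      (mul_le_mul_of_nonneg_right (h x y) (hbp _))) (by positivity) hval

theorem continuous_fourierInv {m : ℝ → ℂ} (h : Integrable m) : Continuous (𝓕⁻ m) :=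
  VectorFourier.fourierIntegral_continuous (L := -innerₗ ℝ) Real.continuous_fourierChar
    continuous_inner.neg h

/-- The split 2 = 3/4 + 5/4 is uneven on purpose: the side with 5/4 loses a further 5/8 to the
inverse weight and must keep an exponent above 1/2. -/
theorem bracket_two_le {w x y t : ℝ} (h : |t| = |x| + |y|) :
    bracket 2 w t ≤ bracket (3 / 4) w x * bracket (5 / 4) w y := by
  have h1 : bracket 2 w t = bracket (3 / 4) w t * bracket (5 / 4) w t := by
    rw [bracket_add]; norm_num
  rw [h1]
  refine mul_le_mul (bracket_le_of_le (by norm_num) ?_) (bracket_le_of_le (by norm_num) ?_)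
    (bracket_pos _ _ _).le (bracket_pos _ _ _).le
  · rw [h]; linarith [abs_nonneg y]
  · rw [h]; linarith [abs_nonneg x]

theorem bracket_two_le' {w x y t : ℝ} (h : |t| = |x| + |y|) :
    bracket 2 w t ≤ bracket (5 / 4) w x * bracket (3 / 4) w y := by
  rw [mul_comm]
  exact bracket_two_le (h.trans (add_comm _ _))

/-- A symbol that is bounded, integrable and square integrable. -/
structure IsMult (m : ℝ → ℂ) : Prop where
  top : MemLp m ⊤ volume
  two : MemLp m 2 volume
  one : Integrable m

theorem IsMult.isKer_trunc {m : ℝ → ℂ} (hm : IsMult m) {S S' : Set ℝ} (hS : MeasurableSet S)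
    (hS' : MeasurableSet S') : IsKer (chiOp S * fmul m * chiOp S')
      fun x y => S.indicator (fun _ => (1 : ℂ)) x * 𝓕⁻ m (x - y) *
        S'.indicator (fun _ => (1 : ℂ)) y :=
  ((isKer_fmul hm.top hm.two hm.one).mulOp_mul (memLp_top_chi hS)).mul_mulOp (memLp_top_chi hS')

/-- Write m = mz and insert 1 = χ_S + χ_{Sᶜ} between the two multipliers. In each product one factor
is off-diagonal. There x and y lie on opposite sides of 0, so its kernel decays in both variables
and stays Hilbert-Schmidt after division by the weight `bracket (5 / 16)`. The other factor becomes
Hilbert-Schmidt after multiplication by that weight. All exponents that occur, 3/4, 5/8 and 2,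
exceed 1/2, and the powers of w cancel, so the bound is scale invariant. -/
theorem traceBound_hankel {m z : ℝ → ℂ} (hm : IsMult m) (hz : IsMult z)
    (hmz : ∀ η, m η * z η = m η) {K K' w : ℝ} (hw : 0 < w) (hd : HasDecay (𝓕⁻ m) K w)
    (hd' : HasDecay (𝓕⁻ z) K' w) {S : Set ℝ} (hS : MeasurableSet S)
    (hsep : ∀ x ∈ S, ∀ y ∈ Sᶜ, |x - y| = |x| + |y|) :
    TraceBound (chiOp S * fmul m * chiOp Sᶜ) (hankelConst * (K * K')) := by
  have hK := hd.nonneg hw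
  have hK' := hd'.nonneg hw
  have e0 : fmul m = fmul m * fmul z := by
    rw [fmul_mul hm.top hz.top]
    congr 1
    ext η
    exact (hmz η).symm
  have e1 : chiOp S * fmul m * chiOp Sᶜ =
      (chiOp S * fmul m * chiOp Sᶜ) * (chiOp Sᶜ * fmul z * chiOp Sᶜ) +
      (chiOp S * fmul m * chiOp S) * (chiOp S * fmul z * chiOp Sᶜ) := by
    have a1 : (chiOp S * fmul m * chiOp Sᶜ) * (chiOp Sᶜ * fmul z * chiOp Sᶜ) =
        chiOp S * fmul m * (chiOp Sᶜ * chiOp Sᶜ) * (fmul z * chiOp Sᶜ) := by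
      simp only [mul_assoc]
    have a2 : (chiOp S * fmul m * chiOp S) * (chiOp S * fmul z * chiOp Sᶜ) =
        chiOp S * fmul m * (chiOp S * chiOp S) * (fmul z * chiOp Sᶜ) := by
      simp only [mul_assoc]
    rw [a1, a2, chiOp_mul_self hS, chiOp_mul_self hS.compl, ← add_mul, ← mul_add,
      add_comm (chiOp Sᶜ), chiOp_add_compl hS, mul_one]
    nth_rewrite 1 [e0]
    simp only [mul_assoc]
  have hSm : ∀ T : Set ℝ, MeasurableSet T → Measurable (T.indicator fun _ => (1 : ℂ)) :=
    fun T hT => measurable_const.indicator hT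
  have hcm := continuous_fourierInv hm.one
  have hcz := continuous_fourierInv hz.one
  have i34 := integrable_bracket (β := 3 / 4) (by norm_num) hw
  have i58 := integrable_bracket (β := 5 / 8) (by norm_num) hw
  have n34 := bracketInt_nonneg (3 / 4)
  have n58 := bracketInt_nonneg (5 / 8)
  have n2 := bracketInt_nonneg 2
  have mb : Measurable fun y => ((bracket (-(5 / 16)) w y : ℝ) : ℂ) :=
    Complex.measurable_ofReal.comp (measurable_bracket _ _)
  have mb' : Measurable fun y => ((bracket (5 / 16) w y : ℝ) : ℂ) :=
    Complex.measurable_ofReal.comp (measurable_bracket _ _)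
  have nb : ∀ β y, ‖((bracket β w y : ℝ) : ℂ)‖ ^ 2 = bracket (2 * β) w y := fun β y => by
    rw [Complex.norm_real, Real.norm_of_nonneg (bracket_pos _ _ _).le, bracket_sq]
  have t1 : TraceBound ((chiOp S * fmul m * chiOp Sᶜ) * (chiOp Sᶜ * fmul z * chiOp Sᶜ))
      ((K * Real.sqrt (bracketInt (3 / 4) * bracketInt (5 / 8))) *
        (K' * Real.sqrt (bracketInt (5 / 8) * bracketInt 2))) := by
    refine traceBound_mul_of_weight (hm.isKer_trunc hS hS.compl) (hz.isKer_trunc hS.compl hS.compl)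
      (measurable_bracket (5 / 16) w) (fun y => bracket_pos _ _ _)
      (fun y => bracket_le_one (by norm_num) _ _) ?_ ?_
    · have := isHS_truncated hcm hw hd (hSm S hS) ((hSm Sᶜ hS.compl).mul mb)
        (a := fun x => w * bracket (3 / 4) w x) (b := fun y => w * bracket (5 / 8) w y)
        (i34.const_mul w) (i58.const_mul w) (mul_nonneg n34 n58) (fun x y => ?_) ?_
      · simpa only [bracket_inv, mul_assoc, Pi.mul_apply] using this
      · by_cases hx : x ∈ S <;> by_cases hy : y ∈ Sᶜ
        · have h1 := bracket_two_le (w := w) (hsep x hx y hy)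
          rw [indicator_of_mem hx, Pi.mul_apply, norm_mul, indicator_of_mem hy, mul_pow, nb]
          have h2 := bracket_add (5 / 4) (2 * -(5 / 16)) w y
          norm_num at h2 ⊢
          have h3 := bracket_pos (-5 / 8) w y
          rw [show (-(5 / 8) : ℝ) = -5 / 8 by norm_num] at *
          calc bracket (-5 / 8) w y * (w ^ 2 * bracket 2 w (x - y))
              ≤ bracket (-5 / 8) w y * (w ^ 2 * (bracket (3 / 4) w x * bracket (5 / 4) w y)) := by
                gcongr
            _ = w ^ 2 * bracket (3 / 4) w x * (bracket (5 / 4) w y * bracket (-5 / 8) w y) := by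
                ring
            _ = _ := by rw [h2]; ring
        all_goals
          have h3 := bracket_pos (3 / 4) w x
          have h4 := bracket_pos (5 / 8) w y
          have : 0 ≤ w * bracket (3 / 4) w x * (w * bracket (5 / 8) w y) := by positivity
          simpa [hx, hy] using this
      · rw [integral_const_mul, integral_const_mul, integral_bracket hw, integral_bracket hw]
        refine le_of_eq ?_
        field_simp
    · have := isHS_weighted hcz hw hd' (mb'.mul (hSm Sᶜ hS.compl)) (hSm Sᶜ hS.compl) i58
        (mul_nonneg n58 n2) (Or.inl fun x y => ?_) ?_
      · simpa only [mul_assoc, Pi.mul_apply] using this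
      · rw [Pi.mul_apply, norm_mul, mul_pow, nb]
        have h1 := norm_indicator_one_le Sᶜ x
        have h2 := norm_indicator_one_le Sᶜ y
        have h3 := bracket_pos (5 / 8) w x
        rw [show (2 * (5 / 16) : ℝ) = 5 / 8 by norm_num]
        calc _ ≤ bracket (5 / 8) w x * 1 ^ 2 * 1 ^ 2 := by gcongr
          _ = _ := by ring
      · rw [integral_bracket hw]
        refine le_of_eq ?_
        field_simp
  have t2 : TraceBound ((chiOp S * fmul m * chiOp S) * (chiOp S * fmul z * chiOp Sᶜ))
      ((K * Real.sqrt (bracketInt (5 / 8) * bracketInt 2)) *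
        (K' * Real.sqrt (bracketInt (3 / 4) * bracketInt (5 / 8)))) := by
    refine traceBound_mul_of_weight' (hm.isKer_trunc hS hS) (hz.isKer_trunc hS hS.compl)
      (measurable_bracket (5 / 16) w) (fun y => bracket_pos _ _ _)
      (fun y => bracket_le_one (by norm_num) _ _) ?_ ?_
    · have := isHS_weighted hcm hw hd (hSm S hS) ((hSm S hS).mul mb') i58
        (mul_nonneg n58 n2) (Or.inr fun x y => ?_) ?_
      · simpa only [mul_assoc, Pi.mul_apply] using this
      · rw [Pi.mul_apply, norm_mul, mul_pow, nb]
        have h1 := norm_indicator_one_le S x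
        have h2 := norm_indicator_one_le S y
        have h3 := bracket_pos (5 / 8) w y
        rw [show (2 * (5 / 16) : ℝ) = 5 / 8 by norm_num]
        calc _ ≤ 1 ^ 2 * (1 ^ 2 * bracket (5 / 8) w y) := by gcongr
          _ = _ := by ring
      · rw [integral_bracket hw]
        refine le_of_eq ?_
        field_simp
    · have := isHS_truncated hcz hw hd' (mb.mul (hSm S hS)) (hSm Sᶜ hS.compl)
        (a := fun x => w * bracket (5 / 8) w x) (b := fun y => w * bracket (3 / 4) w y)
        (i58.const_mul w) (i34.const_mul w) (mul_nonneg n34 n58) (fun x y => ?_) ?_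
      · simpa only [bracket_inv, mul_assoc, Pi.mul_apply] using this
      · by_cases hx : x ∈ S <;> by_cases hy : y ∈ Sᶜ
        · have h1 := bracket_two_le' (w := w) (hsep x hx y hy)
          rw [Pi.mul_apply, norm_mul, indicator_of_mem hx, indicator_of_mem hy, mul_pow, nb]
          have h2 := bracket_add (5 / 4) (2 * -(5 / 16)) w x
          norm_num at h2 ⊢
          have h3 := bracket_pos (-5 / 8) w x
          rw [show (-(5 / 8) : ℝ) = -5 / 8 by norm_num] at *
          calc bracket (-5 / 8) w x * (w ^ 2 * bracket 2 w (x - y))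
              ≤ bracket (-5 / 8) w x * (w ^ 2 * (bracket (5 / 4) w x * bracket (3 / 4) w y)) := by
                gcongr
            _ = w ^ 2 * bracket (3 / 4) w y * (bracket (5 / 4) w x * bracket (-5 / 8) w x) := by
                ring
            _ = _ := by rw [h2]; ring
        all_goals
          have h3 := bracket_pos (3 / 4) w y
          have h4 := bracket_pos (5 / 8) w x
          have : 0 ≤ w * bracket (5 / 8) w x * (w * bracket (3 / 4) w y) := by positivity
          simpa [hx, hy] using this
      · rw [integral_const_mul, integral_const_mul, integral_bracket hw, integral_bracket hw]
        refine le_of_eq ?_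
        field_simp
  rw [e1]
  refine (t1.add t2).mono (le_of_eq ?_)
  unfold hankelConst
  ring

/-- The commutator of a Fourier multiplier with the characteristic function of the half line. -/
theorem traceBound_commutator {m z : ℝ → ℂ} (hm : IsMult m) (hz : IsMult z)
    (hmz : ∀ η, m η * z η = m η) {K K' w : ℝ} (hw : 0 < w) (hd : HasDecay (𝓕⁻ m) K w)
    (hd' : HasDecay (𝓕⁻ z) K' w) :
    TraceBound (fmul m * chiOp (Ioi 0) - chiOp (Ioi 0) * fmul m)
      (2 * hankelConst * (K * K')) := by
  have hS : MeasurableSet (Ioi (0 : ℝ)) := measurableSet_Ioi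
  have h1 := traceBound_hankel hm hz hmz hw hd hd' hS (fun x hx y hy => by
    simp only [mem_Ioi, mem_compl_iff, not_lt] at hx hy
    rw [abs_of_pos hx, abs_of_nonpos hy, abs_of_pos (by linarith)]
    ring)
  have h2 := traceBound_hankel hm hz hmz hw hd hd' hS.compl (fun x hx y hy => by
    simp only [mem_Ioi, mem_compl_iff, not_lt, not_le] at hx hy
    rw [abs_of_pos hy, abs_of_nonpos hx, abs_of_neg (by linarith)]
    ring)
  rw [compl_compl] at h2
  have h3 := h2.sub h1
  -- A commutator with a projection is the difference of the two off-diagonal blocks.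
  have e : chiOp (Ioi 0)ᶜ * fmul m * chiOp (Ioi 0) - chiOp (Ioi 0) * fmul m * chiOp (Ioi 0)ᶜ =
      fmul m * chiOp (Ioi 0) - chiOp (Ioi 0) * fmul m := by
    rw [chiOp_compl hS]
    noncomm_ring
  rw [e] at h3
  exact h3.mono (by linarith)

end TraceEstimates

/-! ### Trace norm of operators localized in position and frequency -/

section PdoTrace

theorem bracket_le_of_le' {β : ℝ} (hβ : 0 ≤ β) {w y z : ℝ} (h : |y| ≤ |z|) :
    bracket (-β) w y ≤ bracket (-β) w z := by
  rw [← bracket_inv, ← bracket_inv]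
  exact inv_anti₀ (bracket_pos _ _ _) (bracket_le_of_le hβ h)

/-- An absolute constant. -/
def pdoConst : ℝ := 4 * (1 + bracketInt 1) * (1 + bracketInt 2)

theorem pdoConst_nonneg : 0 ≤ pdoConst := by
  have := bracketInt_nonneg 1
  have := bracketInt_nonneg 2
  unfold pdoConst
  positivity

/-- Trace norm bound for an operator localized to `1 ≤ x ≤ 4 r` and to frequencies in an interval
of length `w`. -/
theorem traceBound_pdo {B : L2R →L[ℂ] L2R} {q : ℝ → ℝ → ℂ} (hB : IsKer B q)
    (hm : StronglyMeasurable (Function.uncurry q)) {K K' w r : ℝ} (hw : 0 < w) (hr : 1 ≤ r)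
    (hK : 0 ≤ K)
    (hq : ∀ x y, ‖q x y‖ ≤ (Icc 1 (4 * r)).indicator (fun _ => K * w * bracket 1 w (x - y)) x)
    {z : ℝ → ℂ} (hz : IsMult z) (hd : HasDecay (𝓕⁻ z) K' w) (hBz : B * fmul z = B) :
    TraceBound B (pdoConst * (1 + w * r) * (K * K')) := by
  have hK' := hd.nonneg hw
  have n1 := bracketInt_nonneg 1
  have n2 := bracketInt_nonneg 2
  -- `d` is the distance to [1, 4r]. The weight is `bracket (1 / 2)` of this distance: it equals 1
  -- on the interval and decays away from it.
  set d : ℝ → ℝ := fun y => max 0 (max (1 - y) (y - 4 * r)) with hd_def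
  have hd0 : ∀ y, 0 ≤ d y := fun y => le_max_left _ _
  have hdm : Measurable d := by fun_prop
  set D := pdoConst * (1 + w * r) with hD
  have hwr : 0 ≤ w * r := by positivity
  have hD0 : 0 ≤ D := mul_nonneg pdoConst_nonneg (by positivity)
  have hwm : Measurable fun y => bracket (1 / 2) w (d y) := (measurable_bracket _ _).comp hdm
  have hI : Integrable ((Icc 1 (4 * r)).indicator fun _ => (1 : ℝ)) :=
    (integrable_indicator_iff measurableSet_Icc).2 (by simp)
  have hIv : ∫ x, (Icc 1 (4 * r)).indicator (fun _ => (1 : ℝ)) x = 4 * r - 1 := by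
    rw [integral_indicator measurableSet_Icc]
    simp
    linarith
  have ib1 := integrable_bracket (β := 1) (by norm_num) hw
  have ib2 := integrable_bracket (β := 2) (by norm_num) hw
  have hq1 : IsHS (fun x y => q x y * ((bracket (1 / 2) w (d y))⁻¹ : ℝ)) (K * Real.sqrt D) := by
    refine IsHS.of_le_conv (f := (Icc 1 (4 * r)).indicator fun _ => (1 : ℝ))
      (g := fun t => K ^ 2 * w ^ 2 * bracket 1 w t) ?_ hI (ib1.const_mul _) (fun x y => ?_)
      (by positivity) ?_
    · exact hm.mul (Complex.measurable_ofReal.comp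
        (hwm.inv.comp measurable_snd)).stronglyMeasurable
    · by_cases hx : x ∈ Icc 1 (4 * r)
      · have h1 := hq x y
        rw [indicator_of_mem hx] at h1 ⊢
        rw [norm_mul, mul_pow, Complex.norm_real, Real.norm_of_nonneg (by
          have := bracket_pos (1 / 2) w (d y); positivity), bracket_inv, bracket_sq, one_mul]
        -- For x in the interval d(y) ≤ |x - y|. The inverse weight therefore costs one of the two
        -- powers of `bracket 1` in the squared kernel, and one integrable power is left.
        have h2 : bracket (2 * -(1 / 2)) w (d y) ≤ bracket (-1) w (x - y) := by
          rw [show (2 * -(1 / 2) : ℝ) = -1 by norm_num]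
          refine bracket_le_of_le' zero_le_one ?_
          rw [abs_of_nonneg (hd0 y)]
          refine max_le (abs_nonneg _) (max_le ?_ ?_)
          · refine le_trans ?_ (le_abs_self _); linarith [hx.1]
          · refine le_trans ?_ (neg_le_abs _); linarith [hx.2]
        have h3 := bracket_pos (-1) w (x - y)
        calc ‖q x y‖ ^ 2 * bracket (2 * -(1 / 2)) w (d y)
            ≤ (K * w * bracket 1 w (x - y)) ^ 2 * bracket (-1) w (x - y) := by
              have := bracket_pos (2 * -(1 / 2)) w (d y)
              gcongr
          _ = K ^ 2 * w ^ 2 * (bracket 2 w (x - y) * bracket (-1) w (x - y)) := by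
              rw [mul_pow, bracket_sq]; norm_num; ring
          _ = _ := by rw [bracket_add]; norm_num
      · have h1 := hq x y
        rw [indicator_of_notMem hx] at h1 ⊢
        rw [norm_le_zero_iff.1 h1]
        simp
    · rw [integral_const_mul, integral_bracket hw, hIv, mul_pow, Real.sq_sqrt hD0]
      calc (4 * r - 1) * (K ^ 2 * w ^ 2 * (bracketInt 1 / w))
          = K ^ 2 * ((4 * r - 1) * w * bracketInt 1) := by field_simp
        _ ≤ K ^ 2 * D := by
          gcongr
          rw [hD]
          unfold pdoConst
          nlinarith [mul_nonneg hwr n1, mul_nonneg hwr n2, mul_nonneg n1 n2,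
            mul_nonneg hwr (mul_nonneg n1 n2), mul_nonneg hw.le n1]
  have hr1 : IsHS (fun x y => ((bracket (1 / 2) w (d x) : ℝ) : ℂ) * 𝓕⁻ z (x - y))
      (K' * Real.sqrt D) := by
    have hc := continuous_fourierInv hz.one
    -- The squared weight is at most 1 on the interval plus a tail from each end; its integral is 4r
    -- - 1 plus a multiple of 1/w, whence the factor 1 + wr.
    have hia : Integrable fun x => (Icc 1 (4 * r)).indicator (fun _ => (1 : ℝ)) x +
        bracket 1 w (x - 1) + bracket 1 w (x - 4 * r) :=
      (hI.add (ib1.comp_sub_right 1)).add (ib1.comp_sub_right (4 * r))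
    have hiv : ∫ x, ((Icc 1 (4 * r)).indicator (fun _ => (1 : ℝ)) x +
        bracket 1 w (x - 1) + bracket 1 w (x - 4 * r)) = 4 * r - 1 + 2 * (bracketInt 1 / w) := by
      have e1 : Integrable fun x => (Icc 1 (4 * r)).indicator (fun _ => (1 : ℝ)) x +
        bracket 1 w (x - 1) := hI.add (ib1.comp_sub_right 1)
      rw [integral_add e1 (ib1.comp_sub_right (4 * r)), integral_add hI (ib1.comp_sub_right 1), hIv, integral_sub_right_eq_self (bracket 1 w),
        integral_sub_right_eq_self (bracket 1 w), integral_bracket hw]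
      ring
    have := isHS_weighted hc hw hd (f := fun x => ((bracket (1 / 2) w (d x) : ℝ) : ℂ))
      (g := fun _ => 1) (Complex.measurable_ofReal.comp hwm) measurable_const hia hD0
      (Or.inl fun x y => ?_) ?_
    · simpa using this
    · rw [Complex.norm_real, Real.norm_of_nonneg (bracket_pos _ _ _).le, bracket_sq]
      norm_num
      have p1 := bracket_pos 1 w (x - 1)
      have p2 := bracket_pos 1 w (x - 4 * r)
      by_cases hx : x ∈ Icc 1 (4 * r)
      · rw [indicator_of_mem hx]
        linarith [bracket_le_one (β := 1) zero_le_one w (d x)]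
      · rw [indicator_of_notMem hx]
        rw [mem_Icc, not_and_or, not_le, not_le] at hx
        rcases hx with hx | hx
        · have e : bracket 1 w (d x) ≤ bracket 1 w (x - 1) := by
            refine bracket_le_of_le zero_le_one ?_
            rw [abs_of_nonneg (hd0 x), abs_of_neg (by linarith)]
            exact le_max_of_le_right (le_max_of_le_left (by linarith))
          linarith
        · have e : bracket 1 w (d x) ≤ bracket 1 w (x - 4 * r) := by
            refine bracket_le_of_le zero_le_one ?_
            rw [abs_of_nonneg (hd0 x), abs_of_pos (by linarith)]
            exact le_max_of_le_right (le_max_right _ _)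
          linarith
    · rw [hiv]
      have e : w * (4 * r - 1 + 2 * (bracketInt 1 / w)) * bracketInt 2 =
          ((4 * r - 1) * w + 2 * bracketInt 1) * bracketInt 2 := by field_simp
      rw [e, hD]
      unfold pdoConst
      nlinarith [mul_nonneg hwr n1, mul_nonneg hwr n2, mul_nonneg n1 n2,
        mul_nonneg hwr (mul_nonneg n1 n2), mul_nonneg hw.le n2]
  have h := traceBound_mul_of_weight hB (isKer_fmul hz.top hz.two hz.one) hwm
    (fun y => bracket_pos _ _ _) (fun y => bracket_le_one (by norm_num) _ _) hq1 hr1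
  rw [hBz] at h
  refine h.mono (le_of_eq ?_)
  calc K * Real.sqrt D * (K' * Real.sqrt D) = K * K' * (Real.sqrt D * Real.sqrt D) := by ring
    _ = _ := by rw [Real.mul_self_sqrt hD0]; ring

end PdoTrace

/-! ### The logarithmic change of variables on the half line -/

section LogVariables

theorem integral_Ioi_eq_integral_exp {E : Type*} [NormedAddCommGroup E] [NormedSpace ℝ E]
    (F : ℝ → E) : ∫ x in Ioi (0 : ℝ), F x = ∫ u, Real.exp u • F (Real.exp u) := by
  have h := integral_image_eq_integral_abs_deriv_smul (s := univ) (f := Real.exp) (f' := Real.exp)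
    MeasurableSet.univ (fun x _ => (Real.hasDerivAt_exp x).hasDerivWithinAt)
    Real.exp_injective.injOn F
  rw [image_univ, Real.range_exp] at h
  simpa [abs_of_pos (Real.exp_pos _)] using h

theorem integrableOn_Ioi_iff_exp {E : Type*} [NormedAddCommGroup E] [NormedSpace ℝ E]
    (F : ℝ → E) : IntegrableOn F (Ioi (0 : ℝ)) ↔ Integrable fun u => Real.exp u • F (Real.exp u) := by
  have h := integrableOn_image_iff_integrableOn_abs_deriv_smul (s := univ) (f := Real.exp)
    (f' := Real.exp) MeasurableSet.univ (fun x _ => (Real.hasDerivAt_exp x).hasDerivWithinAt)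
    Real.exp_injective.injOn F
  rw [image_univ, Real.range_exp] at h
  simpa [abs_of_pos (Real.exp_pos _)] using h

theorem lintegral_Ioi_eq_lintegral_exp (F : ℝ → ENNReal) :
    ∫⁻ x in Ioi (0 : ℝ), F x = ∫⁻ u, ENNReal.ofReal (Real.exp u) * F (Real.exp u) := by
  have h := lintegral_image_eq_lintegral_abs_deriv_mul (s := univ) (f := Real.exp)
    (f' := Real.exp) MeasurableSet.univ (fun x _ => (Real.hasDerivAt_exp x).hasDerivWithinAt)
    Real.exp_injective.injOn F
  rw [image_univ, Real.range_exp] at h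
  simpa [abs_of_pos (Real.exp_pos _)] using h

/-- The Jacobian of exp is positive, so the change of variables shows that preimages of null sets
are null. -/
theorem ae_comp_exp {p : ℝ → Prop} (h : ∀ᵐ x, p x) : ∀ᵐ u, p (Real.exp u) := by
  obtain ⟨t, ht, htm, ht0⟩ := exists_measurable_superset_of_null h
  have h1 := lintegral_Ioi_eq_lintegral_exp (t.indicator 1)
  have h2 : ∫⁻ x in Ioi (0 : ℝ), t.indicator (1 : ℝ → ENNReal) x = 0 := by
    rw [lintegral_indicator_one htm]
    exact Measure.restrict_apply_eq_zero' measurableSet_Ioi |>.2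
      (measure_mono_null inter_subset_left ht0)
  rw [h2, eq_comm, lintegral_eq_zero_iff (by
    exact (ENNReal.measurable_ofReal.comp Real.measurable_exp).mul
      ((measurable_const.indicator htm).comp Real.measurable_exp))] at h1
  filter_upwards [h1] with u hu
  by_contra hp
  have hut : Real.exp u ∈ t := ht hp
  simp only [indicator_of_mem hut, Pi.one_apply, mul_one, Pi.zero_apply,
    ENNReal.ofReal_eq_zero] at hu
  exact absurd hu (not_le.2 (Real.exp_pos u))

theorem ae_comp_log {p : ℝ → Prop} (h : ∀ᵐ u, p u) : ∀ᵐ x, 0 < x → p (Real.log x) := by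
  obtain ⟨t, ht, htm, ht0⟩ := exists_measurable_superset_of_null h
  have h1 := lintegral_Ioi_eq_lintegral_exp fun x => t.indicator 1 (Real.log x)
  have h2 : ∫⁻ u, ENNReal.ofReal (Real.exp u) *
      t.indicator (1 : ℝ → ENNReal) (Real.log (Real.exp u)) = 0 := by
    rw [lintegral_eq_zero_iff (by
      simp only [Real.log_exp]
      exact (ENNReal.measurable_ofReal.comp Real.measurable_exp).mul
        (measurable_const.indicator htm))]
    have : ∀ᵐ u, u ∉ t := measure_eq_zero_iff_ae_notMem.1 ht0
    filter_upwards [this] with u hu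
    simp [hu]
  rw [h2, lintegral_eq_zero_iff (by
    exact (measurable_const.indicator htm).comp Real.measurable_log)] at h1
  have h3 := (ae_restrict_iff' measurableSet_Ioi).1 h1
  filter_upwards [h3] with x hx hx0
  by_contra hp
  have hut : Real.log x ∈ t := ht hp
  have := hx hx0
  simp [hut] at this

/-- The function `x^{-1/2} h(log x)` on the half line. -/
def logPull (h : ℝ → ℂ) : ℝ → ℂ :=
  (Ioi (0 : ℝ)).indicator fun x => (Real.exp (-(Real.log x / 2)) : ℂ) * h (Real.log x)

theorem logPull_exp (h : ℝ → ℂ) (u : ℝ) :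
    logPull h (Real.exp u) = (Real.exp (-(u / 2)) : ℂ) * h u := by
  rw [logPull, indicator_of_mem (mem_Ioi.2 (Real.exp_pos u)), Real.log_exp]

theorem measurable_logPull {h : ℝ → ℂ} (hh : Measurable h) : Measurable (logPull h) := by
  unfold logPull
  refine Measurable.indicator ?_ measurableSet_Ioi
  exact (Complex.measurable_ofReal.comp (by fun_prop)).mul (hh.comp Real.measurable_log)

theorem integral_logPull_mul (h f : ℝ → ℂ) :
    ∫ x, logPull h x * f x = ∫ u, h u * ((Real.exp (u / 2) : ℂ) * f (Real.exp u)) := by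
  have e : ∀ x, logPull h x * f x = (Ioi (0 : ℝ)).indicator (fun x => logPull h x * f x) x := by
    intro x
    by_cases hx : x ∈ Ioi (0 : ℝ)
    · rw [indicator_of_mem hx]
    · rw [indicator_of_notMem hx, logPull, indicator_of_notMem hx, zero_mul]
  rw [integral_congr_ae (Filter.Eventually.of_forall e), integral_indicator measurableSet_Ioi,
    integral_Ioi_eq_integral_exp]
  refine integral_congr_ae (Filter.Eventually.of_forall fun u => ?_)
  simp only
  rw [logPull_exp, Complex.real_smul]
  have : (Real.exp u : ℂ) * (Real.exp (-(u / 2)) : ℂ) = (Real.exp (u / 2) : ℂ) := by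
    rw [← Complex.ofReal_mul, ← Real.exp_add]
    congr 2
    ring
  rw [← this]
  ring

theorem norm_logPull_sq (h : ℝ → ℂ) (u : ℝ) :
    Real.exp u • ‖logPull h (Real.exp u)‖ ^ 2 = ‖h u‖ ^ 2 := by
  rw [logPull_exp, norm_mul, mul_pow, Complex.norm_real, Real.norm_of_nonneg (Real.exp_pos _).le,
    smul_eq_mul, ← mul_assoc, ← Real.exp_nat_mul, ← Real.exp_add]
  have : u + (2 : ℕ) * -(u / 2) = 0 := by push_cast; ring
  rw [this, Real.exp_zero, one_mul]

theorem indicator_norm_logPull_sq (h : ℝ → ℂ) :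
    (Ioi (0 : ℝ)).indicator (fun x => ‖logPull h x‖ ^ 2) = fun x => ‖logPull h x‖ ^ 2 := by
  ext x
  by_cases hx : x ∈ Ioi (0 : ℝ)
  · rw [indicator_of_mem hx]
  · rw [indicator_of_notMem hx, logPull, indicator_of_notMem hx]
    simp

theorem memLp_logPull {h : ℝ → ℂ} (hm : Measurable h) (hh : MemLp h 2 volume) :
    MemLp (logPull h) 2 volume := by
  rw [memLp_two_iff_integrable_sq_norm (measurable_logPull hm).aestronglyMeasurable,
    ← indicator_norm_logPull_sq, integrable_indicator_iff measurableSet_Ioi,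
    integrableOn_Ioi_iff_exp]
  simp only [norm_logPull_sq]
  exact (memLp_two_iff_integrable_sq_norm hm.aestronglyMeasurable).1 hh

theorem integral_norm_logPull_sq (h : ℝ → ℂ) : ∫ x, ‖logPull h x‖ ^ 2 = ∫ u, ‖h u‖ ^ 2 := by
  rw [← indicator_norm_logPull_sq, integral_indicator measurableSet_Ioi,
    integral_Ioi_eq_integral_exp]
  simp only [norm_logPull_sq]

theorem memLp_logPull_L2R (h : L2R) : MemLp (logPull h) 2 volume :=
  memLp_logPull (Lp.stronglyMeasurable h).measurable (Lp.memLp h)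

theorem logPull_ae_congr {h k : ℝ → ℂ} (hk : h =ᵐ[volume] k) : logPull h =ᵐ[volume] logPull k := by
  filter_upwards [ae_comp_log hk] with x hx
  by_cases h0 : x ∈ Ioi (0 : ℝ)
  · rw [logPull, logPull, indicator_of_mem h0, indicator_of_mem h0, hx h0]
  · rw [logPull, logPull, indicator_of_notMem h0, indicator_of_notMem h0]

theorem logPull_add (h k : ℝ → ℂ) : logPull (h + k) = logPull h + logPull k := by
  ext x
  by_cases h0 : x ∈ Ioi (0 : ℝ)
  · simp only [logPull, indicator_of_mem h0, Pi.add_apply, mul_add]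
  · simp [logPull, indicator_of_notMem h0]

theorem logPull_smul (c : ℂ) (h : ℝ → ℂ) : logPull (c • h) = c • logPull h := by
  ext x
  by_cases h0 : x ∈ Ioi (0 : ℝ)
  · simp only [logPull, indicator_of_mem h0, Pi.smul_apply, smul_eq_mul]
    ring
  · simp [logPull, indicator_of_notMem h0]

/-- The isometry `(V h)(x) = x^{-1/2} h(log x)` of `L²(ℝ)` onto `L²(0, ∞)`. -/
def logIsom : L2R →L[ℂ] L2R :=
  LinearMap.mkContinuous
    { toFun := fun h => (memLp_logPull_L2R h).toLp _
      map_add' := fun h k => by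
        refine Lp.ext ?_
        filter_upwards [(memLp_logPull_L2R (h + k)).coeFn_toLp, (memLp_logPull_L2R h).coeFn_toLp,
          (memLp_logPull_L2R k).coeFn_toLp, Lp.coeFn_add ((memLp_logPull_L2R h).toLp _)
          ((memLp_logPull_L2R k).toLp _), logPull_ae_congr (Lp.coeFn_add h k)] with x h1 h2 h3 h4 h5
        rw [h1, h4, Pi.add_apply, h2, h3, h5, logPull_add, Pi.add_apply]
      map_smul' := fun c h => by
        refine Lp.ext ?_
        filter_upwards [(memLp_logPull_L2R (c • h)).coeFn_toLp, (memLp_logPull_L2R h).coeFn_toLp,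
          Lp.coeFn_smul c ((memLp_logPull_L2R h).toLp _), logPull_ae_congr (Lp.coeFn_smul c h)]
          with x h1 h2 h3 h4
        simp only [RingHom.id_apply]
        rw [h1, h3, Pi.smul_apply, h2, h4, logPull_smul, Pi.smul_apply] } 1 fun h => by
    refine (sq_le_sq₀ (norm_nonneg _) (by positivity)).1 ?_
    have : ‖(memLp_logPull_L2R h).toLp _‖ ^ 2 = ‖h‖ ^ 2 := by
      rw [norm_sq_toLp, integral_norm_logPull_sq, norm_sq_L2R]
    rw [one_mul]
    exact this.le

theorem logIsom_ae (h : L2R) : (logIsom h : ℝ → ℂ) =ᵐ[volume] logPull h :=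
  (memLp_logPull_L2R h).coeFn_toLp

theorem logIsom_toLp_ae {h : ℝ → ℂ} (hh : MemLp h 2 volume) :
    (logIsom (hh.toLp h) : ℝ → ℂ) =ᵐ[volume] logPull h :=
  (logIsom_ae _).trans (logPull_ae_congr hh.coeFn_toLp)

/-- The adjoint of `logIsom`. -/
def logCoisom : L2R →L[ℂ] L2R := ContinuousLinearMap.adjoint logIsom

theorem memLp_exp_mul {f : ℝ → ℂ} (hm : Measurable f) (hf : MemLp f 2 volume) :
    MemLp (fun u => (Real.exp (u / 2) : ℂ) * f (Real.exp u)) 2 volume := by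
  have hm' : Measurable fun u => (Real.exp (u / 2) : ℂ) * f (Real.exp u) :=
    (Complex.measurable_ofReal.comp (by fun_prop)).mul (hm.comp Real.measurable_exp)
  rw [memLp_two_iff_integrable_sq_norm hm'.aestronglyMeasurable]
  have h1 : IntegrableOn (fun x => ‖f x‖ ^ 2) (Ioi 0) :=
    ((memLp_two_iff_integrable_sq_norm hm.aestronglyMeasurable).1 hf).integrableOn
  rw [integrableOn_Ioi_iff_exp] at h1
  refine h1.congr (Filter.Eventually.of_forall fun u => ?_)
  simp only [smul_eq_mul]
  rw [norm_mul, mul_pow, Complex.norm_real, Real.norm_of_nonneg (Real.exp_pos _).le,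
    ← Real.exp_nat_mul]
  congr 2
  push_cast
  ring

/-- The candidate is paired with an arbitrary h; the substitution x = e^u reproduces the pairing of
f with `logIsom h`. -/
theorem logCoisom_ae (f : L2R) : (logCoisom f : ℝ → ℂ) =ᵐ[volume]
    fun u => (Real.exp (u / 2) : ℂ) * f (Real.exp u) := by
  have hm := memLp_exp_mul (Lp.stronglyMeasurable f).measurable (Lp.memLp f)
  have : logCoisom f = hm.toLp _ := by
    refine ext_inner_left ℂ fun h => ?_
    rw [logCoisom, ContinuousLinearMap.adjoint_inner_right, L2.inner_def, L2.inner_def]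
    have e1 : ∫ x, inner ℂ (logIsom h x) (f x) =
        ∫ x, logPull (fun u => (starRingEnd ℂ) (h u)) x * f x := by
      refine integral_congr_ae ?_
      filter_upwards [logIsom_ae h] with x hx
      rw [hx, RCLike.inner_apply, mul_comm]
      congr 1
      by_cases h0 : x ∈ Ioi (0 : ℝ)
      · simp only [logPull, indicator_of_mem h0, map_mul, Complex.conj_ofReal]
      · simp [logPull, indicator_of_notMem h0]
    rw [e1, integral_logPull_mul]
    refine integral_congr_ae ?_
    filter_upwards [hm.coeFn_toLp] with u hu
    rw [hu, RCLike.inner_apply, mul_comm]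
  rw [this]
  exact hm.coeFn_toLp

theorem logCoisom_mul_logIsom : logCoisom * logIsom = 1 := by
  ext1 h
  refine Lp.ext ?_
  filter_upwards [logCoisom_ae (logIsom h), ae_comp_exp (logIsom_ae h)] with u h1 h2
  rw [mul_apply_eq_comp, h1, h2, logPull_exp, ← mul_assoc, ← Complex.ofReal_mul, ← Real.exp_add]
  simp

/-- This absorbs the spatial truncation into the isometry, so that χ₊ P χ₊ becomes a conjugate of an
operator on the whole line. -/
theorem logIsom_mul_logCoisom : logIsom * logCoisom = chiOp (Ioi 0) := by
  ext1 f
  refine Lp.ext ?_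
  filter_upwards [logIsom_ae (logCoisom f), ae_comp_log (logCoisom_ae f),
    mulOp_ae (memLp_top_chi (measurableSet_Ioi : MeasurableSet (Ioi (0 : ℝ)))) f] with x h1 h2 h3
  rw [mul_apply_eq_comp, h1, chiOp, h3]
  by_cases h0 : x ∈ Ioi (0 : ℝ)
  · rw [logPull, indicator_of_mem h0, indicator_of_mem h0, h2 h0, Real.exp_log h0, ← mul_assoc,
      ← Complex.ofReal_mul, ← Real.exp_add]
    simp
  · rw [logPull, indicator_of_notMem h0, indicator_of_notMem h0, zero_mul]

end LogVariables

/-! ### The Gamma integral in the right half plane and the modulus of the Mellin symbol -/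

section Mellin

/-- The integral representation of `Γ(a) z^{-a}` in the right half plane. -/
theorem integral_cpow_mul_exp_neg_mul_Ioi_complex {a z : ℂ} (ha : 0 < a.re) (hz : 0 < z.re) :
    ∫ t in Ioi (0 : ℝ), (t : ℂ) ^ (a - 1) * Complex.exp (-(z * t)) =
      Complex.Gamma a * z ^ (-a) := by
  have hmeas : ∀ (b z : ℂ), AEStronglyMeasurable
      (fun t : ℝ => (t : ℂ) ^ b * Complex.exp (-(z * t))) (volume.restrict (Ioi 0)) := by
    intro b z
    refine ContinuousOn.aestronglyMeasurable (fun t ht => ?_) measurableSet_Ioi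
    refine ContinuousAt.continuousWithinAt ?_
    have h1 : ContinuousAt (fun t : ℝ => (t : ℂ) ^ b) t :=
      Complex.continuousAt_ofReal_cpow_const _ _ (Or.inr (ne_of_gt ht))
    exact h1.mul (by fun_prop)
  have hbound : ∀ (b z : ℂ) (t : ℝ), t ∈ Ioi (0 : ℝ) →
      ‖(t : ℂ) ^ b * Complex.exp (-(z * t))‖ = t ^ b.re * Real.exp (-(z.re * t)) := by
    intro b z t ht
    rw [norm_mul, Complex.norm_cpow_eq_rpow_re_of_pos ht, Complex.norm_exp]
    simp
  -- Both sides are holomorphic in z for Re z > 0 and agree for positive real z; the identity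
  -- theorem gives the rest. Differentiation under the integral is dominated with Re z₀/2 in the
  -- exponent.
  have hdiff : DifferentiableOn ℂ (fun z : ℂ => ∫ t in Ioi (0 : ℝ), (t : ℂ) ^ (a - 1) *
      Complex.exp (-(z * t))) {z | 0 < z.re} := by
    intro z₀ hz₀
    have hz₀' : 0 < z₀.re := hz₀
    have hnhds : {z : ℂ | z₀.re / 2 < z.re} ∈ nhds z₀ :=
      (isOpen_lt continuous_const Complex.continuous_re).mem_nhds (by
        change z₀.re / 2 < z₀.re; linarith)
    have key := hasDerivAt_integral_of_dominated_loc_of_deriv_le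
      (μ := volume.restrict (Ioi (0 : ℝ)))
      (F := fun z t => (t : ℂ) ^ (a - 1) * Complex.exp (-(z * t)))
      (F' := fun z t => (t : ℂ) ^ (a - 1) * (Complex.exp (-(z * t)) * (-(t : ℂ))))
      (bound := fun t => t ^ a.re * Real.exp (-(z₀.re / 2 * t))) (x₀ := z₀) hnhds
      (Filter.Eventually.of_forall fun z => hmeas _ _) ?_ ?_ ?_ ?_ ?_
    · exact key.2.differentiableAt.differentiableWithinAt
    · have h := Real.GammaIntegral_convergent ha
      have h1 : IntegrableOn (fun t : ℝ => t ^ (a.re - 1) * Real.exp (-(z₀.re * t))) (Ioi 0) := by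
        have := integrableOn_rpow_mul_exp_neg_mul_rpow (p := 1) (s := a.re - 1) (b := z₀.re)
          (by linarith) one_pos hz₀'
        simpa using this
      refine h1.mono' (hmeas _ _) ?_
      refine (ae_restrict_iff' measurableSet_Ioi).2 (Filter.Eventually.of_forall fun t ht => ?_)
      rw [hbound _ _ _ ht]
      simp
    · have h1 : AEStronglyMeasurable (fun t : ℝ => -(t : ℂ)) (volume.restrict (Ioi 0)) := by
        fun_prop
      refine ((hmeas (a - 1) z₀).mul h1).congr (Filter.Eventually.of_forall fun t => ?_)
      simp [mul_assoc]
    · refine (ae_restrict_iff' measurableSet_Ioi).2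
        (Filter.Eventually.of_forall fun t ht z hzz => ?_)
      have ht0 : 0 < t := ht
      have e : (t : ℂ) ^ (a - 1) * (Complex.exp (-(z * t)) * (-(t : ℂ))) =
          -((t : ℂ) ^ (a - 1) * Complex.exp (-(z * t)) * t) := by ring
      rw [e, norm_neg, norm_mul, hbound _ _ _ ht, Complex.norm_real, Real.norm_of_nonneg ht0.le]
      have e2 : t ^ a.re = t ^ (a - 1).re * t := by
        rw [Complex.sub_re, Complex.one_re, Real.rpow_sub_one ht0.ne']
        field_simp
      rw [e2]
      have hzz' : z₀.re / 2 < z.re := hzz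
      have : Real.exp (-(z.re * t)) ≤ Real.exp (-(z₀.re / 2 * t)) := by
        apply Real.exp_le_exp.2
        nlinarith
      have h3 : 0 ≤ t ^ (a - 1).re := by positivity
      nlinarith [mul_nonneg h3 ht0.le]
    · have := integrableOn_rpow_mul_exp_neg_mul_rpow (p := 1) (s := a.re) (b := z₀.re / 2)
        (by linarith) one_pos (by linarith)
      rw [← IntegrableOn]
      simpa using this
    · refine Filter.Eventually.of_forall fun t z _ => ?_
      have h1 : HasDerivAt (fun z : ℂ => -(z * t)) (-(t : ℂ)) z := by
        have := ((hasDerivAt_id z).mul_const (t : ℂ)).fun_neg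
        simpa using this
      exact h1.cexp.const_mul _
  have hopen : IsOpen {z : ℂ | 0 < z.re} := isOpen_lt continuous_const Complex.continuous_re
  have hconv : IsPreconnected {z : ℂ | 0 < z.re} :=
    (convex_halfSpace_re_gt 0).isPreconnected
  have hA := hdiff.analyticOnNhd hopen
  have hB : AnalyticOnNhd ℂ (fun z : ℂ => Complex.Gamma a * z ^ (-a)) {z | 0 < z.re} := by
    refine DifferentiableOn.analyticOnNhd (fun z hz => ?_) hopen
    refine DifferentiableAt.differentiableWithinAt ?_
    exact (differentiableAt_id.cpow_const (Or.inl hz)).const_mul _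
  refine hA.eqOn_of_preconnected_of_frequently_eq hB hconv (z₀ := 1) (by simp) ?_ hz
  rw [Filter.frequently_iff]
  intro U hU
  rw [mem_nhdsWithin] at hU
  obtain ⟨O, hO, h1, hOU⟩ := hU
  -- Real points different from 1 that accumulate at 1.
  have hc : Filter.Tendsto (fun n : ℕ => ((1 + 1 / ((n : ℝ) + 1) : ℝ) : ℂ)) Filter.atTop
      (nhds 1) := by
    have := tendsto_one_div_add_atTop_nhds_zero_nat.const_add (1 : ℝ)
    rw [add_zero] at this
    exact (Complex.continuous_ofReal.tendsto _).comp this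
  obtain ⟨n, hn⟩ := (hc.eventually (hO.mem_nhds h1)).exists
  have hr : (0 : ℝ) < 1 / ((n : ℝ) + 1) := by positivity
  refine ⟨((1 + 1 / ((n : ℝ) + 1) : ℝ) : ℂ), hOU ⟨hn, ?_⟩, ?_⟩
  · simp only [mem_compl_iff, mem_singleton_iff]
    intro h
    have : (1 + 1 / ((n : ℝ) + 1) : ℝ) = 1 := by exact_mod_cast h
    linarith
  · set s : ℝ := 1 + 1 / ((n : ℝ) + 1)
    have hs : 0 < s := by positivity
    have := Complex.integral_cpow_mul_exp_neg_mul_Ioi ha hs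
    rw [this, mul_comm, Complex.cpow_neg, one_div, Complex.inv_cpow]
    rw [Complex.arg_ofReal_of_nonneg hs.le]
    exact Real.pi_pos.ne

/-- The Mellin symbol `Γ(1/2 - 2πis) z^{-(1/2 - 2πis)}`. -/
def mellinSymbol (z : ℂ) (s : ℝ) : ℂ :=
  Complex.Gamma (1 / 2 - 2 * Real.pi * Complex.I * s) *
    z ^ (-(1 / 2 - 2 * Real.pi * Complex.I * s))

/-- On the line Re a = 1/2 the conjugate of a is 1 - a, so |Γ(a)|² = Γ(a)Γ(1 - a), and the
reflection formula applies. -/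
theorem norm_Gamma_half_sq (s : ℝ) :
    ‖Complex.Gamma (1 / 2 - 2 * Real.pi * Complex.I * s)‖ ^ 2 =
      Real.pi / Real.cosh (2 * Real.pi ^ 2 * s) := by
  set a : ℂ := 1 / 2 - 2 * Real.pi * Complex.I * s with ha
  have hconj : (starRingEnd ℂ) a = 1 - a := by
    rw [ha]
    simp only [map_sub, map_div₀, map_one, map_mul, Complex.conj_I, Complex.conj_ofReal,
      map_ofNat]
    ring
  have h1 : Complex.Gamma a * Complex.Gamma (1 - a) =
      ((‖Complex.Gamma a‖ ^ 2 : ℝ) : ℂ) := by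
    rw [← hconj, Complex.Gamma_conj, Complex.mul_conj, Complex.normSq_eq_norm_sq]
  rw [Complex.Gamma_mul_Gamma_one_sub] at h1
  have h2 : Complex.sin (Real.pi * a) = ((Real.cosh (2 * Real.pi ^ 2 * s) : ℝ) : ℂ) := by
    have e : (Real.pi : ℂ) * a = Real.pi / 2 - ((2 * Real.pi ^ 2 * s : ℝ) : ℂ) * Complex.I := by
      rw [ha]
      push_cast
      ring
    rw [e, Complex.sin_pi_div_two_sub, Complex.cos_mul_I, Complex.ofReal_cosh]
  rw [h2] at h1
  exact_mod_cast h1.symm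

theorem norm_mellinSymbol_sq {z : ℂ} (hz : z ≠ 0) (s : ℝ) :
    ‖mellinSymbol z s‖ ^ 2 = Real.pi / Real.cosh (2 * Real.pi ^ 2 * s) *
      (‖z‖⁻¹ * Real.exp (-(2 * (z.arg * (2 * Real.pi * s))))) := by
  rw [mellinSymbol, norm_mul, mul_pow, norm_Gamma_half_sq, Complex.norm_cpow_of_ne_zero hz]
  congr 1
  have h1 : (-(1 / 2 - 2 * Real.pi * Complex.I * s) : ℂ).re = -(1 / 2) := by simp
  have h2 : (-(1 / 2 - 2 * Real.pi * Complex.I * s) : ℂ).im = 2 * Real.pi * s := by simp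
  rw [h1, h2, div_pow, ← Real.rpow_natCast, ← Real.rpow_mul (norm_nonneg _), Real.exp_neg,
    ← Real.exp_nat_mul, div_eq_mul_inv]
  congr 1
  push_cast
  norm_num
  rw [Real.rpow_neg_one]

/-- For |arg z| ≤ π/2 the growth of the power is at most e^{2π²|s|}, which the cosh from the Gamma
factor compensates. The bound is uniform up to the imaginary axis and serves as domination in the
limit ε → 0. -/
theorem norm_mellinSymbol_le_one {z : ℂ} (hz : 2 * Real.pi ≤ ‖z‖) (hre : 0 ≤ z.re) (s : ℝ) :
    ‖mellinSymbol z s‖ ≤ 1 := by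
  have hpi := Real.pi_pos
  have hz0 : z ≠ 0 := by
    rintro rfl
    rw [norm_zero] at hz
    linarith
  rw [← sq_le_one_iff₀ (norm_nonneg _), norm_mellinSymbol_sq hz0]
  have harg := Complex.abs_arg_le_pi_div_two_iff.2 hre
  have h1 : -(2 * (z.arg * (2 * Real.pi * s))) ≤ |2 * Real.pi ^ 2 * s| := by
    have : |z.arg * (2 * Real.pi * s)| ≤ Real.pi / 2 * |2 * Real.pi * s| := by
      rw [abs_mul]; gcongr
    have h2 := neg_abs_le (z.arg * (2 * Real.pi * s))
    have h3 : |2 * Real.pi ^ 2 * s| = Real.pi * |2 * Real.pi * s| := by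
      rw [← abs_of_pos hpi, ← abs_mul, abs_of_pos hpi]
      congr 1
      ring
    rw [h3]
    linarith
  have h2 : Real.exp (-(2 * (z.arg * (2 * Real.pi * s)))) ≤
      2 * Real.cosh (2 * Real.pi ^ 2 * s) := by
    refine (Real.exp_le_exp.2 h1).trans ?_
    rw [← Real.cosh_abs, Real.cosh_eq]
    have := Real.exp_pos (-|2 * Real.pi ^ 2 * s|)
    linarith
  have hcosh := Real.cosh_pos (2 * Real.pi ^ 2 * s)
  have h3 : ‖z‖⁻¹ ≤ (2 * Real.pi)⁻¹ := inv_anti₀ (by positivity) hz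
  calc Real.pi / Real.cosh (2 * Real.pi ^ 2 * s) *
      (‖z‖⁻¹ * Real.exp (-(2 * (z.arg * (2 * Real.pi * s)))))
      ≤ Real.pi / Real.cosh (2 * Real.pi ^ 2 * s) *
        ((2 * Real.pi)⁻¹ * (2 * Real.cosh (2 * Real.pi ^ 2 * s))) := by gcongr
    _ = 1 := by field_simp

/-- The symbol `1 / (1 + e^{-4π²s})` of the Wiener-Hopf operator of the half line. -/
def whSymbol (s : ℝ) : ℝ := (1 + Real.exp (-(4 * Real.pi ^ 2 * s)))⁻¹

/-- The point `-2πi`. -/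
def mellinPoint (ε : ℝ) : ℂ := 2 * Real.pi * (ε - Complex.I)

theorem mellinPoint_re (ε : ℝ) : (mellinPoint ε).re = 2 * Real.pi * ε := by simp [mellinPoint]

theorem mellinPoint_im (ε : ℝ) : (mellinPoint ε).im = -(2 * Real.pi) := by simp [mellinPoint]

theorem two_pi_le_norm_mellinPoint (ε : ℝ) : 2 * Real.pi ≤ ‖mellinPoint ε‖ := by
  have := Complex.abs_im_le_norm (mellinPoint ε)
  rw [mellinPoint_im, abs_neg, abs_of_pos Real.two_pi_pos] at this
  exact this

/-- At z = -2πi the argument is -π/2, and the quotient e^u/(2 cosh u) with u = 2π²s is the logistic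
function. -/
theorem norm_mellinSymbol_zero_sq (s : ℝ) :
    ‖mellinSymbol (mellinPoint 0) s‖ ^ 2 = whSymbol s := by
  have hpi := Real.pi_pos
  have h0 : mellinPoint 0 ≠ 0 := by
    intro h
    have := mellinPoint_im 0
    rw [h, Complex.zero_im] at this
    linarith
  have h1 : mellinPoint 0 = ((2 * Real.pi : ℝ) : ℂ) * (-Complex.I) := by
    simp [mellinPoint]
  rw [norm_mellinSymbol_sq h0]
  have harg : (mellinPoint 0).arg = -(Real.pi / 2) := by
    rw [h1, Complex.arg_real_mul _ Real.two_pi_pos, Complex.arg_neg_I]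
  have hn : ‖mellinPoint 0‖ = 2 * Real.pi := by
    rw [h1, norm_mul, norm_neg, Complex.norm_I, mul_one, Complex.norm_real,
      Real.norm_of_nonneg Real.two_pi_pos.le]
  rw [harg, hn, whSymbol, Real.cosh_eq]
  have e1 : -(2 * (-(Real.pi / 2) * (2 * Real.pi * s))) = 2 * Real.pi ^ 2 * s := by ring
  have e2 : Real.exp (-(4 * Real.pi ^ 2 * s)) =
      Real.exp (-(2 * Real.pi ^ 2 * s)) * (Real.exp (2 * Real.pi ^ 2 * s))⁻¹ := by
    rw [← Real.exp_neg, ← Real.exp_add]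
    congr 1
    ring
  have p1 := Real.exp_pos (2 * Real.pi ^ 2 * s)
  have p2 := Real.exp_pos (-(2 * Real.pi ^ 2 * s))
  rw [e1, e2]
  field_simp

end Mellin

/-! ### Mellin diagonalization of the projection onto positive frequencies -/

section WienerHopf

/-- The kernel `e^{w/2} exp(-z e^w)`: the Laplace transform in logarithmic variables. -/
def laplaceKer (z : ℂ) (w : ℝ) : ℂ := (Real.exp (w / 2) : ℂ) * Complex.exp (-(z * Real.exp w))

theorem continuous_laplaceKer (z : ℂ) : Continuous (laplaceKer z) := by
  unfold laplaceKer
  fun_prop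

theorem norm_laplaceKer (z : ℂ) (w : ℝ) :
    ‖laplaceKer z w‖ = Real.exp (w / 2) * Real.exp (-(z.re * Real.exp w)) := by
  rw [laplaceKer, norm_mul, Complex.norm_real, Real.norm_of_nonneg (Real.exp_pos _).le,
    Complex.norm_exp, Complex.neg_re, Complex.re_mul_ofReal]

theorem norm_laplaceKer_le {z : ℂ} (hz : 0 ≤ z.re) (w : ℝ) :
    ‖laplaceKer z w‖ ≤ Real.exp (w / 2) := by
  rw [norm_laplaceKer]
  refine mul_le_of_le_one_right (Real.exp_pos _).le (Real.exp_le_one_iff.2 ?_)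
  have := Real.exp_pos w
  nlinarith [mul_nonneg hz this.le]

theorem integrable_laplaceKer {z : ℂ} (hz : 0 < z.re) : Integrable (laplaceKer z) := by
  have h : IntegrableOn (fun t : ℝ => t ^ (-(1 / 2) : ℝ) * Real.exp (-(z.re * t))) (Ioi 0) := by
    have := integrableOn_rpow_mul_exp_neg_mul_rpow (p := 1) (s := -(1 / 2)) (b := z.re)
      (by norm_num) one_pos hz
    simpa using this
  rw [integrableOn_Ioi_iff_exp] at h
  refine h.mono' (continuous_laplaceKer z).aestronglyMeasurable
    (Filter.Eventually.of_forall fun w => ?_)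
  rw [norm_laplaceKer, smul_eq_mul, ← mul_assoc, ← Real.exp_mul]
  have e : Real.exp w * Real.exp (w * -(1 / 2)) = Real.exp (w / 2) := by
    rw [← Real.exp_add]
    congr 1
    ring
  rw [e]

/-- The substitution t = e^w turns the Gamma integral into a Fourier integral. It needs Re z > 0,
whereas the Fourier kernel sits at z = -2πi; this is the reason for the regularization z = 2π(ε -
i). -/
theorem fourier_laplaceKer {z : ℂ} (hz : 0 < z.re) (s : ℝ) :
    𝓕 (laplaceKer z) s = mellinSymbol z s := by
  have ha : 0 < (1 / 2 - 2 * Real.pi * Complex.I * s : ℂ).re := by simp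
  rw [mellinSymbol, ← integral_cpow_mul_exp_neg_mul_Ioi_complex ha hz,
    integral_Ioi_eq_integral_exp, fourier_eq_ph]
  refine integral_congr_ae (Filter.Eventually.of_forall fun w => ?_)
  simp only
  rw [Complex.real_smul, laplaceKer, ← mul_assoc, ← mul_assoc]
  congr 1
  rw [Complex.cpow_def_of_ne_zero (by exact_mod_cast (Real.exp_pos w).ne'),
    ← Complex.ofReal_log (Real.exp_pos w).le, Real.log_exp, ph, Complex.ofReal_exp,
    Complex.ofReal_exp, ← Complex.exp_add, ← Complex.exp_add]
  congr 1
  push_cast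
  ring

theorem continuous_mellinSymbol {z : ℂ} (hz : z ≠ 0) : Continuous (mellinSymbol z) := by
  unfold mellinSymbol
  refine Continuous.mul ?_ ?_
  · rw [continuous_iff_continuousAt]
    intro s
    have h1 : DifferentiableAt ℂ Complex.Gamma (1 / 2 - 2 * Real.pi * Complex.I * s) := by
      refine Complex.differentiableAt_Gamma _ fun m hm => ?_
      have := congrArg Complex.re hm
      simp at this
      have h0 : (0 : ℝ) ≤ m := Nat.cast_nonneg m
      linarith
    exact ContinuousAt.comp (f := fun s : ℝ => (1 / 2 - 2 * Real.pi * Complex.I * s : ℂ))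
      h1.continuousAt (by fun_prop)
  · exact Continuous.const_cpow (by fun_prop) (Or.inl hz)

theorem memLp_top_mellinSymbol {ε : ℝ} (hε : 0 ≤ ε) :
    MemLp (mellinSymbol (mellinPoint ε)) ⊤ volume := by
  have h0 : mellinPoint ε ≠ 0 := fun h => by
    have := two_pi_le_norm_mellinPoint ε
    rw [h, norm_zero] at this
    linarith [Real.pi_pos]
  refine memLp_top_of_bound (continuous_mellinSymbol h0).aestronglyMeasurable 1
    (Filter.Eventually.of_forall fun s => norm_mellinSymbol_le_one (two_pi_le_norm_mellinPoint ε)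
      ?_ s)
  rw [mellinPoint_re]
  exact mul_nonneg Real.two_pi_pos.le hε

variable {h : ℝ → ℂ}

/-- The convolution of `h` with the Laplace kernel. -/
def laplaceConv (h : ℝ → ℂ) (z : ℂ) (μ : ℝ) : ℂ := ∫ v, h v * laplaceKer z (v + μ)

theorem integrable_laplace_prod (hi : Integrable h) {z : ℂ} (hz : 0 < z.re) :
    Integrable (fun p : ℝ × ℝ => h p.1 * laplaceKer z (p.1 + p.2)) (volume.prod volume) :=
  (measurePreserving_prod_add volume volume).integrable_comp_of_integrable
    (hi.mul_prod (integrable_laplaceKer hz))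

theorem integrable_laplaceConv (hi : Integrable h) {z : ℂ} (hz : 0 < z.re) :
    Integrable (laplaceConv h z) :=
  (integrable_laplace_prod hi hz).integral_prod_right

theorem memLp_laplaceConv (hi : Integrable h) {M : ℝ} (hM : ∀ v, ‖h v‖ ≤ M) {z : ℂ}
    (hz : 0 < z.re) : MemLp (laplaceConv h z) 2 volume := by
  have h1 := integrable_laplaceConv hi hz
  have hb : ∀ μ, ‖laplaceConv h z μ‖ ≤ M * ∫ v, ‖laplaceKer z v‖ := fun μ => by
    have h2 := (integrable_laplaceKer hz).norm.comp_add_right μ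
    calc ‖laplaceConv h z μ‖ ≤ ∫ v, M * ‖laplaceKer z (v + μ)‖ := by
          refine norm_integral_le_of_norm_le (h2.const_mul M)
            (Filter.Eventually.of_forall fun v => ?_)
          rw [norm_mul]
          gcongr
          exact hM v
      _ = _ := by
          rw [integral_const_mul, integral_add_right_eq_self (fun v => ‖laplaceKer z v‖)]
  have h3 : MemLp (laplaceConv h z) ⊤ volume :=
    memLp_top_of_bound h1.aestronglyMeasurable _ (Filter.Eventually.of_forall hb)
  rw [memLp_two_iff_integrable_sq_norm h1.aestronglyMeasurable]
  refine (h1.norm.mul_const (M * ∫ v, ‖laplaceKer z v‖)).mono'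
    (h1.aestronglyMeasurable.norm.pow 2) (Filter.Eventually.of_forall fun μ => ?_)
  rw [Real.norm_of_nonneg (by positivity), sq]
  exact mul_le_mul_of_nonneg_left (hb μ) (norm_nonneg _)

/-- A convolution theorem; the kernel depends on v + μ instead of μ - v, so `h` enters through its
inverse transform. -/
theorem fourier_laplaceConv (hi : Integrable h) {z : ℂ} (hz : 0 < z.re) (s : ℝ) :
    𝓕 (laplaceConv h z) s = mellinSymbol z s * 𝓕⁻ h s := by
  have hint : Integrable (fun p : ℝ × ℝ => ph (-(s * p.2)) * (h p.1 * laplaceKer z (p.1 + p.2)))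
      (volume.prod volume) := by
    refine (integrable_laplace_prod hi hz).bdd_mul (c := 1) ?_
      (Filter.Eventually.of_forall fun p => (norm_ph _).le)
    exact (continuous_ph.comp (by fun_prop)).aestronglyMeasurable
  have e1 : 𝓕 (laplaceConv h z) s =
      ∫ μ, ∫ v, ph (-(s * μ)) * (h v * laplaceKer z (v + μ)) := by
    rw [fourier_eq_ph]
    refine integral_congr_ae (Filter.Eventually.of_forall fun μ => ?_)
    simp only
    rw [laplaceConv, integral_const_mul]
  rw [e1, ← integral_integral_swap (f := fun v μ => ph (-(s * μ)) * (h v * laplaceKer z (v + μ)))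
    hint, fourierInv_eq_ph, ← integral_const_mul]
  refine integral_congr_ae (Filter.Eventually.of_forall fun v => ?_)
  simp only
  have e2 : ∀ μ, ph (-(s * μ)) * (h v * laplaceKer z (v + μ)) =
      (ph (s * v) * h v) * (ph (-(s * (μ + v))) * laplaceKer z (μ + v)) := fun μ => by
    have : ph (-(s * μ)) = ph (s * v) * ph (-(s * (μ + v))) := by
      rw [← ph_add]
      congr 1
      ring
    rw [this, add_comm v μ]
    ring
  simp only [e2]
  rw [integral_const_mul, integral_add_right_eq_self (fun μ => ph (-(s * μ)) * laplaceKer z μ),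
    ← fourier_eq_ph, fourier_laplaceKer hz, mul_comm]

theorem fourierInv_toLp_laplaceConv (hi : Integrable h) (h2 : MemLp h 2 volume) {M : ℝ}
    (hM : ∀ v, ‖h v‖ ≤ M) {ε : ℝ} (hε : 0 < ε) :
    fourierInvOp (mulOp (mellinSymbol (mellinPoint ε)) (fourierInvOp (h2.toLp h))) =
      (memLp_laplaceConv hi hM (z := mellinPoint ε)
        (by rw [mellinPoint_re]; positivity)).toLp _ := by
  have hz : 0 < (mellinPoint ε).re := by rw [mellinPoint_re]; positivity
  have key : fourierOp ((memLp_laplaceConv hi hM hz).toLp _) =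
      mulOp (mellinSymbol (mellinPoint ε)) (fourierInvOp (h2.toLp h)) := by
    refine Lp.ext ?_
    filter_upwards [fourier_toLp_ae (memLp_laplaceConv hi hM hz) (integrable_laplaceConv hi hz),
      mulOp_ae (memLp_top_mellinSymbol hε.le) (fourierInvOp (h2.toLp h)),
      fourierInv_toLp_ae h2 hi] with s h1 h3 h4
    rw [fourierOp_apply, h1, h3, fourierInvOp_apply, h4, fourier_laplaceConv hi hz]
  rw [← key, ← mul_apply_eq_comp, fourierInvOp_mul]
  rfl

/-- Strong convergence as ε → 0 by dominated convergence: the symbols are bounded by 1, so the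
squared difference is dominated by 4|f|². -/
theorem tendsto_mulOp_mellinSymbol (f : L2R) :
    Filter.Tendsto (fun n : ℕ => mulOp (mellinSymbol (mellinPoint (1 / ((n : ℝ) + 1)))) f)
      Filter.atTop (nhds (mulOp (mellinSymbol (mellinPoint 0)) f)) := by
  rw [tendsto_iff_norm_sub_tendsto_zero]
  have hpos : ∀ n : ℕ, (0 : ℝ) ≤ 1 / ((n : ℝ) + 1) := fun n => by positivity
  have hsq : Filter.Tendsto (fun n : ℕ => ‖mulOp (mellinSymbol (mellinPoint (1 / ((n : ℝ) + 1)))) f -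
      mulOp (mellinSymbol (mellinPoint 0)) f‖ ^ 2) Filter.atTop (nhds 0) := by
    have e : ∀ n : ℕ, ‖mulOp (mellinSymbol (mellinPoint (1 / ((n : ℝ) + 1)))) f -
        mulOp (mellinSymbol (mellinPoint 0)) f‖ ^ 2 =
        ∫ s, ‖(mellinSymbol (mellinPoint (1 / ((n : ℝ) + 1))) s - mellinSymbol (mellinPoint 0) s) *
          f s‖ ^ 2 := fun n => by
      rw [norm_sq_L2R]
      refine integral_congr_ae ?_
      filter_upwards [mulOp_ae (memLp_top_mellinSymbol (hpos n)) f,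
        mulOp_ae (memLp_top_mellinSymbol le_rfl) f,
        Lp.coeFn_sub (mulOp (mellinSymbol (mellinPoint (1 / ((n : ℝ) + 1)))) f)
          (mulOp (mellinSymbol (mellinPoint 0)) f)] with s h1 h2 h3
      rw [h3, Pi.sub_apply, h1, h2, sub_mul]
    simp only [e]
    suffices H : Filter.Tendsto (fun n : ℕ => ∫ s, ‖(mellinSymbol (mellinPoint
        (1 / ((n : ℝ) + 1))) s - mellinSymbol (mellinPoint 0) s) * f s‖ ^ 2) Filter.atTop
        (nhds (∫ _ : ℝ, (0 : ℝ))) by simpa using H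
    have hre : ∀ ε : ℝ, 0 ≤ ε → 0 ≤ (mellinPoint ε).re := fun ε hε => by
      rw [mellinPoint_re]
      exact mul_nonneg Real.two_pi_pos.le hε
    refine tendsto_integral_of_dominated_convergence (fun s => 4 * ‖f s‖ ^ 2) (fun n => ?_)
      ((integrable_norm_sq_L2R f).const_mul 4) (fun n => Filter.Eventually.of_forall fun s => ?_)
      (Filter.Eventually.of_forall fun s => ?_)
    · have hm := ((memLp_top_mellinSymbol (hpos n)).1.sub
        (memLp_top_mellinSymbol le_rfl).1).mul (Lp.aestronglyMeasurable f)
      exact hm.norm.pow 2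
    · rw [Real.norm_of_nonneg (by positivity), norm_mul, mul_pow]
      have h1 := norm_sub_le (mellinSymbol (mellinPoint (1 / ((n : ℝ) + 1))) s)
        (mellinSymbol (mellinPoint 0) s)
      have h2 := norm_mellinSymbol_le_one (two_pi_le_norm_mellinPoint (1 / ((n : ℝ) + 1)))
        (hre _ (hpos n)) s
      have h3 := norm_mellinSymbol_le_one (two_pi_le_norm_mellinPoint 0) (hre 0 le_rfl) s
      have h4 : ‖mellinSymbol (mellinPoint (1 / ((n : ℝ) + 1))) s -
        mellinSymbol (mellinPoint 0) s‖ ≤ 2 := by linarith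
      gcongr
      nlinarith [norm_nonneg (mellinSymbol (mellinPoint (1 / ((n : ℝ) + 1))) s -
        mellinSymbol (mellinPoint 0) s)]
    · have h1 : Filter.Tendsto (fun n : ℕ => mellinPoint (1 / ((n : ℝ) + 1))) Filter.atTop
          (nhds (mellinPoint 0)) := by
        have hc : Continuous mellinPoint := by unfold mellinPoint; fun_prop
        exact (hc.tendsto 0).comp tendsto_one_div_add_atTop_nhds_zero_nat
      have h2 : ContinuousAt (fun z : ℂ => mellinSymbol z s) (mellinPoint 0) := by
        unfold mellinSymbol
        refine continuousAt_const.mul (continuousAt_cpow_const (Or.inr ?_))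
        rw [mellinPoint_im]
        exact neg_ne_zero.2 Real.two_pi_pos.ne'
      have h3 := h2.tendsto.comp h1
      have h4 := ((h3.sub_const (mellinSymbol (mellinPoint 0) s)).mul_const (f s)).norm.pow 2
      simpa using h4
  have := hsq.sqrt
  simpa using this

/-- On the imaginary axis the Laplace kernel is no longer integrable; the compact support of `h`
provides the domination instead. -/
theorem tendsto_laplaceConv (hc : Continuous h) (hs : HasCompactSupport h) (μ : ℝ) :
    Filter.Tendsto (fun n : ℕ => laplaceConv h (mellinPoint (1 / ((n : ℝ) + 1))) μ)
      Filter.atTop (nhds (laplaceConv h (mellinPoint 0) μ)) := by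
  refine tendsto_integral_of_dominated_convergence (fun v => ‖h v‖ * Real.exp ((v + μ) / 2))
    (fun n => ?_) ?_ (fun n => Filter.Eventually.of_forall fun v => ?_)
    (Filter.Eventually.of_forall fun v => ?_)
  · exact (hc.mul ((continuous_laplaceKer _).comp (by fun_prop))).aestronglyMeasurable
  · refine Continuous.integrable_of_hasCompactSupport (by fun_prop) ?_
    exact hs.norm.mul_right
  · rw [norm_mul]
    gcongr
    refine norm_laplaceKer_le ?_ _
    rw [mellinPoint_re]
    positivity
  · have h1 : Filter.Tendsto (fun n : ℕ => mellinPoint (1 / ((n : ℝ) + 1))) Filter.atTop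
        (nhds (mellinPoint 0)) := by
      have hc : Continuous mellinPoint := by unfold mellinPoint; fun_prop
      exact (hc.tendsto 0).comp tendsto_one_div_add_atTop_nhds_zero_nat
    have h2 : Continuous fun z : ℂ => h v * laplaceKer z (v + μ) := by
      unfold laplaceKer
      fun_prop
    exact (h2.tendsto _).comp h1

theorem laplaceKer_mellinPoint_zero (w : ℝ) :
    laplaceKer (mellinPoint 0) w = (Real.exp (w / 2) : ℂ) * ph (Real.exp w) := by
  rw [laplaceKer, mellinPoint, ph]
  congr 2
  push_cast
  ring

/-- With x = e^μ and η = e^v the phase is e^{2πi e^{μ+v}}, and the half densities combine to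
e^{(μ+v)/2}: this is the Laplace kernel at z = -2πi. -/
theorem logCoisom_fourierInv_logIsom_ae (hc : Continuous h) (hs : HasCompactSupport h)
    (h2 : MemLp h 2 volume) :
    (logCoisom (fourierInvOp (logIsom (h2.toLp h))) : ℝ → ℂ) =ᵐ[volume]
      laplaceConv h (mellinPoint 0) := by
  have hi : Integrable (logPull h) := by
    have e : logPull h = (Ioi (0 : ℝ)).indicator (logPull h) := by
      unfold logPull
      rw [indicator_indicator, inter_self]
    rw [e, integrable_indicator_iff measurableSet_Ioi, integrableOn_Ioi_iff_exp]
    have e2 : ∀ u, Real.exp u • logPull h (Real.exp u) =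
        ((Real.exp u * Real.exp (-(u / 2)) : ℝ) : ℂ) * h u := fun u => by
      rw [logPull_exp, Complex.real_smul]
      push_cast
      ring
    simp only [e2]
    exact Continuous.integrable_of_hasCompactSupport (by fun_prop) hs.mul_left
  have hL : MemLp (logPull h) 2 volume := memLp_logPull hc.measurable h2
  have e0 : logIsom (h2.toLp h) = hL.toLp _ :=
    Lp.ext ((logIsom_toLp_ae h2).trans hL.coeFn_toLp.symm)
  rw [e0]
  filter_upwards [logCoisom_ae (fourierInvOp (hL.toLp _)),
    ae_comp_exp (fourierInv_toLp_ae hL hi)] with μ h3 h4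
  rw [h3, fourierInvOp_apply, h4, fourierInv_eq_ph, laplaceConv]
  have e1 : ∫ η, ph (Real.exp μ * η) * logPull h η = ∫ η, logPull h η * ph (Real.exp μ * η) := by
    simp only [mul_comm]
  rw [e1, integral_logPull_mul, ← integral_const_mul]
  refine integral_congr_ae (Filter.Eventually.of_forall fun v => ?_)
  simp only
  rw [laplaceKer_mellinPoint_zero, ← Real.exp_add, add_comm μ v]
  have : ((Real.exp ((v + μ) / 2) : ℝ) : ℂ) = Real.exp (v / 2) * Real.exp (μ / 2) := by
    rw [← Complex.ofReal_mul, ← Real.exp_add]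
    congr 2
    ring
  rw [this]
  ring

/-- The inverse Fourier transform restricted to the half line, in logarithmic variables. -/
theorem logCoisom_fourierInv_logIsom :
    logCoisom * fourierInvOp * logIsom =
      fourierInvOp * mulOp (mellinSymbol (mellinPoint 0)) * fourierInvOp := by
  have hcc : ∀ h : ℝ → ℂ, Continuous h → HasCompactSupport h → ∀ h2 : MemLp h 2 volume,
      (logCoisom * fourierInvOp * logIsom) (h2.toLp h) =
      (fourierInvOp * mulOp (mellinSymbol (mellinPoint 0)) * fourierInvOp) (h2.toLp h) := by
    intro h hc hs h2
    have hi : Integrable h := hc.integrable_of_hasCompactSupport hs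
    obtain ⟨M, hM⟩ := hs.exists_bound_of_continuous hc
    have hpos : ∀ n : ℕ, (0 : ℝ) < 1 / ((n : ℝ) + 1) := fun n => by positivity
    -- As ε → 0 the multiplier side converges in L² and hence almost everywhere along a subsequence,
    -- while the convolution side converges at every point; the limits must agree.
    have t1 := (fourierInvOp.continuous.tendsto _).comp
      (tendsto_mulOp_mellinSymbol (fourierInvOp (h2.toLp h)))
    have t2 := (tendstoInMeasure_of_tendsto_Lp t1).exists_seq_tendsto_ae
    obtain ⟨ns, hns, hae⟩ := t2
    refine Lp.ext ?_
    have hall : ∀ᵐ μ, ∀ n : ℕ, (fourierInvOp (mulOp (mellinSymbol (mellinPoint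
        (1 / ((n : ℝ) + 1)))) (fourierInvOp (h2.toLp h))) : ℝ → ℂ) μ =
        laplaceConv h (mellinPoint (1 / ((n : ℝ) + 1))) μ := by
      refine ae_all_iff.2 fun n => ?_
      rw [fourierInv_toLp_laplaceConv hi h2 hM (hpos n)]
      exact MemLp.coeFn_toLp _
    filter_upwards [logCoisom_fourierInv_logIsom_ae hc hs h2, hae, hall] with μ h3 h4 h5
    simp only [mul_apply_eq_comp]
    rw [h3]
    have h6 := (tendsto_laplaceConv hc hs μ).comp hns.tendsto_atTop
    refine tendsto_nhds_unique h6 (h4.congr fun n => ?_)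
    exact h5 (ns n)
  ext1 f
  refine eq_of_forall_dist_le fun ε hε => ?_
  -- The difference of the two bounded operators vanishes on continuous compactly supported
  -- functions, which are dense.
  set D := logCoisom * fourierInvOp * logIsom -
    fourierInvOp * mulOp (mellinSymbol (mellinPoint 0)) * fourierInvOp with hD
  obtain ⟨g, hgs, hge, hgc, hg2⟩ := (Lp.memLp f).exists_hasCompactSupport_eLpNorm_sub_le
    ENNReal.ofNat_ne_top (ε := ENNReal.ofReal (ε / (‖D‖ + 1))) (by positivity)
  have h1 : D (hg2.toLp g) = 0 := by
    rw [hD, sub_apply, hcc g hgc hgs hg2, sub_self]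
  have h2 : D f = D (f - hg2.toLp g) := by rw [map_sub, h1, sub_zero]
  have h3 : ‖f - hg2.toLp g‖ ≤ ε / (‖D‖ + 1) := by
    have : f - hg2.toLp g = ((Lp.memLp f).sub hg2).toLp _ := by
      rw [MemLp.toLp_sub (Lp.memLp f) hg2, Lp.toLp_coeFn]
    rw [this, Lp.norm_toLp]
    exact ENNReal.toReal_le_of_le_ofReal (by positivity) hge
  rw [dist_eq_norm, ← sub_apply, ← hD, h2]
  calc ‖D (f - hg2.toLp g)‖ ≤ ‖D‖ * (ε / (‖D‖ + 1)) := (D.le_opNorm _).trans (by gcongr)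
    _ ≤ (‖D‖ + 1) * (ε / (‖D‖ + 1)) := by gcongr; linarith
    _ = ε := by field_simp

theorem memLp_top_whSymbol : MemLp (fun s => (whSymbol s : ℂ)) ⊤ volume := by
  refine memLp_top_of_bound ?_ 1 (Filter.Eventually.of_forall fun s => ?_)
  · have : Measurable whSymbol := by unfold whSymbol; fun_prop
    exact (Complex.measurable_ofReal.comp this).aestronglyMeasurable
  · rw [← norm_mellinSymbol_zero_sq, Complex.norm_real, Real.norm_of_nonneg (by positivity)]
    exact pow_le_one₀ (norm_nonneg _) (norm_mellinSymbol_le_one (two_pi_le_norm_mellinPoint 0)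
      (by rw [mellinPoint_re]; simp) s)

/-- Mellin diagonalization of the Wiener-Hopf operator of the half line. -/
theorem logCoisom_fmul_logIsom :
    logCoisom * fmul ((Ioi (0 : ℝ)).indicator fun _ => 1) * logIsom =
      fmul fun s => (whSymbol s : ℂ) := by
  have hm := memLp_top_mellinSymbol (le_refl (0 : ℝ))
  have h1 := logCoisom_fourierInv_logIsom
  have h2 := congrArg ContinuousLinearMap.adjoint h1
  simp only [ContinuousLinearMap.mul_def, ContinuousLinearMap.adjoint_comp] at h2
  simp only [← ContinuousLinearMap.mul_def] at h2
  rw [adjoint_fourierInvOp, adjoint_mulOp hm, logCoisom, ContinuousLinearMap.adjoint_adjoint,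
    ← logCoisom] at h2
  have e : mulOp ((Ioi (0 : ℝ)).indicator fun _ => (1 : ℂ)) = logIsom * logCoisom :=
    logIsom_mul_logCoisom.symm
  -- The frequency cutoff is itself χ₊ = V V*. The conjugated projection thus factors as (V* F⁻¹
  -- V)(V* F V), a product of mutually adjoint operators, and the symbol is the squared modulus of
  -- the Mellin symbol.
  calc logCoisom * fmul ((Ioi (0 : ℝ)).indicator fun _ => 1) * logIsom
      = (logCoisom * fourierInvOp * logIsom) * (logCoisom * (fourierOp * logIsom)) := by
        rw [fmul, e]
        simp only [mul_assoc]
    _ = fourierInvOp * mulOp (mellinSymbol (mellinPoint 0)) * (fourierInvOp * fourierOp) *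
          (mulOp (fun x => (starRingEnd ℂ) (mellinSymbol (mellinPoint 0) x)) * fourierOp) := by
        rw [h1, h2]
        simp only [mul_assoc]
    _ = fmul fun s => (whSymbol s : ℂ) := by
        rw [fourierInvOp_mul, mul_one, mul_assoc, ← mul_assoc (mulOp _), mulOp_mul hm
          (memLp_conj hm), fmul, mul_assoc]
        congr 3
        ext s
        rw [Complex.mul_conj, Complex.normSq_eq_norm_sq, norm_mellinSymbol_zero_sq]

end WienerHopf

/-! ### Frequency translation as conjugation by characters -/

section Modulation

/-- Multiplication by the character `e^{2πiθx}`. -/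
def modOp (θ : ℝ) : L2R →L[ℂ] L2R := mulOp fun x => ph (θ * x)

theorem memLp_top_ph (θ : ℝ) : MemLp (fun x => ph (θ * x)) ⊤ (volume : Measure ℝ) :=
  memLp_top_of_bound (continuous_ph.comp (by fun_prop)).aestronglyMeasurable 1
    (Filter.Eventually.of_forall fun _ => (norm_ph _).le)

theorem modOp_mul (θ θ' : ℝ) : modOp θ * modOp θ' = modOp (θ + θ') := by
  rw [modOp, modOp, mulOp_mul (memLp_top_ph θ) (memLp_top_ph θ'), modOp]
  congr 1
  ext x
  rw [← ph_add, add_mul]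

theorem modOp_zero : modOp 0 = 1 := by
  rw [← mulOp_one, modOp]
  congr 1
  ext x
  rw [zero_mul, ph_zero]

theorem modOp_neg_mul (θ : ℝ) : modOp (-θ) * modOp θ = 1 := by
  rw [modOp_mul, neg_add_cancel, modOp_zero]

theorem modOp_comm_mulOp (θ : ℝ) {f : ℝ → ℂ} (hf : MemLp f ⊤ volume) :
    modOp θ * mulOp f = mulOp f * modOp θ := by
  rw [modOp, mulOp_mul (memLp_top_ph θ) hf, mulOp_mul hf (memLp_top_ph θ)]
  congr 1
  ext x
  rw [mul_comm]

theorem memLp_comp_sub {m : ℝ → ℂ} {p : ENNReal} (hm : MemLp m p volume) (θ : ℝ) :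
    MemLp (fun η => m (η - θ)) p volume :=
  hm.comp_measurePreserving (measurePreserving_sub_right volume θ)

theorem fourierInv_comp_sub (m : ℝ → ℂ) (θ t : ℝ) :
    𝓕⁻ (fun η => m (η - θ)) t = ph (t * θ) * 𝓕⁻ m t := by
  rw [fourierInv_eq_ph, fourierInv_eq_ph, ← integral_const_mul,
    ← integral_add_right_eq_self (fun η => ph (t * η) * m (η - θ)) θ]
  refine integral_congr_ae (Filter.Eventually.of_forall fun η => ?_)
  simp only
  rw [mul_add, ph_add, add_sub_cancel_right]
  ring

theorem fmul_comp_sub_of_isMult {m : ℝ → ℂ} (hm : IsMult m) (θ : ℝ) :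
    fmul (fun η => m (η - θ)) = modOp θ * fmul m * modOp (-θ) := by
  have h1 := isKer_fmul (memLp_comp_sub hm.top θ) (memLp_comp_sub hm.two θ) (hm.one.comp_sub_right θ)
  have h2 := ((isKer_fmul hm.top hm.two hm.one).mulOp_mul (memLp_top_ph θ)).mul_mulOp
    (memLp_top_ph (-θ))
  suffices e : (fun x y => 𝓕⁻ (fun η => m (η - θ)) (x - y)) =
      fun x y => ph (θ * x) * 𝓕⁻ m (x - y) * ph (-θ * y) by
    rw [e] at h1
    exact IsKer.unique h1 h2
  ext x y
  rw [fourierInv_comp_sub, show (x - y) * θ = θ * x + -θ * y by ring, ph_add]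
  ring

theorem isMult_indicator_ball {m : ℝ → ℂ} (hm : MemLp m ⊤ volume) (R : ℝ) :
    IsMult fun η => m η * (Metric.closedBall (0 : ℝ) R).indicator (fun _ => (1 : ℂ)) η := by
  have hfin : volume (Metric.closedBall (0 : ℝ) R) ≠ ⊤ := measure_closedBall_lt_top.ne
  have h : ∀ p : ENNReal, MemLp ((Metric.closedBall (0 : ℝ) R).indicator fun _ => (1 : ℂ)) p volume :=
    fun p => memLp_indicator_const p Metric.isClosed_closedBall.measurableSet 1 (Or.inr hfin)
  exact ⟨memLp_mul_top hm (h ⊤), memLp_mul_top hm (h 2),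
    memLp_one_iff_integrable.1 (memLp_mul_top hm (h 1))⟩

/-- Translation of a Fourier multiplier is conjugation by a character. -/
theorem fmul_comp_sub {m : ℝ → ℂ} (hm : MemLp m ⊤ volume) (θ : ℝ) :
    fmul (fun η => m (η - θ)) = modOp θ * fmul m * modOp (-θ) := by
  set D := fmul (fun η => m (η - θ)) - modOp θ * fmul m * modOp (-θ) with hD
  -- Kernels exist only for integrable symbols. The identity is therefore checked after cutting the
  -- symbol to a ball, and functions with compactly supported Fourier transform are dense.
  suffices h0 : D = 0 from sub_eq_zero.1 h0
  have key : ∀ R : ℝ, D * fmul (fun η => (Metric.closedBall (0 : ℝ) R).indicator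
      (fun _ => (1 : ℂ)) (η - θ)) = 0 := fun R => by
    have h1 := isMult_indicator_ball memLp_top_one R
    simp only [one_mul] at h1
    have h2 := isMult_indicator_ball hm R
    rw [hD, sub_mul, sub_eq_zero, fmul_mul (memLp_comp_sub hm θ) (memLp_comp_sub h1.top θ),
      fmul_comp_sub_of_isMult h1, fmul_comp_sub_of_isMult h2, ← fmul_mul hm h1.top]
    have alg : ∀ a b c e : L2R →L[ℂ] L2R, e * a = 1 → a * (b * c) * e = a * b * e * (a * c * e) :=
      fun a b c e h => by
        calc a * (b * c) * e = a * b * 1 * (c * e) := by simp only [mul_assoc, one_mul]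
          _ = _ := by rw [← h]; simp only [mul_assoc]
    exact alg _ _ _ _ (modOp_neg_mul θ)
  ext1 f
  refine eq_of_forall_dist_le fun ε hε => ?_
  obtain ⟨g, hgs, hge, hgc, hg2⟩ := (Lp.memLp (fourierOp f)).exists_hasCompactSupport_eLpNorm_sub_le
    ENNReal.ofNat_ne_top (ε := ENNReal.ofReal (ε / (‖D‖ + 1))) (by positivity)
  obtain ⟨R, hR⟩ := hgs.isBounded.subset_closedBall θ
  have h1 : D (fourierInvOp (hg2.toLp g)) = 0 := by
    have e : fmul (fun η => (Metric.closedBall (0 : ℝ) R).indicator (fun _ => (1 : ℂ)) (η - θ))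
        (fourierInvOp (hg2.toLp g)) = fourierInvOp (hg2.toLp g) := by
      have h1 := isMult_indicator_ball memLp_top_one R
      simp only [one_mul] at h1
      rw [fmul, mul_apply_eq_comp, mul_apply_eq_comp, ← mul_apply_eq_comp fourierOp,
        fourierOp_mul_inv, one_apply_eq_self]
      congr 1
      refine Lp.ext ?_
      filter_upwards [mulOp_ae (memLp_comp_sub h1.top θ) (hg2.toLp g), hg2.coeFn_toLp] with x h3 h4
      rw [h3, h4]
      by_cases hx : g x = 0
      · rw [hx, mul_zero]
      · have := hR (subset_tsupport g hx)
        rw [indicator_of_mem, one_mul]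
        rw [Metric.mem_closedBall, dist_eq_norm] at this ⊢
        simpa using this
    rw [← e, ← mul_apply_eq_comp, key R]
    rfl
  have h2 : D f = D (f - fourierInvOp (hg2.toLp g)) := by rw [map_sub, h1, sub_zero]
  have h3 : ‖f - fourierInvOp (hg2.toLp g)‖ ≤ ε / (‖D‖ + 1) := by
    have e1 : f - fourierInvOp (hg2.toLp g) = fourierInvOp (fourierOp f - hg2.toLp g) := by
      rw [map_sub, ← mul_apply_eq_comp fourierInvOp, fourierInvOp_mul, one_apply_eq_self]
    have e2 : fourierOp f - hg2.toLp g = ((Lp.memLp (fourierOp f)).sub hg2).toLp _ := by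
      rw [MemLp.toLp_sub (Lp.memLp _) hg2, Lp.toLp_coeFn]
    rw [e1]
    refine (fourierInvOp.le_of_opNorm_le norm_fourierInvOp_le _).trans ?_
    rw [one_mul, e2, Lp.norm_toLp]
    exact ENNReal.toReal_le_of_le_ofReal (by positivity) hge
  rw [dist_eq_norm, h2]
  change ‖D _ - 0‖ ≤ ε
  rw [sub_zero]
  calc ‖D (f - fourierInvOp (hg2.toLp g))‖ ≤ ‖D‖ * (ε / (‖D‖ + 1)) :=
        (D.le_opNorm _).trans (by gcongr)
    _ ≤ (‖D‖ + 1) * (ε / (‖D‖ + 1)) := by gcongr; linarith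
    _ = ε := by field_simp

end Modulation

/-! ### Truncated half-line projections as multipliers in logarithmic variables -/

section HalfLine

theorem memLp_top_indicator {S : Set ℝ} (hS : MeasurableSet S) :
    MemLp (S.indicator fun _ => (1 : ℂ)) ⊤ (volume : Measure ℝ) := memLp_top_chi hS

/-- The truncation `χ₊ P_S χ₊` of the spectral projection `P_S` to the half line. -/
def halfTrunc (S : Set ℝ) : L2R →L[ℂ] L2R :=
  chiOp (Ioi 0) * fmul (S.indicator fun _ => (1 : ℂ)) * chiOp (Ioi 0)

theorem whSymbol_pos (s : ℝ) : 0 < whSymbol s := by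
  unfold whSymbol
  positivity

theorem whSymbol_neg (s : ℝ) : whSymbol (-s) = 1 - whSymbol s := by
  have h1 := Real.exp_pos (-(4 * Real.pi ^ 2 * s))
  have e : Real.exp (-(4 * Real.pi ^ 2 * -s)) = (Real.exp (-(4 * Real.pi ^ 2 * s)))⁻¹ := by
    rw [← Real.exp_neg]
    congr 1
    ring
  unfold whSymbol
  rw [e]
  field_simp
  ring

theorem whSymbol_lt_one (s : ℝ) : whSymbol s < 1 := by
  have := whSymbol_pos (-s)
  rw [whSymbol_neg] at this
  linarith

theorem continuous_whSymbol : Continuous whSymbol := by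
  unfold whSymbol
  exact Continuous.inv₀ (by fun_prop) fun s => by positivity

/-- Almost everywhere the indicators of the two half lines add up to 1, and correspondingly the
logistic symbols at s and -s add up to 1. -/
theorem logCoisom_fmul_Iio_logIsom :
    logCoisom * fmul ((Iio (0 : ℝ)).indicator fun _ => 1) * logIsom =
      fmul fun s => (whSymbol (-s) : ℂ) := by
  have e : fmul ((Iio (0 : ℝ)).indicator fun _ => (1 : ℂ)) =
      1 - fmul ((Ioi (0 : ℝ)).indicator fun _ => (1 : ℂ)) := by
    rw [← fmul_one, fmul_sub memLp_top_one (memLp_top_indicator measurableSet_Ioi)]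
    refine fmul_congr (memLp_top_indicator measurableSet_Iio) ?_
    have h0 : ∀ᵐ x : ℝ, x ≠ 0 := by simp [ae_iff]
    filter_upwards [h0] with x hx
    rcases lt_or_gt_of_ne hx with h | h
    · rw [indicator_of_mem (mem_Iio.2 h), indicator_of_notMem (by simpa using h.le), sub_zero]
    · rw [indicator_of_notMem (by simpa using h.le), indicator_of_mem (mem_Ioi.2 h), sub_self]
  rw [e, mul_sub, sub_mul, mul_one, logCoisom_mul_logIsom, logCoisom_fmul_logIsom, ← fmul_one,
    fmul_sub memLp_top_one memLp_top_whSymbol]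
  congr 1
  ext s
  rw [whSymbol_neg]
  push_cast
  rfl

/-- The half lines with end point `θ`. -/
def IsHalfLine (θ : ℝ) (S : Set ℝ) : Prop := S = Ioi θ ∨ S = Iio θ

theorem IsHalfLine.measurableSet {θ : ℝ} {S : Set ℝ} (h : IsHalfLine θ S) : MeasurableSet S := by
  rcases h with rfl | rfl
  exacts [measurableSet_Ioi, measurableSet_Iio]

theorem indicator_Ioi_sub (θ : ℝ) : ((Ioi θ).indicator fun _ => (1 : ℂ)) =
    fun η => (Ioi (0 : ℝ)).indicator (fun _ => (1 : ℂ)) (η - θ) := by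
  ext η
  simp [indicator, sub_pos]

theorem indicator_Iio_sub (θ : ℝ) : ((Iio θ).indicator fun _ => (1 : ℂ)) =
    fun η => (Iio (0 : ℝ)).indicator (fun _ => (1 : ℂ)) (η - θ) := by
  ext η
  simp [indicator, sub_neg]

theorem chi_conj {P : L2R →L[ℂ] L2R} {m : ℝ → ℂ} (h : logCoisom * P * logIsom = fmul m) (θ : ℝ) :
    chiOp (Ioi 0) * (modOp θ * P * modOp (-θ)) * chiOp (Ioi 0) =
      (modOp θ * logIsom) * fmul m * (logCoisom * modOp (-θ)) := by
  have hc : ∀ θ, chiOp (Ioi 0) * modOp θ = modOp θ * chiOp (Ioi 0) := fun θ =>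
    (modOp_comm_mulOp θ (memLp_top_indicator measurableSet_Ioi)).symm
  calc _ = (chiOp (Ioi 0) * modOp θ) * P * (modOp (-θ) * chiOp (Ioi 0)) := by simp only [mul_assoc]
    _ = (modOp θ * chiOp (Ioi 0)) * P * (chiOp (Ioi 0) * modOp (-θ)) := by rw [hc, hc]
    _ = modOp θ * logIsom * (logCoisom * P * logIsom) * (logCoisom * modOp (-θ)) := by
        rw [← logIsom_mul_logCoisom]
        simp only [mul_assoc]
    _ = _ := by rw [h]

/-- The truncation of a half-line projection is a Fourier multiplier in logarithmic variables. -/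
theorem IsHalfLine.halfTrunc_eq {θ : ℝ} {S : Set ℝ} (h : IsHalfLine θ S) :
    ∃ ε : ℝ, (ε = 1 ∨ ε = -1) ∧ halfTrunc S =
      (modOp θ * logIsom) * fmul (fun s => (whSymbol (ε * s) : ℂ)) *
        (logCoisom * modOp (-θ)) := by
  rcases h with rfl | rfl
  · refine ⟨1, Or.inl rfl, ?_⟩
    simp only [one_mul]
    rw [halfTrunc, indicator_Ioi_sub, fmul_comp_sub (memLp_top_indicator measurableSet_Ioi),
      chi_conj logCoisom_fmul_logIsom]
  · refine ⟨-1, Or.inr rfl, ?_⟩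
    simp only [neg_one_mul]
    rw [halfTrunc, indicator_Iio_sub, fmul_comp_sub (memLp_top_indicator measurableSet_Iio),
      chi_conj logCoisom_fmul_Iio_logIsom]

/-- Only W U = 1 is available, since U W is a projection; for this reason the zeroth power is
excluded. -/
theorem conj_pow_sub {U W M : L2R →L[ℂ] L2R} (h : W * U = 1) {p : ℕ} (hp : 1 ≤ p) :
    (U * M * W) ^ p = U * M ^ p * W := by
  induction p, hp using Nat.le_induction with
  | base => rw [pow_one, pow_one]
  | succ n _ ih =>
    rw [pow_succ, ih, pow_succ]
    calc U * M ^ n * W * (U * M * W) = U * M ^ n * (W * U) * M * W := by simp only [mul_assoc]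
      _ = _ := by rw [h, mul_one]; simp only [mul_assoc]

theorem fmul_pow {m : ℝ → ℂ} (hm : MemLp m ⊤ volume) (p : ℕ) :
    MemLp (fun s => m s ^ p) ⊤ volume ∧ fmul m ^ p = fmul fun s => m s ^ p := by
  induction p with
  | zero => simpa using ⟨memLp_top_one, fmul_one.symm⟩
  | succ n ih =>
    simp only [pow_succ]
    exact ⟨memLp_mul_top ih.1 hm, by rw [ih.2, fmul_mul ih.1 hm]⟩

/-- The symbol `c^p - c` of `T^p - T` in logarithmic variables. -/
def powSymbol (p : ℕ) (ε s : ℝ) : ℝ := whSymbol (ε * s) ^ p - whSymbol (ε * s)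

theorem memLp_top_whSymbol_mul (ε : ℝ) : MemLp (fun s => (whSymbol (ε * s) : ℂ)) ⊤ volume := by
  refine memLp_top_of_bound (Complex.continuous_ofReal.comp
    (continuous_whSymbol.comp (by fun_prop))).aestronglyMeasurable 1
    (Filter.Eventually.of_forall fun s => ?_)
  rw [Complex.norm_real, Real.norm_of_nonneg (whSymbol_pos _).le]
  exact (whSymbol_lt_one _).le

theorem IsHalfLine.halfTrunc_pow_sub {θ : ℝ} {S : Set ℝ} (h : IsHalfLine θ S) {p : ℕ}
    (hp : 1 ≤ p) :
    ∃ ε : ℝ, (ε = 1 ∨ ε = -1) ∧ halfTrunc S ^ p - halfTrunc S =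
      (modOp θ * logIsom) * fmul (fun s => (powSymbol p ε s : ℂ)) *
        (logCoisom * modOp (-θ)) := by
  obtain ⟨ε, hε, he⟩ := h.halfTrunc_eq
  refine ⟨ε, hε, ?_⟩
  have hWU : (logCoisom * modOp (-θ)) * (modOp θ * logIsom) = 1 := by
    calc _ = logCoisom * (modOp (-θ) * modOp θ) * logIsom := by simp only [mul_assoc]
      _ = 1 := by rw [modOp_neg_mul, mul_one, logCoisom_mul_logIsom]
  have hm := memLp_top_whSymbol_mul ε
  rw [he, conj_pow_sub hWU hp, (fmul_pow hm p).2, ← sub_mul, ← mul_sub,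
    fmul_sub (fmul_pow hm p).1 hm]
  congr 3
  ext s
  rw [powSymbol]
  push_cast
  rfl

end HalfLine

/-! ### The model symbol: decay, Lipschitz bound, and its integral -/

section ModelSymbol

theorem norm_ph_sub_le (a b : ℝ) : ‖ph a - ph b‖ ≤ 2 * Real.pi * |a - b| := by
  have h : ph a - ph b = ph b * (ph (a - b) - 1) := by
    rw [mul_sub, ← ph_add, mul_one, add_sub_cancel]
  rw [h, norm_mul, norm_ph, one_mul, ph, mul_comm]
  refine (Real.norm_exp_I_mul_ofReal_sub_one_le (x := 2 * Real.pi * (a - b))).trans ?_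
  rw [Real.norm_eq_abs, abs_mul, abs_of_pos Real.two_pi_pos]

theorem norm_fourierInv_sub_le {m : ℝ → ℂ} (hi : Integrable m)
    (hi' : Integrable fun η => |η| * ‖m η‖) (u v : ℝ) :
    ‖𝓕⁻ m u - 𝓕⁻ m v‖ ≤ 2 * Real.pi * (∫ η, |η| * ‖m η‖) * |u - v| := by
  have hint : ∀ u, Integrable fun η => ph (u * η) * m η := fun u =>
    hi.bdd_mul (c := 1) (continuous_ph.comp (by fun_prop)).aestronglyMeasurable
      (Filter.Eventually.of_forall fun _ => (norm_ph _).le)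
  rw [fourierInv_eq_ph, fourierInv_eq_ph, ← integral_sub (hint u) (hint v)]
  calc ‖∫ η, (ph (u * η) * m η - ph (v * η) * m η)‖
      ≤ ∫ η, (2 * Real.pi * |u - v|) * (|η| * ‖m η‖) := by
        refine norm_integral_le_of_norm_le (hi'.const_mul _)
          (Filter.Eventually.of_forall fun η => ?_)
        rw [← sub_mul, norm_mul, ← mul_assoc]
        refine mul_le_mul_of_nonneg_right ((norm_ph_sub_le _ _).trans (le_of_eq ?_))
          (norm_nonneg _)
        rw [← sub_mul, abs_mul]
        ring
    _ = _ := by rw [integral_const_mul]; ring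

theorem whSymbol_le_exp (s : ℝ) : whSymbol s ≤ Real.exp (4 * Real.pi ^ 2 * s) := by
  have h := Real.exp_pos (-(4 * Real.pi ^ 2 * s))
  have e : Real.exp (4 * Real.pi ^ 2 * s) = (Real.exp (-(4 * Real.pi ^ 2 * s)))⁻¹ := by
    rw [← Real.exp_neg, neg_neg]
  rw [whSymbol, e]
  exact inv_anti₀ h (by linarith)

theorem whSymbol_mul_le (s : ℝ) :
    whSymbol s * (1 - whSymbol s) ≤ Real.exp (-(4 * Real.pi ^ 2 * |s|)) := by
  have h1 := whSymbol_pos s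
  have h2 := whSymbol_lt_one s
  rcases le_total 0 s with h | h
  · have h3 := whSymbol_le_exp (-s)
    rw [whSymbol_neg, mul_neg] at h3
    rw [abs_of_nonneg h]
    nlinarith
  · have h3 := whSymbol_le_exp s
    rw [abs_of_nonpos h, mul_neg, neg_neg]
    nlinarith

/-- Bernoulli's inequality gives t - t^p ≤ (p - 1) t(1 - t), and t(1 - t) decays exponentially at
both ends. The vanishing of g at 0 and 1 enters here. -/
theorem abs_powSymbol_le {p : ℕ} (hp : 1 ≤ p) {ε : ℝ} (hε : ε = 1 ∨ ε = -1) (s : ℝ) :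
    |powSymbol p ε s| ≤ p * Real.exp (-(4 * Real.pi ^ 2 * |s|)) := by
  have habs : |ε * s| = |s| := by rcases hε with rfl | rfl <;> simp
  have h0 := whSymbol_mul_le (ε * s)
  rw [habs] at h0
  have h1 := whSymbol_pos (ε * s)
  have h2 := whSymbol_lt_one (ε * s)
  unfold powSymbol
  generalize whSymbol (ε * s) = t at h0 h1 h2
  obtain ⟨n, rfl⟩ : ∃ n, p = n + 1 := ⟨p - 1, by omega⟩
  have h3 := one_add_mul_sub_le_pow (a := t) (by linarith) n
  have h4 : t ^ n ≤ 1 := pow_le_one₀ h1.le h2.le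
  have h5 : t ^ (n + 1) - t = -(t * (1 - t ^ n)) := by ring
  rw [h5, abs_neg, abs_of_nonneg (mul_nonneg h1.le (by linarith))]
  have h6 : t * (1 - t ^ n) ≤ n * (t * (1 - t)) := by nlinarith
  refine h6.trans ?_
  push_cast
  have h7 : 0 ≤ t * (1 - t) := mul_nonneg h1.le (by linarith)
  have h8 : (0 : ℝ) ≤ n := Nat.cast_nonneg n
  nlinarith

theorem exp_neg_mul_le_bracket (s : ℝ) :
    Real.exp (-(4 * Real.pi ^ 2 * |s|)) * (1 + |s|) ≤ 2 * bracket 1 1 s := by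
  have hpi : 2 ≤ 4 * Real.pi ^ 2 := by nlinarith [Real.pi_gt_three]
  have h0 := abs_nonneg s
  have h1 := Real.quadratic_le_exp_of_nonneg h0
  have h2 : Real.exp (-(4 * Real.pi ^ 2 * |s|)) ≤ (Real.exp |s|)⁻¹ * (Real.exp |s|)⁻¹ := by
    rw [← Real.exp_neg, ← Real.exp_add]
    exact Real.exp_le_exp.2 (by nlinarith)
  have h3 := Real.exp_pos |s|
  have h4 : 1 + |s| ≤ Real.exp |s| := by nlinarith [sq_nonneg |s|]
  calc Real.exp (-(4 * Real.pi ^ 2 * |s|)) * (1 + |s|)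
      ≤ ((Real.exp |s|)⁻¹ * (Real.exp |s|)⁻¹) * Real.exp |s| := by gcongr
    _ = (Real.exp |s|)⁻¹ := by field_simp
    _ ≤ ((1 + (1 * s) ^ 2) / 2)⁻¹ := by
        refine inv_anti₀ (by positivity) ?_
        have : (1 * s) ^ 2 = |s| ^ 2 := by rw [one_mul, sq_abs]
        rw [this]
        nlinarith
    _ = _ := by rw [bracket_one, inv_div]; ring

theorem powSymbol_mul_le {p : ℕ} (hp : 1 ≤ p) {ε : ℝ} (hε : ε = 1 ∨ ε = -1) (s : ℝ) :
    ‖(powSymbol p ε s : ℂ)‖ * (1 + |s|) ≤ 2 * p * bracket 1 1 s := by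
  rw [Complex.norm_real, Real.norm_eq_abs]
  calc |powSymbol p ε s| * (1 + |s|)
      ≤ p * Real.exp (-(4 * Real.pi ^ 2 * |s|)) * (1 + |s|) := by
        gcongr
        exact abs_powSymbol_le hp hε s
    _ = p * (Real.exp (-(4 * Real.pi ^ 2 * |s|)) * (1 + |s|)) := by ring
    _ ≤ p * (2 * bracket 1 1 s) :=
        mul_le_mul_of_nonneg_left (exp_neg_mul_le_bracket s) (Nat.cast_nonneg p)
    _ = _ := by ring

theorem continuous_powSymbol (p : ℕ) (ε : ℝ) : Continuous fun s => (powSymbol p ε s : ℂ) := by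
  have := continuous_whSymbol
  unfold powSymbol
  fun_prop

theorem norm_powSymbol_le {p : ℕ} (hp : 1 ≤ p) {ε : ℝ} (hε : ε = 1 ∨ ε = -1) (s : ℝ) :
    ‖(powSymbol p ε s : ℂ)‖ ≤ 2 * p * bracket 1 1 s :=
  (le_mul_of_one_le_right (norm_nonneg _) (by linarith [abs_nonneg s])).trans
    (powSymbol_mul_le hp hε s)

theorem isMult_powSymbol {p : ℕ} (hp : 1 ≤ p) {ε : ℝ} (hε : ε = 1 ∨ ε = -1) :
    IsMult fun s => (powSymbol p ε s : ℂ) := by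
  have hb := integrable_bracket (β := 1) (w := 1) (by norm_num) one_pos
  have hm := (continuous_powSymbol p ε).aestronglyMeasurable (μ := volume)
  have hbd : ∀ s, ‖(powSymbol p ε s : ℂ)‖ ≤ 2 * p := fun s => by
    refine (norm_powSymbol_le hp hε s).trans ?_
    exact mul_le_of_le_one_right (by positivity) (bracket_le_one zero_le_one 1 s)
  have h1 : Integrable fun s => (powSymbol p ε s : ℂ) :=
    (hb.const_mul (2 * p)).mono' hm (Filter.Eventually.of_forall (norm_powSymbol_le hp hε))
  refine ⟨memLp_top_of_bound hm _ (Filter.Eventually.of_forall hbd), ?_, h1⟩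
  rw [memLp_two_iff_integrable_sq_norm hm]
  refine (h1.norm.const_mul (2 * p : ℝ)).mono' (hm.norm.pow 2)
    (Filter.Eventually.of_forall fun s => ?_)
  rw [Real.norm_of_nonneg (by positivity), sq]
  exact mul_le_mul_of_nonneg_right (hbd s) (norm_nonneg _)

/-- A bounded Lipschitz function with constant `M`. -/
structure IsLipBdd (k : ℝ → ℂ) (M : ℝ) : Prop where
  bound : ∀ u, ‖k u‖ ≤ M
  lip : ∀ u v, ‖k u - k v‖ ≤ M * |u - v|
  nonneg : 0 ≤ M

theorem isLipBdd_powSymbol {p : ℕ} (hp : 1 ≤ p) {ε : ℝ} (hε : ε = 1 ∨ ε = -1) :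
    IsLipBdd (𝓕⁻ fun s => (powSymbol p ε s : ℂ)) (4 * Real.pi * p * bracketInt 1) := by
  have hb := (integrable_bracket (β := 1) (w := 1) (by norm_num) one_pos).const_mul (2 * p : ℝ)
  have hI : ∫ s, 2 * p * bracket 1 1 s = 2 * p * bracketInt 1 := by
    rw [integral_const_mul, bracketInt]
  have hm := isMult_powSymbol hp hε
  have hB := bracketInt_nonneg 1
  have hpi := Real.pi_gt_three
  have hle : ∀ s, |s| * ‖(powSymbol p ε s : ℂ)‖ ≤ 2 * p * bracket 1 1 s := fun s => by
    refine le_trans ?_ (powSymbol_mul_le hp hε s)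
    nlinarith [norm_nonneg (powSymbol p ε s : ℂ)]
  have hi : Integrable fun s => |s| * ‖(powSymbol p ε s : ℂ)‖ :=
    hb.mono' (continuous_abs.mul (continuous_powSymbol p ε).norm).aestronglyMeasurable
      (Filter.Eventually.of_forall fun s => by
        rw [Real.norm_of_nonneg (by positivity)]
        exact hle s)
  have h2 : ∫ s, |s| * ‖(powSymbol p ε s : ℂ)‖ ≤ 2 * p * bracketInt 1 :=
    hI ▸ integral_mono hi hb hle
  have h3 : 0 ≤ p * bracketInt 1 := by positivity
  refine ⟨fun u => ?_, fun u v => ?_, by positivity⟩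
  · have h1 : ∫ s, ‖(powSymbol p ε s : ℂ)‖ ≤ 2 * p * bracketInt 1 :=
      hI ▸ integral_mono hm.one.norm hb (norm_powSymbol_le hp hε)
    refine (norm_fourierInv_le _ u).trans (h1.trans ?_)
    nlinarith
  · refine (norm_fourierInv_sub_le hm.one hi u v).trans
      (mul_le_mul_of_nonneg_right ?_ (abs_nonneg _))
    calc 2 * Real.pi * ∫ s, |s| * ‖(powSymbol p ε s : ℂ)‖
        ≤ 2 * Real.pi * (2 * p * bracketInt 1) := by gcongr
      _ = _ := by ring

theorem whSymbol_injective : Function.Injective whSymbol := by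
  intro a b h
  unfold whSymbol at h
  have h1 := Real.exp_injective (add_left_cancel (inv_injective h))
  have h2 : 4 * Real.pi ^ 2 * a = 4 * Real.pi ^ 2 * b := neg_injective h1
  exact mul_left_cancel₀ (by positivity) h2

theorem exists_whSymbol_eq {t : ℝ} (ht : t ∈ Ioo (0 : ℝ) 1) : ∃ s, whSymbol s = t := by
  have h1 : 0 < (1 - t) / t := div_pos (by linarith [ht.2]) ht.1
  have ht0 := ht.1.ne'
  refine ⟨-Real.log ((1 - t) / t) / (4 * Real.pi ^ 2), ?_⟩
  rw [whSymbol, show -(4 * Real.pi ^ 2 * (-Real.log ((1 - t) / t) / (4 * Real.pi ^ 2))) =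
    Real.log ((1 - t) / t) by field_simp, Real.exp_log h1]
  field_simp
  ring

theorem hasDerivAt_whSymbol (s : ℝ) :
    HasDerivAt whSymbol (4 * Real.pi ^ 2 * (whSymbol s * (1 - whSymbol s))) s := by
  have h1 : HasDerivAt (fun s => 1 + Real.exp (-(4 * Real.pi ^ 2 * s)))
      (Real.exp (-(4 * Real.pi ^ 2 * s)) * -(4 * Real.pi ^ 2 * 1)) s :=
    (((hasDerivAt_id s).const_mul (4 * Real.pi ^ 2)).fun_neg.exp).const_add 1
  have h0 := Real.exp_pos (-(4 * Real.pi ^ 2 * s))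
  have h2 := h1.fun_inv (by positivity)
  have e : (fun s => (1 + Real.exp (-(4 * Real.pi ^ 2 * s)))⁻¹) = whSymbol := rfl
  rw [e] at h2
  refine h2.congr_deriv ?_
  unfold whSymbol
  field_simp
  ring

/-- Substitution t = `whSymbol (ε * s)`: |dt| = 4π² t(1 - t) ds, which yields both the denominator
t(1 - t) and the prefactor (2π)^{-2}. The orientation ε does not matter, so left and right end
points contribute equally. -/
theorem integral_powSymbol (p : ℕ) {ε : ℝ} (hε : ε = 1 ∨ ε = -1) :
    ∫ s, powSymbol p ε s = coeffA (fun t => t ^ p - t) 1 := by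
  have hpi : (0 : ℝ) < 4 * Real.pi ^ 2 := by positivity
  have hε0 : ε ≠ 0 := by rcases hε with rfl | rfl <;> norm_num
  have hεa : |ε| = 1 := by rcases hε with rfl | rfl <;> simp
  have himg : (fun s => whSymbol (ε * s)) '' univ = Ioo 0 1 := by
    ext t
    constructor
    · rintro ⟨s, -, rfl⟩
      exact ⟨whSymbol_pos _, whSymbol_lt_one _⟩
    · intro ht
      obtain ⟨s, hs⟩ := exists_whSymbol_eq ht
      exact ⟨ε⁻¹ * s, mem_univ _, by simp only; rw [mul_inv_cancel_left₀ hε0, hs]⟩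
  have key := integral_image_eq_integral_abs_deriv_smul (s := univ)
    (f := fun s => whSymbol (ε * s))
    (f' := fun s => 4 * Real.pi ^ 2 * (whSymbol (ε * s) * (1 - whSymbol (ε * s))) * (ε * 1))
    MeasurableSet.univ
    (fun s _ => ((hasDerivAt_whSymbol (ε * s)).comp s
      ((hasDerivAt_id s).const_mul ε)).hasDerivWithinAt)
    (fun a _ b _ h => mul_left_cancel₀ hε0 (whSymbol_injective h))
    (fun t => (t ^ p - t) / (t * (1 - t)))
  rw [himg, Measure.restrict_univ] at key
  have e : ∀ s, |4 * Real.pi ^ 2 * (whSymbol (ε * s) * (1 - whSymbol (ε * s))) * (ε * 1)| •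
      ((whSymbol (ε * s) ^ p - whSymbol (ε * s)) / (whSymbol (ε * s) * (1 - whSymbol (ε * s)))) =
      4 * Real.pi ^ 2 * powSymbol p ε s := fun s => by
    have h1 := whSymbol_pos (ε * s)
    have h2 := whSymbol_lt_one (ε * s)
    have h3 : 0 < whSymbol (ε * s) * (1 - whSymbol (ε * s)) := mul_pos h1 (by linarith)
    rw [mul_one, abs_mul, hεa, mul_one, abs_of_pos (by positivity), powSymbol, smul_eq_mul]
    have h4 : 1 - whSymbol (ε * s) ≠ 0 := (sub_pos.2 h2).ne'
    field_simp
  simp only [e] at key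
  rw [integral_const_mul] at key
  rw [coeffA, intervalIntegral.integral_of_le zero_le_one, integral_Ioc_eq_integral_Ioo]
  have e2 : ∀ t : ℝ, ((1 * t) ^ p - 1 * t - t * (1 ^ p - 1)) / (t * (1 - t)) =
      (t ^ p - t) / (t * (1 - t)) := fun t => by simp
  simp only [e2]
  rw [key]
  field_simp
  ring

theorem fourierInv_powSymbol_zero (p : ℕ) {ε : ℝ} (hε : ε = 1 ∨ ε = -1) :
    𝓕⁻ (fun s => (powSymbol p ε s : ℂ)) 0 = (coeffA (fun t => t ^ p - t) 1 : ℂ) := by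
  rw [fourierInv_eq_ph, ← integral_powSymbol p hε, ← integral_complex_ofReal]
  refine integral_congr_ae (Filter.Eventually.of_forall fun s => ?_)
  simp only
  rw [zero_mul, ph_zero, one_mul]

end ModelSymbol

/-! ### The integral kernel of a multiplier in logarithmic variables -/

section LogKernel

/-- The kernel `(xy)^{-1/2} k(log x - log y)` on the quadrant. -/
def logKer (k : ℝ → ℂ) (x y : ℝ) : ℂ :=
  logPull (fun μ => logPull (fun v => k (μ - v)) y) x

theorem logKer_of_pos (k : ℝ → ℂ) {x y : ℝ} (hx : 0 < x) (hy : 0 < y) :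
    logKer k x y = ((Real.sqrt x)⁻¹ * (Real.sqrt y)⁻¹ : ℝ) * k (Real.log x - Real.log y) := by
  have h : ∀ x : ℝ, 0 < x → Real.exp (-(Real.log x / 2)) = (Real.sqrt x)⁻¹ := fun x hx => by
    rw [Real.exp_neg, Real.exp_half, Real.exp_log hx]
  unfold logKer logPull
  rw [indicator_of_mem (mem_Ioi.2 hx)]
  beta_reduce
  rw [indicator_of_mem (mem_Ioi.2 hy), h x hx, h y hy]
  push_cast
  ring

theorem logKer_of_nonpos_left (k : ℝ → ℂ) {x : ℝ} (hx : x ≤ 0) (y : ℝ) : logKer k x y = 0 := by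
  rw [logKer, logPull, indicator_of_notMem (by simpa using hx)]

theorem logKer_of_nonpos_right (k : ℝ → ℂ) (x : ℝ) {y : ℝ} (hy : y ≤ 0) : logKer k x y = 0 := by
  unfold logKer logPull
  simp only [indicator_of_notMem (show y ∉ Ioi (0 : ℝ) by simpa using hy), mul_zero,
    indicator_zero]

theorem measurable_logKer {k : ℝ → ℂ} (hk : Measurable k) :
    Measurable (Function.uncurry (logKer k)) := by
  have e : Function.uncurry (logKer k) = (Ioi (0 : ℝ) ×ˢ Ioi (0 : ℝ)).indicator fun z : ℝ × ℝ =>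
      (((Real.sqrt z.1)⁻¹ * (Real.sqrt z.2)⁻¹ : ℝ) : ℂ) *
        k (Real.log z.1 - Real.log z.2) := by
    ext ⟨x, y⟩
    by_cases hx : 0 < x
    · by_cases hy : 0 < y
      · rw [indicator_of_mem (show (x, y) ∈ Ioi (0 : ℝ) ×ˢ Ioi (0 : ℝ) from ⟨hx, hy⟩)]
        exact logKer_of_pos k hx hy
      · rw [indicator_of_notMem (fun h => hy h.2)]
        exact logKer_of_nonpos_right k x (not_lt.1 hy)
    · rw [indicator_of_notMem (fun h => hx h.1)]
      exact logKer_of_nonpos_left k (not_lt.1 hx) y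
  rw [e]
  refine Measurable.indicator ?_ (measurableSet_Ioi.prod measurableSet_Ioi)
  fun_prop

theorem isKer_logKer {m : ℝ → ℂ} (hm : IsMult m) :
    IsKer (logIsom * fmul m * logCoisom) (logKer (𝓕⁻ m)) := by
  intro u
  have hk := isKer_fmul hm.top hm.two hm.one (logCoisom u)
  have h1 := logIsom_ae (fmul m (logCoisom u))
  have h2 : ∀ μ, ∫ v, 𝓕⁻ m (μ - v) * (logCoisom u) v =
      ∫ y, logPull (fun v => 𝓕⁻ m (μ - v)) y * u y := fun μ => by
    rw [integral_logPull_mul]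
    refine integral_congr_ae ?_
    filter_upwards [logCoisom_ae u] with v hv
    rw [hv]
  simp only [h2] at hk
  refine h1.trans ((logPull_ae_congr hk).trans (Filter.Eventually.of_forall fun x => ?_))
  unfold logKer
  simp only [logPull, indicator]
  split_ifs with hx
  · rw [← integral_const_mul]
    refine integral_congr_ae (Filter.Eventually.of_forall fun y => ?_)
    simp only
    ring
  · simp

theorem memLp_two_fourierInv {m : ℝ → ℂ} (hm : IsMult m) : MemLp (𝓕⁻ m) 2 volume :=
  (memLp_congr_ae (fourierInv_toLp_ae hm.two hm.one)).1 (Lp.memLp _)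

end LogKernel

/-! ### Comparison of the logarithmic kernel with its diagonal value -/

section ModelKernelBounds

variable {k : ℝ → ℂ} {M : ℝ}

theorem abs_log_sub_log_le {x y : ℝ} (hx : 0 < x) (hxy : |x - y| ≤ x / 2) :
    |Real.log y - Real.log x| ≤ 2 * |x - y| / x := by
  have h2 := abs_le.1 hxy
  have hy : x / 2 ≤ y := by linarith
  have hy0 : 0 < y := by linarith
  have h0 := abs_nonneg (x - y)
  have ub : ∀ {a b : ℝ}, 0 < a → 0 < b → Real.log a - Real.log b ≤ (a - b) / b := by
    intro a b ha hb
    rw [← Real.log_div ha.ne' hb.ne', sub_div, div_self hb.ne']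
    exact Real.log_le_sub_one_of_pos (by positivity)
  rw [abs_le]
  constructor
  · have := ub hx hy0
    have h3 : (x - y) / y ≤ 2 * |x - y| / x := by
      rw [div_le_div_iff₀ hy0 hx]
      nlinarith [le_abs_self (x - y)]
    linarith
  · have := ub hy0 hx
    have h3 : (y - x) / x ≤ 2 * |x - y| / x := by
      gcongr
      linarith [neg_abs_le (x - y)]
    linarith

/-- Two errors of the same order: the Lipschitz bound of k along log y - log x, and the difference
of 1/√(xy) and 1/x. -/
theorem norm_logKer_sub_le_near (hk : IsLipBdd k M) {x y : ℝ} (hx : 0 < x)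
    (hxy : |x - y| ≤ x / 2) : ‖logKer k y x - k 0 / x‖ ≤ 6 * M * (|x - y| / x ^ 2) := by
  have h2 := abs_le.1 hxy
  have hy : x / 2 ≤ y := by linarith
  have hy0 : 0 < y := by linarith
  have hlog := abs_log_sub_log_le hx hxy
  have hM := hk.nonneg
  obtain ⟨a, ha⟩ : ∃ a, a = Real.sqrt x := ⟨_, rfl⟩
  obtain ⟨b, hb⟩ : ∃ b, b = Real.sqrt y := ⟨_, rfl⟩
  have ha0 : 0 < a := ha ▸ Real.sqrt_pos.2 hx
  have hb0 : 0 < b := hb ▸ Real.sqrt_pos.2 hy0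
  have hax : x = a ^ 2 := by rw [ha, Real.sq_sqrt hx.le]
  have hby : y = b ^ 2 := by rw [hb, Real.sq_sqrt hy0.le]
  have hba : a / 2 ≤ b := by nlinarith
  have e : logKer k y x - k 0 / x = ((b⁻¹ * a⁻¹ : ℝ) : ℂ) * (k (Real.log y - Real.log x) - k 0) +
      ((b⁻¹ * a⁻¹ - 1 / x : ℝ) : ℂ) * k 0 := by
    rw [logKer_of_pos k hy0 hx, ← ha, ← hb]
    push_cast
    ring
  have h3 : b⁻¹ * a⁻¹ ≤ 2 / x := by
    rw [hax, ← mul_inv, inv_eq_one_div, div_le_div_iff₀ (by positivity) (by positivity)]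
    nlinarith
  have h4 : |b⁻¹ * a⁻¹ - 1 / x| ≤ 2 * (|x - y| / x ^ 2) := by
    have e1 : b⁻¹ * a⁻¹ - 1 / x = (x - y) / (a ^ 2 * b * (a + b)) := by
      rw [hax, hby]
      field_simp
      ring
    rw [e1, abs_div, abs_of_pos (show 0 < a ^ 2 * b * (a + b) by positivity), mul_div_assoc',
      div_le_div_iff₀ (by positivity) (by positivity), hax]
    have : (a ^ 2) ^ 2 ≤ 2 * (a ^ 2 * b * (a + b)) := by
      have : a ^ 2 ≤ 2 * (b * (a + b)) := by nlinarith
      nlinarith [sq_nonneg a]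
    nlinarith [abs_nonneg (a ^ 2 - y)]
  rw [e]
  calc _ ≤ (b⁻¹ * a⁻¹) * (M * |Real.log y - Real.log x|) + |b⁻¹ * a⁻¹ - 1 / x| * M := by
        refine (norm_add_le _ _).trans ?_
        rw [norm_mul, norm_mul, Complex.norm_real, Complex.norm_real, Real.norm_eq_abs,
          Real.norm_eq_abs, abs_of_pos (show 0 < b⁻¹ * a⁻¹ by positivity)]
        have := hk.lip (Real.log y - Real.log x) 0
        rw [sub_zero] at this
        gcongr
        exact hk.bound 0
    _ ≤ (2 / x) * (M * (2 * |x - y| / x)) + 2 * (|x - y| / x ^ 2) * M := by gcongr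
    _ = _ := by
        field_simp
        ring

/-- Far from the diagonal there is no cancellation to exploit; each of the two terms is bounded by
its size. -/
theorem norm_logKer_sub_le_far (hk : IsLipBdd k M) {x y : ℝ} (hx : 0 < x) :
    ‖logKer k y x - k 0 / x‖ ≤
      M * ((Real.sqrt x)⁻¹ * (Ioi (0 : ℝ)).indicator (fun y => (Real.sqrt y)⁻¹) y + 1 / x) := by
  have hM := hk.nonneg
  have h1 : ‖k 0 / x‖ ≤ M * (1 / x) := by
    rw [norm_div, Complex.norm_real, Real.norm_of_nonneg hx.le, div_eq_mul_one_div]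
    gcongr
    exact hk.bound 0
  have h2 : ‖logKer k y x‖ ≤
      M * ((Real.sqrt x)⁻¹ * (Ioi (0 : ℝ)).indicator (fun y => (Real.sqrt y)⁻¹) y) := by
    by_cases hy : 0 < y
    · rw [logKer_of_pos k hy hx, indicator_of_mem (mem_Ioi.2 hy), norm_mul, Complex.norm_real,
        Real.norm_of_nonneg (by positivity), mul_comm M, mul_comm (Real.sqrt y)⁻¹]
      gcongr
      exact hk.bound _
    · rw [logKer_of_nonpos_left k (not_lt.1 hy), indicator_of_notMem (show y ∉ Ioi (0 : ℝ) from hy)]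
      simp
  rw [mul_add]
  exact (norm_sub_le _ _).trans (add_le_add h2 h1)

/-- The weight `x^{-3/2}` on `(1, ∞)`. -/
def modelWeight (x : ℝ) : ℝ := (Ioi (1 : ℝ)).indicator (fun x => x ^ (-(3 / 2) : ℝ)) x

/-- The weight `y^{-1/2}` on `(0, 1]` and `y^{-3/2}` on `(1, ∞)`. -/
def modelWeight' (y : ℝ) : ℝ :=
  (Ioc (0 : ℝ) 1).indicator (fun y => y ^ (-(1 / 2) : ℝ)) y + modelWeight y

theorem integrable_modelWeight : Integrable modelWeight :=
  (integrable_indicator_iff measurableSet_Ioi).2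
    (integrableOn_Ioi_rpow_of_lt (by norm_num) one_pos)

theorem integrable_modelWeight' : Integrable modelWeight' := by
  refine Integrable.add ?_ integrable_modelWeight
  refine (integrable_indicator_iff measurableSet_Ioc).2 ?_
  have := intervalIntegral.intervalIntegrable_rpow' (a := 0) (b := 1) (r := -(1 / 2)) (by norm_num)
  rwa [intervalIntegrable_iff_integrableOn_Ioc_of_le zero_le_one] at this

theorem modelWeight_nonneg (x : ℝ) : 0 ≤ modelWeight x :=
  indicator_nonneg (fun _ hx => Real.rpow_nonneg (zero_le_one.trans (le_of_lt hx)) _) x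

theorem modelWeight'_nonneg (x : ℝ) : 0 ≤ modelWeight' x :=
  add_nonneg (indicator_nonneg (fun _ hx => Real.rpow_nonneg hx.1.le _) x) (modelWeight_nonneg x)

theorem rpow_neg_three_half {x : ℝ} (hx : 0 < x) :
    x ^ (-(3 / 2) : ℝ) = (x * Real.sqrt x)⁻¹ := by
  rw [Real.rpow_neg hx.le, show (3 / 2 : ℝ) = 1 + 1 / 2 by norm_num, Real.rpow_add hx,
    Real.rpow_one, Real.sqrt_eq_rpow]

theorem rpow_neg_half {x : ℝ} (hx : 0 < x) : x ^ (-(1 / 2) : ℝ) = (Real.sqrt x)⁻¹ := by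
  rw [Real.rpow_neg hx.le, Real.sqrt_eq_rpow]

/-- For w ≥ 1 a factor |t|^{1/2} costs a quarter of the profile exponent; the remaining 3/4 is still
integrable. -/
theorem sqrt_mul_bracket_le {w : ℝ} (hw : 1 ≤ w) (t : ℝ) :
    Real.sqrt |t| * bracket 1 w t ≤ bracket (3 / 4) w t := by
  have h1 : Real.sqrt |t| ≤ bracket (-(1 / 4)) w t := by
    have e : Real.sqrt |t| = (t ^ 2) ^ (1 / 4 : ℝ) := by
      rw [← sq_abs, ← Real.rpow_natCast, ← Real.rpow_mul (abs_nonneg t), Real.sqrt_eq_rpow]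
      norm_num
    rw [e, bracket, neg_neg]
    refine Real.rpow_le_rpow (sq_nonneg t) ?_ (by norm_num)
    nlinarith [sq_nonneg t, mul_le_mul hw hw zero_le_one (by linarith)]
  calc _ ≤ bracket (-(1 / 4)) w t * bracket 1 w t := by
        gcongr
        exact (bracket_pos 1 w t).le
    _ = _ := by rw [bracket_add]; norm_num

theorem mul_bracket_le_inv_sq {w : ℝ} (hw : 1 ≤ w) {t : ℝ} (ht : t ≠ 0) :
    w * bracket 1 w t ≤ (t ^ 2)⁻¹ := by
  have ht2 : 0 < t ^ 2 := by positivity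
  rw [bracket_one, ← div_eq_mul_inv, inv_eq_one_div, div_le_div_iff₀ (by positivity) ht2]
  nlinarith [mul_le_mul_of_nonneg_right hw ht2.le, mul_le_mul hw hw zero_le_one (by linarith)]

/-- The majorant has an integral over x > 1 and all y that does not depend on w or r. This makes the
error in the trace O(1) rather than logarithmic. -/
theorem kernel_difference_le (hk : IsLipBdd k M) {w : ℝ} (hw : 1 ≤ w) {x : ℝ} (hx : 1 < x)
    (y : ℝ) :
    w * bracket 1 w (x - y) * ‖logKer k y x - k 0 / x‖ ≤
      6 * M * (modelWeight x * (w * bracket (3 / 4) w (x - y)) +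
        modelWeight x * modelWeight' y) := by
  have hM := hk.nonneg
  have hx0 : 0 < x := by linarith
  have hw0 : 0 < w := by linarith
  have hF : modelWeight x = (x * Real.sqrt x)⁻¹ := by
    rw [modelWeight, indicator_of_mem (mem_Ioi.2 hx), rpow_neg_three_half hx0]
  have hsx : 0 < Real.sqrt x := Real.sqrt_pos.2 hx0
  have hsx2 : Real.sqrt x ^ 2 = x := Real.sq_sqrt hx0.le
  have hb := bracket_pos 1 w (x - y)
  have hs := sqrt_mul_bracket_le hw (x - y)
  have hst : Real.sqrt |x - y| ^ 2 = |x - y| := Real.sq_sqrt (abs_nonneg _)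
  have hst0 : 0 ≤ Real.sqrt |x - y| := Real.sqrt_nonneg _
  -- Near the diagonal |x - y|/x² ≤ |x - y|^{1/2} x^{-3/2}: half a power of |x - y| is traded for
  -- integrability in x.
  rcases le_or_gt |x - y| (x / 2) with h | h
  · have h1 : |x - y| / x ^ 2 ≤ Real.sqrt |x - y| * (x * Real.sqrt x)⁻¹ := by
      have h2 : Real.sqrt |x - y| ≤ Real.sqrt x := Real.sqrt_le_sqrt (by linarith)
      rw [← div_eq_mul_inv, div_le_div_iff₀ (by positivity) (by positivity)]
      calc |x - y| * (x * Real.sqrt x)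
          = Real.sqrt |x - y| * (Real.sqrt |x - y| * (x * Real.sqrt x)) := by
            rw [← mul_assoc (Real.sqrt _), ← sq, hst]
        _ ≤ Real.sqrt |x - y| * (Real.sqrt x * (x * Real.sqrt x)) := by gcongr
        _ = Real.sqrt |x - y| * x ^ 2 := by
            rw [show Real.sqrt x * (x * Real.sqrt x) = Real.sqrt x ^ 2 * x by ring, hsx2, sq]
    calc _ ≤ w * bracket 1 w (x - y) * (6 * M * (Real.sqrt |x - y| * (x * Real.sqrt x)⁻¹)) := by
          gcongr
          exact (norm_logKer_sub_le_near hk hx0 h).trans (by gcongr)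
      _ = 6 * M * ((x * Real.sqrt x)⁻¹ * (w * (Real.sqrt |x - y| * bracket 1 w (x - y)))) := by
          ring
      _ ≤ 6 * M * ((x * Real.sqrt x)⁻¹ * (w * bracket (3 / 4) w (x - y))) := by gcongr
      _ ≤ _ := by
          rw [hF]
          gcongr
          exact le_add_of_nonneg_right (mul_nonneg (by positivity) (modelWeight'_nonneg y))
  · have ht0 : 0 < |x - y| := by linarith
    have htne : x - y ≠ 0 := abs_pos.1 ht0
    have h1 : 1 / x ≤ 2 * (Real.sqrt |x - y| * (x * Real.sqrt x)⁻¹) := by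
      have h2 : Real.sqrt x ≤ 2 * Real.sqrt |x - y| := by
        refine (abs_le_of_sq_le_sq' ?_ (by positivity)).2
        rw [mul_pow, hst, hsx2]
        linarith
      rw [← div_eq_mul_inv, mul_div_assoc', div_le_div_iff₀ hx0 (by positivity)]
      nlinarith
    have h3 : w * bracket 1 w (x - y) * (1 / x) ≤
        2 * (modelWeight x * (w * bracket (3 / 4) w (x - y))) := by
      calc _ ≤ w * bracket 1 w (x - y) * (2 * (Real.sqrt |x - y| * (x * Real.sqrt x)⁻¹)) := by
            gcongr
        _ = 2 * ((x * Real.sqrt x)⁻¹ * (w * (Real.sqrt |x - y| * bracket 1 w (x - y)))) := by ring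
        _ ≤ _ := by
            rw [hF]
            gcongr
    -- For the term (xy)^{-1/2} the profile is replaced by |x - y|^{-2} with |x - y| > x/2: one
    -- power improves x^{-1/2} to x^{-3/2}, the other tames y^{-1/2} for y > 1 and is bounded for y
    -- ≤ 1.
    have h4 : w * bracket 1 w (x - y) *
        ((Real.sqrt x)⁻¹ * (Ioi (0 : ℝ)).indicator (fun y => (Real.sqrt y)⁻¹) y) ≤
        6 * (modelWeight x * modelWeight' y) := by
      by_cases hy : 0 < y
      · have hsy : 0 < Real.sqrt y := Real.sqrt_pos.2 hy
        have h5 : |x - y|⁻¹ * (Real.sqrt y)⁻¹ ≤ 3 * modelWeight' y := by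
          rcases le_or_gt y 1 with hy1 | hy1
          · have : modelWeight' y = (Real.sqrt y)⁻¹ := by
              rw [modelWeight', modelWeight, indicator_of_mem (show y ∈ Ioc (0 : ℝ) 1 from ⟨hy, hy1⟩),
                indicator_of_notMem (by simpa using hy1), add_zero, rpow_neg_half hy]
            rw [this]
            gcongr
            rw [inv_le_comm₀ ht0 (by norm_num)]
            linarith
          · have : modelWeight' y = (y * Real.sqrt y)⁻¹ := by
              rw [modelWeight', modelWeight, indicator_of_notMem (fun h => by linarith [h.2]),
                indicator_of_mem (mem_Ioi.2 hy1), zero_add, rpow_neg_three_half hy]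
            rw [this, mul_inv, ← mul_assoc]
            gcongr
            rw [← div_eq_mul_inv, inv_eq_one_div, div_le_div_iff₀ ht0 hy]
            linarith [neg_abs_le (x - y)]
        have h6 : ((x - y) ^ 2)⁻¹ ≤ 2 / x * |x - y|⁻¹ := by
          rw [← sq_abs, sq, mul_inv]
          gcongr
          rw [inv_eq_one_div, div_le_div_iff₀ ht0 hx0]
          linarith
        rw [indicator_of_mem (mem_Ioi.2 hy)]
        calc _ ≤ (2 / x * |x - y|⁻¹) * ((Real.sqrt x)⁻¹ * (Real.sqrt y)⁻¹) := by
              exact mul_le_mul_of_nonneg_right ((mul_bracket_le_inv_sq hw htne).trans h6)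
                (by positivity)
          _ = 2 * (x * Real.sqrt x)⁻¹ * (|x - y|⁻¹ * (Real.sqrt y)⁻¹) := by
              field_simp
          _ ≤ 2 * (x * Real.sqrt x)⁻¹ * (3 * modelWeight' y) := by gcongr
          _ = _ := by rw [hF]; ring
      · rw [indicator_of_notMem (show y ∉ Ioi (0 : ℝ) from hy), mul_zero, mul_zero]
        exact mul_nonneg (by norm_num) (mul_nonneg (modelWeight_nonneg x) (modelWeight'_nonneg y))
    calc _ ≤ w * bracket 1 w (x - y) * (M * ((Real.sqrt x)⁻¹ *
            (Ioi (0 : ℝ)).indicator (fun y => (Real.sqrt y)⁻¹) y + 1 / x)) := by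
          gcongr
          exact norm_logKer_sub_le_far hk hx0
      _ = M * (w * bracket 1 w (x - y) * ((Real.sqrt x)⁻¹ *
            (Ioi (0 : ℝ)).indicator (fun y => (Real.sqrt y)⁻¹) y) +
            w * bracket 1 w (x - y) * (1 / x)) := by ring
      _ ≤ M * (6 * (modelWeight x * modelWeight' y) +
            2 * (modelWeight x * (w * bracket (3 / 4) w (x - y)))) := by gcongr
      _ ≤ _ := by
          have := mul_nonneg hM (mul_nonneg (modelWeight_nonneg x)
            (mul_nonneg hw0.le (bracket_pos (3 / 4) w (x - y)).le))
          nlinarith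

end ModelKernelBounds

/-! ### Square integrability of the logarithmic kernel over bounded sets -/

section HilbertSchmidt

theorem isHS_of_integrable {q : ℝ → ℝ → ℂ} (hm : StronglyMeasurable (Function.uncurry q))
    (hi : Integrable (fun z : ℝ × ℝ => ‖q z.1 z.2‖ ^ 2) (volume.prod volume)) :
    IsHS q (Real.sqrt (∫ z : ℝ × ℝ, ‖q z.1 z.2‖ ^ 2 ∂(volume.prod volume))) :=
  ⟨hm, hi, (Real.sq_sqrt (integral_nonneg fun _ => by positivity)).ge, Real.sqrt_nonneg _⟩

/-- For fixed x the logarithmic isometry gives the L² norm of the kernel in y exactly: its square is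
‖k‖²/x, integrable over a bounded set away from 0. The factor `f` only carries the modulation
phases. -/
theorem isHS_logKer {k : ℝ → ℂ} (hk : Measurable k) (hk2 : MemLp k 2 volume) {S : Set ℝ}
    (hS : MeasurableSet S) {R : ℝ} (hSR : S ⊆ Icc 1 R) {f : ℝ → ℝ → ℂ}
    (hf : Measurable (Function.uncurry f)) (hf1 : ∀ x y, ‖f x y‖ = 1) :
    ∃ K, IsHS (fun y x => f y x * logKer k y x * S.indicator (fun _ => (1 : ℂ)) x) K := by
  have hmeas : Measurable (Function.uncurry fun y x =>
      f y x * logKer k y x * S.indicator (fun _ => (1 : ℂ)) x) :=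
    (hf.mul (measurable_logKer hk)).mul ((measurable_const.indicator hS).comp measurable_snd)
  refine ⟨_, isHS_of_integrable hmeas.stronglyMeasurable ?_⟩
  have hn : ∀ y x, ‖f y x * logKer k y x * S.indicator (fun _ => (1 : ℂ)) x‖ ^ 2 =
      S.indicator (fun x => ‖logKer k y x‖ ^ 2) x := fun y x => by
    by_cases hx : x ∈ S
    · rw [indicator_of_mem hx, indicator_of_mem hx, mul_one, norm_mul, hf1, one_mul]
    · rw [indicator_of_notMem hx, indicator_of_notMem hx, mul_zero, norm_zero]
      norm_num
  have hsl : ∀ x ∈ S, ∀ μ, logPull (fun v => k (μ - v)) x =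
      (Real.exp (-(Real.log x / 2)) : ℂ) * k (μ - Real.log x) := fun x hx μ => by
    rw [logPull, indicator_of_mem (mem_Ioi.2 (zero_lt_one.trans_le (hSR hx).1))]
  have hsl2 : ∀ x ∈ S, MemLp (fun μ => logPull (fun v => k (μ - v)) x) 2 volume := fun x hx => by
    simp only [hsl x hx]
    exact (memLp_comp_sub hk2 _).const_mul _
  have hslm : ∀ x ∈ S, Measurable (fun μ => logPull (fun v => k (μ - v)) x) := fun x hx => by
    simp only [hsl x hx]
    fun_prop
  have hint : ∀ x ∈ S, ∫ y, ‖logKer k y x‖ ^ 2 = x⁻¹ * ∫ μ, ‖k μ‖ ^ 2 := fun x hx => by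
    have hx0 : 0 < x := zero_lt_one.trans_le (hSR hx).1
    unfold logKer
    rw [integral_norm_logPull_sq]
    simp only [hsl x hx, norm_mul, mul_pow]
    rw [integral_const_mul, integral_sub_right_eq_self (fun μ => ‖k μ‖ ^ 2), Complex.norm_real,
      Real.norm_of_nonneg (Real.exp_pos _).le, sq, ← Real.exp_add]
    congr 1
    rw [show -(Real.log x / 2) + -(Real.log x / 2) = -Real.log x by ring, Real.exp_neg,
      Real.exp_log hx0]
  have hm2 : AEStronglyMeasurable (fun z : ℝ × ℝ => ‖f z.1 z.2 * logKer k z.1 z.2 *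
      S.indicator (fun _ => (1 : ℂ)) z.2‖ ^ 2) (volume.prod volume) :=
    (hmeas.norm.pow_const 2).aestronglyMeasurable
  rw [integrable_prod_iff' hm2]
  simp only [hn]
  constructor
  · refine Filter.Eventually.of_forall fun x => ?_
    by_cases hx : x ∈ S
    · simp only [indicator_of_mem hx]
      have := memLp_logPull (hslm x hx) (hsl2 x hx)
      exact (memLp_two_iff_integrable_sq_norm this.1).1 this
    · simp only [indicator_of_notMem hx]
      exact integrable_zero _ _ _
  · have e : (fun x => ∫ y, ‖S.indicator (fun x => ‖logKer k y x‖ ^ 2) x‖) =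
        S.indicator fun x => x⁻¹ * ∫ μ, ‖k μ‖ ^ 2 := by
      ext x
      by_cases hx : x ∈ S
      · simp only [indicator_of_mem hx]
        rw [← hint x hx]
        refine integral_congr_ae (Filter.Eventually.of_forall fun y => ?_)
        simp only
        rw [Real.norm_of_nonneg (by positivity)]
      · simp only [indicator_of_notMem hx]
        simp
    rw [e, integrable_indicator_iff hS]
    refine IntegrableOn.mono_set ?_ hSR
    refine ContinuousOn.integrableOn_Icc ?_
    exact ContinuousOn.mul (continuousOn_inv₀.mono fun x hx =>
      (zero_lt_one.trans_le hx.1).ne') continuousOn_const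

end HilbertSchmidt

/-! ### The trace against the model kernel -/

section ModelTrace

theorem IsKer.congr {A : L2R →L[ℂ] L2R} {q q' : ℝ → ℝ → ℂ} (hA : IsKer A q)
    (h : ∀ x y, q x y = q' x y) : IsKer A q' := by
  have e : q = q' := by
    ext x y
    exact h x y
  exact e ▸ hA

/-- The constant in the trace asymptotics for half lines. -/
def modelConst : ℝ := 6 * ((∫ x, modelWeight x) * (bracketInt (3 / 4) + ∫ y, modelWeight' y))

theorem modelConst_nonneg : 0 ≤ modelConst := by
  have h1 := integral_nonneg (μ := volume) (f := modelWeight) modelWeight_nonneg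
  have h2 := integral_nonneg (μ := volume) (f := modelWeight') modelWeight'_nonneg
  have h3 := bracketInt_nonneg (3 / 4)
  unfold modelConst
  positivity

variable {k : ℝ → ℂ} {M K w r θ : ℝ} {q : ℝ → ℝ → ℂ}

theorem integrable_indicator_mul_bracket_sq (R : ℝ) (hw : 0 < w) :
    Integrable (fun z : ℝ × ℝ => (Ioo 1 R).indicator (fun _ => (1 : ℝ)) z.1 *
      ((K * w) ^ 2 * bracket 2 w (z.1 - z.2))) (volume.prod volume) :=
  integrable_mul_comp_sub (f := (Ioo 1 R).indicator fun _ => (1 : ℝ))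
    (g := fun t => (K * w) ^ 2 * bracket 2 w t)
    ((integrable_indicator_iff measurableSet_Ioo).2 (by simp))
    ((integrable_bracket (by norm_num) hw).const_mul _)

theorem exists_isHS_of_decay (hm : StronglyMeasurable (Function.uncurry q)) (hw : 0 < w) {R : ℝ}
    (hq : ∀ x y, ‖q x y‖ ≤ (Ioo 1 R).indicator (fun _ => K * w * bracket 1 w (x - y)) x) :
    ∃ K', IsHS q K' := by
  refine ⟨_, isHS_of_integrable hm ?_⟩
  refine (integrable_indicator_mul_bracket_sq (K := K) R hw).mono'
    (hm.norm.pow 2).aestronglyMeasurable (Filter.Eventually.of_forall fun z => ?_)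
  rw [Real.norm_of_nonneg (by positivity)]
  have := hq z.1 z.2
  by_cases hx : z.1 ∈ Ioo 1 R
  · rw [indicator_of_mem hx] at this
    rw [indicator_of_mem hx, one_mul]
    calc ‖q z.1 z.2‖ ^ 2 ≤ (K * w * bracket 1 w (z.1 - z.2)) ^ 2 := by gcongr
      _ = _ := by rw [mul_pow, bracket_sq, mul_one]
  · rw [indicator_of_notMem hx] at this
    rw [indicator_of_notMem hx, zero_mul, le_antisymm this (norm_nonneg _)]
    norm_num

/-- The difference between the trace density of `A G` and its value on the diagonal. -/
theorem integrable_trace_difference (hm : StronglyMeasurable (Function.uncurry q))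
    (hk : IsLipBdd k M) (hkm : Measurable k) (hw : 1 ≤ w) (hK : 0 ≤ K) {R : ℝ}
    (hq : ∀ x y, ‖q x y‖ ≤ (Ioo 1 R).indicator (fun _ => K * w * bracket 1 w (x - y)) x) :
    Integrable (fun z : ℝ × ℝ => q z.1 z.2 * ph (-(θ * (z.1 - z.2))) *
      (logKer k z.2 z.1 - k 0 / z.1)) (volume.prod volume) ∧
    ∫ z : ℝ × ℝ, ‖q z.1 z.2 * ph (-(θ * (z.1 - z.2))) * (logKer k z.2 z.1 - k 0 / z.1)‖
      ∂(volume.prod volume) ≤ modelConst * M * K := by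
  have hw0 : 0 < w := by linarith
  have hM := hk.nonneg
  have hg : Integrable fun t => w * bracket (3 / 4) w t :=
    (integrable_bracket (by norm_num) hw0).const_mul w
  have i1 := integrable_mul_comp_sub integrable_modelWeight hg
  have i2 := integrable_modelWeight.mul_prod integrable_modelWeight'
  have hi : Integrable (fun z : ℝ × ℝ => 6 * M * K * (modelWeight z.1 *
      (w * bracket (3 / 4) w (z.1 - z.2)) + modelWeight z.1 * modelWeight' z.2))
      (volume.prod volume) := (i1.add i2).const_mul _
  have hmeas : AEStronglyMeasurable (fun z : ℝ × ℝ => q z.1 z.2 * ph (-(θ * (z.1 - z.2))) *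
      (logKer k z.2 z.1 - k 0 / z.1)) (volume.prod volume) := by
    have h1 : Measurable fun z : ℝ × ℝ => logKer k z.2 z.1 :=
      (measurable_logKer hkm).comp measurable_swap
    have h2 : Measurable fun z : ℝ × ℝ => ph (-(θ * (z.1 - z.2))) :=
      continuous_ph.measurable.comp (by fun_prop)
    have h3 : Measurable fun z : ℝ × ℝ => q z.1 z.2 := hm.measurable
    exact ((h3.mul h2).mul (h1.sub (by fun_prop))).aestronglyMeasurable
  have hle : ∀ z : ℝ × ℝ, ‖q z.1 z.2 * ph (-(θ * (z.1 - z.2))) *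
      (logKer k z.2 z.1 - k 0 / z.1)‖ ≤ 6 * M * K * (modelWeight z.1 *
      (w * bracket (3 / 4) w (z.1 - z.2)) + modelWeight z.1 * modelWeight' z.2) := fun z => by
    have h0 := hq z.1 z.2
    rw [norm_mul, norm_mul, norm_ph, mul_one]
    by_cases hx : z.1 ∈ Ioo 1 R
    · rw [indicator_of_mem hx] at h0
      calc _ ≤ K * w * bracket 1 w (z.1 - z.2) * ‖logKer k z.2 z.1 - k 0 / z.1‖ := by gcongr
        _ = K * (w * bracket 1 w (z.1 - z.2) * ‖logKer k z.2 z.1 - k 0 / z.1‖) := by ring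
        _ ≤ K * (6 * M * (modelWeight z.1 * (w * bracket (3 / 4) w (z.1 - z.2)) +
              modelWeight z.1 * modelWeight' z.2)) := by
            exact mul_le_mul_of_nonneg_left (kernel_difference_le hk hw hx.1 z.2) hK
        _ = _ := by ring
    · rw [indicator_of_notMem hx] at h0
      rw [le_antisymm h0 (norm_nonneg _), zero_mul]
      have := modelWeight_nonneg z.1
      have := modelWeight'_nonneg z.2
      have := (bracket_pos (3 / 4) w (z.1 - z.2)).le
      positivity
  have hI := hi.mono' hmeas (Filter.Eventually.of_forall hle)
  refine ⟨hI, (integral_mono hI.norm hi hle).trans (le_of_eq ?_)⟩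
  rw [integral_const_mul, integral_add i1 i2, integral_mul_comp_sub modelWeight
    (fun t => w * bracket (3 / 4) w t), integral_prod_mul, integral_const_mul,
    integral_bracket hw0, modelConst]
  field_simp

/-- Trace asymptotics for an operator with decaying kernel against a function of the truncated
half-line projection. -/
theorem norm_opTrace_model_sub_le {A G : L2R →L[ℂ] L2R} {σ : ℝ → ℝ → ℂ} {K₀ : ℝ}
    (hA : IsKer A fun x y => 𝓕⁻ (σ x) (x - y))
    (hm : StronglyMeasurable (Function.uncurry fun x y => 𝓕⁻ (σ x) (x - y)))
    (hw : 1 ≤ w) (hK : 0 ≤ K)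
    (hd : ∀ x y, ‖𝓕⁻ (σ x) (x - y)‖ ≤
      (Ioo 1 (4 * r)).indicator (fun _ => K * w * bracket 1 w (x - y)) x)
    (hc : ∀ x, Continuous (σ x)) (hi : ∀ x, Integrable (σ x)) (hT : TraceBound A K₀)
    (hG : IsKer G fun y x => ph (θ * y) * logKer k y x * ph (-θ * x))
    (hk : IsLipBdd k M) (hkm : Measurable k) (hk2 : MemLp k 2 volume) :
    ‖opTrace (A * G) - k 0 * ∫ x, σ x θ / x‖ ≤ modelConst * M * K := by
  have hw0 : 0 < w := by linarith
  obtain ⟨q, hqdef⟩ : ∃ q : ℝ → ℝ → ℂ, q = fun x y => 𝓕⁻ (σ x) (x - y) := ⟨_, rfl⟩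
  have hqe : ∀ x y, 𝓕⁻ (σ x) (x - y) = q x y := fun x y => by rw [hqdef]
  rw [← hqdef] at hA hm
  simp only [hqe] at hd
  obtain ⟨S, hS⟩ : ∃ S, S = Ioo 1 (4 * r) := ⟨_, rfl⟩
  rw [← hS] at hd
  have hSm : MeasurableSet S := hS ▸ measurableSet_Ioo
  have hq0 : ∀ x, x ∉ S → ∀ y, q x y = 0 := fun x hx y => by
    have := hd x y
    rw [indicator_of_notMem hx] at this
    exact norm_le_zero_iff.1 this
  have hχA : chiOp S * A = A := by
    refine IsKer.unique (hA.mulOp_mul (memLp_top_indicator hSm)) (hA.congr fun x y => ?_)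
    by_cases hx : x ∈ S
    · rw [indicator_of_mem hx, one_mul]
    · rw [hq0 x hx, mul_zero]
  -- A = χ_S A because the symbol lives in x ∈ S; by cyclicity χ_S moves to the right of G and makes
  -- the second factor Hilbert-Schmidt.
  have htr : opTrace (A * G) = opTrace (A * (G * chiOp S)) := by
    have h := opTrace_comm (hT.mul_right G) (chiOp S)
    rw [← mul_assoc, hχA, mul_assoc] at h
    exact h
  obtain ⟨K₁, h1⟩ := exists_isHS_of_decay hm hw0 (hS ▸ hd)
  have hff : Measurable (Function.uncurry fun y x => ph (θ * y) * ph (-θ * x)) :=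
    (continuous_ph.comp (by fun_prop) |>.mul (continuous_ph.comp (by fun_prop)) :
      Continuous fun z : ℝ × ℝ => ph (θ * z.1) * ph (-θ * z.2)).measurable
  obtain ⟨K₂, h2⟩ := isHS_logKer hkm hk2 hSm (hS ▸ Ioo_subset_Icc_self) hff
    (fun x y => by rw [norm_mul, norm_ph, norm_ph, one_mul])
  have hGS : IsKer (G * chiOp S) fun y x => ph (θ * y) * ph (-θ * x) * logKer k y x *
      S.indicator (fun _ => (1 : ℂ)) x :=
    (hG.mul_mulOp (memLp_top_indicator hSm)).congr fun y x => by ring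
  have hform := (h1.traceBound_mul h2 hA hGS).2
  obtain ⟨hZ, hZle⟩ := integrable_trace_difference (θ := θ) hm hk hkm hw hK (hS ▸ hd)
  have hdi : ∀ x, Integrable fun t => 𝓕⁻ (σ x) t := fun x => by
    have h4 := ((integrable_bracket (β := 1) (by norm_num) hw0).const_mul (K * w))
    refine h4.mono' (continuous_fourierInv (hi x)).aestronglyMeasurable
      (Filter.Eventually.of_forall fun t => ?_)
    have h3 := hd x (x - t)
    rw [← hqe, sub_sub_cancel] at h3
    refine h3.trans ?_
    by_cases hx : x ∈ S
    · rw [indicator_of_mem hx]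
    · rw [indicator_of_notMem hx]
      have := (bracket_pos 1 w t).le
      positivity
  -- Fourier inversion: the modulated row integral of the kernel is the symbol at frequency θ. It
  -- produces the main term once the logarithmic kernel has been replaced by k(0)/x.
  have hinv : ∀ x, ∫ y, q x y * ph (-(θ * (x - y))) = σ x θ := fun x => by
    simp only [← hqe]
    rw [integral_sub_left_eq_self (fun t => 𝓕⁻ (σ x) t * ph (-(θ * t))) volume x]
    have h4 : 𝓕 (𝓕⁻ (σ x)) θ = σ x θ := by
      rw [Continuous.fourier_fourierInv_eq (hc x) (hi x)]
      refine (hdi x).comp_neg.congr (Filter.Eventually.of_forall fun t => ?_)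
      beta_reduce
      rw [fourierInv_eq_ph, fourier_eq_ph]
      simp only [neg_mul]
    rw [← h4, fourier_eq_ph]
    simp only [mul_comm]
  have hqi : ∀ x, Integrable fun y => q x y * ph (-(θ * (x - y))) := fun x => by
    simp only [← hqe]
    refine Integrable.comp_sub_left (f := fun t => 𝓕⁻ (σ x) t * ph (-(θ * t))) ?_ x
    exact (hdi x).mul_bdd (c := 1) (continuous_ph.comp (by fun_prop)).aestronglyMeasurable
      (Filter.Eventually.of_forall fun _ => (norm_ph _).le)
  have hσb : ∀ x, ‖σ x θ‖ ≤ S.indicator (fun _ => K * bracketInt 1) x := fun x => by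
    rw [← hinv x]
    by_cases hx : x ∈ S
    · have h4 := (((integrable_bracket (β := 1) (by norm_num) hw0).const_mul (K * w)).comp_sub_left x)
      rw [indicator_of_mem hx]
      refine (norm_integral_le_of_norm_le h4 (Filter.Eventually.of_forall fun y => ?_)).trans
        (le_of_eq ?_)
      · rw [norm_mul, norm_ph, mul_one]
        have := hd x y
        rwa [indicator_of_mem hx] at this
      · rw [integral_sub_left_eq_self (fun t => K * w * bracket 1 w t) volume x,
          integral_const_mul, integral_bracket hw0]
        field_simp
    · simp only [hq0 x hx, zero_mul, integral_zero, norm_zero, indicator_of_notMem hx, le_refl]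
  have hσm : AEStronglyMeasurable (fun x => σ x θ / x) volume := by
    -- Measurability of the symbol in x is read off from the same formula.
    have h5 : StronglyMeasurable fun x => ∫ y, q x y * ph (-(θ * (x - y))) := by
      refine StronglyMeasurable.integral_prod_right (ν := volume)
        (f := fun x y => q x y * ph (-(θ * (x - y)))) ?_
      have h7 : Continuous fun z : ℝ × ℝ => ph (-(θ * (z.1 - z.2))) :=
        continuous_ph.comp (by fun_prop)
      exact StronglyMeasurable.mul (f := fun z : ℝ × ℝ => q z.1 z.2) hm h7.stronglyMeasurable
    simp only [hinv] at h5
    exact (h5.measurable.div Complex.measurable_ofReal).aestronglyMeasurable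
  have hσi : Integrable fun x => σ x θ / x := by
    have h6 : Integrable (S.indicator fun _ => K * bracketInt 1) :=
      (integrable_indicator_iff hSm).2 (integrableOn_const (by rw [hS]; simp))
    refine h6.mono' hσm (Filter.Eventually.of_forall fun x => ?_)
    rw [norm_div, Complex.norm_real]
    by_cases hx : x ∈ S
    · have hx1 : 1 < x := by rw [hS] at hx; exact hx.1
      refine (div_le_self (norm_nonneg _) ?_).trans (hσb x)
      rw [Real.norm_of_nonneg (by linarith)]
      exact hx1.le
    · have := hσb x
      rw [indicator_of_notMem hx] at this ⊢
      rw [le_antisymm this (norm_nonneg _), zero_div]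
  have hsplit : ∀ᵐ x, ∫ y, q x y * (ph (θ * y) * ph (-θ * x) * logKer k y x *
      S.indicator (fun _ => (1 : ℂ)) x) =
      (∫ y, q x y * ph (-(θ * (x - y))) * (logKer k y x - k 0 / x)) + k 0 * (σ x θ / x) := by
    filter_upwards [hZ.prod_right_ae] with x hx
    have e : k 0 * (σ x θ / x) = ∫ y, q x y * ph (-(θ * (x - y))) * (k 0 / x) := by
      rw [integral_mul_const, hinv]
      ring
    rw [e, ← integral_add hx ((hqi x).mul_const _)]
    refine integral_congr_ae (Filter.Eventually.of_forall fun y => ?_)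
    simp only
    by_cases hxS : x ∈ S
    · rw [indicator_of_mem hxS, show -(θ * (x - y)) = θ * y + -θ * x by ring, ph_add]
      ring
    · simp only [hq0 x hxS, zero_mul, add_zero]
  have hZ1 : Integrable fun x => ∫ y, q x y * ph (-(θ * (x - y))) * (logKer k y x - k 0 / x) :=
    hZ.integral_prod_left
  rw [htr, hform, integral_congr_ae hsplit, integral_add hZ1 (hσi.const_mul _),
    integral_const_mul, add_sub_cancel_right, ← integral_prod _ hZ]
  exact (norm_integral_le_integral_norm _).trans hZle

end ModelTrace

/-! ### Trace asymptotics for a half line and the logarithmic integral -/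

section HalfLineTrace

variable {K w r θ : ℝ}

/-- Trace asymptotics for a half line, with the density integrated along the boundary. -/
theorem norm_opTrace_halfLine_sub_le {A : L2R →L[ℂ] L2R} {σ : ℝ → ℝ → ℂ} {K₀ : ℝ}
    (hA : IsKer A fun x y => 𝓕⁻ (σ x) (x - y))
    (hm : StronglyMeasurable (Function.uncurry fun x y => 𝓕⁻ (σ x) (x - y)))
    (hw : 1 ≤ w) (hK : 0 ≤ K)
    (hd : ∀ x y, ‖𝓕⁻ (σ x) (x - y)‖ ≤
      (Ioo 1 (4 * r)).indicator (fun _ => K * w * bracket 1 w (x - y)) x)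
    (hc : ∀ x, Continuous (σ x)) (hi : ∀ x, Integrable (σ x)) (hT : TraceBound A K₀)
    {S : Set ℝ} (hS : IsHalfLine θ S) {p : ℕ} (hp : 1 ≤ p) :
    ‖opTrace (A * (halfTrunc S ^ p - halfTrunc S)) -
      (coeffA (fun t => t ^ p - t) 1 : ℂ) * ∫ x, σ x θ / x‖ ≤
      modelConst * (4 * Real.pi * p * bracketInt 1) * K := by
  obtain ⟨ε, hε, he⟩ := hS.halfTrunc_pow_sub hp
  have hM := isMult_powSymbol hp hε
  rw [he, ← fourierInv_powSymbol_zero p hε]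
  refine norm_opTrace_model_sub_le hA hm hw hK hd hc hi hT ?_ (isLipBdd_powSymbol hp hε)
    (continuous_fourierInv hM.one).measurable (memLp_two_fourierInv hM)
  have h := ((isKer_logKer hM).mulOp_mul (memLp_top_ph θ)).mul_mulOp (memLp_top_ph (-θ))
  simpa only [modOp, mul_assoc] using h

/-- The integral lies between those of 1/x over (4, r) and over (1, 4r), each within log 4 of log r;
for r ≤ 4 the lower bound 0 already suffices. -/
theorem integral_cutoff_div {ψ : ℝ → ℝ} (hr : 1 ≤ r) (hψ : IsCutoff r ψ) :
    Integrable (fun x => ψ x / x) ∧ |(∫ x, ψ x / x) - Real.log r| ≤ Real.log 4 := by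
  have hr0 : 0 < r := by linarith
  have h14 : (1 : ℝ) ≤ 4 * r := by linarith
  have hii : ∀ {a b : ℝ}, 1 ≤ a → IntegrableOn (fun x : ℝ => x⁻¹) (Ioc a b) := fun {a b} ha => by
    refine IntegrableOn.mono_set ?_ Ioc_subset_Icc_self
    refine ContinuousOn.integrableOn_Icc (continuousOn_inv₀.mono fun x hx => ?_)
    exact (zero_lt_one.trans_le (ha.trans hx.1)).ne'
  have hI1 : Integrable ((Ioc 1 (4 * r)).indicator fun x : ℝ => x⁻¹) :=
    (integrable_indicator_iff measurableSet_Ioc).2 (hii le_rfl)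
  have hle : ∀ x, ψ x / x ≤ (Ioc 1 (4 * r)).indicator (fun x : ℝ => x⁻¹) x := fun x => by
    by_cases hx : x ∈ Ioo 1 (4 * r)
    · have hx0 : 0 < x := by linarith [hx.1]
      rw [indicator_of_mem (Ioo_subset_Ioc_self hx), div_eq_mul_inv]
      exact mul_le_of_le_one_left (by positivity) (hψ.le_one x)
    · rw [hψ.eq_zero x hx, zero_div]
      exact indicator_nonneg (fun y hy => inv_nonneg.2 (zero_le_one.trans hy.1.le)) x
  have hnn : ∀ x, 0 ≤ ψ x / x := fun x => by
    by_cases hx : x ∈ Ioo 1 (4 * r)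
    · exact div_nonneg (hψ.nonneg x) (by linarith [hx.1])
    · rw [hψ.eq_zero x hx, zero_div]
  have hI : Integrable fun x => ψ x / x := by
    refine hI1.mono' ?_ (Filter.Eventually.of_forall fun x => ?_)
    · exact (hψ.contDiff.continuous.measurable.div measurable_id).aestronglyMeasurable
    · rw [Real.norm_of_nonneg (hnn x)]
      exact hle x
  have hinv : ∀ {a b : ℝ}, 1 ≤ a → a ≤ b →
      ∫ x, (Ioc a b).indicator (fun x : ℝ => x⁻¹) x = Real.log (b / a) := fun {a b} ha hab => by
    rw [integral_indicator measurableSet_Ioc, ← intervalIntegral.integral_of_le hab,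
      integral_inv_of_pos (by linarith) (by linarith)]
  refine ⟨hI, abs_le.2 ⟨?_, ?_⟩⟩
  · rcases le_or_gt r 4 with h | h
    · have h1 : 0 ≤ ∫ x, ψ x / x := integral_nonneg hnn
      have h2 := Real.log_le_log hr0 h
      linarith
    · have hne : ∀ᵐ x : ℝ, x ≠ r := by simp [ae_iff]
      have h1 := integral_mono_ae ((integrable_indicator_iff measurableSet_Ioc).2
        (hii (a := 4) (b := r) (by norm_num))) hI (by
          filter_upwards [hne] with x hxr
          by_cases hx : x ∈ Ioc 4 r
          · rw [indicator_of_mem hx, hψ.eq_one x ⟨hx.1, lt_of_le_of_ne hx.2 hxr⟩, one_div]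
          · rw [indicator_of_notMem hx]
            exact hnn x)
      rw [hinv (by norm_num) h.le, Real.log_div hr0.ne' (by norm_num)] at h1
      linarith
  · have h1 := integral_mono hI hI1 hle
    rw [hinv le_rfl h14, div_one, Real.log_mul (by norm_num) hr0.ne'] at h1
    linarith

/-- Freezing f at 0 costs at most N/L on an interval shorter than 4r, hence at most 4N since r ≤ L;
replacing the integral of ψ/x by log r costs at most N log 4 ≤ 2N. -/
theorem norm_integral_cutoff_sub_le {ψ : ℝ → ℝ} (hr : 1 ≤ r) (hψ : IsCutoff r ψ) {L : ℝ}
    (hL : r ≤ L) {f : ℝ → ℂ} (hf : Continuous f) {N : ℝ} (h0 : ‖f 0‖ ≤ N)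
    (hN : ∀ x, 0 < x → ‖f x - f 0‖ ≤ N * (x / L)) :
    ‖(∫ x, ψ x * f x / x) - f 0 * Real.log r‖ ≤ 6 * N := by
  have hL0 : 0 < L := by linarith
  have hN0 : 0 ≤ N := (norm_nonneg _).trans h0
  obtain ⟨hI, hlog⟩ := integral_cutoff_div hr hψ
  have hIc : Integrable fun x => ((ψ x / x : ℝ) : ℂ) * f 0 := hI.ofReal.mul_const _
  have hle : ∀ x, ‖((ψ x / x : ℝ) : ℂ) * (f x - f 0)‖ ≤
      (Ioc 1 (4 * r)).indicator (fun _ => N / L) x := fun x => by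
    by_cases hx : x ∈ Ioo 1 (4 * r)
    · have hx0 : 0 < x := by linarith [hx.1]
      rw [indicator_of_mem (Ioo_subset_Ioc_self hx), norm_mul, Complex.norm_real,
        Real.norm_of_nonneg (div_nonneg (hψ.nonneg x) hx0.le)]
      calc ψ x / x * ‖f x - f 0‖ ≤ 1 / x * (N * (x / L)) := by
            gcongr
            · exact hψ.le_one x
            · exact hN x hx0
        _ = N / L := by field_simp
    · rw [hψ.eq_zero x hx, zero_div]
      simp only [Complex.ofReal_zero, zero_mul, norm_zero]
      exact indicator_nonneg (fun _ _ => by positivity) x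
  have hI2 : Integrable ((Ioc 1 (4 * r)).indicator fun _ => N / L) :=
    (integrable_indicator_iff measurableSet_Ioc).2 (integrableOn_const (by simp))
  have hId : Integrable fun x => ((ψ x / x : ℝ) : ℂ) * (f x - f 0) := by
    refine hI2.mono' ?_ (Filter.Eventually.of_forall hle)
    have h1 : Measurable fun x => ((ψ x / x : ℝ) : ℂ) :=
      Complex.measurable_ofReal.comp (hψ.contDiff.continuous.measurable.div measurable_id)
    exact (h1.mul (hf.measurable.sub_const _)).aestronglyMeasurable
  have e : ∫ x, ψ x * f x / x = (∫ x, ((ψ x / x : ℝ) : ℂ) * (f x - f 0)) +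
      ((∫ x, ψ x / x : ℝ) : ℂ) * f 0 := by
    rw [← integral_complex_ofReal, ← integral_mul_const, ← integral_add hId hIc]
    refine integral_congr_ae (Filter.Eventually.of_forall fun x => ?_)
    simp only
    push_cast
    ring
  have e2 : (∫ x, ψ x * f x / x) - f 0 * Real.log r =
      (∫ x, ((ψ x / x : ℝ) : ℂ) * (f x - f 0)) +
      (((∫ x, ψ x / x) - Real.log r : ℝ) : ℂ) * f 0 := by
    rw [e]
    push_cast
    ring
  have h4 : Real.log 4 ≤ 2 := by
    rw [show (4 : ℝ) = 2 ^ 2 by norm_num, Real.log_pow]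
    have := Real.log_two_lt_d9
    push_cast
    linarith
  rw [e2]
  refine (norm_add_le _ _).trans ?_
  have h5 : ‖∫ x, ((ψ x / x : ℝ) : ℂ) * (f x - f 0)‖ ≤ 4 * N := by
    refine (norm_integral_le_of_norm_le hI2 (Filter.Eventually.of_forall hle)).trans ?_
    rw [integral_indicator measurableSet_Ioc, setIntegral_const, smul_eq_mul, Measure.real,
      Real.volume_Ioc, ENNReal.toReal_ofReal (by linarith), mul_div_assoc', div_le_iff₀ hL0]
    nlinarith
  have h6 : ‖(((∫ x, ψ x / x) - Real.log r : ℝ) : ℂ) * f 0‖ ≤ 2 * N := by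
    rw [norm_mul, Complex.norm_real, Real.norm_eq_abs]
    exact mul_le_mul (hlog.trans h4) h0 (norm_nonneg _) (by norm_num)
  linarith

end HalfLineTrace

/-! ### Operator algebra: localization of polynomials of truncations -/

section Localization

variable {H : Type*} [NormedAddCommGroup H] [InnerProductSpace ℂ H] [CompleteSpace H]

theorem norm_pow_le_one {T : H →L[ℂ] H} (hT : ‖T‖ ≤ 1) (n : ℕ) : ‖T ^ n‖ ≤ 1 := by
  induction n with
  | zero => rw [pow_zero]; exact ContinuousLinearMap.norm_id_le
  | succ n ih =>
    rw [pow_succ]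
    exact (norm_mul_le _ _).trans (mul_le_one₀ ih (norm_nonneg _) hT)

/-- Telescoping: each of the n factors is exchanged once, between contractions. -/
theorem TraceBound.intertwine_pow {T T' Φ : H →L[ℂ] H} {κ : ℝ} (h : TraceBound (Φ * T - T' * Φ) κ)
    (hT : ‖T‖ ≤ 1) (hT' : ‖T'‖ ≤ 1) (n : ℕ) :
    TraceBound (Φ * T ^ n - T' ^ n * Φ) (n * κ) := by
  induction n with
  | zero => simpa using TraceBound.zero
  | succ n ih =>
    have e : Φ * T ^ (n + 1) - T' ^ (n + 1) * Φ =
        (Φ * T ^ n - T' ^ n * Φ) * T + T' ^ n * (Φ * T - T' * Φ) := by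
      rw [pow_succ, pow_succ]
      noncomm_ring
    rw [e]
    refine ((ih.mul_right_le ih.nonneg hT).add
      (h.mul_left_le h.nonneg (norm_pow_le_one hT' n))).mono (le_of_eq ?_)
    push_cast
    ring

/-- Φ passes through the projections exactly, so only its two crossings of χ leave commutators. -/
theorem traceBound_intertwine {χ P P' Φ : H →L[ℂ] H} {κ : ℝ} (hχ : ‖χ‖ ≤ 1) (hP : ‖P‖ ≤ 1)
    (hP' : ‖P'‖ ≤ 1) (hΦ : Φ * P = P' * Φ) (h : TraceBound (Φ * χ - χ * Φ) κ) :
    TraceBound (Φ * (χ * P * χ) - (χ * P' * χ) * Φ) (2 * κ) := by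
  have e : Φ * (χ * P * χ) - (χ * P' * χ) * Φ =
      (Φ * χ - χ * Φ) * (P * χ) + (χ * P') * (Φ * χ - χ * Φ) := by
    have : χ * (Φ * P) * χ = χ * (P' * Φ) * χ := by rw [hΦ]
    have h2 : (Φ * χ - χ * Φ) * (P * χ) + (χ * P') * (Φ * χ - χ * Φ) =
      Φ * (χ * P * χ) - (χ * P' * χ) * Φ + (χ * (P' * Φ) * χ - χ * (Φ * P) * χ) := by noncomm_ring
    rw [h2, this, sub_self, add_zero]
  have n1 : ‖P * χ‖ ≤ 1 := (norm_mul_le _ _).trans (mul_le_one₀ hP (norm_nonneg _) hχ)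
  have n2 : ‖χ * P'‖ ≤ 1 := (norm_mul_le _ _).trans (mul_le_one₀ hχ (norm_nonneg _) hP')
  rw [e]
  exact ((h.mul_right_le h.nonneg n1).add (h.mul_left_le h.nonneg n2)).mono (le_of_eq (by ring))

/-- Replacing `P` by `P'` in `g(χPχ)`, `g(t) = t^p - t`, after localization by `Φ`. -/
theorem traceBound_localize {χ P P' Φ : H →L[ℂ] H} {κ : ℝ} (hχ : ‖χ‖ ≤ 1) (hP : ‖P‖ ≤ 1)
    (hP' : ‖P'‖ ≤ 1) (hΦ : Φ * P = P' * Φ) (hΦ' : Φ * P' = P' * Φ)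
    (h : TraceBound (Φ * χ - χ * Φ) κ) (p : ℕ) :
    TraceBound (Φ * (((χ * P * χ) ^ p - χ * P * χ) - ((χ * P' * χ) ^ p - χ * P' * χ)))
      (4 * (p + 1) * κ) := by
  have nT : ∀ {P : H →L[ℂ] H}, ‖P‖ ≤ 1 → ‖χ * P * χ‖ ≤ 1 := fun hP =>
    (norm_mul_le _ _).trans (mul_le_one₀ ((norm_mul_le _ _).trans
      (mul_le_one₀ hχ (norm_nonneg _) hP)) (norm_nonneg _) hχ)
  -- Both g(χPχ) and g(χP'χ) are intertwined by Φ with g(χP'χ); subtraction cancels the common term.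
  have h1 := traceBound_intertwine hχ hP hP' hΦ h
  have h2 := traceBound_intertwine hχ hP' hP' hΦ' h
  have h3 := ((h1.intertwine_pow (nT hP) (nT hP') p).sub h1).sub
    ((h2.intertwine_pow (nT hP') (nT hP') p).sub h2)
  refine TraceBound.mono (A := _) ?_ (le_of_eq (show (p * (2 * κ) + 2 * κ) +
    (p * (2 * κ) + 2 * κ) = 4 * (p + 1) * κ by ring))
  convert h3 using 1
  noncomm_ring

/-- Smallness of `b g(χPχ)`, `g(t) = t^p - t`, when `b` and `bP` almost commute with `χ`. -/
theorem traceBound_mul_pow_sub {χ P b : H →L[ℂ] H} {κ κ' : ℝ} (hχ : ‖χ‖ ≤ 1) (hP : ‖P‖ ≤ 1)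
    (hχ2 : χ * χ = χ) (hP2 : P * P = P) (hχ' : ‖1 - χ‖ ≤ 1)
    (h : TraceBound (b * χ - χ * b) κ) (h' : TraceBound (b * P * χ - χ * (b * P)) κ') {p : ℕ}
    (hp : 1 ≤ p) :
    TraceBound (b * ((χ * P * χ) ^ p - χ * P * χ)) (p * (κ + κ')) := by
  have hT : ‖χ * P * χ‖ ≤ 1 :=
    (norm_mul_le _ _).trans (mul_le_one₀ ((norm_mul_le _ _).trans
      (mul_le_one₀ hχ (norm_nonneg _) hP)) (norm_nonneg _) hχ)
  have n1 : ‖P * χ‖ ≤ 1 := (norm_mul_le _ _).trans (mul_le_one₀ hP (norm_nonneg _) hχ)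
  have n2 : ‖(1 - χ) * (P * χ)‖ ≤ 1 :=
    (norm_mul_le _ _).trans (mul_le_one₀ hχ' (norm_nonneg _) n1)
  have n3 : ‖P * ((1 - χ) * (P * χ))‖ ≤ 1 :=
    (norm_mul_le _ _).trans (mul_le_one₀ hP (norm_nonneg _) n2)
  -- With T = χPχ one has T - T² = χP(1 - χ)Pχ. Moving b past the first χ leaves [b, χ], and χbP(1 -
  -- χ) = -χ[bP, χ].
  have e1 : b * (χ * P * χ - (χ * P * χ) * (χ * P * χ)) =
      (b * χ - χ * b) * (P * ((1 - χ) * (P * χ))) -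
        χ * ((b * P * χ - χ * (b * P)) * (P * χ)) := by
    have a1 : (χ * P * χ) * (χ * P * χ) = χ * P * χ * P * χ := by
      calc _ = χ * P * (χ * χ) * P * χ := by simp only [mul_assoc]
        _ = _ := by rw [hχ2]
    have a2 : χ * ((b * P * χ - χ * (b * P)) * (P * χ)) =
        χ * b * P * χ * P * χ - (χ * χ) * b * (P * P) * χ := by noncomm_ring
    have a3 : (b * χ - χ * b) * (P * ((1 - χ) * (P * χ))) =
        b * χ * (P * P) * χ - b * χ * P * χ * P * χ - χ * b * (P * P) * χ +
          χ * b * P * χ * P * χ := by noncomm_ring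
    rw [a1, a2, a3, hχ2, hP2]
    noncomm_ring
  have hB : TraceBound (b * (χ * P * χ - (χ * P * χ) * (χ * P * χ))) (κ + κ') := by
    rw [e1]
    refine ((h.mul_right_le h.nonneg n3).sub
      ((h'.mul_right_le h'.nonneg n1).mul_left_le (by linarith [h'.nonneg]) hχ)).mono
      (le_of_eq (by ring))
  induction p, hp using Nat.le_induction with
  | base =>
    rw [pow_one, sub_self, mul_zero]
    exact TraceBound.zero.mono (by push_cast; linarith [h.nonneg, h'.nonneg])
  | succ n hn ih =>
    obtain ⟨m, rfl⟩ : ∃ m, n = m + 1 := ⟨n - 1, by omega⟩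
    -- The general power reduces to the quadratic case through T^{m+2} - T = (T^{m+1} - T) - (T -
    -- T²)T^m.
    have e : b * ((χ * P * χ) ^ (m + 1 + 1) - χ * P * χ) =
        b * ((χ * P * χ) ^ (m + 1) - χ * P * χ) -
        b * (χ * P * χ - (χ * P * χ) * (χ * P * χ)) * (χ * P * χ) ^ m := by
      generalize χ * P * χ = T
      rw [pow_succ' T (m + 1), pow_succ' T m]
      noncomm_ring
    rw [e]
    refine (ih.sub (hB.mul_right_le hB.nonneg (norm_pow_le_one hT m))).mono (le_of_eq ?_)
    push_cast
    ring

end Localization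

/-! ### Slowly varying symbols and smooth cutoffs -/

section Slow

/-- `f` is `C²` with `w^i |f^{(i)}| ≤ N` for `i ≤ 2`. -/
structure IsSlow (f : ℝ → ℂ) (N w : ℝ) : Prop where
  contDiff : ContDiff ℝ 2 f
  bound : ∀ i ≤ 2, ∀ η, w ^ i * ‖iteratedDeriv i f η‖ ≤ N

theorem IsSlow.norm_le {f : ℝ → ℂ} {N w : ℝ} (h : IsSlow f N w) (η : ℝ) : ‖f η‖ ≤ N := by
  simpa using h.bound 0 (by norm_num) η

theorem IsSlow.nonneg {f : ℝ → ℂ} {N w : ℝ} (h : IsSlow f N w) : 0 ≤ N :=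
  (norm_nonneg _).trans (h.norm_le 0)

theorem IsSlow.of_le {f : ℝ → ℂ} {N w w' : ℝ} (h : IsSlow f N w) (hw : 0 ≤ w') (hww : w' ≤ w) :
    IsSlow f N w' :=
  ⟨h.contDiff, fun i hi η => le_trans (by gcongr) (h.bound i hi η)⟩

theorem IsSlow.mul {f g : ℝ → ℂ} {N M w : ℝ} (hf : IsSlow f N w) (hg : IsSlow g M w)
    (hw : 0 ≤ w) : IsSlow (fun η => f η * g η) (4 * (N * M)) w := by
  refine ⟨hf.contDiff.mul hg.contDiff, fun i hi η => ?_⟩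
  have h := norm_iteratedFDeriv_mul_le hf.contDiff hg.contDiff η (n := i) (by exact_mod_cast hi)
  simp only [norm_iteratedFDeriv_eq_norm_iteratedDeriv] at h
  have hN := hf.nonneg
  have hM := hg.nonneg
  calc w ^ i * ‖iteratedDeriv i (fun η => f η * g η) η‖
      ≤ w ^ i * ∑ j ∈ Finset.range (i + 1), (i.choose j : ℝ) * ‖iteratedDeriv j f η‖ *
          ‖iteratedDeriv (i - j) g η‖ := by gcongr
    _ = ∑ j ∈ Finset.range (i + 1), (i.choose j : ℝ) * ((w ^ j * ‖iteratedDeriv j f η‖) *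
          (w ^ (i - j) * ‖iteratedDeriv (i - j) g η‖)) := by
        rw [Finset.mul_sum]
        refine Finset.sum_congr rfl fun j hj => ?_
        have : w ^ i = w ^ j * w ^ (i - j) := by
          rw [← pow_add, Nat.add_sub_cancel' (Nat.lt_succ_iff.1 (Finset.mem_range.1 hj))]
        rw [this]
        ring
    _ ≤ ∑ j ∈ Finset.range (i + 1), (i.choose j : ℝ) * (N * M) := by
        refine Finset.sum_le_sum fun j hj => ?_
        have hj' := Nat.lt_succ_iff.1 (Finset.mem_range.1 hj)
        gcongr
        · exact hf.bound j (by omega) η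
        · exact hg.bound (i - j) (by omega) η
    _ = 2 ^ i * (N * M) := by
        rw [← Finset.sum_mul]
        congr 1
        exact_mod_cast Nat.sum_range_choose i
    -- The sum of the binomial coefficients in Leibniz's rule of order at most 2: the source of the
    -- factor 4.
    _ ≤ 2 ^ 2 * (N * M) := by
        gcongr
        norm_num
    _ = _ := by norm_num

/-- A fixed smooth bump: `1` on `[-1, 1]` and `0` outside `(-5/4, 5/4)`. -/
def baseBump : ContDiffBump (0 : ℝ) := ⟨1, 5 / 4, one_pos, by norm_num⟩

/-- The bump with centre `c` and radius `R`. -/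
def cut (c R : ℝ) (η : ℝ) : ℂ := (baseBump (R⁻¹ * (η - c)) : ℂ)

theorem contDiff_cut (c R : ℝ) {n : ℕ∞} : ContDiff ℝ n (cut c R) :=
  Complex.ofRealCLM.contDiff.comp (baseBump.contDiff.comp (by fun_prop))

theorem cut_eq_one {c R η : ℝ} (hR : 0 < R) (h : |η - c| ≤ R) : cut c R η = 1 := by
  have : R⁻¹ * (η - c) ∈ Metric.closedBall (0 : ℝ) baseBump.rIn := by
    rw [mem_closedBall_zero_iff, Real.norm_eq_abs, abs_mul, abs_of_pos (inv_pos.2 hR)]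
    change R⁻¹ * |η - c| ≤ 1
    rw [← div_eq_inv_mul]
    exact (div_le_one hR).2 h
  rw [cut, baseBump.one_of_mem_closedBall this, Complex.ofReal_one]

theorem cut_eq_zero {c R η : ℝ} (hR : 0 < R) (h : 5 / 4 * R ≤ |η - c|) : cut c R η = 0 := by
  rw [cut, baseBump.zero_of_le_dist, Complex.ofReal_zero]
  rw [dist_zero_right, Real.norm_eq_abs, abs_mul, abs_of_pos (inv_pos.2 hR)]
  change 5 / 4 ≤ R⁻¹ * |η - c|
  rw [← div_eq_inv_mul]
  exact (le_div_iff₀ hR).2 h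

theorem norm_cut_le_one (c R η : ℝ) : ‖cut c R η‖ ≤ 1 := by
  rw [cut, Complex.norm_real, Real.norm_of_nonneg baseBump.nonneg]
  exact baseBump.le_one

theorem exists_cutConst : ∃ G : ℝ, ∀ i ≤ 2, ∀ t, ‖iteratedDeriv i (cut 0 1) t‖ ≤ G := by
  have hs : HasCompactSupport (cut 0 1) := by
    refine HasCompactSupport.of_support_subset_isCompact (isCompact_closedBall (0 : ℝ) (5 / 4))
      fun t ht => ?_
    by_contra h
    rw [mem_closedBall_zero_iff, Real.norm_eq_abs, not_le] at h
    exact ht (cut_eq_zero one_pos (by rw [sub_zero]; linarith))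
  have h : ∀ i : ℕ, ∃ G : ℝ, ∀ t, ‖iteratedDeriv i (cut 0 1) t‖ ≤ G := fun i => by
    have h1 := hs.iteratedFDeriv (𝕜 := ℝ) i
    have h2 : Continuous (iteratedFDeriv ℝ i (cut 0 1)) :=
      (contDiff_cut 0 1 (n := ⊤)).continuous_iteratedFDeriv (by exact_mod_cast le_top)
    obtain ⟨G, hG⟩ := h1.exists_bound_of_continuous h2
    exact ⟨G, fun t => by rw [← norm_iteratedFDeriv_eq_norm_iteratedDeriv]; exact hG t⟩
  choose G hG using h
  refine ⟨∑ i ∈ Finset.range 3, |G i|, fun i hi t => (hG i t).trans ((le_abs_self _).trans ?_)⟩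
  exact Finset.single_le_sum (f := fun i => |G i|) (fun _ _ => abs_nonneg _)
    (Finset.mem_range.2 (by omega))

/-- A bound for the first derivatives of the fixed bump. -/
def cutConst : ℝ := exists_cutConst.choose

theorem isSlow_cut (c : ℝ) {R w : ℝ} (hw : 0 < w) (hR : w ≤ R) : IsSlow (cut c R) cutConst w := by
  have hR0 : 0 < R := hw.trans_le hR
  have h1 : IsSlow (cut c R) cutConst R := by
    refine ⟨contDiff_cut c R, fun i hi η => ?_⟩
    have e : iteratedDeriv i (cut c R) η = R⁻¹ ^ i • iteratedDeriv i (cut 0 1) (R⁻¹ * (η - c)) := by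
      have e1 : cut c R = fun z => (fun y => cut 0 1 (R⁻¹ * y)) (z - c) := by
        ext z
        simp [cut]
      have hcd : ContDiff ℝ i (cut 0 1) := by exact_mod_cast contDiff_cut 0 1 (n := i)
      have e2 := iteratedDeriv_comp_const_smul (n := i) hcd R⁻¹
      have e3 := iteratedDeriv_comp_sub_const i (fun y => cut 0 1 (R⁻¹ * y)) c
      rw [e1, e3]
      beta_reduce
      rw [e2]
    rw [e, norm_smul, norm_pow, norm_inv, Real.norm_of_nonneg hR0.le, ← mul_assoc, ← mul_pow,
      mul_inv_cancel₀ hR0.ne', one_pow, one_mul]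
    exact exists_cutConst.choose_spec i hi _
  exact h1.of_le hw.le hR

theorem cutConst_nonneg : 0 ≤ cutConst := (isSlow_cut 0 one_pos le_rfl).nonneg

end Slow

/-! ### Compactly supported multipliers at a given frequency scale -/

section Sobolev

/-- Compactly supported `C²` functions with a bound for `‖m‖₁ + w² ‖m''‖₁`. -/
structure IsSob (m : ℝ → ℂ) (K w : ℝ) : Prop where
  contDiff : ContDiff ℝ 2 m
  supp : HasCompactSupport m
  bound : (∫ η, ‖m η‖) + w ^ 2 * ∫ η, ‖iteratedDeriv 2 m η‖ ≤ K * w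

variable {m m' : ℝ → ℂ} {K K' w : ℝ}

theorem IsSob.integrable (h : IsSob m K w) : Integrable m :=
  h.contDiff.continuous.integrable_of_hasCompactSupport h.supp

theorem IsSob.integrable_deriv (h : IsSob m K w) : Integrable (iteratedDeriv 2 m) := by
  refine (h.contDiff.continuous_iteratedDeriv 2 le_rfl).integrable_of_hasCompactSupport ?_
  refine HasCompactSupport.of_support_subset_isCompact h.supp fun x hx => ?_
  refine support_iteratedFDeriv_subset (𝕜 := ℝ) 2 (f := m) ?_
  rw [Function.mem_support, ← norm_ne_zero_iff, norm_iteratedFDeriv_eq_norm_iteratedDeriv,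
    norm_ne_zero_iff]
  exact hx

theorem IsSob.isMult (h : IsSob m K w) : IsMult m :=
  ⟨h.contDiff.continuous.memLp_of_hasCompactSupport h.supp,
    h.contDiff.continuous.memLp_of_hasCompactSupport h.supp, h.integrable⟩

theorem IsSob.hasDecay (h : IsSob m K w) (hw : 0 < w) : HasDecay (𝓕⁻ m) K w :=
  hasDecay_fourierInv h.contDiff h.supp hw h.bound

theorem IsSob.sub (h : IsSob m K w) (h' : IsSob m' K' w) :
    IsSob (fun η => m η - m' η) (K + K') w := by
  refine ⟨h.contDiff.sub h'.contDiff, h.supp.sub h'.supp, ?_⟩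
  have e : ∀ η, iteratedDeriv 2 (fun η => m η - m' η) η =
      iteratedDeriv 2 m η - iteratedDeriv 2 m' η := fun η =>
    iteratedDeriv_sub h.contDiff.contDiffAt h'.contDiff.contDiffAt
  have h1 : ∫ η, ‖m η - m' η‖ ≤ (∫ η, ‖m η‖) + ∫ η, ‖m' η‖ := by
    rw [← integral_add h.integrable.norm h'.integrable.norm]
    exact integral_mono (h.integrable.sub h'.integrable).norm
      (h.integrable.norm.add h'.integrable.norm) fun η => norm_sub_le _ _
  have h2 : ∫ η, ‖iteratedDeriv 2 (fun η => m η - m' η) η‖ ≤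
      (∫ η, ‖iteratedDeriv 2 m η‖) + ∫ η, ‖iteratedDeriv 2 m' η‖ := by
    simp only [e]
    rw [← integral_add h.integrable_deriv.norm h'.integrable_deriv.norm]
    exact integral_mono (h.integrable_deriv.sub h'.integrable_deriv).norm
      (h.integrable_deriv.norm.add h'.integrable_deriv.norm) fun η => norm_sub_le _ _
  have h3 := mul_le_mul_of_nonneg_left h2 (sq_nonneg w)
  linarith [h.bound, h'.bound]

theorem IsSob.sub_sum {κ : Type*} (s : Finset κ) {f : κ → ℝ → ℂ} {k : κ → ℝ} (h : IsSob m K w)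
    (hf : ∀ i ∈ s, IsSob (f i) (k i) w) :
    IsSob (fun η => m η - ∑ i ∈ s, f i η) (K + ∑ i ∈ s, k i) w := by
  classical
  induction s using Finset.induction_on with
  | empty => simpa using h
  | insert i s hi ih =>
    have h1 := (ih fun j hj => hf j (Finset.mem_insert_of_mem hj)).sub
      (hf i (Finset.mem_insert_self i s))
    simp only [Finset.sum_insert hi]
    have e : K + (k i + ∑ j ∈ s, k j) = K + ∑ j ∈ s, k j + k i := by ring
    rw [e]
    convert h1 using 2 with η
    ring

/-- Viewing a narrow bump at a coarser scale costs the ratio of the scales. This is the origin of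
the terms ρ/D in the remainder. -/
theorem IsSob.rescale (h : IsSob m K w) (hw : 0 < w) {W : ℝ} (hW : w ≤ W) :
    IsSob m (K * (W / w)) W := by
  refine ⟨h.contDiff, h.supp, ?_⟩
  have h1 : 0 ≤ ∫ η, ‖m η‖ := integral_nonneg fun _ => norm_nonneg _
  have h2 : 0 ≤ ∫ η, ‖iteratedDeriv 2 m η‖ := integral_nonneg fun _ => norm_nonneg _
  have h3 : 1 ≤ (W / w) ^ 2 := one_le_pow₀ ((one_le_div hw).2 hW)
  calc (∫ η, ‖m η‖) + W ^ 2 * ∫ η, ‖iteratedDeriv 2 m η‖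
      ≤ (W / w) ^ 2 * (∫ η, ‖m η‖) + W ^ 2 * ∫ η, ‖iteratedDeriv 2 m η‖ := by nlinarith
    _ = (W / w) ^ 2 * ((∫ η, ‖m η‖) + w ^ 2 * ∫ η, ‖iteratedDeriv 2 m η‖) := by field_simp
    _ ≤ (W / w) ^ 2 * (K * w) := by
        gcongr
        exact h.bound
    _ = _ := by field_simp

/-- Near every point the product is either m or 0, because m vanishes near the boundary of S; no
derivative of the indicator appears. -/
theorem IsSob.indicator (h : IsSob m K w) {S : Set ℝ}
    (hS : ∀ η ∈ frontier S, m =ᶠ[nhds η] 0) :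
    IsSob (fun η => m η * S.indicator (fun _ => (1 : ℂ)) η) K w := by
  have hloc : ∀ η, (fun η => m η * S.indicator (fun _ => (1 : ℂ)) η) =ᶠ[nhds η] m ∨
      (fun η => m η * S.indicator (fun _ => (1 : ℂ)) η) =ᶠ[nhds η] 0 := fun η => by
    by_cases hη : η ∈ frontier S
    · right
      filter_upwards [hS η hη] with t ht
      rw [ht]
      simp
    · by_cases h1 : η ∈ interior S
      · left
        filter_upwards [mem_interior_iff_mem_nhds.1 h1] with t ht
        rw [indicator_of_mem ht, mul_one]
      · right
        have h2 : η ∈ (closure S)ᶜ := fun h2 => hη ⟨h2, h1⟩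
        filter_upwards [isClosed_closure.isOpen_compl.mem_nhds h2] with t ht
        rw [indicator_of_notMem fun h3 => ht (subset_closure h3), mul_zero]
        rfl
  have hcd : ContDiff ℝ 2 fun η => m η * S.indicator (fun _ => (1 : ℂ)) η := by
    rw [contDiff_iff_contDiffAt]
    intro η
    rcases hloc η with h1 | h1
    · exact h.contDiff.contDiffAt.congr_of_eventuallyEq h1
    · exact (contDiff_const (c := (0 : ℂ))).contDiffAt.congr_of_eventuallyEq h1
  have hn : ∀ η, ‖m η * S.indicator (fun _ => (1 : ℂ)) η‖ ≤ ‖m η‖ := fun η => by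
    rw [norm_mul]
    exact mul_le_of_le_one_right (norm_nonneg _) (norm_indicator_one_le S η)
  have hn2 : ∀ η, ‖iteratedDeriv 2 (fun η => m η * S.indicator (fun _ => (1 : ℂ)) η) η‖ ≤
      ‖iteratedDeriv 2 m η‖ := fun η => by
    rcases hloc η with h1 | h1
    · rw [h1.iteratedDeriv_eq]
    · rw [h1.iteratedDeriv_eq]
      have : iteratedDeriv 2 (0 : ℝ → ℂ) η = 0 := by
        simp
      rw [this, norm_zero]
      exact norm_nonneg _
  have hsupp : HasCompactSupport fun η => m η * S.indicator (fun _ => (1 : ℂ)) η :=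
    h.supp.mul_right
  have h1 : ∫ η, ‖m η * S.indicator (fun _ => (1 : ℂ)) η‖ ≤ ∫ η, ‖m η‖ :=
    integral_mono_of_nonneg (Filter.Eventually.of_forall fun _ => norm_nonneg _)
      h.integrable.norm (Filter.Eventually.of_forall hn)
  have h2 := integral_mono_of_nonneg (μ := volume)
    (Filter.Eventually.of_forall fun _ => norm_nonneg _)
    h.integrable_deriv.norm (Filter.Eventually.of_forall hn2)
  refine ⟨hcd, hsupp, le_trans ?_ h.bound⟩
  gcongr

/-- Slowly varying functions supported in an interval. -/
theorem IsSlow.isSob {N c R : ℝ} (h : IsSlow m N w) (hw : 0 < w) (hR : 0 ≤ R)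
    (hm : ∀ η, R < |η - c| → m η = 0) : IsSob m (4 * R / w * N) w := by
  have hN := h.nonneg
  have hsub : tsupport m ⊆ Metric.closedBall c R := by
    refine closure_minimal (fun η hη => ?_) Metric.isClosed_closedBall
    by_contra h1
    rw [Metric.mem_closedBall, Real.dist_eq, not_le] at h1
    exact hη (hm η h1)
  have hs : HasCompactSupport m := (isCompact_closedBall c R).of_isClosed_subset
    (isClosed_tsupport m) hsub
  have hI : ∀ C : ℝ, Integrable ((Metric.closedBall c R).indicator fun _ => C) := fun C =>
    (integrable_indicator_iff Metric.isClosed_closedBall.measurableSet).2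
      (integrableOn_const measure_closedBall_lt_top.ne)
  have hIe : ∀ C : ℝ, ∫ η, (Metric.closedBall c R).indicator (fun _ => C) η = 2 * R * C :=
    fun C => by
      rw [integral_indicator Metric.isClosed_closedBall.measurableSet, setIntegral_const,
        Measure.real, Real.volume_closedBall, ENNReal.toReal_ofReal (by linarith), smul_eq_mul]
  refine ⟨h.contDiff, hs, ?_⟩
  have h1 : ∫ η, ‖m η‖ ≤ 2 * R * N := by
    rw [← hIe N]
    refine integral_mono_of_nonneg (Filter.Eventually.of_forall fun _ => norm_nonneg _) (hI N)
      (Filter.Eventually.of_forall fun η => ?_)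
    by_cases hη : η ∈ Metric.closedBall c R
    · rw [indicator_of_mem hη]
      exact h.norm_le η
    · beta_reduce
      rw [indicator_of_notMem hη, image_eq_zero_of_notMem_tsupport fun h2 => hη (hsub h2),
        norm_zero]
  have h2 : ∫ η, ‖iteratedDeriv 2 m η‖ ≤ 2 * R * (N / w ^ 2) := by
    rw [← hIe (N / w ^ 2)]
    refine integral_mono_of_nonneg (Filter.Eventually.of_forall fun _ => norm_nonneg _) (hI _)
      (Filter.Eventually.of_forall fun η => ?_)
    by_cases hη : η ∈ Metric.closedBall c R
    · rw [indicator_of_mem hη, le_div_iff₀ (by positivity), mul_comm]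
      exact h.bound 2 le_rfl η
    · rw [indicator_of_notMem hη]
      have h3 : η ∉ Function.support (iteratedFDeriv ℝ 2 m) := fun h3 =>
        hη (hsub (support_iteratedFDeriv_subset 2 h3))
      rw [Function.notMem_support] at h3
      beta_reduce
      rw [← norm_iteratedFDeriv_eq_norm_iteratedDeriv, h3, norm_zero]
  calc _ ≤ 2 * R * N + w ^ 2 * (2 * R * (N / w ^ 2)) := by gcongr
    _ = _ := by
        field_simp
        ring

end Sobolev

/-! ### Frequency-localized pieces of the operator -/

section LocalPieces

theorem isSob_cut (c : ℝ) {R w : ℝ} (hw : 0 < w) (h1 : w ≤ R) (h2 : R ≤ 2 * w) :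
    IsSob (cut c R) (10 * cutConst) w := by
  have hR : 0 < R := hw.trans_le h1
  have h := (isSlow_cut c hw h1).isSob (c := c) (R := 5 / 4 * R) hw (by positivity)
    fun η hη => cut_eq_zero hR hη.le
  refine ⟨h.contDiff, h.supp, h.bound.trans ?_⟩
  have hG := cutConst_nonneg
  have : 4 * (5 / 4 * R) / w ≤ 10 := by
    rw [div_le_iff₀ hw]
    linarith
  gcongr

theorem cut_mul_cut {c R R' : ℝ} (hR : 0 < R) (hR' : 5 / 4 * R ≤ R') (η : ℝ) :
    cut c R η * cut c R' η = cut c R η := by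
  rcases le_or_gt (5 / 4 * R) |η - c| with h | h
  · rw [cut_eq_zero hR h, zero_mul]
  · rw [cut_eq_one (by linarith) (h.le.trans hR'), mul_one]

/-- Bounds for the commutator of a smooth multiplier with the half-line truncation. -/
theorem traceBound_commutator_cut {m : ℝ → ℂ} {K w c R : ℝ} (hm : IsSob m K w) (hw : 0 < w)
    (h1 : w ≤ R) (h2 : R ≤ 2 * w) (hmz : ∀ η, m η * cut c R η = m η) :
    TraceBound (fmul m * chiOp (Ioi 0) - chiOp (Ioi 0) * fmul m)
      (2 * hankelConst * (K * (10 * cutConst))) :=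
  traceBound_commutator hm.isMult (isSob_cut c hw h1 h2).isMult hmz hw (hm.hasDecay hw)
    ((isSob_cut c hw h1 h2).hasDecay hw)

theorem norm_halfTrunc_le {S : Set ℝ} (hS : MeasurableSet S) : ‖halfTrunc S‖ ≤ 1 := by
  have h1 := norm_chiOp_le (measurableSet_Ioi (a := (0 : ℝ)))
  have h2 : ‖fmul (S.indicator fun _ => (1 : ℂ))‖ ≤ 1 :=
    norm_fmul_le (memLp_top_indicator hS) zero_le_one (norm_indicator_one_le S)
  exact (norm_mul_le _ _).trans (mul_le_one₀ ((norm_mul_le _ _).trans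
    (mul_le_one₀ h1 (norm_nonneg _) h2)) (norm_nonneg _) h1)

/-- The function `g(t) = t^p - t` of the truncation. -/
def powTrunc (p : ℕ) (S : Set ℝ) : L2R →L[ℂ] L2R := halfTrunc S ^ p - halfTrunc S

theorem norm_powTrunc_le {S : Set ℝ} (hS : MeasurableSet S) (p : ℕ) : ‖powTrunc p S‖ ≤ 2 := by
  have h := norm_halfTrunc_le hS
  have := (norm_sub_le (halfTrunc S ^ p) (halfTrunc S)).trans
    (add_le_add (norm_pow_le_one h p) h)
  unfold powTrunc
  linarith

/-- The operator `A` with a symbol supported in `(1, 4r) × (-W, W)`. -/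
structure IsLocPdo (A : L2R →L[ℂ] L2R) (σ : ℝ → ℝ → ℂ) (N W r : ℝ) : Prop where
  pdo : IsPdo A σ
  meas : StronglyMeasurable (Function.uncurry σ)
  slow : ∀ x, IsSlow (σ x) N W
  supp : ∀ x η, W ≤ |η| → σ x η = 0
  zero : ∀ x, x ∉ Ioo 1 (4 * r) → ∀ η, σ x η = 0

variable {A : L2R →L[ℂ] L2R} {σ : ℝ → ℝ → ℂ} {N W r : ℝ}

theorem stronglyMeasurable_kernel (hσ : StronglyMeasurable (Function.uncurry σ)) {m : ℝ → ℂ}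
    (hm : Continuous m) :
    StronglyMeasurable (Function.uncurry fun x y => 𝓕⁻ (fun η => σ x η * m η) (x - y)) := by
  have e : (Function.uncurry fun x y => 𝓕⁻ (fun η => σ x η * m η) (x - y)) =
      fun z : ℝ × ℝ => ∫ η, ph ((z.1 - z.2) * η) * (σ z.1 η * m η) := by
    ext z
    exact fourierInv_eq_ph _ _
  rw [e]
  refine StronglyMeasurable.integral_prod_right (ν := volume)
    (f := fun (z : ℝ × ℝ) η => ph ((z.1 - z.2) * η) * (σ z.1 η * m η)) ?_
  have h1 : Continuous fun z : (ℝ × ℝ) × ℝ => ph ((z.1.1 - z.1.2) * z.2) :=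
    continuous_ph.comp (by fun_prop)
  have h2 : Measurable fun z : (ℝ × ℝ) × ℝ => σ z.1.1 z.2 :=
    hσ.measurable.comp (by fun_prop : Measurable fun z : (ℝ × ℝ) × ℝ => (z.1.1, z.2))
  exact (h1.measurable.mul (h2.mul (hm.measurable.comp measurable_snd))).stronglyMeasurable

/-- Localization of `A` in the dual variable by a multiplier `m`. -/
theorem IsLocPdo.kernel (h : IsLocPdo A σ N W r) {m : ℝ → ℂ} (hmt : MemLp m ⊤ volume) {K w : ℝ}
    (hs : ∀ x, IsSob (fun η => σ x η * m η) K w) (hw : 0 < w) :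
    IsKer (A * fmul m) (fun x y => 𝓕⁻ (fun η => σ x η * m η) (x - y)) ∧ 0 ≤ K ∧
    (∀ x y, ‖𝓕⁻ (fun η => σ x η * m η) (x - y)‖ ≤
      (Ioo 1 (4 * r)).indicator (fun _ => K * w * bracket 1 w (x - y)) x) ∧
    ‖A * fmul m‖ ≤ K * bracketInt 1 := by
  have hK : 0 ≤ K := ((hs 0).hasDecay hw).nonneg hw
  have hk := (h.pdo.mul_fmul hmt).isKer (fun x => (hs x).isMult.two) fun x => (hs x).isMult.one
  have hd : ∀ x y, ‖𝓕⁻ (fun η => σ x η * m η) (x - y)‖ ≤ K * w * bracket 1 w (x - y) :=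
    fun x y => ((hs x).hasDecay hw).norm_le _
  refine ⟨hk, hK, fun x y => ?_, norm_le_of_decay hk hw hd⟩
  by_cases hx : x ∈ Ioo 1 (4 * r)
  · rw [indicator_of_mem hx]
    exact hd x y
  · rw [indicator_of_notMem hx, fourierInv_eq_ph]
    simp only [h.zero x hx, zero_mul, mul_zero, integral_zero, norm_zero, le_refl]

theorem IsLocPdo.isSob_mul_cut (h : IsLocPdo A σ N W r) {w : ℝ} (hw : 0 < w) (hW : w ≤ W) (c x : ℝ) :
    IsSob (fun η => σ x η * cut c w η) (20 * (N * cutConst)) w := by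
  have h1 := (((h.slow x).of_le hw.le hW).mul (isSlow_cut c hw le_rfl) hw.le).isSob (c := c)
    (R := 5 / 4 * w) hw (by positivity) fun η hη => by rw [cut_eq_zero hw hη.le, mul_zero]
  -- A support of half-length 5w/4 contributes 5, Leibniz's rule 4.
  have e : 4 * (5 / 4 * w) / w * (4 * (N * cutConst)) = 20 * (N * cutConst) := by
    field_simp
    ring
  rwa [e] at h1

theorem memLp_top_cut (c : ℝ) {R : ℝ} : MemLp (cut c R) ⊤ volume :=
  memLp_top_of_bound (contDiff_cut c R (n := 0)).continuous.aestronglyMeasurable 1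
    (Filter.Eventually.of_forall (norm_cut_le_one c R))

theorem IsLocPdo.traceBound_cut (h : IsLocPdo A σ N W r) {w : ℝ} (hw : 0 < w) (hW : w ≤ W)
    (hr : 1 ≤ r) (c : ℝ) :
    TraceBound (A * fmul (cut c w))
      (pdoConst * (1 + w * r) * (20 * (N * cutConst) * (10 * cutConst))) := by
  obtain ⟨h1, h2, h3, -⟩ := h.kernel (memLp_top_cut c) (h.isSob_mul_cut hw hW c) hw
  -- The wider bump equals 1 where `cut c w` is nonzero, so it can be inserted on the right for
  -- free.
  have hz := isSob_cut c (R := 5 / 4 * w) hw (by linarith) (by linarith)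
  refine traceBound_pdo h1 (stronglyMeasurable_kernel h.meas
    (contDiff_cut c w (n := 0)).continuous) hw hr h2 (fun x y => (h3 x y).trans ?_)
    hz.isMult (hz.hasDecay hw) ?_
  · refine indicator_le_indicator_of_subset Ioo_subset_Icc_self (fun _ => ?_) x
    have := (bracket_pos 1 w (x - y)).le
    positivity
  · rw [mul_assoc, fmul_mul (memLp_top_cut c) (memLp_top_cut c)]
    congr 2
    ext η
    exact cut_mul_cut hw le_rfl η

/-- The trace of the localization of `A` at an isolated boundary point of `Ω`. -/
theorem IsLocPdo.opTrace_cut_sub_le (h : IsLocPdo A σ N W r) {w : ℝ} (hw : 1 ≤ w) (hW : w ≤ W)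
    (hr : 1 ≤ r) {c : ℝ} {Ω S : Set ℝ} (hΩ : MeasurableSet Ω) (hS : IsHalfLine c S)
    (hΩS : ∀ η, |η - c| < 2 * w → (η ∈ Ω ↔ η ∈ S)) {p : ℕ} (hp : 1 ≤ p) :
    ‖opTrace (A * fmul (cut c w) * powTrunc p Ω) -
      (coeffA (fun t => t ^ p - t) 1 : ℂ) * ∫ x, σ x c / x‖ ≤
      (20 * (N * cutConst)) * (modelConst * (4 * Real.pi * p * bracketInt 1) +
        bracketInt 1 * (4 * (p + 1) * (2 * hankelConst * (10 * cutConst * (10 * cutConst))))) := by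
  have hw0 : 0 < w := by linarith
  obtain ⟨h1, h2, h3, h4⟩ := h.kernel (memLp_top_cut c) (h.isSob_mul_cut hw0 hW c) hw0
  have hT := h.traceBound_cut hw0 hW hr c
  have hmodel := norm_opTrace_halfLine_sub_le (θ := c) h1 (stronglyMeasurable_kernel h.meas
    (contDiff_cut c w (n := 0)).continuous) hw h2 h3
    (fun x => (h.isSob_mul_cut hw0 hW c x).contDiff.continuous)
    (fun x => (h.isSob_mul_cut hw0 hW c x).integrable) hT hS hp
  have hcc : cut c w c = 1 := cut_eq_one hw0 (by simp [hw0.le])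
  simp only [hcc, mul_one] at hmodel
  -- Three nested bumps of radii w, 5w/4 and 25w/16: each is 1 on the support of the previous one.
  -- The middle one, Φ, is supported within 25w/16 of c, inside the range 2w where Ω is the half
  -- line; the outer one is needed for the commutator of Φ with χ₊.
  have hΦt := memLp_top_cut c (R := 5 / 4 * w)
  have hcom := traceBound_commutator_cut (c := c) (R := 25 / 16 * w)
    (isSob_cut c (R := 5 / 4 * w) hw0 (by linarith) (by linarith)) hw0 (by linarith)
    (by linarith) (cut_mul_cut (by positivity) (by linarith))
  have hSm := hS.measurableSet
  have hP : ∀ {S : Set ℝ}, MeasurableSet S → ‖fmul (S.indicator fun _ => (1 : ℂ))‖ ≤ 1 :=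
    fun {S} hS => norm_fmul_le (memLp_top_indicator hS) zero_le_one (norm_indicator_one_le S)
  have hcm : ∀ {S : Set ℝ}, MeasurableSet S → fmul (cut c (5 / 4 * w)) *
      fmul (S.indicator fun _ => (1 : ℂ)) = fmul (S.indicator fun _ => (1 : ℂ)) *
      fmul (cut c (5 / 4 * w)) := fun {S} hS => by
    rw [fmul_mul hΦt (memLp_top_indicator hS), fmul_mul (memLp_top_indicator hS) hΦt]
    simp only [mul_comm]
  have hΦ : fmul (cut c (5 / 4 * w)) * fmul (Ω.indicator fun _ => (1 : ℂ)) =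
      fmul (S.indicator fun _ => (1 : ℂ)) * fmul (cut c (5 / 4 * w)) := by
    rw [← hcm hSm, fmul_mul hΦt (memLp_top_indicator hΩ), fmul_mul hΦt (memLp_top_indicator hSm)]
    congr 1
    ext η
    rcases le_or_gt (5 / 4 * (5 / 4 * w)) |η - c| with h | h
    · rw [cut_eq_zero (by positivity) h, zero_mul, zero_mul]
    · congr 1
      by_cases hη : η ∈ S
      · rw [indicator_of_mem hη, indicator_of_mem ((hΩS η (by linarith)).2 hη)]
      · rw [indicator_of_notMem hη, indicator_of_notMem fun h5 => hη ((hΩS η (by linarith)).1 h5)]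
  have hloc := traceBound_localize (norm_chiOp_le measurableSet_Ioi) (hP hΩ) (hP hSm) hΦ (hcm hSm)
    hcom p
  have hAΦ : A * fmul (cut c w) * fmul (cut c (5 / 4 * w)) = A * fmul (cut c w) := by
    rw [mul_assoc, fmul_mul (memLp_top_cut c) hΦt]
    congr 2
    ext η
    exact cut_mul_cut hw0 le_rfl η
  have hdiff : TraceBound (A * fmul (cut c w) * (powTrunc p Ω - powTrunc p S)) _ :=
    TraceBound.mono (A := _) (by
      have := hloc.mul_left_le hloc.nonneg h4
      rw [← mul_assoc, hAΦ] at this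
      exact this) le_rfl
  have hsplit : A * fmul (cut c w) * powTrunc p Ω = A * fmul (cut c w) * powTrunc p S +
      A * fmul (cut c w) * (powTrunc p Ω - powTrunc p S) := by
    rw [← mul_add, add_sub_cancel]
  rw [hsplit, opTrace_add (hT.mul_right _).isTraceClass hdiff.isTraceClass, add_sub_right_comm]
  refine (norm_add_le _ _).trans ((add_le_add hmodel hdiff.norm_opTrace_le).trans (le_of_eq ?_))
  ring

/-- The part of `A` away from the boundary points of `Ω`. -/
theorem IsLocPdo.traceBound_rest (h : IsLocPdo A σ N W r) (hW : 0 < W) {b : ℝ → ℂ} {K : ℝ}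
    (hb : IsSob b K W) (hbz : ∀ η, b η * cut 0 (5 / 4 * W) η = b η) {Ω : Set ℝ}
    (hΩ : MeasurableSet Ω) (hf : ∀ η ∈ frontier Ω, b =ᶠ[nhds η] 0) {p : ℕ} (hp : 1 ≤ p) :
    TraceBound (A * fmul b * powTrunc p Ω)
      (4 * N * bracketInt 1 * (p * (4 * hankelConst * (K * (10 * cutConst))))) := by
  -- The trivial multiplier 1 gives the operator norm of A itself, by Schur's test.
  have hσ : ∀ x, IsSob (fun η => σ x η * 1) (4 * N) W := fun x => by
    have h1 := (h.slow x).isSob (c := 0) (R := W) hW hW.le fun η hη => h.supp x η (by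
      rw [sub_zero] at hη
      exact hη.le)
    simpa [hW.ne'] using h1
  obtain ⟨-, -, -, h4⟩ := h.kernel memLp_top_one hσ hW
  rw [fmul_one, mul_one] at h4
  -- The product of b with the indicator of Ω is as smooth as b, with the same constant, so its
  -- commutator with χ₊ obeys the same bound.
  have hb' := hb.indicator hf
  have c1 := traceBound_commutator_cut (c := 0) (R := 5 / 4 * W) hb hW (by linarith) (by linarith)
    hbz
  have c2 := traceBound_commutator_cut (c := 0) (R := 5 / 4 * W) hb' hW (by linarith) (by linarith)
    (fun η => by rw [mul_right_comm, hbz])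
  have hΩt := memLp_top_indicator hΩ
  rw [← fmul_mul hb.isMult.top hΩt] at c2
  have hχ := measurableSet_Ioi (a := (0 : ℝ))
  have key := traceBound_mul_pow_sub (norm_chiOp_le hχ)
    (norm_fmul_le hΩt zero_le_one (norm_indicator_one_le Ω)) (chiOp_mul_self hχ)
    (by
      rw [fmul_mul hΩt hΩt]
      congr 1
      ext η
      by_cases hη : η ∈ Ω
      · simp [hη]
      · simp [hη])
    (by
      rw [← chiOp_compl hχ]
      exact norm_chiOp_le hχ.compl) c1 c2 hp
  have := key.mul_left_le key.nonneg h4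
  rw [← mul_assoc] at this
  exact this.mono (le_of_eq (by ring))

end LocalPieces

/-! ### Partition in frequency around the boundary points -/

section Partition

theorem opTrace_zero {H : Type*} [NormedAddCommGroup H] [InnerProductSpace ℂ H] [CompleteSpace H] :
    opTrace (0 : H →L[ℂ] H) = 0 := by
  simp [opTrace]

theorem isTraceClass_sum {H : Type*} [NormedAddCommGroup H] [InnerProductSpace ℂ H]
    [CompleteSpace H] {ι : Type*} (s : Finset ι) {X : ι → H →L[ℂ] H} {k : ι → ℝ}
    (h : ∀ i ∈ s, TraceBound (X i) (k i)) : opTrace (∑ i ∈ s, X i) = ∑ i ∈ s, opTrace (X i) := by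
  classical
  induction s using Finset.induction_on with
  | empty => rw [Finset.sum_empty, Finset.sum_empty, opTrace_zero]
  | insert i s hi ih =>
    have h1 : ∀ j ∈ s, TraceBound (X j) (k j) := fun j hj => h j (Finset.mem_insert_of_mem hj)
    rw [Finset.sum_insert hi, Finset.sum_insert hi,
      opTrace_add (h i (Finset.mem_insert_self i s)).isTraceClass (TraceBound.sum s h1).isTraceClass,
      ih h1]

theorem fmul_sub_sum {ι : Type*} (s : Finset ι) {m : ℝ → ℂ} {f : ι → ℝ → ℂ}
    (hm : MemLp m ⊤ volume) (hf : ∀ i ∈ s, MemLp (f i) ⊤ volume) :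
    MemLp (fun η => m η - ∑ i ∈ s, f i η) ⊤ volume ∧
      fmul (fun η => m η - ∑ i ∈ s, f i η) = fmul m - ∑ i ∈ s, fmul (f i) := by
  classical
  induction s using Finset.induction_on with
  | empty => simpa using hm
  | insert i s hi ih =>
    obtain ⟨h1, h2⟩ := ih fun j hj => hf j (Finset.mem_insert_of_mem hj)
    have h3 := hf i (Finset.mem_insert_self i s)
    have e : (fun η => m η - ∑ j ∈ insert i s, f j η) =
        fun η => (m η - ∑ j ∈ s, f j η) - f i η := by
      ext η
      rw [Finset.sum_insert hi]
      ring
    rw [e]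
    refine ⟨h1.sub h3, ?_⟩
    rw [← fmul_sub h1 h3, h2, Finset.sum_insert hi]
    abel

/-- The boundary points `c i` of `Ω` in `[-5W/4, 5W/4]`, with spacings `d i`. -/
structure IsLocallyHalfLine {ι : Type*} (s : Finset ι) (c d : ι → ℝ) (W : ℝ) (Ω : Set ℝ) :
    Prop where
  meas : MeasurableSet Ω
  pos : ∀ i ∈ s, 0 < d i
  le : ∀ i ∈ s, d i ≤ 4 * W
  sep : ∀ i ∈ s, ∀ j ∈ s, i ≠ j → d i ≤ |c i - c j|
  half : ∀ i ∈ s, ∃ S, IsHalfLine (c i) S ∧ ∀ η, |η - c i| < d i / 8 → (η ∈ Ω ↔ η ∈ S)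
  reg : ∀ η ∈ frontier Ω, |η| ≤ 5 / 4 * W → ∃ i ∈ s, η = c i

variable {ι : Type*} {s : Finset ι} {c d : ι → ℝ} {W : ℝ} {Ω : Set ℝ}

/-- The part of the cutoff to `[-W, W]` away from the boundary points. -/
def restCut (s : Finset ι) (c d : ι → ℝ) (W η : ℝ) : ℂ :=
  cut 0 W η - ∑ i ∈ s, cut 0 W η * cut (c i) (d i / 16) η

/-- Each removed bump is controlled at its own scale d_i/16 and then rescaled to W, which multiplies
its constant by 16W/d_i. -/
theorem IsLocallyHalfLine.isSob_restCut (h : IsLocallyHalfLine s c d W Ω) (hW : 0 < W) :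
    IsSob (restCut s c d W)
      (10 * cutConst + ∑ i ∈ s, 20 * (cutConst * cutConst) * (W / (d i / 16))) W := by
  refine (isSob_cut 0 hW le_rfl (by linarith)).sub_sum s fun i hi => ?_
  have hd : 0 < d i / 16 := div_pos (h.pos i hi) (by norm_num)
  have hdW : d i / 16 ≤ W := by linarith [h.le i hi]
  have h1 := ((isSlow_cut 0 hd hdW).mul (isSlow_cut (c i) hd le_rfl) hd.le).isSob (c := c i)
    (R := 5 / 4 * (d i / 16)) hd (by positivity)
    fun η hη => by rw [cut_eq_zero hd hη.le, mul_zero]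
  have e : 4 * (5 / 4 * (d i / 16)) / (d i / 16) * (4 * (cutConst * cutConst)) =
      20 * (cutConst * cutConst) := by
    generalize d i / 16 = w at hd
    field_simp
    ring
  rw [e] at h1
  exact h1.rescale hd hdW

theorem restCut_mul_cut (hW : 0 < W) (η : ℝ) :
    restCut s c d W η * cut 0 (5 / 4 * W) η = restCut s c d W η := by
  have h := cut_mul_cut (c := 0) hW le_rfl η
  rw [restCut, sub_mul, h, Finset.sum_mul]
  congr 1
  refine Finset.sum_congr rfl fun i _ => ?_
  rw [mul_right_comm, h]

/-- Near a boundary point within 5W/4 its own bump equals 1, and the others vanish since radii d/16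
are far below the separation; farther out the global cutoff is already 0. -/
theorem IsLocallyHalfLine.restCut_eventually_zero (h : IsLocallyHalfLine s c d W Ω) (hW : 0 < W) :
    ∀ η ∈ frontier Ω, restCut s c d W =ᶠ[nhds η] 0 := by
  intro η hη
  rcases le_or_gt |η| (5 / 4 * W) with h1 | h1
  · obtain ⟨i, hi, rfl⟩ := h.reg η hη h1
    have hd : ∀ j ∈ s, 0 < d j / 16 := fun j hj => div_pos (h.pos j hj) (by norm_num)
    have hnear : ∀ᶠ t in nhds (c i), |t - c i| < d i / 16 := by
      have := Metric.ball_mem_nhds (c i) (hd i hi)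
      filter_upwards [this] with t ht
      rwa [Metric.mem_ball, Real.dist_eq] at ht
    filter_upwards [hnear] with t ht
    have hz : ∀ j ∈ s, j ≠ i → cut 0 W t * cut (c j) (d j / 16) t = 0 := fun j hj hji => by
      have h2 := h.sep i hi j hj hji.symm
      have h3 := h.sep j hj i hi hji
      have h4 : |c i - c j| ≤ |t - c i| + |t - c j| := by
        have := abs_sub_le (c i) t (c j)
        rwa [abs_sub_comm (c i) t] at this
      rw [abs_sub_comm] at h3
      rw [cut_eq_zero (hd j hj) (by linarith [hd j hj, hd i hi]), mul_zero]
    rw [restCut, Finset.sum_eq_single_of_mem i hi hz, cut_eq_one (hd i hi) ht.le, mul_one, sub_self]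
    rfl
  · have hopen : ∀ᶠ t in nhds η, 5 / 4 * W < |t| :=
      (isOpen_lt continuous_const continuous_abs).mem_nhds h1
    filter_upwards [hopen] with t ht
    have : cut 0 W t = 0 := cut_eq_zero hW (by rw [sub_zero]; exact ht.le)
    rw [restCut, this]
    simp

variable {A : L2R →L[ℂ] L2R} {σ : ℝ → ℝ → ℂ} {N r : ℝ}

/-- The global cutoff is invisible to A, so the factor `cut 0 W`, present on the bumps inside
`restCut`, can be dropped from the local pieces. -/
theorem IsLocPdo.decompose (h : IsLocPdo A σ N W r) (hW : 0 < W) (s : Finset ι) (c d : ι → ℝ) :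
    A = ∑ i ∈ s, A * fmul (cut (c i) (d i / 16)) + A * fmul (restCut s c d W) := by
  have hσ : ∀ x η, σ x η * cut 0 W η = σ x η := fun x η => by
    rcases le_or_gt W |η| with h1 | h1
    · rw [h.supp x η h1, zero_mul]
    · rw [cut_eq_one hW (by rw [sub_zero]; exact h1.le), mul_one]
  have e0 : A * fmul (cut 0 W) = A := by
    refine IsPdo.unique (h.pdo.mul_fmul (memLp_top_cut 0)) ?_
    simpa only [hσ] using h.pdo
  have hmt : ∀ i, MemLp (fun η => cut 0 W η * cut (c i) (d i / 16) η) ⊤ volume := fun i =>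
    memLp_mul_top (memLp_top_cut 0) (memLp_top_cut (c i))
  have e1 : ∀ i, A * fmul (fun η => cut 0 W η * cut (c i) (d i / 16) η) =
      A * fmul (cut (c i) (d i / 16)) := fun i => by
    rw [← fmul_mul (memLp_top_cut 0) (memLp_top_cut (c i)), ← mul_assoc, e0]
  have e2 : fmul (restCut s c d W) = fmul (cut 0 W) -
      ∑ i ∈ s, fmul (fun η => cut 0 W η * cut (c i) (d i / 16) η) :=
    (fmul_sub_sum s (memLp_top_cut 0) fun i _ => hmt i).2
  rw [e2, mul_sub, e0, Finset.mul_sum, Finset.sum_congr rfl fun i _ => e1 i, add_sub_cancel]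

/-- The constant for the trace at a boundary point with large spacing. -/
def pointConst (p : ℕ) : ℝ := (20 * cutConst) * (modelConst * (4 * Real.pi * p * bracketInt 1) +
  bracketInt 1 * (4 * (p + 1) * (2 * hankelConst * (10 * cutConst * (10 * cutConst)))))

/-- The constant for the trace at a boundary point with small spacing. -/
def smallConst : ℝ := 4 * (pdoConst * (20 * cutConst * (10 * cutConst)))

/-- The constant for the part away from the boundary points. -/
def restConst (p : ℕ) : ℝ := 4 * bracketInt 1 * (p * (4 * hankelConst * (10 * cutConst)))

theorem pointConst_nonneg (p : ℕ) : 0 ≤ pointConst p := by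
  have := cutConst_nonneg
  have := modelConst_nonneg
  have := bracketInt_nonneg 1
  have := hankelConst_nonneg
  have := Real.pi_pos
  unfold pointConst
  positivity

theorem smallConst_nonneg : 0 ≤ smallConst := by
  have := cutConst_nonneg
  have := pdoConst_nonneg
  unfold smallConst
  positivity

theorem restConst_nonneg (p : ℕ) : 0 ≤ restConst p := by
  have := cutConst_nonneg
  have := bracketInt_nonneg 1
  have := hankelConst_nonneg
  unfold restConst
  positivity

/-- Trace of `A g(T)`, in terms of the boundary points with spacing at least `16`. -/
theorem IsLocPdo.opTrace_powTrunc_sub_le (h : IsLocPdo A σ N W r) (hW : 0 < W) (hr : 1 ≤ r)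
    (hΩ : IsLocallyHalfLine s c d W Ω) {p : ℕ} (hp : 1 ≤ p) :
    IsTraceClass (A * powTrunc p Ω) ∧
    ‖opTrace (A * powTrunc p Ω) - ∑ i ∈ s, (if 1 ≤ d i / 16 then
      (coeffA (fun t => t ^ p - t) 1 : ℂ) * ∫ x, σ x (c i) / x else 0)‖ ≤
      N * (∑ i ∈ s, (if 1 ≤ d i / 16 then pointConst p else smallConst * r) +
        restConst p * (10 * cutConst +
          ∑ i ∈ s, 20 * (cutConst * cutConst) * (W / (d i / 16)))) := by
  have hd : ∀ i ∈ s, 0 < d i / 16 := fun i hi => div_pos (hΩ.pos i hi) (by norm_num)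
  have hdW : ∀ i ∈ s, d i / 16 ≤ W := fun i hi => by linarith [hΩ.le i hi]
  have hN : 0 ≤ N := (h.slow 0).nonneg
  have hX : ∀ i ∈ s, TraceBound (A * fmul (cut (c i) (d i / 16)) * powTrunc p Ω)
      (2 * (pdoConst * (1 + d i / 16 * r) * (20 * (N * cutConst) * (10 * cutConst)))) :=
    fun i hi => by
      have h1 := h.traceBound_cut (hd i hi) (hdW i hi) hr (c i)
      exact h1.mul_right_le h1.nonneg (norm_powTrunc_le hΩ.meas p)
  have hY := h.traceBound_rest hW (hΩ.isSob_restCut hW) (restCut_mul_cut hW) hΩ.meas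
    (hΩ.restCut_eventually_zero hW) hp
  have e : A * powTrunc p Ω = ∑ i ∈ s, A * fmul (cut (c i) (d i / 16)) * powTrunc p Ω +
      A * fmul (restCut s c d W) * powTrunc p Ω := by
    rw [← Finset.sum_mul, ← add_mul, ← h.decompose hW s c d]
  have hS := TraceBound.sum s hX
  rw [e]
  refine ⟨(hS.add hY).isTraceClass, ?_⟩
  rw [opTrace_add hS.isTraceClass hY.isTraceClass, isTraceClass_sum s hX, add_sub_right_comm,
    ← Finset.sum_sub_distrib, mul_add, Finset.mul_sum]
  refine (norm_add_le _ _).trans (add_le_add ((norm_sum_le _ _).trans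
    (Finset.sum_le_sum fun i hi => ?_)) (hY.norm_opTrace_le.trans (le_of_eq ?_)))
  -- A bump of width w = d_i/16 ≥ 1 is compared with the half-line model, valid within 2w = d_i/8.
  -- For w < 1 only the trace norm is used, and 1 + wr ≤ 2r.
  · split_ifs with hi1
    · obtain ⟨S, hS, hΩS⟩ := hΩ.half i hi
      refine (h.opTrace_cut_sub_le hi1 (hdW i hi) hr hΩ.meas hS (fun η hη => hΩS η ?_) hp).trans
        (le_of_eq ?_)
      · linarith
      · rw [pointConst]
        ring
    · rw [sub_zero]
      refine (hX i hi).norm_opTrace_le.trans ?_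
      have hC := smallConst_nonneg
      have h1 : 1 + d i / 16 * r ≤ 2 * r := by
        rw [not_le] at hi1
        nlinarith [hd i hi]
      calc _ = N * (smallConst / 2 * (1 + d i / 16 * r)) := by rw [smallConst]; ring
        _ ≤ N * (smallConst / 2 * (2 * r)) := by gcongr
        _ = _ := by ring
  · rw [restConst]
    ring

end Partition

/-! ### Elementary bounds for the spacings -/

section Spacing

variable {ρ : ℝ} {X : Finset ℝ}

theorem spacing_le_abs_sub {x y : ℝ} (hx : x ∈ X) (hy : y ∈ X) (hxy : x ≠ y) :
    spacing ρ X x ≤ |x - y| := by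
  have h1 : X.card ≠ 1 := fun h => by
    obtain ⟨z, hz⟩ := Finset.card_eq_one.1 h
    rw [hz, Finset.mem_singleton] at hx hy
    exact hxy (hx.trans hy.symm)
  rw [spacing, if_neg h1, ← Real.dist_eq]
  exact Metric.infDist_le_dist_of_mem ⟨hy, fun h => hxy h.symm⟩

theorem exists_ne_of_card_ne_one {x : ℝ} (hx : x ∈ X) (h : X.card ≠ 1) : ∃ y ∈ X, y ≠ x := by
  have : 1 < X.card := by
    have := Finset.card_pos.2 ⟨x, hx⟩
    omega
  obtain ⟨y, hy, hyx⟩ := Finset.exists_mem_ne this x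
  exact ⟨y, hy, hyx⟩

theorem spacing_pos (hρ : 0 < ρ) {x : ℝ} (hx : x ∈ X) : 0 < spacing ρ X x := by
  rw [spacing]
  split_ifs with h
  · positivity
  · obtain ⟨y, hy, hyx⟩ := exists_ne_of_card_ne_one hx h
    have hc : IsClosed ((X : Set ℝ) \ {x}) := (X.finite_toSet.subset sdiff_subset).isClosed
    exact (hc.notMem_iff_infDist_pos ⟨y, hy, hyx⟩).1 fun h => h.2 rfl

theorem spacing_le (hX : ∀ x ∈ X, x ∈ Ioo (-(2 * ρ)) (2 * ρ)) {x : ℝ} (hx : x ∈ X) :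
    spacing ρ X x ≤ 4 * ρ := by
  by_cases h : X.card = 1
  · rw [spacing, if_pos h]
  · obtain ⟨y, hy, hyx⟩ := exists_ne_of_card_ne_one hx h
    refine (spacing_le_abs_sub hx hy hyx.symm).trans (abs_le.2 ⟨?_, ?_⟩)
    · linarith [(hX x hx).1, (hX y hy).2]
    · linarith [(hX x hx).2, (hX y hy).1]

end Spacing

/-! ### Geometry of unions of intervals near an end point -/

section Intervals

/-- A connected set that avoids the boundary lies entirely in the interior or entirely in the
exterior. -/
theorem subset_or_disjoint_of_frontier {C I : Set ℝ} (hC : IsPreconnected C)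
    (h : ∀ t ∈ C, t ∉ frontier I) : C ⊆ I ∨ Disjoint C I := by
  have hcov : C ⊆ interior I ∪ (closure I)ᶜ := fun t ht => by
    by_cases hi : t ∈ interior I
    · exact Or.inl hi
    · exact Or.inr fun hc => h t ht ⟨hc, hi⟩
  have hdis : Disjoint (interior I) (closure I)ᶜ :=
    disjoint_compl_right.mono_left interior_subset_closure
  by_cases hne : (C ∩ interior I).Nonempty
  · exact Or.inl ((hC.subset_left_of_subset_union isOpen_interior isClosed_closure.isOpen_compl
      hdis hcov hne).trans interior_subset)
  · refine Or.inr (disjoint_left.2 fun t ht htI => ?_)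
    rcases hcov ht with h1 | h1
    · exact hne ⟨t, ht, h1⟩
    · exact h1 (subset_closure htI)

theorem subset_Ioi_or_Iio {I : Set ℝ} (hI : I.OrdConnected) {x : ℝ} (hx : x ∉ I) :
    I ⊆ Ioi x ∨ I ⊆ Iio x := by
  by_contra hcon
  rw [not_or, not_subset, not_subset] at hcon
  obtain ⟨⟨a, ha, hax⟩, b, hb, hbx⟩ := hcon
  exact hx (hI.out ha hb ⟨not_lt.1 hax, not_lt.1 hbx⟩)

/-- Near an isolated end point, a disjoint union of open intervals is a half line. -/
theorem exists_isHalfLine {ι : Type*} {I : ι → Set ℝ} (hI : ∀ j, IsOpenInterval (I j))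
    (hd : ∀ j s, j ≠ s → Disjoint (closure (I j)) (closure (I s))) {x ε : ℝ} (hε : 0 < ε)
    (hx : x ∈ ⋃ j, frontier (I j))
    (hiso : ∀ t, |t - x| < ε → t ≠ x → t ∉ ⋃ j, frontier (I j)) :
    ∃ S, IsHalfLine x S ∧ ∀ t, |t - x| < ε → (t ∈ ⋃ j, I j ↔ t ∈ S) := by
  obtain ⟨j, hj⟩ := mem_iUnion.1 hx
  have hxj : x ∉ I j := fun h => by
    rw [(hI j).1.frontier_eq] at hj
    exact hj.2 h
  have hxc : x ∈ closure (I j) := frontier_subset_closure hj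
  have hball : ∀ t, t ∈ Ioo (x - ε) (x + ε) ↔ |t - x| < ε := fun t => by
    rw [abs_lt, mem_Ioo]
    constructor <;> rintro ⟨h1, h2⟩ <;> constructor <;> linarith
  -- The ball is contained in another interval or disjoint from it; containment would put x in two
  -- closures.
  have hother : ∀ i, i ≠ j → ∀ t, |t - x| < ε → t ∉ I i := fun i hij t ht hti => by
    have hxi : x ∉ closure (I i) := fun h => (hd j i hij.symm).le_bot ⟨hxc, h⟩
    rcases subset_or_disjoint_of_frontier (isPreconnected_Ioo (a := x - ε) (b := x + ε)) (I := I i)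
      (fun t ht htf => by
        by_cases htx : t = x
        · rw [htx] at htf
          exact hxi (frontier_subset_closure htf)
        · exact hiso t ((hball t).1 ht) htx (mem_iUnion.2 ⟨i, htf⟩)) with h | h
    · exact hxi (subset_closure (h ⟨by linarith, by linarith⟩))
    · exact h.le_bot ⟨(hball t).2 ht, hti⟩
  have hU : ∀ t, |t - x| < ε → (t ∈ ⋃ j, I j ↔ t ∈ I j) := fun t ht => by
    constructor
    · intro h
      obtain ⟨i, hi⟩ := mem_iUnion.1 h
      by_cases hij : i = j
      · rwa [hij] at hi
      · exact absurd hi (hother i hij t ht)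
    · exact fun h => mem_iUnion.2 ⟨j, h⟩
  obtain ⟨t₀, ht₀, ht₀x⟩ := Metric.mem_closure_iff.1 hxc ε hε
  rw [dist_comm, Real.dist_eq] at ht₀x
  have ht₀' := (hball t₀).2 ht₀x
  -- The interval ending at x lies on one side of x. The half ball on that side meets it and
  -- contains no end point, hence lies inside it.
  rcases subset_Ioi_or_Iio (hI j).2.1 hxj with h | h
  · refine ⟨Ioi x, Or.inl rfl, fun t ht => (hU t ht).trans ⟨fun h1 => h h1, fun h1 => ?_⟩⟩
    have ht' := (hball t).2 ht
    rcases subset_or_disjoint_of_frontier (isPreconnected_Ioo (a := x) (b := x + ε)) (I := I j)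
      (fun t ht htf => hiso t ((hball t).1 ⟨by linarith [ht.1], ht.2⟩) ht.1.ne'
        (mem_iUnion.2 ⟨j, htf⟩)) with h2 | h2
    · exact h2 ⟨h1, ht'.2⟩
    · exact absurd ht₀ fun h3 => h2.le_bot ⟨⟨h ht₀, ht₀'.2⟩, h3⟩
  · refine ⟨Iio x, Or.inr rfl, fun t ht => (hU t ht).trans ⟨fun h1 => h h1, fun h1 => ?_⟩⟩
    have ht' := (hball t).2 ht
    rcases subset_or_disjoint_of_frontier (isPreconnected_Ioo (a := x - ε) (b := x)) (I := I j)
      (fun t ht htf => hiso t ((hball t).1 ⟨ht.1, by linarith [ht.2]⟩) ht.2.ne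
        (mem_iUnion.2 ⟨j, htf⟩)) with h2 | h2
    · exact h2 ⟨ht'.1, h1⟩
    · exact absurd ht₀ fun h3 => h2.le_bot ⟨⟨ht₀'.1, h ht₀⟩, h3⟩

theorem frontier_iUnion_subset_of_finite {ι : Type*} [Finite ι] {I : ι → Set ℝ}
    (hI : ∀ j, IsOpen (I j)) : frontier (⋃ j, I j) ⊆ ⋃ j, frontier (I j) := by
  intro x hx
  rw [(isOpen_iUnion hI).frontier_eq, closure_iUnion_of_finite] at hx
  obtain ⟨j, hj⟩ := mem_iUnion.1 hx.1
  refine mem_iUnion.2 ⟨j, ?_⟩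
  rw [(hI j).frontier_eq]
  exact ⟨hj, fun h => hx.2 (mem_iUnion.2 ⟨j, h⟩)⟩

theorem mem_frontier_congr {S T B : Set ℝ} (hB : IsOpen B) (h : S ∩ B = T ∩ B) {x : ℝ}
    (hx : x ∈ B) (hxS : x ∈ frontier S) : x ∈ frontier T := by
  have h1 : x ∈ frontier S ∩ B := ⟨hxS, hx⟩
  rw [← frontier_inter_open_inter hB, h, frontier_inter_open_inter hB] at h1
  exact h1.1

/-- The set `Ω` of the theorem, rescaled by `κ`, near its boundary points. -/
theorem isLocallyHalfLine_scaled {κ ρ : ℝ} (hκ : 0 < κ) (hρ : 0 < ρ) {Ω : Set ℝ}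
    (hΩ : MeasurableSet Ω) {n : ℕ} {I : Fin n → Set ℝ} (hI : ∀ j, IsOpenInterval (I j))
    (hd : ∀ j s, j ≠ s → Disjoint (closure (I j)) (closure (I s)))
    (hΩI : Ω ∩ Ioo (-(2 * ρ)) (2 * ρ) = (⋃ j, I j) ∩ Ioo (-(2 * ρ)) (2 * ρ))
    {X : Finset ℝ} (hX : (X : Set ℝ) = (⋃ j, frontier (I j)) ∩ Ioo (-(2 * ρ)) (2 * ρ)) :
    IsLocallyHalfLine (X.filter fun ξ => |ξ| ≤ 3 / 2 * ρ) (fun ξ => κ * ξ)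
      (fun ξ => κ * spacing ρ X ξ) (κ * ρ) ((fun η => κ⁻¹ * η) ⁻¹' Ω) := by
  have hXm : ∀ ξ, ξ ∈ X ↔ ξ ∈ (⋃ j, frontier (I j)) ∧ ξ ∈ Ioo (-(2 * ρ)) (2 * ρ) := fun ξ => by
    rw [← Finset.mem_coe, hX]
    rfl
  have hXI : ∀ ξ ∈ X, ξ ∈ Ioo (-(2 * ρ)) (2 * ρ) := fun ξ h => ((hXm ξ).1 h).2
  refine ⟨hΩ.preimage (measurable_const_mul _), fun i hi => ?_, fun i hi => ?_,
    fun i hi j hj hij => ?_, fun i hi => ?_, fun η hη hηW => ?_⟩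
  · exact mul_pos hκ (spacing_pos hρ (Finset.mem_filter.1 hi).1)
  · have := spacing_le hXI (Finset.mem_filter.1 hi).1
    nlinarith
  · rw [← mul_sub, abs_mul, abs_of_pos hκ]
    have := spacing_le_abs_sub (ρ := ρ) (Finset.mem_filter.1 hi).1 (Finset.mem_filter.1 hj).1 hij
    gcongr
  · obtain ⟨hiX, hiρ⟩ := Finset.mem_filter.1 hi
    have h1 := spacing_pos hρ hiX
    have h2 := spacing_le hXI hiX
    -- A spacing is at most 4ρ, so the radius is at most ρ/2; together with |ξ| ≤ 3ρ/2 this stays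
    -- inside (-2ρ, 2ρ), where Ω is known. The bound 3ρ/2 also covers the range 5ρ/4 of the
    -- frequency cutoff.
    have hin : ∀ t, |t - i| < spacing ρ X i / 8 → t ∈ Ioo (-(2 * ρ)) (2 * ρ) := fun t ht => by
      have h3 := abs_lt.1 ht
      have h4 := abs_le.1 hiρ
      exact ⟨by linarith, by linarith⟩
    obtain ⟨S, hS, hSt⟩ := exists_isHalfLine hI hd (show 0 < spacing ρ X i / 8 by linarith)
      ((hXm i).1 hiX).1 fun t ht hti htf => by
        have h3 := spacing_le_abs_sub (ρ := ρ) hiX ((hXm t).2 ⟨htf, hin t ht⟩) hti.symm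
        rw [abs_sub_comm] at h3
        linarith
    have hmem : ∀ t, |t - i| < spacing ρ X i / 8 → (t ∈ Ω ↔ t ∈ S) := fun t ht => by
      rw [← hSt t ht]
      have h3 := hin t ht
      have h4 := Set.ext_iff.1 hΩI t
      constructor
      · exact fun h => (h4.1 ⟨h, h3⟩).1
      · exact fun h => (h4.2 ⟨h, h3⟩).1
    have hS' : IsHalfLine (κ * i) ((fun η => κ⁻¹ * η) ⁻¹' S) := by
      rcases hS with rfl | rfl
      · left
        ext η
        rw [mem_preimage, mem_Ioi, mem_Ioi, ← div_eq_inv_mul, lt_div_iff₀ hκ, mul_comm]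
      · right
        ext η
        rw [mem_preimage, mem_Iio, mem_Iio, ← div_eq_inv_mul, div_lt_iff₀ hκ, mul_comm]
    refine ⟨_, hS', fun η hη => hmem _ ?_⟩
    have e : κ⁻¹ * η - i = κ⁻¹ * (η - κ * i) := by field_simp
    rw [e, abs_mul, abs_of_pos (inv_pos.2 hκ), ← div_eq_inv_mul, div_lt_iff₀ hκ]
    linarith
  · have hη' : κ⁻¹ * η ∈ frontier Ω := by
      have h1 := (Homeomorph.mulLeft₀ κ⁻¹ (inv_ne_zero hκ.ne')).preimage_frontier Ω
      have h2 : η ∈ frontier ((Homeomorph.mulLeft₀ κ⁻¹ (inv_ne_zero hκ.ne')) ⁻¹' Ω) := hη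
      rw [← h1] at h2
      exact h2
    have habs : |κ⁻¹ * η| ≤ 5 / 4 * ρ := by
      rw [abs_mul, abs_of_pos (inv_pos.2 hκ), ← div_eq_inv_mul, div_le_iff₀ hκ]
      linarith
    have hB : κ⁻¹ * η ∈ Ioo (-(2 * ρ)) (2 * ρ) := by
      have := abs_le.1 habs
      exact ⟨by linarith, by linarith⟩
    have h1 := frontier_iUnion_subset_of_finite (fun j => (hI j).1)
      (mem_frontier_congr isOpen_Ioo hΩI hB hη')
    refine ⟨κ⁻¹ * η, Finset.mem_filter.2 ⟨(hXm _).2 ⟨h1, hB⟩, by linarith⟩, ?_⟩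
    field_simp

end Intervals

/-! ### Passage from the α-quantization to the unit scale -/

section Quantization

theorem IsPdo.isLeftPDO {α : ℝ} (hα : 0 < α) {A : L2R →L[ℂ] L2R} {b : ℝ → ℝ → ℂ}
    (h : IsPdo A fun x η => b x ((α / (2 * Real.pi))⁻¹ * η)) : IsLeftPDO α b A := by
  intro u
  have hpi := Real.pi_pos
  have hκ : (0 : ℝ) < α / (2 * Real.pi) := by positivity
  have hF : ((𝓕 (u.toLp 2 volume : L2R) : L2R) : ℝ → ℂ) =ᵐ[volume] 𝓕 (u : ℝ → ℂ) := by
    rw [SchwartzMap.toLp_fourier_eq]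
    filter_upwards [(𝓕 u).coeFn_toLp 2 volume] with η h1
    rw [h1, SchwartzMap.fourier_coe]
  filter_upwards [h (u.toLp 2 volume)] with x hx
  rw [hx]
  have hinner : ∀ ξ : ℝ,
      (∫ y : ℝ, Complex.exp (Complex.I * ((α * (x - y) * ξ : ℝ) : ℂ)) * b x ξ * u y) =
      ph (x * (α / (2 * Real.pi) * ξ)) * b x ξ * 𝓕 (u : ℝ → ℂ) (α / (2 * Real.pi) * ξ) := by
    intro ξ
    rw [fourier_eq_ph, ← integral_const_mul]
    refine integral_congr_ae (Filter.Eventually.of_forall fun y => ?_)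
    have : Complex.exp (Complex.I * ((α * (x - y) * ξ : ℝ) : ℂ)) =
        ph (x * (α / (2 * Real.pi) * ξ)) * ph (-(α / (2 * Real.pi) * ξ * y)) := by
      rw [← ph_add, ph, mul_comm Complex.I]
      congr 3
      field_simp
      ring
    simp only [this]
    ring
  simp only [hinner]
  -- The prefactor α/(2π) is exactly the Jacobian of the substitution η = (α/2π)ξ.
  have hs := Measure.integral_comp_mul_left
    (fun η : ℝ => ph (x * η) * b x ((α / (2 * Real.pi))⁻¹ * η) * 𝓕 (u : ℝ → ℂ) η)
    (α / (2 * Real.pi))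
  rw [abs_of_pos (inv_pos.2 hκ), Complex.real_smul] at hs
  simp only [inv_mul_cancel_left₀ hκ.ne'] at hs
  rw [hs, ← mul_assoc, ← Complex.ofReal_mul, mul_inv_cancel₀ hκ.ne', Complex.ofReal_one, one_mul]
  refine integral_congr_ae ?_
  filter_upwards [hF] with η hη
  rw [hη]

theorem opL_chiSymbol {α : ℝ} (hα : 0 < α) {Ω : Set ℝ} (hΩ : MeasurableSet Ω) :
    opL α (chiSymbol Ω) =
      fmul (((fun η => (α / (2 * Real.pi))⁻¹ * η) ⁻¹' Ω).indicator fun _ => 1) := by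
  have hm : MemLp (fun η : ℝ => Ω.indicator (fun _ => (1 : ℂ)) (2 * Real.pi / α * η)) ⊤
      (volume : Measure ℝ) :=
    memLp_top_chi (Λ := (fun η : ℝ => 2 * Real.pi / α * η) ⁻¹' Ω)
      (hΩ.preimage (measurable_const_mul _))
  have h : IsLeftPDO α (chiSymbol Ω) _ :=
    isLeftPDO_multiplier hα (m := fun ξ => Ω.indicator (fun _ => (1 : ℂ)) ξ) hm
  rw [h.opL_eq, inv_div]
  have e : mulLinf (hm.toLp _) =
      mulOp (((fun η => 2 * Real.pi / α * η) ⁻¹' Ω).indicator fun _ => (1 : ℂ)) := by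
    have hm' : MemLp (((fun η => 2 * Real.pi / α * η) ⁻¹' Ω).indicator fun _ => (1 : ℂ)) ⊤
      (volume : Measure ℝ) := hm
    rw [mulOp, dif_pos hm']
    rfl
  rw [e]
  rfl

theorem truncOp_one {α : ℝ} (hα : 0 < α) {Ω : Set ℝ} (hΩ : MeasurableSet Ω) :
    truncOp α (fun _ _ => 1) (Ioi 0) measurableSet_Ioi Ω =
      halfTrunc ((fun η => (α / (2 * Real.pi))⁻¹ * η) ⁻¹' Ω) := by
  have hm := memLp_top_indicator (hΩ.preimage (measurable_const_mul (α / (2 * Real.pi))⁻¹))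
  rw [truncOp, opL_one hα, mul_one, opL_chiSymbol hα hΩ, mulChi_eq_mulOp, halfTrunc, chiOp,
    mul_assoc (mulOp _), fmul_mul hm hm]
  congr 3
  refine funext fun η => ?_
  by_cases h : η ∈ (fun η => (α / (2 * Real.pi))⁻¹ * η) ⁻¹' Ω
  · rw [indicator_of_mem h, one_mul]
  · rw [indicator_of_notMem h, mul_zero]

/-- The decaying kernel, restricted to bounded x, is Hilbert-Schmidt; boundedness of the operator
needs nothing more. -/
theorem exists_isPdo_of_isSlow {σ : ℝ → ℝ → ℂ} {N W r : ℝ} (hW : 0 < W)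
    (meas : StronglyMeasurable (Function.uncurry σ)) (slow : ∀ x, IsSlow (σ x) N W)
    (supp : ∀ x η, W ≤ |η| → σ x η = 0)
    (zero : ∀ x, x ∉ Ioo 1 (4 * r) → ∀ η, σ x η = 0) : ∃ A, IsPdo A σ := by
  have hs : ∀ x, IsSob (σ x) (4 * W / W * N) W := fun x =>
    (slow x).isSob (c := 0) hW hW.le fun η h => supp x η (by simpa using h.le)
  have hm := stronglyMeasurable_kernel meas (m := fun _ => 1) continuous_const
  simp only [mul_one] at hm
  obtain ⟨K, hK⟩ := exists_isHS_of_decay (R := 4 * r) (K := 4 * W / W * N) hm hW fun x y => by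
    by_cases hx : x ∈ Ioo 1 (4 * r)
    · rw [indicator_of_mem hx]
      exact ((hs x).hasDecay hW).norm_le _
    · rw [indicator_of_notMem hx, fourierInv_eq_ph]
      simp [zero x hx]
  obtain ⟨A, hA, -⟩ := hK.exists_isKer
  exact ⟨A, hA.isPdo (fun x => (hs x).isMult.two) fun x => (hs x).isMult.one⟩

end Quantization

/-! ### From the symbol class to the localized operator -/

section Symbols

variable {a : ℝ → ℝ → ℂ} {L ρ : ℝ}

/-- The norm is a real supremum and bounds its members only when the family is bounded above; the
bound is the sum over the finitely many orders. -/
theorem IsSymbol.le_symbolNorm {n m : ℕ} (ha : IsSymbol n m a) (hL : 0 ≤ L) (hρ : 0 ≤ ρ) {i j : ℕ}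
    (hi : i ≤ n) (hj : j ≤ m) (x ξ : ℝ) :
    L ^ i * ρ ^ j * ‖mixedDeriv i j a x ξ‖ ≤ symbolNorm n m a L ρ := by
  choose! M hM using ha.bounded_deriv
  have hb : BddAbove (range fun q : (Fin (n + 1) × Fin (m + 1)) × (ℝ × ℝ) =>
      L ^ (q.1.1 : ℕ) * ρ ^ (q.1.2 : ℕ) * ‖mixedDeriv q.1.1 q.1.2 a q.2.1 q.2.2‖) := by
    refine ⟨∑ t : Fin (n + 1) × Fin (m + 1), L ^ (t.1 : ℕ) * ρ ^ (t.2 : ℕ) * |M t.1 t.2|, ?_⟩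
    rintro _ ⟨⟨t, z⟩, rfl⟩
    have h1 := hM t.1 (by omega) t.2 (by omega) z.1 z.2
    refine le_trans ?_ (Finset.single_le_sum
      (f := fun t : Fin (n + 1) × Fin (m + 1) => L ^ (t.1 : ℕ) * ρ ^ (t.2 : ℕ) * |M t.1 t.2|)
      (fun t _ => by positivity) (Finset.mem_univ t))
    exact mul_le_mul_of_nonneg_left (h1.trans (le_abs_self _)) (by positivity)
  exact le_ciSup hb ((⟨i, by omega⟩, ⟨j, by omega⟩), (x, ξ))

theorem mixedDeriv_zero_left (j : ℕ) (x ξ : ℝ) : mixedDeriv 0 j a x ξ = iteratedDeriv j (a x) ξ := by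
  rw [mixedDeriv, iteratedDeriv_zero]

theorem IsSymbol.norm_le (ha : IsSymbol 2 2 a) (hL : 0 ≤ L) (hρ : 0 ≤ ρ) (x ξ : ℝ) :
    ‖a x ξ‖ ≤ symbolNorm 2 2 a L ρ := by
  simpa [mixedDeriv_zero_left] using
    ha.le_symbolNorm hL hρ (i := 0) (j := 0) (by norm_num) (by norm_num) x ξ

theorem IsSymbol.isSlow (ha : IsSymbol 2 2 a) (hL : 0 ≤ L) (hρ : 0 < ρ) {κ : ℝ} (hκ : 0 < κ)
    {t : ℝ} (ht0 : 0 ≤ t) (ht1 : t ≤ 1) (x : ℝ) :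
    IsSlow (fun η => (t : ℂ) * a x (κ⁻¹ * η)) (symbolNorm 2 2 a L ρ) (κ * ρ) := by
  have hc : ContDiff ℝ 2 fun η => a x (κ⁻¹ * η) :=
    (ha.contDiff_xi x).comp (contDiff_const.mul contDiff_id)
  refine ⟨contDiff_const.mul hc, fun i hi η => ?_⟩
  have hd : iteratedDeriv i (fun η => (t : ℂ) * a x (κ⁻¹ * η)) η =
      t * (κ⁻¹ ^ i • iteratedDeriv i (a x) (κ⁻¹ * η)) := by
    have hi' : (i : WithTop ℕ∞) ≤ 2 := by exact_mod_cast hi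
    rw [iteratedDeriv_const_mul_field,
      iteratedDeriv_comp_const_smul ((ha.contDiff_xi x).of_le hi') κ⁻¹]
  have h1 := ha.le_symbolNorm hL hρ.le (i := 0) (j := i) (by norm_num) hi x (κ⁻¹ * η)
  rw [pow_zero, one_mul, mixedDeriv_zero_left] at h1
  rw [hd, norm_mul, norm_smul, Complex.norm_real, Real.norm_of_nonneg ht0,
    Real.norm_of_nonneg (by positivity)]
  have e : (κ * ρ) ^ i * (t * (κ⁻¹ ^ i * ‖iteratedDeriv i (a x) (κ⁻¹ * η)‖)) =
      t * (ρ ^ i * ‖iteratedDeriv i (a x) (κ⁻¹ * η)‖) := by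
    rw [mul_pow, inv_pow]
    field_simp
  rw [e]
  exact (mul_le_of_le_one_left (by positivity) ht1).trans h1

/-- The mean value inequality, with one x-derivative bounded by the symbol norm over L. -/
theorem IsSymbol.norm_sub_le (ha : IsSymbol 2 2 a) (hL : 0 < L) (hρ : 0 ≤ ρ) {x : ℝ} (hx : 0 < x)
    (ξ : ℝ) : ‖a x ξ - a 0 ξ‖ ≤ symbolNorm 2 2 a L ρ * (x / L) := by
  have hd : Differentiable ℝ fun x => a x ξ := by
    have := ha.contDiff_x 0 (by norm_num) ξ
    simp only [iteratedDeriv_zero] at this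
    exact this.differentiable (by norm_num)
  have hb : ∀ t ∈ (univ : Set ℝ), ‖deriv (fun x => a x ξ) t‖ ≤ symbolNorm 2 2 a L ρ / L :=
    fun t _ => by
      have := ha.le_symbolNorm hL.le hρ (i := 1) (j := 0) (by norm_num) (by norm_num) t ξ
      simp only [mixedDeriv, iteratedDeriv_zero, iteratedDeriv_one, pow_one, pow_zero,
        mul_one] at this
      rw [le_div_iff₀ hL, mul_comm]
      exact this
  have := convex_univ.norm_image_sub_le_of_norm_deriv_le (fun t _ => hd t) hb (mem_univ 0)
    (mem_univ x)
  rw [sub_zero, Real.norm_of_nonneg hx.le] at this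
  refine this.trans (le_of_eq ?_)
  ring

theorem IsSymbol.continuous (ha : IsSymbol 2 2 a) : Continuous fun z : ℝ × ℝ => a z.1 z.2 := by
  simpa [mixedDeriv_zero_left] using ha.continuous_deriv 0 (by norm_num) 0 (by norm_num)

variable {ψ : ℝ → ℝ} {r κ : ℝ}

theorem IsSymbol.exists_isLocPdo (ha : IsSymbol 2 2 a) (hL : 0 < L) (hρ : 0 < ρ) (hκ : 0 < κ)
    (hsupp : ∀ x ξ, ρ ≤ |ξ| → a x ξ = 0) (hψ : IsCutoff r ψ) :
    ∃ A, IsLocPdo A (fun x η => (ψ x : ℂ) * a x (κ⁻¹ * η)) (symbolNorm 2 2 a L ρ) (κ * ρ) r := by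
  have meas : StronglyMeasurable
      (Function.uncurry fun x η => (ψ x : ℂ) * a x (κ⁻¹ * η)) := by
    refine Continuous.stronglyMeasurable ?_
    have h1 : Continuous fun z : ℝ × ℝ => a z.1 (κ⁻¹ * z.2) :=
      ha.continuous.comp (continuous_fst.prodMk (continuous_const.mul continuous_snd))
    exact (Complex.continuous_ofReal.comp (hψ.contDiff.continuous.comp continuous_fst)).mul h1
  have slow := fun x => ha.isSlow hL.le hρ hκ (hψ.nonneg x) (hψ.le_one x) x
  have supp : ∀ x η, κ * ρ ≤ |η| → (ψ x : ℂ) * a x (κ⁻¹ * η) = 0 := fun x η h => by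
    rw [hsupp x (κ⁻¹ * η), mul_zero]
    rw [abs_mul, abs_of_pos (inv_pos.2 hκ), inv_mul_eq_div, le_div_iff₀ hκ, mul_comm]
    exact h
  have zero : ∀ x, x ∉ Ioo 1 (4 * r) → ∀ η, (ψ x : ℂ) * a x (κ⁻¹ * η) = 0 := fun x hx η => by
    rw [hψ.eq_zero x hx, Complex.ofReal_zero, zero_mul]
  obtain ⟨A, hA⟩ := exists_isPdo_of_isSlow (mul_pos hκ hρ) meas slow supp zero
  exact ⟨A, hA, meas, slow, supp, zero⟩

theorem IsSymbol.norm_integral_cutoff_sub_le (ha : IsSymbol 2 2 a) (hr : 1 ≤ r) (hL : r ≤ L)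
    (hρ : 0 ≤ ρ) (hψ : IsCutoff r ψ) (ξ : ℝ) :
    ‖(∫ x, ψ x * a x ξ / x) - a 0 ξ * Real.log r‖ ≤ 6 * symbolNorm 2 2 a L ρ := by
  have hL0 : 0 < L := by linarith
  exact _root_.norm_integral_cutoff_sub_le hr hψ hL (f := fun x => a x ξ)
    (ha.continuous.comp (continuous_id.prodMk continuous_const)) (ha.norm_le hL0.le hρ 0 ξ)
    fun x hx => ha.norm_sub_le hL0 hρ hx ξ

end Symbols

/-! ### Absorbing the errors into the stated remainder -/

section Remainder

variable {α ρ δ c r D : ℝ} {X : Finset ℝ}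

/-- The size `ρ^δ + α^{1-δ} ρ r + α^{-δ} log r` of the remainder. -/
def remainderSize (α ρ δ r : ℝ) : ℝ := ρ ^ δ + α ^ (1 - δ) * ρ * r + α ^ (-δ) * Real.log r

theorem rpow_le_remainderSize (hα : 0 < α) (hρ : 0 < ρ) (hr : 1 ≤ r) :
    ρ ^ δ ≤ remainderSize α ρ δ r := by
  have h1 := Real.rpow_nonneg hα.le (1 - δ)
  have h2 := mul_nonneg (Real.rpow_nonneg hα.le (-δ)) (Real.log_nonneg hr)
  have h3 : 0 ≤ α ^ (1 - δ) * ρ * r := by positivity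
  unfold remainderSize
  linarith

theorem mul_le_remainderSize (hα : 0 < α) (hρ : 0 < ρ) (hr : 1 ≤ r) :
    α ^ (1 - δ) * ρ * r ≤ remainderSize α ρ δ r := by
  have h1 := Real.rpow_nonneg hρ.le δ
  have h2 := mul_nonneg (Real.rpow_nonneg hα.le (-δ)) (Real.log_nonneg hr)
  unfold remainderSize
  linarith

theorem remainderSize_nonneg (hα : 0 < α) (hρ : 0 < ρ) (hr : 1 ≤ r) :
    0 ≤ remainderSize α ρ δ r :=
  (Real.rpow_nonneg hρ.le δ).trans (rpow_le_remainderSize hα hρ hr)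

theorem one_le_div_of_spacing (hD : 0 < D) (hD4 : D ≤ 4 * ρ) : 1 ≤ 4 * ρ / D := by
  rwa [one_le_div hD]

/-- Since 4ρ/D ≥ 1 and δ ≥ 1, the ratio is at most its δ-th power, which the term ρ^δ controls. -/
theorem div_le_rpow_mul_remainderSize (hα : 0 < α) (hρ : 0 < ρ) (hr : 1 ≤ r) (hδ : 1 ≤ δ)
    (hD : 0 < D) (hD4 : D ≤ 4 * ρ) :
    4 * ρ / D ≤ 4 ^ δ * (D ^ (-δ) * remainderSize α ρ δ r) := by
  have h1 := Real.rpow_le_rpow_of_exponent_le (one_le_div_of_spacing hD hD4) hδ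
  rw [Real.rpow_one, Real.div_rpow (by positivity) hD.le, Real.mul_rpow (by norm_num) hρ.le] at h1
  refine h1.trans ?_
  rw [div_eq_mul_inv, ← Real.rpow_neg hD.le, mul_assoc, mul_comm (ρ ^ δ)]
  exact mul_le_mul_of_nonneg_left (mul_le_mul_of_nonneg_left (rpow_le_remainderSize hα hρ hr)
    (by positivity)) (by positivity)

/-- A narrow bump means αD ≤ 32π, so 1 is bounded by a multiple of α^{-δ}D^{-δ}; multiplying by αρ/c
≥ 1 and by r gives the middle term of the remainder. -/
theorem le_rpow_mul_remainderSize (hα : 0 < α) (hρ : 0 < ρ) (hr : 1 ≤ r) (hδ : 1 ≤ δ) (hc : 0 < c)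
    (hαρ : c ≤ α * ρ) (hD : 0 < D) (hs : α / (2 * Real.pi) * D / 16 < 1) :
    r ≤ (32 * Real.pi) ^ δ * c⁻¹ * (D ^ (-δ) * remainderSize α ρ δ r) := by
  have hpi := Real.pi_pos
  have h1 : α * D ≤ 32 * Real.pi := by
    have e : α / (2 * Real.pi) * D / 16 = α * D / (32 * Real.pi) := by
      field_simp
      norm_num
    rw [e, div_lt_one (by positivity)] at hs
    exact hs.le
  have h2 := Real.rpow_le_rpow (by positivity) h1 (by linarith : 0 ≤ δ)
  have h3 : 1 ≤ (32 * Real.pi) ^ δ * (α ^ (-δ) * D ^ (-δ)) := by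
    rw [← Real.mul_rpow hα.le hD.le, Real.rpow_neg (by positivity), ← div_eq_mul_inv,
      one_le_div (by positivity)]
    exact h2
  have h4 : 1 ≤ c⁻¹ * (α * ρ) := by
    rw [inv_mul_eq_div, one_le_div hc]
    exact hαρ
  have e1 : α ^ (1 - δ) = α * α ^ (-δ) := by
    rw [sub_eq_add_neg, Real.rpow_add hα, Real.rpow_one]
  have h5 : r ≤ (32 * Real.pi) ^ δ * c⁻¹ * (D ^ (-δ) * (α ^ (1 - δ) * ρ * r)) := by
    have e2 : (32 * Real.pi) ^ δ * c⁻¹ * (D ^ (-δ) * (α ^ (1 - δ) * ρ * r)) =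
        ((32 * Real.pi) ^ δ * (α ^ (-δ) * D ^ (-δ))) * (c⁻¹ * (α * ρ)) * r := by
      rw [e1]
      ring
    rw [e2]
    exact le_mul_of_one_le_left (by linarith) (one_le_mul_of_one_le_of_one_le h3 h4)
  refine h5.trans ?_
  exact mul_le_mul_of_nonneg_left (mul_le_mul_of_nonneg_left (mul_le_remainderSize hα hρ hr)
    (by positivity)) (by positivity)

theorem spacing_nonneg (hρ : 0 < ρ) (x : ℝ) : 0 ≤ spacing ρ X x := by
  rw [spacing]
  split_ifs
  · positivity
  · exact Metric.infDist_nonneg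

theorem sum_filter_le_spacingSum (hρ : 0 < ρ) (P : ℝ → Prop) [DecidablePred P] :
    ∑ ξ ∈ X.filter P, spacing ρ X ξ ^ (-δ) ≤ spacingSum ρ δ X := by
  rw [spacingSum]
  split_ifs with h
  · rw [h, Finset.filter_empty, Finset.sum_empty]
    positivity
  · exact Finset.sum_le_sum_of_subset_of_nonneg (Finset.filter_subset _ _) fun ξ _ _ =>
      Real.rpow_nonneg (spacing_nonneg hρ ξ) _

/-- Pays for the error that remains even without end points; for empty X the convention (4ρ)^{-δ} is
what makes it true. -/
theorem one_le_spacingSum (hα : 0 < α) (hρ : 0 < ρ) (hr : 1 ≤ r) (hδ : 1 ≤ δ)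
    (hX : ∀ x ∈ X, x ∈ Ioo (-(2 * ρ)) (2 * ρ)) :
    1 ≤ 4 ^ δ * (spacingSum ρ δ X * remainderSize α ρ δ r) := by
  have key : ∀ D, 0 < D → D ≤ 4 * ρ → D ^ (-δ) ≤ spacingSum ρ δ X →
      1 ≤ 4 ^ δ * (spacingSum ρ δ X * remainderSize α ρ δ r) := fun D hD hD4 h =>
    (one_le_div_of_spacing hD hD4).trans <|
      (div_le_rpow_mul_remainderSize hα hρ hr hδ hD hD4).trans <|
      mul_le_mul_of_nonneg_left (mul_le_mul_of_nonneg_right h (remainderSize_nonneg hα hρ hr))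
        (by positivity)
  rcases X.eq_empty_or_nonempty with h | ⟨x, hx⟩
  · refine key (4 * ρ) (by positivity) le_rfl ?_
    rw [spacingSum, if_pos h]
  · refine key (spacing ρ X x) (spacing_pos hρ hx) (spacing_le hX hx) ?_
    rw [spacingSum, if_neg (Finset.ne_empty_of_mem hx)]
    exact Finset.single_le_sum (f := fun ξ => spacing ρ X ξ ^ (-δ))
      (fun ξ _ => Real.rpow_nonneg (spacing_nonneg hρ ξ) _) hx

end Remainder

/-! ### The constant and the cost of one end point -/

section Assembly

/-- The contribution of one end point to the remainder. -/
def endpointConst (p : ℕ) (δ c : ℝ) : ℝ :=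
  4 ^ δ * (pointConst p + 6 * |coeffA (fun t => t ^ p - t) 1|) +
    (32 * Real.pi) ^ δ * c⁻¹ * (smallConst + |coeffA (fun t => t ^ p - t) 1|) +
    4 * 4 ^ δ * (20 * (cutConst * cutConst) * restConst p)

/-- The constant of the asymptotic formula. -/
def traceConst (p : ℕ) (δ c : ℝ) : ℝ :=
  4 ^ δ * (10 * cutConst * restConst p) + endpointConst p δ c

theorem endpointConst_nonneg (p : ℕ) (δ : ℝ) {c : ℝ} (hc : 0 < c) : 0 ≤ endpointConst p δ c := by
  have h1 := pointConst_nonneg p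
  have h2 := smallConst_nonneg
  have h3 := restConst_nonneg p
  have h4 := cutConst_nonneg
  have := Real.pi_pos
  unfold endpointConst
  positivity

theorem traceConst_nonneg (p : ℕ) (δ : ℝ) {c : ℝ} (hc : 0 < c) : 0 ≤ traceConst p δ c := by
  have h1 := endpointConst_nonneg p δ hc
  have h3 := restConst_nonneg p
  have h4 := cutConst_nonneg
  unfold traceConst
  positivity

theorem endpoint_remainder_le {α ρ δ c r D : ℝ} (hα : 0 < α) (hρ : 0 < ρ) (hr : 1 ≤ r)
    (hδ : 1 ≤ δ) (hc : 0 < c) (hαρ : c ≤ α * ρ) (hD : 0 < D) (hD4 : D ≤ 4 * ρ) (p : ℕ) :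
    (if 1 ≤ α / (2 * Real.pi) * D / 16 then pointConst p else smallConst * r) +
      (if 1 ≤ α / (2 * Real.pi) * D / 16 then 6 * |coeffA (fun t => t ^ p - t) 1|
        else |coeffA (fun t => t ^ p - t) 1| * r) +
      restConst p * (20 * (cutConst * cutConst) *
        (α / (2 * Real.pi) * ρ / (α / (2 * Real.pi) * D / 16))) ≤
      endpointConst p δ c * (D ^ (-δ) * remainderSize α ρ δ r) := by
  have hpi := Real.pi_pos
  have h1 := pointConst_nonneg p
  have h2 := smallConst_nonneg
  have h3 := restConst_nonneg p
  have h4 := cutConst_nonneg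
  have hG : 0 ≤ D ^ (-δ) * remainderSize α ρ δ r :=
    mul_nonneg (by positivity) (remainderSize_nonneg hα hρ hr)
  have hdiv := div_le_rpow_mul_remainderSize hα hρ hr hδ hD hD4
  have hone := (one_le_div_of_spacing hD hD4).trans hdiv
  set G := D ^ (-δ) * remainderSize α ρ δ r with hGdef
  set A := |coeffA (fun t => t ^ p - t) 1|
  have hA : 0 ≤ A := abs_nonneg _
  -- The scaling factor cancels: the cost of the rest depends only on ρ/D.
  have e : α / (2 * Real.pi) * ρ / (α / (2 * Real.pi) * D / 16) = 4 * (4 * ρ / D) := by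
    field_simp
    norm_num
  have hthird : restConst p * (20 * (cutConst * cutConst) * (4 * (4 * ρ / D))) ≤
      4 * 4 ^ δ * (20 * (cutConst * cutConst) * restConst p) * G := by
    have := mul_le_mul_of_nonneg_left hdiv
      (by positivity : 0 ≤ restConst p * (20 * (cutConst * cutConst)) * 4)
    refine le_trans (le_of_eq ?_) (this.trans (le_of_eq ?_)) <;> ring
  rw [e, endpointConst, add_mul, add_mul]
  refine add_le_add ?_ hthird
  have hP : 0 ≤ 4 ^ δ * (pointConst p + 6 * A) * G := by positivity
  have hS : 0 ≤ (32 * Real.pi) ^ δ * c⁻¹ * (smallConst + A) * G := by positivity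
  split_ifs with hs
  · have := mul_le_mul_of_nonneg_left hone (by positivity : 0 ≤ pointConst p + 6 * A)
    calc pointConst p + 6 * A ≤ (pointConst p + 6 * A) * (4 ^ δ * G) := by linarith
      _ = 4 ^ δ * (pointConst p + 6 * A) * G := by ring
      _ ≤ _ := by linarith
  · have hr' := le_rpow_mul_remainderSize hα hρ hr hδ hc hαρ hD (not_le.1 hs)
    have := mul_le_mul_of_nonneg_left hr' (by positivity : 0 ≤ smallConst + A)
    rw [← hGdef] at this
    calc smallConst * r + A * r = (smallConst + A) * r := by ring
      _ ≤ (smallConst + A) * ((32 * Real.pi) ^ δ * c⁻¹ * G) := this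
      _ = (32 * Real.pi) ^ δ * c⁻¹ * (smallConst + A) * G := by ring
      _ ≤ _ := by linarith

end Assembly

end

theorem theorem8p6 (p : ℕ) (hp : 1 ≤ p) (δ : ℝ) (hδ : 1 ≤ δ) (c : ℝ) (hc : 0 < c) :
    ∃ C : ℝ, 0 < C ∧
      ∀ (α ρ L r : ℝ), 0 < α → 0 < ρ → c ≤ α * ρ → 1 ≤ r → r ≤ L →
      ∀ (Ω : Set ℝ), MeasurableSet Ω →
      ∀ (N : ℕ) (I : Fin N → Set ℝ), (∀ j, IsOpenInterval (I j)) →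
        (∀ j s, j ≠ s → Disjoint (closure (I j)) (closure (I s))) →
        Ω ∩ Set.Ioo (-(2 * ρ)) (2 * ρ) = (⋃ j, I j) ∩ Set.Ioo (-(2 * ρ)) (2 * ρ) →
      ∀ (X : Finset ℝ),
        (X : Set ℝ) = (⋃ j, frontier (I j)) ∩ Set.Ioo (-(2 * ρ)) (2 * ρ) →
      ∀ (ψ : ℝ → ℝ), IsCutoff r ψ →
      ∀ (a : ℝ → ℝ → ℂ), IsSymbol 2 2 a → (∀ x ξ, ρ ≤ |ξ| → a x ξ = 0) →
        IsLeftPDO α (fun x ξ => (ψ x : ℂ) * a x ξ) (opL α (fun x ξ => (ψ x : ℂ) * a x ξ)) ∧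
        IsTraceClass (opL α (fun x ξ => (ψ x : ℂ) * a x ξ) *
          (truncOp α (fun _ _ => 1) (Set.Ioi 0) measurableSet_Ioi Ω ^ p -
            truncOp α (fun _ _ => 1) (Set.Ioi 0) measurableSet_Ioi Ω)) ∧
        ‖opTrace (opL α (fun x ξ => (ψ x : ℂ) * a x ξ) *
            (truncOp α (fun _ _ => 1) (Set.Ioi 0) measurableSet_Ioi Ω ^ p -
              truncOp α (fun _ _ => 1) (Set.Ioi 0) measurableSet_Ioi Ω)) -
          (coeffA (fun t => t ^ p - t) 1 : ℂ) * (∑ ξ ∈ X, a 0 ξ) * (Real.log r : ℂ)‖ ≤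
        C * spacingSum ρ δ X *
          (ρ ^ δ + α ^ (1 - δ) * ρ * r + α ^ (-δ) * Real.log r) * symbolNorm 2 2 a L ρ := by
  -- The added 1 makes the constant strictly positive.
  refine ⟨traceConst p δ c + 1, by linarith [traceConst_nonneg p δ hc], ?_⟩
  intro α ρ L r hα hρ hαρ hr hL Ω hΩ n I hI hd hΩI X hX ψ hψ a ha hsupp
  have hκ : 0 < α / (2 * Real.pi) := div_pos hα (by positivity)
  have hL0 : 0 < L := by linarith
  obtain ⟨A, hA⟩ := ha.exists_isLocPdo hL0 hρ hκ hsupp hψ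
  have hAl : IsLeftPDO α (fun x ξ => (ψ x : ℂ) * a x ξ) A :=
    IsPdo.isLeftPDO hα (b := fun x ξ => (ψ x : ℂ) * a x ξ) hA.pdo
  obtain ⟨htr, hle⟩ := hA.opTrace_powTrunc_sub_le (mul_pos hκ hρ) hr
    (isLocallyHalfLine_scaled hκ hρ hΩ hI hd hΩI hX) hp
  rw [hAl.opL_eq, truncOp_one hα hΩ]
  refine ⟨hAl, htr, ?_⟩
  simp only [inv_mul_cancel_left₀ hκ.ne'] at hle
  have hXm : ∀ x ∈ X, x ∈ Ioo (-(2 * ρ)) (2 * ρ) := fun x hx => by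
    have h : x ∈ (X : Set ℝ) := hx
    rw [hX] at h
    exact h.2
  set M := symbolNorm 2 2 a L ρ
  have hM : 0 ≤ M := (norm_nonneg _).trans (ha.norm_le hL0.le hρ.le 0 0)
  set Y := X.filter fun ξ => |ξ| ≤ 3 / 2 * ρ with hY
  -- Points beyond 3ρ/2 are dropped at no cost, as a vanishes for |ξ| ≥ ρ.
  have hsum : ∑ ξ ∈ X, a 0 ξ = ∑ ξ ∈ Y, a 0 ξ :=
    (Finset.sum_filter_of_ne fun ξ _ h => by
      by_contra hlt
      exact h (hsupp 0 ξ (by linarith [not_le.1 hlt]))).symm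
  set κ := α / (2 * Real.pi) with hκdef
  set B : ℝ := coeffA (fun t => t ^ p - t) 1 with hB
  -- End points with wide bumps have the true main term up to 6N|𝔄|. For narrow bumps nothing was
  -- extracted, so the whole term 𝔄 a(0, ξ) log r counts as error and is bounded by |𝔄| N r.
  have hmain : ‖(∑ ξ ∈ Y, (if 1 ≤ κ * spacing ρ X ξ / 16 then
      (B : ℂ) * ∫ x, ψ x * a x ξ / x else 0)) - (B : ℂ) * (∑ ξ ∈ X, a 0 ξ) * Real.log r‖ ≤
      ∑ ξ ∈ Y, M * (if 1 ≤ κ * spacing ρ X ξ / 16 then 6 * |B| else |B| * r) := by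
    rw [hsum, Finset.mul_sum, Finset.sum_mul, ← Finset.sum_sub_distrib]
    refine norm_sum_le_of_le _ fun ξ _ => ?_
    split_ifs
    · rw [mul_assoc, ← mul_sub, norm_mul, Complex.norm_real, Real.norm_eq_abs]
      have := mul_le_mul_of_nonneg_left (ha.norm_integral_cutoff_sub_le hr hL hρ.le hψ ξ)
        (abs_nonneg B)
      linarith
    · rw [zero_sub, norm_neg, norm_mul, norm_mul, Complex.norm_real, Complex.norm_real,
        Real.norm_eq_abs, Real.norm_of_nonneg (Real.log_nonneg hr)]
      have h1 := ha.norm_le hL0.le hρ.le 0 ξ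
      have h2 := Real.log_le_self (by linarith : 0 ≤ r)
      have h3 := mul_le_mul (mul_le_mul_of_nonneg_left h1 (abs_nonneg B)) h2
        (Real.log_nonneg hr) (by positivity)
      linarith
  have hend : ∑ ξ ∈ Y, ((if 1 ≤ κ * spacing ρ X ξ / 16 then pointConst p else smallConst * r) +
      (if 1 ≤ κ * spacing ρ X ξ / 16 then 6 * |B| else |B| * r) +
      restConst p * (20 * (cutConst * cutConst) * (κ * ρ / (κ * spacing ρ X ξ / 16)))) ≤
      endpointConst p δ c * (spacingSum ρ δ X * remainderSize α ρ δ r) := by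
    refine (Finset.sum_le_sum fun ξ hξ => endpoint_remainder_le hα hρ hr hδ hc hαρ
      (spacing_pos hρ (Finset.mem_of_mem_filter ξ hξ))
      (spacing_le hXm (Finset.mem_of_mem_filter ξ hξ)) p).trans ?_
    rw [← Finset.mul_sum, ← Finset.sum_mul]
    exact mul_le_mul_of_nonneg_left (mul_le_mul_of_nonneg_right (sum_filter_le_spacingSum hρ _)
      (remainderSize_nonneg hα hρ hr)) (endpointConst_nonneg p δ hc)
  have hone := mul_le_mul_of_nonneg_left (one_le_spacingSum hα hρ hr hδ hXm)
    (mul_nonneg (mul_nonneg (by norm_num) cutConst_nonneg) (restConst_nonneg p) :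
      0 ≤ 10 * cutConst * restConst p)
  rw [Finset.sum_add_distrib, Finset.sum_add_distrib, ← Finset.mul_sum] at hend
  rw [← Finset.mul_sum] at hmain
  have htri := (norm_add_le _ _).trans (add_le_add hle hmain)
  rw [sub_add_sub_cancel, ← mul_add] at htri
  -- Needed for the surplus 1 in the constant; the sign follows from the lower bound just used.
  have hG : 0 ≤ spacingSum ρ δ X * remainderSize α ρ δ r := by
    have := one_le_spacingSum hα hρ hr hδ hXm
    by_contra hneg
    have := mul_neg_of_pos_of_neg (by positivity : (0 : ℝ) < 4 ^ δ) (not_le.1 hneg)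
    linarith
  refine htri.trans ?_
  change _ ≤ (traceConst p δ c + 1) * spacingSum ρ δ X * remainderSize α ρ δ r * M
  rw [mul_comm M]
  refine mul_le_mul_of_nonneg_right ?_ hM
  rw [mul_assoc, add_mul, one_mul, traceConst, add_mul]
  linarith
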